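/- **Setup.** Let $F$ be a totally real number field, $\mathcal K/F$ a totally imaginary quadratic extension with nontrivial automorphism $c$, and $D$ a central simple $\mathcal K$-algebra of dimension $4$ with an $F$-linear anti-involution $\star$ of the second kind (that is, $(xy)^\star=y^\star x^\star$, $x^{\star\star}=x$, and $\star$ restricts to $c$ on $\mathcal K$). Let $U=U(D,\star)$ be the unitary group over $F$ with $U(R)=\{x\in (R\otimes_F D)^\times : x^\star x=1\}$, and let $G=\mathrm{Res}_{F/\mathbb Q}U$. Assume that $G(\mathbb R)$ is compact. Let $p>3$ be a prime which splits completely in $\mathcal K$, and assume that $D$ splits at all places of $\mathcal K$ above $p$. Let $E/\mathbb Q_p$ be a finite extension inside $\bar{\mathbb Q}_p$, with ring of integers $\mathcal O$, and fix an isomorphism $\iota:\mathbb C\simeq\bar{\mathbb Q}_p$. **Hecke algebras.** Fix a tame level, i.e. a compact open subgroup $K^p=\prod_{v\nmid p}K_v$ of $G(\mathbb A_f^p)$. For a compact open subgroup $K_p\subset G(\mathbb Q_p)$ put $K=K_pK^p$, and let $H^0(K)_{\mathcal O}$ be the $\mathcal O$-module of functions $G(\mathbb Q)\backslash G(\mathbb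 A_f)/K\to\mathcal O$. Let $\mathbb T(K)_{\mathcal O}\subset\mathrm{End}_{\mathcal O}H^0(K)_{\mathcal O}$ be the commutative $\mathcal O$-subalgebra generated by the double coset operators $[K_vgK_v]$, $g\in U(F_v)$, for all finite places $v\nmid p$ of $F$ such that $K_v$ is hyperspecial. Let $\mathbb T(K^p)_{\mathcal O}=\varprojlim_{K_p}\mathbb T(K_pK^p)_{\mathcal O}$, with the projective limit topology; the transition maps are given by restriction of operators. **Classical crystalline points.** A continuous homomorphism of $\mathcal O$-algebras $\lambda:\mathbb T(K^p)_{\mathcal O}\to\bar{\mathbb Q}_p$ is *associated with* an automorphic representation $\pi$ of $G(\mathbb A)$ if $\pi^{K^p}\neq0$ and every $T=[K_vgK_v]$ as above acts on $\pi^{K^p}$ as multiplication by $\iota^{-1}(\lambda(T))$. A prime ideal $\mathfrak p$ of $\mathbb T(K^p)_{\mathcal O}$ is *classical crystalline* if $\mathfrak p=\ker\lambda$ for some $\lambda$ associated with an automorphic representation $\pi$ of $G(\mathbb A)$, of any weight, such that $\pi_p$ is unramified (it has a nonzero vector fixed by a hyperspecial subgroup of $G(\mathbb Q_p)$). **Statement.**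 Let $\mathfrak m$ be a maximal ideal of $\mathbb T(K^p)_{\mathcal O}$, let $\mathbb T(K^p)_{\mathcal O,\mathfrak m}$ be the localization at $\mathfrak m$, and let $\mathcal C_{\mathfrak m}$ be the set of all classical crystalline primes $\mathfrak p\subset\mathfrak m$, viewed as primes of $\mathbb T(K^p)_{\mathcal O,\mathfrak m}$. Then $$\bigcap_{\mathfrak p\in\mathcal C_{\mathfrak m}}\mathfrak p\,\mathbb T(K^p)_{\mathcal O,\mathfrak m}=0,$$ and $\mathcal C_{\mathfrak m}$ is Zariski dense in $\mathrm{Spec}\,\mathbb T(K^p)_{\mathcal O,\mathfrak m}$. -/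

import Mathlib

open NumberField IsDedekindDomain TensorProduct
open scoped RestrictedProduct

namespace DefiniteUnitary

/-! ### Hecke operators attached to double cosets -/

section Hecke

variable {H : Type*} [Group H] (K : Subgroup H)

/-- The set `K g K / K` of left cosets `h K` contained in the double coset `K g K`. -/
def cosets (g : H) : Set (H ⧸ K) := MulAction.orbit K (g : H ⧸ K)

/-- For a homomorphism `j : H → X`, the Hecke operator `[K g K]` on functions `f` on `X` (which
will always be right invariant under `j K`): `([K g K] f)(x) = ∑ f(x j(h))`, the sum being over
the left cosets `h K` contained in `K g K`. -/
noncomputable def heckeFun {X A : Type*} [Group X] [AddCommMonoid A] (j : H →* X) (g : H)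
    (f : X → A) : X → A :=
  fun x => ∑ᶠ c ∈ cosets K g, f (x * j c.out)

variable {K}

theorem mk_mem_cosets {g x : H} :
    (x : H ⧸ K) ∈ cosets K g ↔ ∃ a ∈ K, ∃ b ∈ K, x = a * g * b := by
  constructor
  · rintro ⟨a, ha⟩
    have h : ((a : H) * g : H) = (x : H ⧸ K) := ha
    rw [QuotientGroup.eq] at h
    exact ⟨a, a.2, _, h, by group⟩
  · rintro ⟨a, ha, b, hb, rfl⟩
    refine ⟨⟨a, ha⟩, ?_⟩
    change ((a * g : H) : H ⧸ K) = _
    rw [QuotientGroup.eq]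
    simpa [mul_assoc] using hb

theorem mk_mul_out (x : H) (c : H ⧸ K) (y : H) (hy : (y : H ⧸ K) = c) :
    ∃ k ∈ K, x * c.out = x * y * k := by
  have : (y : H ⧸ K) = (c.out : H) := by rw [hy, QuotientGroup.out_eq']
  rw [QuotientGroup.eq] at this
  exact ⟨_, this, by group⟩

section

variable {X A : Type*} [Group X] [AddCommMonoid A] {j : H →* X} {f : X → A}

theorem out_invariant {A : Type*} {f : X → A} (hf : ∀ x, ∀ k ∈ K, f (x * j k) = f x) (x : X) (y : H) :
    f (x * j ((y : H ⧸ K).out)) = f (x * j y) := by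
  obtain ⟨k, hk, h⟩ := mk_mul_out (K := K) 1 (y : H ⧸ K) y rfl
  rw [one_mul, one_mul] at h
  rw [h, map_mul, ← mul_assoc, hf _ k hk]

theorem heckeFun_right (hf : ∀ x, ∀ k ∈ K, f (x * j k) = f x) (g : H) (x : X) (k : H)
    (hk : k ∈ K) : heckeFun K j g f (x * j k) = heckeFun K j g f x := by
  unfold heckeFun
  have hbij : Set.BijOn (fun c : H ⧸ K => (⟨k, hk⟩ : K) • c) (cosets K g) (cosets K g) := by
    refine ⟨fun c hc => ?_, (MulAction.injective _).injOn, fun c hc => ?_⟩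
    · exact MulAction.mem_orbit_of_mem_orbit _ hc
    · refine ⟨(⟨k, hk⟩ : K)⁻¹ • c, MulAction.mem_orbit_of_mem_orbit _ hc, ?_⟩
      simp
  refine finsum_mem_eq_of_bijOn _ hbij fun c hc => ?_
  obtain ⟨y, rfl⟩ := QuotientGroup.mk_surjective c
  change _ = f (x * j ((k * y : H) : H ⧸ K).out)
  rw [out_invariant hf, out_invariant hf, map_mul, mul_assoc]

theorem heckeFun_left (g : H) (γ : X) (hf : ∀ x, f (γ * x) = f x) (x : X) :
    heckeFun K j g f (γ * x) = heckeFun K j g f x := by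
  unfold heckeFun
  simp only [mul_assoc, hf]

theorem heckeFun_comm_right (g : H) (k : X) (hk : ∀ h, Commute k (j h))
    (hf : ∀ x, f (x * k) = f x) (x : X) :
    heckeFun K j g f (x * k) = heckeFun K j g f x := by
  unfold heckeFun
  refine finsum_congr fun c => finsum_congr fun _ => ?_
  rw [mul_assoc, (hk _).eq, ← mul_assoc, hf]

theorem heckeFun_comm {H' : Type*} [Group H'] {K' : Subgroup H'} {j' : H' →* X} (g : H)
    (g' : H') (hfin : (cosets K g).Finite) (hfin' : (cosets K' g').Finite)
    (hc : ∀ h h', Commute (j h) (j' h')) :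
    heckeFun K j g (heckeFun K' j' g' f) = heckeFun K' j' g' (heckeFun K j g f) := by
  funext x
  unfold heckeFun
  simp only [finsum_mem_eq_finite_toFinset_sum _ hfin,
    finsum_mem_eq_finite_toFinset_sum _ hfin']
  rw [Finset.sum_comm]
  refine Finset.sum_congr rfl fun c _ => Finset.sum_congr rfl fun d _ => ?_
  rw [mul_assoc, (hc _ _).eq, ← mul_assoc]

/-- Gelfand's trick: the double coset operators commute as soon as there is an anti-automorphism
which preserves `K` and every double coset `K g K`. -/
theorem heckeFun_comm_of_anti (θ : H → H) (hmul : ∀ x y, θ (x * y) = θ y * θ x)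
    (hK : ∀ x, θ x ∈ K ↔ x ∈ K) (hθ : ∀ x, ∃ a ∈ K, ∃ b ∈ K, θ x = a * x * b)
    (g g' : H) (hfin : (cosets K g).Finite) (hfin' : (cosets K g').Finite)
    (hf : ∀ x, ∀ k ∈ K, f (x * j k) = f x) :
    heckeFun K j g (heckeFun K j g' f) = heckeFun K j g' (heckeFun K j g f) := by
  classical
  have hone : θ 1 = 1 := by
    have := hmul 1 1
    rw [mul_one] at this
    exact (mul_eq_left.mp this.symm)
  have hinv : ∀ x, θ x⁻¹ = (θ x)⁻¹ := fun x => by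
    rw [eq_inv_iff_mul_eq_one, ← hmul, mul_inv_cancel, hone]
  have hmem : ∀ x h : H, (x : H ⧸ K) ∈ cosets K h → ∃ a ∈ K, ∃ b ∈ K, θ x = a * h * b := by
    intro x h hx
    obtain ⟨a, ha, b, hb, rfl⟩ := mk_mem_cosets.mp hx
    obtain ⟨c, hc, d, hd, e⟩ := hθ h
    refine ⟨θ b * c, K.mul_mem ((hK _).mpr hb) hc, d * θ a, K.mul_mem hd ((hK _).mpr ha), ?_⟩
    rw [hmul, hmul, e]
    group
  -- the number of ways of writing a coset as a product is symmetric
  have key : ∀ (h h' : H) (s s' : Finset (H ⧸ K)), (∀ c, c ∈ s ↔ c ∈ cosets K h) →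
      (∀ c, c ∈ s' ↔ c ∈ cosets K h') → ∀ c : H ⧸ K,
      ((s ×ˢ s').filter fun q => ((q.1.out * q.2.out : H) : H ⧸ K) = c).card ≤
      ((s' ×ˢ s).filter fun q => ((q.1.out * q.2.out : H) : H ⧸ K) = c).card := by
    intro h h' s s' hs hs' c
    obtain ⟨k₁, hk₁, k₂, hk₂, hc⟩ := hθ c.out
    let d : H ⧸ K → H ⧸ K := fun a => ((c.out * k₂ * (θ a.out)⁻¹ : H) : H ⧸ K)
    refine Finset.card_le_card_of_injOn
      (fun q => (d q.1, (((d q.1).out)⁻¹ * c.out : H))) ?_ ?_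
    · rintro ⟨a, b⟩ hab
      simp only [Finset.coe_filter, Finset.mem_product, Set.mem_ofPred_eq] at hab
      obtain ⟨⟨ha, hb⟩, hab⟩ := hab
      rw [hs, ← QuotientGroup.out_eq' a] at ha
      rw [hs', ← QuotientGroup.out_eq' b] at hb
      have hab' : ((a.out * b.out : H) : H ⧸ K) = (c.out : H) := by
        rw [hab, QuotientGroup.out_eq']
      rw [QuotientGroup.eq] at hab'
      have hb' : ((a.out⁻¹ * c.out : H) : H ⧸ K) ∈ cosets K h' := by
        have : ((a.out⁻¹ * c.out : H) : H ⧸ K) = (b.out : H) := by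
          symm
          rw [QuotientGroup.eq]
          convert hab' using 1
          group
        rw [this]
        exact hb
      have hd : d a ∈ cosets K h' := by
        obtain ⟨x, hx, y, hy, e⟩ := hmem _ _ hb'
        rw [hmul, hinv, hc] at e
        refine mk_mem_cosets.mpr ⟨k₁⁻¹ * x, K.mul_mem (K.inv_mem hk₁) hx, y, hy, ?_⟩
        calc c.out * k₂ * (θ a.out)⁻¹ = k₁⁻¹ * (k₁ * c.out * k₂ * (θ a.out)⁻¹) := by group
          _ = _ := by rw [e]; group
      obtain ⟨k, hk, ek⟩ := mk_mul_out (K := K) 1 (d a) _ rfl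
      rw [one_mul, one_mul] at ek
      simp only [Finset.coe_filter, Finset.mem_product, Set.mem_ofPred_eq]
      refine ⟨⟨(hs' _).mpr hd, (hs _).mpr ?_⟩, ?_⟩
      · obtain ⟨x, hx, y, hy, e⟩ := hmem _ _ ha
        refine mk_mem_cosets.mpr ⟨k⁻¹ * x, K.mul_mem (K.inv_mem hk) hx, y * k₂⁻¹,
          K.mul_mem hy (K.inv_mem hk₂), ?_⟩
        rw [ek]
        calc (c.out * k₂ * (θ a.out)⁻¹ * k)⁻¹ * c.out = k⁻¹ * θ a.out * k₂⁻¹ := by group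
          _ = _ := by rw [e]; group
      · obtain ⟨k', hk', ek'⟩ := mk_mul_out (K := K) (d a).out
          (((d a).out⁻¹ * c.out : H) : H ⧸ K) _ rfl
        rw [ek']
        rw [← QuotientGroup.out_eq' c]
        symm
        rw [QuotientGroup.eq]
        simp only [QuotientGroup.out_eq']
        convert hk' using 1
        group
    · rintro ⟨a, b⟩ hab ⟨a', b'⟩ hab' e
      simp only [Finset.coe_filter, Finset.mem_product, Set.mem_ofPred_eq] at hab hab'
      have e1 : d a = d a' := congrArg Prod.fst e
      have ha : a = a' := by
        rw [QuotientGroup.eq] at e1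
        have h1 : θ (a'.out⁻¹ * a.out) ∈ K := by
          rw [hmul, hinv]
          convert e1 using 1
          group
        rw [hK, ← QuotientGroup.eq, QuotientGroup.out_eq', QuotientGroup.out_eq'] at h1
        exact h1.symm
      subst ha
      have h1 := hab.2.trans hab'.2.symm
      rw [QuotientGroup.eq] at h1
      have h2 : b = b' := by
        rw [← QuotientGroup.out_eq' b, ← QuotientGroup.out_eq' b', QuotientGroup.eq]
        convert h1 using 1
        group
      rw [h2]
  funext x
  have expand : ∀ h h' : H, ∀ (hh : (cosets K h).Finite) (hh' : (cosets K h').Finite),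
      heckeFun K j h (heckeFun K j h' f) x =
      ∑ c ∈ (hh.toFinset ×ˢ hh'.toFinset).image
          (fun q => ((q.1.out * q.2.out : H) : H ⧸ K)),
        ((hh.toFinset ×ˢ hh'.toFinset).filter
          fun q => ((q.1.out * q.2.out : H) : H ⧸ K) = c).card • f (x * j c.out) := by
    intro h h' hh hh'
    rw [← Finset.sum_comp (fun c : H ⧸ K => f (x * j c.out))
      (fun q : (H ⧸ K) × (H ⧸ K) => ((q.1.out * q.2.out : H) : H ⧸ K)), Finset.sum_product]
    unfold heckeFun
    simp only [finsum_mem_eq_finite_toFinset_sum _ hh,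
      finsum_mem_eq_finite_toFinset_sum _ hh']
    refine Finset.sum_congr rfl fun c _ => Finset.sum_congr rfl fun d _ => ?_
    rw [out_invariant hf, map_mul, mul_assoc]
  have hcard : ∀ c, _ := fun c => le_antisymm
    (key g g' hfin.toFinset hfin'.toFinset (by simp) (by simp) c)
    (key g' g hfin'.toFinset hfin.toFinset (by simp) (by simp) c)
  rw [expand g g' hfin hfin', expand g' g hfin' hfin]
  refine Finset.sum_congr ?_ fun c _ => by rw [hcard c]
  ext c
  have := hcard c
  simp only [Finset.mem_image]
  constructor
  · rintro ⟨q, hq, e⟩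
    have h0 : 0 < ((hfin.toFinset ×ˢ hfin'.toFinset).filter
        fun q => ((q.1.out * q.2.out : H) : H ⧸ K) = c).card :=
      Finset.card_pos.mpr ⟨q, Finset.mem_filter.mpr ⟨hq, e⟩⟩
    rw [this] at h0
    obtain ⟨q', hq'⟩ := Finset.card_pos.mp h0
    exact ⟨q', (Finset.mem_filter.mp hq').1, (Finset.mem_filter.mp hq').2⟩
  · rintro ⟨q, hq, e⟩
    have h0 : 0 < ((hfin'.toFinset ×ˢ hfin.toFinset).filter
        fun q => ((q.1.out * q.2.out : H) : H ⧸ K) = c).card :=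
      Finset.card_pos.mpr ⟨q, Finset.mem_filter.mpr ⟨hq, e⟩⟩
    rw [← this] at h0
    obtain ⟨q', hq'⟩ := Finset.card_pos.mp h0
    exact ⟨q', (Finset.mem_filter.mp hq').1, (Finset.mem_filter.mp hq').2⟩

end

theorem finite_cosets [TopologicalSpace H] [IsTopologicalGroup H] (ho : IsOpen (K : Set H))
    (hK : IsCompact (K : Set H)) (g : H) : (cosets K g).Finite := by
  have : DiscreteTopology (H ⧸ K) := QuotientGroup.discreteTopology ho
  have h1 : cosets K g = (fun x : H => ((x * g : H) : H ⧸ K)) '' (K : Set H) := by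
    ext c
    constructor
    · rintro ⟨a, rfl⟩
      exact ⟨a, a.2, rfl⟩
    · rintro ⟨a, ha, rfl⟩
      exact ⟨⟨a, ha⟩, rfl⟩
  rw [h1]
  exact (hK.image (QuotientGroup.continuous_mk.comp
    (continuous_id.mul continuous_const))).finite_of_discrete

end Hecke

/-! ### Unitary groups in two variables -/

section Unitary

variable (F 𝒦 D : Type*) [Field F] [NumberField F] [Field 𝒦] [NumberField 𝒦] [Algebra F 𝒦]
  [Algebra.IsQuadraticExtension F 𝒦] [Ring D] [Algebra F D] [Algebra 𝒦 D]

theorem exists_conj : ∃ c : 𝒦 ≃ₐ[F] 𝒦, c ≠ 1 := by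
  by_contra! h
  have h1 : Nat.card (𝒦 ≃ₐ[F] 𝒦) = 2 := by
    rw [IsGalois.card_aut_eq_finrank, Algebra.IsQuadraticExtension.finrank_eq_two]
  have : Subsingleton (𝒦 ≃ₐ[F] 𝒦) := ⟨fun a b => by rw [h a, h b]⟩
  have h2 := (Finite.card_le_one_iff_subsingleton (α := 𝒦 ≃ₐ[F] 𝒦)).mpr this
  omega

/-- The nontrivial automorphism of the quadratic extension `𝒦 / F`. -/
noncomputable def conj : 𝒦 ≃ₐ[F] 𝒦 := (exists_conj F 𝒦).choose

theorem conj_ne_one : conj F 𝒦 ≠ 1 := (exists_conj F 𝒦).choose_spec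

/-- An `F`-linear anti-involution of the second kind on the `𝒦`-algebra `D`: it restricts to the
nontrivial automorphism of `𝒦 / F`. -/
structure Involution extends D →ₗ[F] D where
  map_mul' : ∀ x y, toFun (x * y) = toFun y * toFun x
  map_map' : ∀ x, toFun (toFun x) = x
  map_algebraMap' : ∀ z : 𝒦, toFun (algebraMap 𝒦 D z) = algebraMap 𝒦 D (conj F 𝒦 z)

variable {F 𝒦 D} (τ : Involution F 𝒦 D)

namespace Involution

section

variable (R : Type*) [CommRing R] [Algebra F R]

/-- The anti-involution of `R ⊗ D` obtained by extension of scalars. -/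
noncomputable def ext : R ⊗[F] D →ₗ[R] R ⊗[F] D := τ.toLinearMap.baseChange R

@[simp] theorem ext_tmul (r : R) (x : D) : τ.ext R (r ⊗ₜ x) = r ⊗ₜ τ.toLinearMap x := rfl

theorem ext_mul (x y : R ⊗[F] D) : τ.ext R (x * y) = τ.ext R y * τ.ext R x := by
  induction x with
  | zero => simp
  | add a b ha hb => rw [add_mul, map_add, map_add, mul_add, ha, hb]
  | tmul r a =>
    induction y with
    | zero => simp
    | add a b ha hb => rw [mul_add, map_add, map_add, add_mul, ha, hb]
    | tmul s b =>
      simp only [Algebra.TensorProduct.tmul_mul_tmul, ext_tmul, mul_comm s r]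
      exact congrArg _ (τ.map_mul' a b)

theorem ext_ext (x : R ⊗[F] D) : τ.ext R (τ.ext R x) = x := by
  induction x with
  | zero => simp
  | add a b ha hb => rw [map_add, map_add, ha, hb]
  | tmul r a => exact congrArg (r ⊗ₜ[F] ·) (τ.map_map' a)

theorem ext_one : τ.ext R 1 = 1 := by
  have h := τ.ext_mul R (τ.ext R 1) 1
  rwa [mul_one, τ.ext_ext, mul_one, eq_comm] at h

/-- The group `U(R)` of `R`-valued points of the unitary group `U = U(D, ⋆)` over `F`:
the `g ∈ (R ⊗ D)ˣ` such that `g⋆ g = 1`. -/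
def points : Subgroup (R ⊗[F] D)ˣ where
  carrier := {g | τ.ext R g * g = 1}
  one_mem' := by simp [ext_one]
  mul_mem' := by
    intro a b ha hb
    simp only [Set.mem_ofPred_eq] at ha hb ⊢
    rw [Units.val_mul, ext_mul, mul_assoc, ← mul_assoc _ (a : R ⊗[F] D), ha, one_mul, hb]
  inv_mem' := by
    intro a ha
    simp only [Set.mem_ofPred_eq] at ha ⊢
    have h1 : τ.ext R a = (a⁻¹ : (R ⊗[F] D)ˣ) := by
      rw [← Units.mul_eq_one_iff_eq_inv, ha]
    rw [← h1, ext_ext, h1, Units.mul_inv]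

variable {R} {S : Type*} [CommRing S] [Algebra F S]

theorem map_ext (f : R →ₐ[F] S) (x : R ⊗[F] D) :
    τ.ext S (Algebra.TensorProduct.map f (AlgHom.id F D) x) =
      Algebra.TensorProduct.map f (AlgHom.id F D) (τ.ext R x) := by
  induction x with
  | zero => simp
  | add a b ha hb => simp only [map_add, ha, hb]
  | tmul r a => simp

/-- Functoriality of `R ↦ U(R)`. -/
noncomputable def pointsMap (f : R →ₐ[F] S) : τ.points R →* τ.points S :=
  ((Units.map (Algebra.TensorProduct.map f (AlgHom.id F D) :
    R ⊗[F] D →* S ⊗[F] D)).comp (τ.points R).subtype).codRestrict (τ.points S) <| by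
      intro g
      have h : τ.ext R (g : (R ⊗[F] D)ˣ) * (g : (R ⊗[F] D)ˣ) = 1 := g.2
      change τ.ext S (Algebra.TensorProduct.map f (AlgHom.id F D) (g : (R ⊗[F] D)ˣ)) *
        (Algebra.TensorProduct.map f (AlgHom.id F D) (g : (R ⊗[F] D)ˣ)) = 1
      rw [map_ext, ← map_mul, h, map_one]

end

end Involution

/-- For a topological ring `R`, the finite free `R`-module `R ⊗ D` carries its module topology
(the product topology for any basis); `U(R)` is topologized as a subgroup of `(R ⊗ D)ˣ`. -/
instance tensorTopology (R : Type*) [CommRing R] [Algebra F R] [TopologicalSpace R] :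
    TopologicalSpace (R ⊗[F] D) := moduleTopology R (R ⊗[F] D)

instance isTopologicalGroup_points [Module.Finite F D] (R : Type*) [CommRing R] [Algebra F R]
    [TopologicalSpace R] [IsTopologicalRing R] : IsTopologicalGroup (τ.points R) := by
  have : IsModuleTopology R (R ⊗[F] D) := ⟨rfl⟩
  have := IsModuleTopology.isTopologicalRing R (R ⊗[F] D)
  infer_instance

/-! ### Local groups and hyperspecial subgroups -/

variable (v : HeightOneSpectrum (𝓞 F))

/-- The local group `U(F_v)`. -/
abbrev Involution.localPoints : Type _ := τ.points (v.adicCompletion F)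

/-- The conjugation of `F_v ⊗ 𝒦` over `F_v`. -/
noncomputable def conjAt : v.adicCompletion F ⊗[F] 𝒦 →ₐ[v.adicCompletion F]
    v.adicCompletion F ⊗[F] 𝒦 :=
  Algebra.TensorProduct.map (AlgHom.id _ _) (conj F 𝒦 : 𝒦 →ₐ[F] 𝒦)

/-- A subgroup `K_v` of `U(F_v)` is hyperspecial if `v` is unramified in `𝒦` and `U` can be
identified over `F_v` with the quasi-split unitary group of `M₂(F_v ⊗ 𝒦)` relative to the
involution `x ↦ adj(xᶜ)` (that is `J (xᶜ)ᵗ J⁻¹` with `J` antidiagonal with entries `1, -1`), in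
such a way that `K_v` becomes the group of matrices with entries in the ring of integers of
`F_v ⊗ 𝒦`. (If `v` splits in `𝒦`, this is `GL₂(𝓞_v)` inside `GL₂(F_v)`.) -/
def IsHyperspecial (Kv : Subgroup (τ.localPoints v)) : Prop :=
  Algebra.IsUnramifiedIn (𝓞 𝒦) v.asIdeal ∧
  ∃ φ : (v.adicCompletion F ⊗[F] D) ≃ₐ[v.adicCompletion F]
      Matrix (Fin 2) (Fin 2) (v.adicCompletion F ⊗[F] 𝒦),
    (∀ z : 𝒦, φ (1 ⊗ₜ algebraMap 𝒦 D z) = Matrix.scalar (Fin 2) (1 ⊗ₜ z)) ∧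
    (∀ x, φ (τ.ext _ x) = ((φ x).map (conjAt v)).adjugate) ∧
    ∀ g : τ.localPoints v, g ∈ Kv ↔ ∀ i k, φ (g : (v.adicCompletion F ⊗[F] D)ˣ) i k ∈
      integralClosure (v.adicCompletionIntegers F) (v.adicCompletion F ⊗[F] 𝒦)

section Commutativity

/-! The following facts show that the Hecke algebra of a hyperspecial subgroup is commutative. -/

open Matrix

/-- `x` and `y` lie in the same double coset of `SL₂(A)`. -/
def SLEquiv {k : Type*} [Field k] (A : ValuationSubring k) (x y : Matrix (Fin 2) (Fin 2) k) :
    Prop :=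
  ∃ s t : Matrix (Fin 2) (Fin 2) k, (∀ i j, s i j ∈ A) ∧ (∀ i j, t i j ∈ A) ∧ s.det = 1 ∧
    t.det = 1 ∧ y = s * x * t

namespace SLEquiv

variable {k : Type*} [Field k] {A : ValuationSubring k} {x y z : Matrix (Fin 2) (Fin 2) k}

theorem mul_mem {s t : Matrix (Fin 2) (Fin 2) k} (hs : ∀ i j, s i j ∈ A)
    (ht : ∀ i j, t i j ∈ A) (i j : Fin 2) : (s * t) i j ∈ A := by
  rw [Matrix.mul_apply]
  exact sum_mem fun l _ => A.mul_mem _ _ (hs i l) (ht l j)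

theorem adj_mem {s : Matrix (Fin 2) (Fin 2) k} (hs : ∀ i j, s i j ∈ A) (i j : Fin 2) :
    s.adjugate i j ∈ A := by
  rw [Matrix.adjugate_fin_two]
  fin_cases i <;> fin_cases j <;> simp [hs, A.neg_mem]

theorem trans (h : SLEquiv A x y) (h' : SLEquiv A y z) : SLEquiv A x z := by
  obtain ⟨s, t, hs, ht, ds, dt, rfl⟩ := h
  obtain ⟨s', t', hs', ht', ds', dt', rfl⟩ := h'
  exact ⟨s' * s, t * t', mul_mem hs' hs, mul_mem ht ht', by simp [ds, ds'], by simp [dt, dt'],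
    by simp only [Matrix.mul_assoc]⟩

theorem symm (h : SLEquiv A x y) : SLEquiv A y x := by
  obtain ⟨s, t, hs, ht, ds, dt, rfl⟩ := h
  refine ⟨s.adjugate, t.adjugate, adj_mem hs, adj_mem ht, by simp [det_adjugate, ds],
    by simp [det_adjugate, dt], ?_⟩
  have h1 : s.adjugate * s = 1 := by rw [adjugate_mul, ds, one_smul]
  have h2 : t * t.adjugate = 1 := by rw [mul_adjugate, dt, one_smul]
  calc x = (s.adjugate * s) * x * (t * t.adjugate) := by rw [h1, h2, one_mul, mul_one]
    _ = _ := by simp only [Matrix.mul_assoc]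

theorem adj (h : SLEquiv A x y) : SLEquiv A x.adjugate y.adjugate := by
  obtain ⟨s, t, hs, ht, ds, dt, rfl⟩ := h
  exact ⟨t.adjugate, s.adjugate, adj_mem ht, adj_mem hs, by simp [det_adjugate, dt],
    by simp [det_adjugate, ds], by simp only [adjugate_mul_distrib, Matrix.mul_assoc]⟩

theorem w_left (x : Matrix (Fin 2) (Fin 2) k) :
    SLEquiv A x !![x 1 0, x 1 1; -x 0 0, -x 0 1] := by
  refine ⟨!![0, 1; -1, 0], 1, ?_, ?_, by simp, by simp, ?_⟩
  · intro i j
    fin_cases i <;> fin_cases j <;> simp [A.neg_mem, A.one_mem, A.zero_mem]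
  · intro i j
    fin_cases i <;> fin_cases j <;> simp [A.one_mem, A.zero_mem]
  · ext i j
    fin_cases i <;> fin_cases j <;> simp [Matrix.mul_apply, Fin.sum_univ_two, Matrix.vecMul, dotProduct]

theorem w_right (x : Matrix (Fin 2) (Fin 2) k) :
    SLEquiv A x !![-x 0 1, x 0 0; -x 1 1, x 1 0] := by
  refine ⟨1, !![0, 1; -1, 0], ?_, ?_, by simp, by simp, ?_⟩
  · intro i j
    fin_cases i <;> fin_cases j <;> simp [A.one_mem, A.zero_mem]
  · intro i j
    fin_cases i <;> fin_cases j <;> simp [A.neg_mem, A.one_mem, A.zero_mem]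
  · ext i j
    fin_cases i <;> fin_cases j <;> simp [Matrix.mul_apply, Fin.sum_univ_two]

theorem elim {a b c d : k} (ha : a ≠ 0) (hb : b / a ∈ A) (hc : c / a ∈ A) :
    SLEquiv A !![a, b; c, d] !![a, 0; 0, d - c * b / a] := by
  refine ⟨!![1, 0; -(c / a), 1], !![1, -(b / a); 0, 1], ?_, ?_, by simp, by simp, ?_⟩
  · intro i j
    fin_cases i <;> fin_cases j <;> simp [A.neg_mem, A.one_mem, A.zero_mem, hc]
  · intro i j
    fin_cases i <;> fin_cases j <;> simp [A.neg_mem, A.one_mem, A.zero_mem, hb]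
  · ext i j
    fin_cases i <;> fin_cases j <;> simp [Matrix.mul_apply, Fin.sum_univ_two] <;> field_simp <;>
      ring

theorem exists_diag (x : Matrix (Fin 2) (Fin 2) k) :
    ∃ a d, SLEquiv A x !![a, 0; 0, d] := by
  have hdiv : ∀ {a b : k}, A.valuation b ≤ A.valuation a → b / a ∈ A := by
    intro a b h
    rw [← A.valuation_le_one_iff, map_div₀]
    exact div_le_one_of_le₀ h zero_le
  obtain ⟨q, hq⟩ := Finite.exists_max fun q : Fin 2 × Fin 2 => A.valuation (x q.1 q.2)
  -- move an entry of maximal valuation to the upper left corner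
  obtain ⟨y, hy, hmax⟩ : ∃ y, SLEquiv A x y ∧
      ∀ i j, A.valuation (y i j) ≤ A.valuation (y 0 0) := by
    obtain ⟨i, j⟩ := q
    have h00 := hq (0, 0)
    have h01 := hq (0, 1)
    have h10 := hq (1, 0)
    have h11 := hq (1, 1)
    fin_cases i <;> fin_cases j
    · refine ⟨x, ⟨1, 1, ?_, ?_, by simp, by simp, by simp⟩, fun i j => hq (i, j)⟩ <;>
      · intro i j
        fin_cases i <;> fin_cases j <;> simp [A.one_mem, A.zero_mem]
    · refine ⟨_, w_right x, fun i j => ?_⟩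
      fin_cases i <;> fin_cases j <;> simpa [Valuation.map_neg] using by assumption
    · refine ⟨_, w_left x, fun i j => ?_⟩
      fin_cases i <;> fin_cases j <;> simpa [Valuation.map_neg] using by assumption
    · refine ⟨_, (w_right x).trans (w_left _), fun i j => ?_⟩
      fin_cases i <;> fin_cases j <;> simpa [Valuation.map_neg] using by assumption
  by_cases h0 : y 0 0 = 0
  · have hz : ∀ i j, y i j = 0 := fun i j => by
      have := hmax i j
      rw [h0, map_zero, le_zero_iff] at this
      exact (map_eq_zero _).mp this
    refine ⟨0, 0, ?_⟩
    convert hy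
    ext i j
    fin_cases i <;> fin_cases j <;> simp [hz]
  · rw [Matrix.eta_fin_two y] at hy
    exact ⟨_, _, hy.trans (elim h0 (hdiv (hmax _ _)) (hdiv (hmax _ _)))⟩

theorem adjugate (x : Matrix (Fin 2) (Fin 2) k) : SLEquiv A x x.adjugate := by
  obtain ⟨a, d, h⟩ := exists_diag (A := A) x
  refine h.trans (SLEquiv.trans ?_ h.symm.adj)
  rw [adjugate_fin_two_of]
  convert (((w_left (A := A) !![a, 0; 0, d]).trans (w_right _)).trans (w_left _)).trans (w_left _) using 1
  ext i j
  fin_cases i <;> fin_cases j <;> simp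

end SLEquiv

theorem conj_conj (z : 𝒦) : conj F 𝒦 (conj F 𝒦 z) = z := by
  have h1 : Nat.card (𝒦 ≃ₐ[F] 𝒦) = 2 := by
    rw [IsGalois.card_aut_eq_finrank, Algebra.IsQuadraticExtension.finrank_eq_two]
  have h2 : conj F 𝒦 ^ 2 = 1 := by rw [← h1, pow_card_eq_one']
  rw [pow_two] at h2
  exact DFunLike.congr_fun h2 z

theorem eq_one_or_eq_conj (f : 𝒦 ≃ₐ[F] 𝒦) : f = 1 ∨ f = conj F 𝒦 := by
  have h1 : Nat.card (𝒦 ≃ₐ[F] 𝒦) = 2 := by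
    rw [IsGalois.card_aut_eq_finrank, Algebra.IsQuadraticExtension.finrank_eq_two]
  obtain ⟨x, y, -, hxy⟩ := Nat.card_eq_two_iff.mp h1
  have hm : ∀ g : 𝒦 ≃ₐ[F] 𝒦, g = x ∨ g = y := fun g => by
    have := Set.mem_univ g
    rw [← hxy] at this
    simpa using this
  have hc := conj_ne_one F 𝒦
  rcases hm f with h | h <;> rcases hm 1 with h' | h' <;> rcases hm (conj F 𝒦) with h'' | h'' <;>
    simp_all

theorem add_conj_mem (z : 𝒦) : ∃ a : F, algebraMap F 𝒦 a = z + conj F 𝒦 z := by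
  have := (IsGalois.mem_range_algebraMap_iff_fixed (F := F) (E := 𝒦) (z + conj F 𝒦 z)).mpr
    fun f => by
      rcases eq_one_or_eq_conj f with rfl | rfl
      · rfl
      · rw [map_add, conj_conj, add_comm]
  exact this

theorem conjAt_conjAt (x : v.adicCompletion F ⊗[F] 𝒦) : conjAt v (conjAt v x) = x := by
  induction x with
  | zero => simp
  | add a b ha hb => rw [map_add, map_add, ha, hb]
  | tmul r a => simp [conjAt, conj_conj]

theorem add_conjAt_mem (x : v.adicCompletion F ⊗[F] 𝒦) :
    ∃ a, algebraMap (v.adicCompletion F) _ a = x + conjAt v x := by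
  induction x with
  | zero => exact ⟨0, by simp⟩
  | add x y hx hy =>
    obtain ⟨a, ha⟩ := hx
    obtain ⟨b, hb⟩ := hy
    exact ⟨a + b, by rw [map_add, map_add, ha, hb]; abel⟩
  | tmul r z =>
    obtain ⟨a, ha⟩ := add_conj_mem (F := F) z
    refine ⟨a • r, ?_⟩
    have h : conjAt v (r ⊗ₜ[F] z) = r ⊗ₜ conj F 𝒦 z := by simp [conjAt]
    rw [h, ← TensorProduct.tmul_add, ← ha, Algebra.algebraMap_eq_smul_one (A := 𝒦),
      ← TensorProduct.smul_tmul]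
    rfl

theorem two_ne_zero_at : (2 : v.adicCompletion F) ≠ 0 := by
  have : (2 : v.adicCompletion F) = algebraMap F _ 2 := (map_ofNat _ 2).symm
  rw [this, Ne, map_eq_zero]
  exact two_ne_zero

theorem mem_of_conjAt_eq {x : v.adicCompletion F ⊗[F] 𝒦} (hx : conjAt v x = x) :
    ∃ a, algebraMap (v.adicCompletion F) _ a = x := by
  obtain ⟨a, ha⟩ := add_conjAt_mem v x
  rw [hx, ← two_smul (v.adicCompletion F)] at ha
  refine ⟨2⁻¹ * a, ?_⟩
  rw [map_mul, ha, ← Algebra.smul_def, smul_smul, inv_mul_cancel₀ (two_ne_zero_at v), one_smul]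

theorem isUnit_of_norm {x : v.adicCompletion F ⊗[F] 𝒦} (hx : x * conjAt v x ≠ 0) :
    IsUnit x := by
  obtain ⟨a, ha⟩ := mem_of_conjAt_eq v (x := x * conjAt v x) (by
    rw [map_mul, conjAt_conjAt, mul_comm])
  have h0 : a ≠ 0 := by
    rintro rfl
    exact hx (by rw [← ha, map_zero])
  refine isUnit_of_mul_isUnit_left (y := conjAt v x) ?_
  rw [← ha]
  exact (IsUnit.mk0 a h0).map _

/-- Hilbert's theorem 90 for `F_v ⊗ 𝒦` over `F_v`. -/
theorem exists_unit {u : v.adicCompletion F ⊗[F] 𝒦} (hu : conjAt v u * u = 1) :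
    ∃ c, IsUnit c ∧ conjAt v c = conjAt v u * c := by
  obtain ⟨z, hz⟩ : ∃ z : 𝒦, conj F 𝒦 z ≠ z := by
    by_contra! h
    exact conj_ne_one F 𝒦 (AlgEquiv.ext h)
  have hz0 : z - conj F 𝒦 z ≠ 0 := sub_ne_zero.mpr hz.symm
  set t : v.adicCompletion F ⊗[F] 𝒦 := 1 ⊗ₜ (z - conj F 𝒦 z) with ht
  have ht1 : conjAt v t = -t := by
    rw [ht, ← TensorProduct.tmul_neg]
    simp [conjAt, conj_conj]
  have htu : IsUnit t :=
    (IsUnit.mk0 _ hz0).map (Algebra.TensorProduct.includeRight : 𝒦 →ₐ[F] _)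
  by_cases h : (1 + u) * conjAt v (1 + u) = 0
  · refine ⟨t * (1 - u), htu.mul (isUnit_of_norm v ?_), ?_⟩
    · intro h'
      rw [map_add, map_one] at h
      rw [map_sub, map_one] at h'
      have h4 : (4 : v.adicCompletion F ⊗[F] 𝒦) = 0 := by
        linear_combination h + h' - 2 * hu
      have h5 : (4 : v.adicCompletion F ⊗[F] 𝒦) =
          algebraMap (v.adicCompletion F) _ (2 * 2) := by
        rw [map_mul, map_ofNat]
        norm_num
      have h6 : Nontrivial (v.adicCompletion F ⊗[F] 𝒦) := inferInstance
      rw [h5, map_eq_zero] at h4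
      exact mul_ne_zero (two_ne_zero_at v) (two_ne_zero_at v) h4
    · rw [map_mul, ht1, map_sub, map_one]
      linear_combination t * hu
  · refine ⟨1 + u, isUnit_of_norm v h, ?_⟩
    rw [map_add, map_one]
    linear_combination -hu

section

variable {k B : Type*} [Field k] (A : ValuationSubring k) [CommRing B] [Algebra k B]
  (σ : B →ₐ[k] B)

theorem adjugate_map_algHom (M : Matrix (Fin 2) (Fin 2) B) :
    M.adjugate.map σ = (M.map σ).adjugate :=
  RingHom.map_adjugate (σ : B →+* B) M

theorem adjugate_adjugate_two (M : Matrix (Fin 2) (Fin 2) B) : M.adjugate.adjugate = M := by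
  ext i j
  fin_cases i <;> fin_cases j <;> simp [adjugate_fin_two]

theorem det_map_algHom (M : Matrix (Fin 2) (Fin 2) B) : (M.map σ).det = σ M.det :=
  (RingHom.map_det (σ : B →+* B) M).symm

/-- A unitary `2 × 2` matrix `M` is equivalent to its adjugate under `SL₂(A)`. -/
theorem adjugate_unitary (hfix : ∀ x, σ x = x → ∃ a, algebraMap k B a = x)
    (h90 : ∀ u, σ u * u = 1 → ∃ c, IsUnit c ∧ σ c = σ u * c)
    {M : Matrix (Fin 2) (Fin 2) B} (hM : (M.map σ).adjugate * M = 1) :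
    ∃ s t : Matrix (Fin 2) (Fin 2) k, (∀ i j, s i j ∈ A) ∧ (∀ i j, t i j ∈ A) ∧ s.det = 1 ∧
      t.det = 1 ∧ M.adjugate = s.map (algebraMap k B) * M * t.map (algebraMap k B) := by
  have hu : σ M.det * M.det = 1 := by
    have := congrArg Matrix.det hM
    simpa [det_adjugate, det_map_algHom] using this
  have hσ : M.map σ = σ M.det • M := by
    have := congrArg (M.map σ * ·) hM
    simp only [← Matrix.mul_assoc, mul_adjugate, det_map_algHom, mul_one, smul_mul_assoc,
      one_mul] at this
    exact this.symm
  obtain ⟨c, hc, hcσ⟩ := h90 _ hu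
  obtain ⟨c, rfl⟩ := hc
  have hN : ∀ i j, σ ((c⁻¹ : Bˣ) * M i j) = (c⁻¹ : Bˣ) * M i j := by
    intro i j
    have h1 : σ (M i j) = σ M.det * M i j := by
      simpa using congrFun (congrFun hσ i) j
    have h2 : IsUnit (σ (c : B)) := c.isUnit.map _
    refine h2.mul_left_cancel ?_
    rw [← map_mul, Units.mul_inv_cancel_left, h1, hcσ, mul_assoc, Units.mul_inv_cancel_left]
  choose N hN using fun i j => hfix _ (hN i j)
  have hMN : M = (c : B) • (Matrix.of N).map (algebraMap k B) := by
    ext i j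
    simp [hN]
  obtain ⟨s, t, hs, ht, ds, dt, e⟩ := SLEquiv.adjugate (A := A) (Matrix.of N)
  refine ⟨s, t, hs, ht, ds, dt, ?_⟩
  have e2 := congrArg (fun Q => Q.map (algebraMap k B)) e
  simp only [Matrix.map_mul] at e2
  have e3 : (Matrix.of N).adjugate.map (algebraMap k B) =
      ((Matrix.of N).map (algebraMap k B)).adjugate :=
    RingHom.map_adjugate (algebraMap k B) (Matrix.of N)
  rw [hMN, adjugate_smul, ← e3, e2]
  simp

end

theorem IsHyperspecial.exists_anti {v : HeightOneSpectrum (𝓞 F)} {τ : Involution F 𝒦 D}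
    {Kv : Subgroup (τ.localPoints v)} (h : IsHyperspecial τ v Kv) :
    ∃ θ : τ.localPoints v → τ.localPoints v, (∀ x y, θ (x * y) = θ y * θ x) ∧
      (∀ x, θ x ∈ Kv ↔ x ∈ Kv) ∧ ∀ x, ∃ a ∈ Kv, ∃ b ∈ Kv, θ x = a * x * b := by
  obtain ⟨-, φ, -, hφ, hK⟩ := h
  let ψ : τ.localPoints v → Matrix (Fin 2) (Fin 2) (v.adicCompletion F ⊗[F] 𝒦) :=
    fun g => φ (g : (v.adicCompletion F ⊗[F] D)ˣ)
  have hψ : Function.Injective ψ := fun a b hab =>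
    Subtype.ext (Units.ext (φ.injective hab))
  have hψm : ∀ a b, ψ (a * b) = ψ a * ψ b := fun a b => map_mul φ _ _
  have hψu : ∀ g, ((ψ g).map (conjAt v)).adjugate * ψ g = 1 := by
    intro g
    have hg : τ.ext (v.adicCompletion F) (g : (v.adicCompletion F ⊗[F] D)ˣ) *
      (g : (v.adicCompletion F ⊗[F] D)ˣ) = 1 := g.2
    have := congrArg φ hg
    rwa [map_mul, map_one, hφ] at this
  have lift : ∀ M, (M.map (conjAt v)).adjugate * M = 1 → ∃ g, ψ g = M := by
    intro M hM
    have hM' : M * (M.map (conjAt v)).adjugate = 1 := mul_eq_one_comm.mp hM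
    refine ⟨⟨⟨φ.symm M, φ.symm (M.map (conjAt v)).adjugate, ?_, ?_⟩, ?_⟩, ?_⟩
    · rw [← map_mul, hM', map_one]
    · rw [← map_mul, hM, map_one]
    · change τ.ext _ (φ.symm M) * φ.symm M = 1
      apply φ.injective
      rw [map_mul, hφ, φ.apply_symm_apply, hM, map_one]
    · exact φ.apply_symm_apply M
  have hθ : ∀ g, ∃ g', ψ g' = (ψ g).adjugate := fun g => by
    refine lift _ ?_
    have h1 := mul_eq_one_comm.mp (hψu g)
    rw [adjugate_map_algHom, ← adjugate_mul_distrib, h1, adjugate_one]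
  choose θ hθ using hθ
  have hSL : ∀ s : Matrix (Fin 2) (Fin 2) (v.adicCompletion F),
      (∀ i j, s i j ∈ v.adicCompletionIntegers F) → s.det = 1 →
      ∃ a ∈ Kv, ψ a = s.map (algebraMap _ _) := by
    intro s hs ds
    obtain ⟨a, ha⟩ := lift (s.map (algebraMap _ _)) (by
      have h1 : (s.map (algebraMap (v.adicCompletion F) (v.adicCompletion F ⊗[F] 𝒦))).map
          (conjAt v) = s.map (algebraMap _ _) := by
        ext i j
        exact (conjAt v).commutes (s i j)
      have h2 : (s.map (algebraMap (v.adicCompletion F) (v.adicCompletion F ⊗[F] 𝒦))).det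
          = 1 := by
        have := RingHom.map_det (algebraMap (v.adicCompletion F)
          (v.adicCompletion F ⊗[F] 𝒦)) s
        rw [ds, map_one] at this
        exact this.symm
      rw [h1, adjugate_mul, h2, one_smul])
    refine ⟨a, (hK a).mpr fun i k => ?_, ha⟩
    change ψ a i k ∈ _
    rw [ha, Matrix.map_apply]
    exact (isIntegral_algebraMap (R := v.adicCompletionIntegers F)
      (x := (⟨s i k, hs i k⟩ : v.adicCompletionIntegers F))
      (A := v.adicCompletion F ⊗[F] 𝒦))
  refine ⟨θ, fun x y => hψ ?_, fun x => ?_, fun x => ?_⟩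
  · rw [hθ, hψm, hψm, hθ, hθ, adjugate_mul_distrib]
  · rw [hK, hK]
    change (∀ i k, ψ (θ x) i k ∈ _) ↔ ∀ i k, ψ x i k ∈ _
    have aux : ∀ M : Matrix (Fin 2) (Fin 2) (v.adicCompletion F ⊗[F] 𝒦),
        (∀ i k, M i k ∈ integralClosure (v.adicCompletionIntegers F)
          (v.adicCompletion F ⊗[F] 𝒦)) →
        ∀ i k, M.adjugate i k ∈ integralClosure (v.adicCompletionIntegers F)
          (v.adicCompletion F ⊗[F] 𝒦) := by
      intro M hM i k
      rw [adjugate_fin_two]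
      fin_cases i <;> fin_cases k <;> simp [hM]
    rw [hθ]
    refine ⟨fun h => ?_, aux _⟩
    have := aux _ h
    rwa [adjugate_adjugate_two] at this
  · obtain ⟨s, t, hs, ht, ds, dt, e⟩ := adjugate_unitary (v.adicCompletionIntegers F) (conjAt v)
      (fun _ => mem_of_conjAt_eq v) (fun _ => exists_unit v) (hψu x)
    obtain ⟨a, ha, ea⟩ := hSL s hs ds
    obtain ⟨b, hb, eb⟩ := hSL t ht dt
    refine ⟨a, ha, b, hb, hψ ?_⟩
    rw [hθ, hψm, hψm, ea, eb, e]

end Commutativity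

/-! ### Adelic groups -/

section Adelic

theorem eventually_mem_integers (a : F) :
    ∀ᶠ v : HeightOneSpectrum (𝓞 F) in Filter.cofinite,
      algebraMap F (v.adicCompletion F) a ∈ v.adicCompletionIntegers F := by
  refine (HeightOneSpectrum.Support.finite (𝓞 F) a).subset fun v hv => ?_
  simp only [Set.mem_compl_iff, Set.mem_ofPred_eq] at hv
  rw [HeightOneSpectrum.mem_adicCompletionIntegers, not_le] at hv
  have h := HeightOneSpectrum.valuedAdicCompletion_eq_valuation' v a
  change 1 < v.valuation F a
  rw [← h]
  exact hv

variable [Module.Finite F D]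

/-- The lattice in `F_v ⊗ D` spanned over `𝓞_v` by a fixed `F`-basis of `D`. -/
noncomputable def latticeAt (F D : Type*) [Field F] [NumberField F] [Ring D] [Algebra F D]
    [Module.Finite F D] (v : HeightOneSpectrum (𝓞 F)) :
    Submodule (v.adicCompletionIntegers F) (v.adicCompletion F ⊗[F] D) :=
  Submodule.span _ (Set.range fun i => 1 ⊗ₜ Module.finBasis F D i)

/-- The stabilizer in `U(F_v)` of the lattice `latticeAt F D v`. -/
def Involution.integralPoints : Subgroup (τ.localPoints v) where
  carrier := {g | (∀ x ∈ latticeAt F D v,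
      (g.1 : v.adicCompletion F ⊗[F] D) * x ∈ latticeAt F D v) ∧
    ∀ x ∈ latticeAt F D v, (↑(g.1⁻¹) : v.adicCompletion F ⊗[F] D) * x ∈ latticeAt F D v}
  one_mem' := by simp
  mul_mem' := by
    rintro a b ⟨ha, ha'⟩ ⟨hb, hb'⟩
    refine ⟨fun x hx => ?_, fun x hx => ?_⟩
    · simpa [mul_assoc] using ha _ (hb x hx)
    · simpa [mul_assoc] using hb' _ (ha' x hx)
  inv_mem' := by
    rintro a ⟨ha, ha'⟩
    exact ⟨ha', by simpa using ha⟩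

/-- The group `G(𝔸_f) = U(𝔸_{F,f})`: the restricted product of the groups `U(F_v)` over the finite
places `v` of `F`, with respect to the stabilizers of a lattice in `D`. -/
abbrev Involution.finAdelic : Type _ :=
  Πʳ v : HeightOneSpectrum (𝓞 F), [τ.localPoints v, τ.integralPoints v]

/-- The group `G(ℝ) = ∏ U(F_v)`, over the infinite places `v` of `F`. -/
abbrev Involution.infinite : Type _ := ∀ v : InfinitePlace F, τ.points v.Completion

/-- The group `G(𝔸) = G(ℝ) × G(𝔸_f)`. -/
abbrev Involution.adelic : Type _ := τ.infinite × τ.finAdelic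

theorem eventually_mem_lattice (z : F ⊗[F] D) :
    ∀ᶠ v : HeightOneSpectrum (𝓞 F) in Filter.cofinite,
      Algebra.TensorProduct.map (Algebra.ofId F (v.adicCompletion F)) (AlgHom.id F D) z ∈
        latticeAt F D v := by
  induction z with
  | zero => simp
  | add x y hx hy =>
    filter_upwards [hx, hy] with v hx hy
    rw [map_add]
    exact add_mem hx hy
  | tmul r d =>
    have h : ∀ᶠ v : HeightOneSpectrum (𝓞 F) in Filter.cofinite, ∀ i,
        algebraMap F (v.adicCompletion F) (r * (Module.finBasis F D).repr d i) ∈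
          v.adicCompletionIntegers F :=
      Filter.eventually_all.mpr fun i => eventually_mem_integers _
    filter_upwards [h] with v hv
    have e : Algebra.TensorProduct.map (Algebra.ofId F (v.adicCompletion F)) (AlgHom.id F D)
        (r ⊗ₜ d) = ∑ i, algebraMap F (v.adicCompletion F)
          (r * (Module.finBasis F D).repr d i) ⊗ₜ[F] Module.finBasis F D i := by
      conv_lhs => rw [← (Module.finBasis F D).sum_repr d]
      rw [TensorProduct.tmul_sum, map_sum]
      refine Finset.sum_congr rfl fun i _ => ?_
      rw [TensorProduct.tmul_smul, TensorProduct.smul_tmul', smul_eq_mul, mul_comm]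
      rfl
    rw [e]
    refine sum_mem fun i _ => ?_
    have := (latticeAt F D v).smul_mem ⟨_, hv i⟩ (Submodule.subset_span ⟨i, rfl⟩)
    convert this using 1
    change _ = algebraMap F (v.adicCompletion F) (r * (Module.finBasis F D).repr d i) •
      ((1 : v.adicCompletion F) ⊗ₜ[F] Module.finBasis F D i)
    rw [TensorProduct.smul_tmul', smul_eq_mul, mul_one]

theorem eventually_mul_mem_lattice (z : F ⊗[F] D) :
    ∀ᶠ v : HeightOneSpectrum (𝓞 F) in Filter.cofinite, ∀ x ∈ latticeAt F D v,
      Algebra.TensorProduct.map (Algebra.ofId F (v.adicCompletion F)) (AlgHom.id F D) z * x ∈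
        latticeAt F D v := by
  have h : ∀ᶠ v : HeightOneSpectrum (𝓞 F) in Filter.cofinite, ∀ i,
      Algebra.TensorProduct.map (Algebra.ofId F (v.adicCompletion F)) (AlgHom.id F D)
        (z * 1 ⊗ₜ Module.finBasis F D i) ∈ latticeAt F D v :=
    Filter.eventually_all.mpr fun i => eventually_mem_lattice _
  filter_upwards [h] with v hv x hx
  induction hx using Submodule.span_induction with
  | mem x hx =>
    obtain ⟨i, rfl⟩ := hx
    have := hv i
    rw [map_mul] at this
    simpa using this
  | zero => simp
  | add x y _ _ hx hy => rw [mul_add]; exact add_mem hx hy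
  | smul a x _ hx => rw [mul_smul_comm]; exact (latticeAt F D v).smul_mem a hx

/-- The diagonal embedding `G(ℚ) = U(F) → G(𝔸_f)`. -/
noncomputable def Involution.diagFin : τ.points F →* τ.finAdelic where
  toFun γ := ⟨fun v => τ.pointsMap (Algebra.ofId F (v.adicCompletion F)) γ, by
    filter_upwards [eventually_mul_mem_lattice ((γ : (F ⊗[F] D)ˣ) : F ⊗[F] D),
      eventually_mul_mem_lattice (((γ : (F ⊗[F] D)ˣ)⁻¹ : (F ⊗[F] D)ˣ) : F ⊗[F] D)]
      with v h h'
    exact show _ ∧ _ from ⟨h, h'⟩⟩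
  map_one' := RestrictedProduct.ext _ _ fun v =>
    map_one (τ.pointsMap (Algebra.ofId F (v.adicCompletion F)))
  map_mul' a b := RestrictedProduct.ext _ _ fun v =>
    map_mul (τ.pointsMap (Algebra.ofId F (v.adicCompletion F))) a b

/-- The diagonal embedding `G(ℚ) = U(F) → G(𝔸)`. -/
noncomputable def Involution.diag : τ.points F →* τ.adelic :=
  (MonoidHom.pi fun v : InfinitePlace F =>
    τ.pointsMap (Algebra.ofId F v.Completion)).prod τ.diagFin

open Classical in
/-- The embedding of `U(F_v)` in `G(𝔸_f)`. -/
noncomputable def Involution.localEmb : τ.localPoints v →* τ.finAdelic where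
  toFun := RestrictedProduct.mulSingle (fun v => τ.integralPoints v) v
  map_one' := RestrictedProduct.mulSingle_one _ _
  map_mul' := RestrictedProduct.mulSingle_mul _ _

variable {τ} {v}

theorem localEmb_same (g : τ.localPoints v) : τ.localEmb v g v = g := by
  classical
  exact RestrictedProduct.mulSingle_eq_same (fun v => τ.integralPoints v) v g

theorem localEmb_ne {w : HeightOneSpectrum (𝓞 F)} (h : w ≠ v) (g : τ.localPoints v) :
    τ.localEmb v g w = 1 := by
  classical
  exact RestrictedProduct.mulSingle_eq_of_ne (fun v => τ.integralPoints v) g h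

theorem commute_localEmb {x : τ.finAdelic} (hx : x v = 1) (g : τ.localPoints v) :
    Commute x (τ.localEmb v g) := by
  refine RestrictedProduct.ext _ _ fun w => ?_
  rw [RestrictedProduct.mul_apply, RestrictedProduct.mul_apply]
  by_cases h : w = v
  · subst h
    rw [hx, one_mul, mul_one]
  · rw [localEmb_ne h, one_mul, mul_one]

end Adelic

/-! ### Levels, Hecke algebras -/

/-- The place `v` lies above `p`. -/
def AboveP (p : ℕ) (v : HeightOneSpectrum (𝓞 F)) : Prop := (p : 𝓞 F) ∈ v.asIdeal

variable [Module.Finite F D] (p : ℕ)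

/-- The group `G(ℚ_p) = ∏_{v ∣ p} U(F_v)`. -/
abbrev Involution.padicPoints : Type _ :=
  ∀ v : {v : HeightOneSpectrum (𝓞 F) // AboveP p v}, τ.localPoints v.1

/-- A tame level: a compact open subgroup `K^p = ∏_{v ∤ p} K_v` of `G(𝔸_f^p)`. -/
structure TameLevel where
  K : ∀ v : {v : HeightOneSpectrum (𝓞 F) // ¬ AboveP p v}, Subgroup (τ.localPoints v.1)
  isOpen' : ∀ v, IsOpen (K v : Set (τ.localPoints v.1))
  isCompact' : ∀ v, IsCompact (K v : Set (τ.localPoints v.1))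
  eventually_eq : ∀ᶠ v in Filter.cofinite, K v = τ.integralPoints v.1

/-- The compact open subgroups `K_p` of `G(ℚ_p)`. -/
abbrev PLevel : Type _ :=
  {Kp : Subgroup (τ.padicPoints p) // IsOpen (Kp : Set (τ.padicPoints p)) ∧
    IsCompact (Kp : Set (τ.padicPoints p))}

variable {τ p} (U : TameLevel τ p)

namespace TameLevel

/-- The subgroup `K^p` of `G(𝔸_f)` (with trivial components above `p`). -/
def tame : Subgroup τ.finAdelic where
  carrier := {g | (∀ v : {v // AboveP p v}, g v.1 = 1) ∧ ∀ v, g v.1 ∈ U.K v}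
  one_mem' := ⟨fun _ => rfl, fun v => (U.K v).one_mem⟩
  mul_mem' := fun ha hb => ⟨fun v => by
    rw [RestrictedProduct.mul_apply, ha.1, hb.1, one_mul],
    fun v => (U.K v).mul_mem (ha.2 v) (hb.2 v)⟩
  inv_mem' := fun ha => ⟨fun v => by
    rw [RestrictedProduct.inv_apply, ha.1, inv_one], fun v => (U.K v).inv_mem (ha.2 v)⟩

/-- The subgroup `K = K_p K^p` of `G(𝔸_f)`. -/
def level (Kp : PLevel τ p) : Subgroup τ.finAdelic where
  carrier := {g | (fun v : {v // AboveP p v} => g v.1) ∈ Kp.1 ∧ ∀ v, g v.1 ∈ U.K v}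
  one_mem' := ⟨Kp.1.one_mem, fun v => (U.K v).one_mem⟩
  mul_mem' := fun ha hb => ⟨Kp.1.mul_mem ha.1 hb.1, fun v => (U.K v).mul_mem (ha.2 v) (hb.2 v)⟩
  inv_mem' := fun ha => ⟨Kp.1.inv_mem ha.1, fun v => (U.K v).inv_mem (ha.2 v)⟩

theorem level_mono {Kp Kp' : PLevel τ p} (h : Kp' ≤ Kp) : U.level Kp' ≤ U.level Kp :=
  fun _ hg => ⟨h hg.1, hg.2⟩

theorem localEmb_mem_level (Kp : PLevel τ p) {v : {v : HeightOneSpectrum (𝓞 F) // ¬ AboveP p v}}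
    {k : τ.localPoints v.1} (hk : k ∈ U.K v) : τ.localEmb v.1 k ∈ U.level Kp := by
  refine ⟨?_, fun w => ?_⟩
  · convert Kp.1.one_mem using 1
    funext w
    exact localEmb_ne (fun h : w.1 = v.1 => v.2 (by rw [← h]; exact w.2)) k
  · by_cases h : w = v
    · subst h
      rwa [localEmb_same]
    · rw [localEmb_ne (fun h' => h (Subtype.ext h'))]
      exact (U.K w).one_mem

variable (A : Type*) [CommRing A]

/-- The functions `G(ℚ) \ G(𝔸_f) / K → A` for `K = K_p K^p`, as functions on `G(𝔸_f)`. -/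
def forms (Kp : PLevel τ p) : Submodule A (τ.finAdelic → A) where
  carrier := {f | (∀ γ x, f (τ.diagFin γ * x) = f x) ∧ ∀ x, ∀ k ∈ U.level Kp, f (x * k) = f x}
  zero_mem' := ⟨fun _ _ => rfl, fun _ _ _ => rfl⟩
  add_mem' := fun ha hb => ⟨fun γ x => by simp only [Pi.add_apply, ha.1, hb.1],
    fun x k hk => by simp only [Pi.add_apply, ha.2 x k hk, hb.2 x k hk]⟩
  smul_mem' := fun c f hf => ⟨fun γ x => by simp only [Pi.smul_apply, hf.1],
    fun x k hk => by simp only [Pi.smul_apply, hf.2 x k hk]⟩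

/-- The `A`-module `H⁰(K)_A` of functions `G(ℚ) \ G(𝔸_f) / K → A`, for `K = K_p K^p`. -/
def H0 (Kp : PLevel τ p) : Type _ := U.forms A Kp

instance (Kp : PLevel τ p) : AddCommGroup (U.H0 A Kp) :=
  inferInstanceAs (AddCommGroup (U.forms A Kp))

instance (Kp : PLevel τ p) : Module A (U.H0 A Kp) :=
  inferInstanceAs (Module A (U.forms A Kp))

variable {A} in
/-- The inclusion of `H⁰(K_p K^p)_A` in `H⁰(K_p' K^p)_A` for `K_p' ⊆ K_p`. -/
def H0.incl {Kp Kp' : PLevel τ p} (h : Kp' ≤ Kp) (f : U.H0 A Kp) : U.H0 A Kp' :=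
  ⟨f.1, f.2.1, fun x k hk => f.2.2 x k (U.level_mono h hk)⟩

theorem finite_cosets (v : {v : HeightOneSpectrum (𝓞 F) // ¬ AboveP p v})
    (g : τ.localPoints v.1) : (cosets (U.K v) g).Finite :=
  DefiniteUnitary.finite_cosets (U.isOpen' v) (U.isCompact' v) g

variable {A} in
theorem heckeFun_mem (Kp : PLevel τ p) (v : {v : HeightOneSpectrum (𝓞 F) // ¬ AboveP p v})
    (g : τ.localPoints v.1) {f : τ.finAdelic → A} (hf : f ∈ U.forms A Kp) :
    heckeFun (U.K v) (τ.localEmb v.1) g f ∈ U.forms A Kp := by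
  refine ⟨fun γ x => heckeFun_left g _ (hf.1 γ) x, fun x k hk => ?_⟩
  have h1 : τ.localEmb v.1 (k v.1) ∈ U.level Kp := U.localEmb_mem_level Kp (hk.2 v)
  have h2 : k = τ.localEmb v.1 (k v.1) * ((τ.localEmb v.1 (k v.1))⁻¹ * k) := by group
  have h3 : ((τ.localEmb v.1 (k v.1))⁻¹ * k) v.1 = 1 := by
    rw [RestrictedProduct.mul_apply, RestrictedProduct.inv_apply, localEmb_same,
      inv_mul_cancel]
  rw [h2, ← mul_assoc, heckeFun_comm_right g _ (fun h => commute_localEmb h3 h)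
      (fun x => hf.2 x _ (Subgroup.mul_mem _ (Subgroup.inv_mem _ h1) hk)),
    heckeFun_right (fun x k hk => hf.2 x _ (U.localEmb_mem_level Kp hk)) g x _ (hk.2 v)]

/-- The Hecke operator `[K_v g K_v]` on `H⁰(K)_A`, for `v ∤ p` and `g ∈ U(F_v)`. -/
noncomputable def heckeOp (Kp : PLevel τ p)
    (v : {v : HeightOneSpectrum (𝓞 F) // ¬ AboveP p v}) (g : τ.localPoints v.1) :
    Module.End A (U.H0 A Kp) where
  toFun f := ⟨heckeFun (U.K v) (τ.localEmb v.1) g f.1, U.heckeFun_mem Kp v g f.2⟩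
  map_add' f f' := Subtype.ext <| funext fun x => by
    change heckeFun (U.K v) (τ.localEmb v.1) g (f.1 + f'.1) x =
      heckeFun (U.K v) (τ.localEmb v.1) g f.1 x + heckeFun (U.K v) (τ.localEmb v.1) g f'.1 x
    simp only [heckeFun, finsum_mem_eq_finite_toFinset_sum _ (U.finite_cosets v g),
      Pi.add_apply, Finset.sum_add_distrib]
  map_smul' c f := Subtype.ext <| funext fun x => by
    change heckeFun (U.K v) (τ.localEmb v.1) g (c • f.1) x =
      c • heckeFun (U.K v) (τ.localEmb v.1) g f.1 x
    simp only [heckeFun, finsum_mem_eq_finite_toFinset_sum _ (U.finite_cosets v g),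
      Pi.smul_apply, Finset.smul_sum]

/-- The set of Hecke operators `[K_v g K_v]` on `H⁰(K)_A`, where `v` runs through the places
not above `p` such that `K_v` is hyperspecial. -/
def heckeOps (Kp : PLevel τ p) : Set (Module.End A (U.H0 A Kp)) :=
  {T | ∃ v g, IsHyperspecial τ v.1 (U.K v) ∧ T = U.heckeOp A Kp v g}

theorem heckeOps_comm (Kp : PLevel τ p) :
    ∀ S ∈ U.heckeOps A Kp, ∀ T ∈ U.heckeOps A Kp, S * T = T * S := by
  rintro _ ⟨v, g, hv, rfl⟩ _ ⟨w, h, hw, rfl⟩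
  refine LinearMap.ext fun f => Subtype.ext ?_
  change heckeFun (U.K v) (τ.localEmb v.1) g (heckeFun (U.K w) (τ.localEmb w.1) h f.1) =
    heckeFun (U.K w) (τ.localEmb w.1) h (heckeFun (U.K v) (τ.localEmb v.1) g f.1)
  by_cases e : v = w
  · subst e
    obtain ⟨θ, h1, h2, h3⟩ := hv.exists_anti
    exact heckeFun_comm_of_anti θ h1 h2 h3 g h (U.finite_cosets v g) (U.finite_cosets v h)
      fun x k hk => f.2.2 x _ (U.localEmb_mem_level Kp hk)
  · exact heckeFun_comm g h (U.finite_cosets v g) (U.finite_cosets w h) fun a b =>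
      commute_localEmb (localEmb_ne (fun h => e (Subtype.ext h.symm)) a) b

/-- The Hecke algebra `𝕋(K)_A`: the `A`-subalgebra of `End H⁰(K)_A` generated by the Hecke
operators at the places `v ∤ p` where `K_v` is hyperspecial. -/
def HeckeAlg (Kp : PLevel τ p) : Type _ := Algebra.adjoin A (U.heckeOps A Kp)

noncomputable instance instRingHeckeAlg (Kp : PLevel τ p) : Ring (U.HeckeAlg A Kp) :=
  inferInstanceAs (Ring (Algebra.adjoin A (U.heckeOps A Kp)))

noncomputable instance (Kp : PLevel τ p) : CommRing (U.HeckeAlg A Kp) :=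
  { U.instRingHeckeAlg A Kp with
    mul_comm := fun a b =>
      (Algebra.isMulCommutative_adjoin A (U.heckeOps_comm A Kp)).is_comm.comm a b }

noncomputable instance (Kp : PLevel τ p) : Algebra A (U.HeckeAlg A Kp) :=
  inferInstanceAs (Algebra A (Algebra.adjoin A (U.heckeOps A Kp)))

/-- The Hecke algebra `𝕋(K^p)_A`: the projective limit of the `𝕋(K_p K^p)_A` over all compact
open subgroups `K_p` of `G(ℚ_p)`, along the maps `𝕋(K_p' K^p)_A → 𝕋(K_p K^p)_A` (for
`K_p' ⊆ K_p`) given by the restriction of operators to `H⁰(K_p K^p)_A ⊆ H⁰(K_p' K^p)_A`. -/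
def bigHeckeSubalgebra : Subalgebra A (∀ Kp : PLevel τ p, U.HeckeAlg A Kp) where
  carrier := {t | ∀ (Kp Kp' : PLevel τ p) (h : Kp' ≤ Kp) (f : U.H0 A Kp),
    (t Kp').1 (H0.incl U h f) = H0.incl U h ((t Kp).1 f)}
  mul_mem' := by
    intro s t hs ht Kp Kp' h f
    change (s Kp').1 ((t Kp').1 (H0.incl U h f)) = H0.incl U h ((s Kp).1 ((t Kp).1 f))
    rw [← hs Kp Kp' h, ← ht Kp Kp' h]
  add_mem' := by
    intro s t hs ht Kp Kp' h f
    change (s Kp').1 (H0.incl U h f) + (t Kp').1 (H0.incl U h f) = _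
    rw [hs Kp Kp' h, ht Kp Kp' h]
    rfl
  algebraMap_mem' := by
    intro a Kp Kp' h f
    rfl

/-- The commutative `A`-algebra `𝕋(K^p)_A = lim 𝕋(K_p K^p)_A`. -/
def BigHeckeAlg : Type _ := U.bigHeckeSubalgebra A

noncomputable instance : CommRing (U.BigHeckeAlg A) :=
  inferInstanceAs (CommRing (U.bigHeckeSubalgebra A))

noncomputable instance : Algebra A (U.BigHeckeAlg A) :=
  inferInstanceAs (Algebra A (U.bigHeckeSubalgebra A))

/-- The projective limit topology of `𝕋(K^p)_A`, each `𝕋(K)_A` being topologized as a subspace of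
`End H⁰(K)_A` with the topology of pointwise convergence. -/
instance [TopologicalSpace A] : TopologicalSpace (U.BigHeckeAlg A) :=
  TopologicalSpace.induced
    (fun t (Kp : PLevel τ p) (f : U.H0 A Kp) => ((t.1 Kp).1 f).1) inferInstance

/-- The image of the Hecke operator `[K_v g K_v]` in `𝕋(K^p)_A`. -/
noncomputable def heckeElt (v : {v : HeightOneSpectrum (𝓞 F) // ¬ AboveP p v})
    (hv : IsHyperspecial τ v.1 (U.K v)) (g : τ.localPoints v.1) : U.BigHeckeAlg A :=
  ⟨fun Kp => ⟨U.heckeOp A Kp v g, Algebra.subset_adjoin ⟨v, g, hv, rfl⟩⟩,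
    fun _ _ _ _ => rfl⟩

end TameLevel

/-! ### Automorphic representations -/

variable (τ)

/-- Automorphic forms on `G(𝔸)`, for `G(ℝ)` compact: functions `φ` on `G(ℚ) \ G(𝔸)` which are
right invariant under an open subgroup of `G(𝔸_f)`, continuous in the variable in `G(ℝ)`, and
`G(ℝ)`-finite. -/
structure IsAutomorphicForm (φ : τ.adelic → ℂ) : Prop where
  left_invariant : ∀ γ x, φ (τ.diag γ * x) = φ x
  smooth : ∃ V : Subgroup τ.finAdelic, IsOpen (V : Set τ.finAdelic) ∧
    ∀ x, ∀ k ∈ V, φ (x * (1, k)) = φ x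
  continuous : ∀ x : τ.finAdelic, Continuous fun g : τ.infinite => φ (g, x)
  finite : FiniteDimensional ℂ
    (Submodule.span ℂ (Set.range fun (h : τ.infinite) (x : τ.adelic) => φ (x * (h, 1))))

/-- A space of functions on `G(𝔸)` is stable under right translation by `G(𝔸)`. -/
def IsStable (W : Submodule ℂ (τ.adelic → ℂ)) : Prop :=
  ∀ g, ∀ φ ∈ W, (fun x => φ (x * g)) ∈ W

/-- An automorphic representation of `G(𝔸)`, realized on an irreducible space of automorphic forms
(`G(ℝ)` being compact, the space of all automorphic forms is semisimple). -/
structure AutomorphicRep where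
  space : Submodule ℂ (τ.adelic → ℂ)
  isAutomorphicForm : ∀ φ ∈ space, IsAutomorphicForm τ φ
  isStable : IsStable τ space
  ne_bot : space ≠ ⊥
  irreducible : ∀ W ≤ space, IsStable τ W → W = ⊥ ∨ W = space

variable {τ}

namespace AutomorphicRep

variable (π : AutomorphicRep τ)

/-- The subspace of `π` fixed by a subgroup `V` of `G(𝔸_f)`. -/
def fixed (V : Subgroup τ.finAdelic) : Submodule ℂ (τ.adelic → ℂ) where
  carrier := {φ | φ ∈ π.space ∧ ∀ x, ∀ k ∈ V, φ (x * (1, k)) = φ x}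
  zero_mem' := ⟨π.space.zero_mem, fun _ _ _ => rfl⟩
  add_mem' := fun ha hb => ⟨π.space.add_mem ha.1 hb.1, fun x k hk => by
    simp only [Pi.add_apply, ha.2 x k hk, hb.2 x k hk]⟩
  smul_mem' := fun c f hf => ⟨π.space.smul_mem c hf.1, fun x k hk => by
    simp only [Pi.smul_apply, hf.2 x k hk]⟩

/-- `π` has tame level `K^p`: it has a nonzero vector fixed by `K^p`. -/
def HasTameLevel : Prop := π.fixed U.tame ≠ ⊥

variable (p) in
/-- `π_p` is unramified: `π` has a nonzero vector fixed by `∏_{v ∣ p} K_v`, for some hyperspecial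
subgroups `K_v` of the `U(F_v)`. -/
def IsUnramifiedAtP : Prop :=
  ∃ K : ∀ v : {v : HeightOneSpectrum (𝓞 F) // AboveP p v}, Subgroup (τ.localPoints v.1),
    (∀ v, IsHyperspecial τ v.1 (K v)) ∧
    ∃ φ ∈ π.space, φ ≠ 0 ∧ ∀ x, ∀ k : τ.finAdelic, (∀ v, k v.1 ∈ K v) →
      (∀ v, ¬ AboveP p v → k v = 1) → φ (x * (1, k)) = φ x

end AutomorphicRep

section Eigensystem

variable [Fact p.Prime] (E : IntermediateField ℚ_[p] (PadicAlgCl p)) (ι : ℂ ≃+* PadicAlgCl p)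

/-- The ring of integers `𝓞` of the extension `E` of `ℚ_p`. -/
noncomputable abbrev intE : Subalgebra ℤ_[p] E := integralClosure ℤ_[p] E

/-- The eigensystem (continuous homomorphism of `𝓞`-algebras) `λ : 𝕋(K^p)_𝓞 → ℚ̄_p` is associated
with `π` of tame level `K^p`: each Hecke operator `T = [K_v g K_v]` acts on the nonzero space
`π^{K^p}` as multiplication by `ι⁻¹(λ(T))`. -/
def IsAssociated (lam : U.BigHeckeAlg (intE E) →ₐ[intE E] PadicAlgCl p)
    (π : AutomorphicRep τ) : Prop :=
  Continuous lam ∧ π.HasTameLevel U ∧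
  ∀ v (hv : IsHyperspecial τ v.1 (U.K v)) (g : τ.localPoints v.1), ∀ φ ∈ π.fixed U.tame,
    heckeFun (U.K v) ((MonoidHom.inr τ.infinite τ.finAdelic).comp (τ.localEmb v.1)) g φ =
      ι.symm (lam (U.heckeElt (intE E) v hv g)) • φ

/-- The set `𝒞` of classical crystalline points of `Spec 𝕋(K^p)_𝓞`. -/
def classicalCrystalline : Set (PrimeSpectrum (U.BigHeckeAlg (intE E))) :=
  {𝔭 | ∃ (lam : U.BigHeckeAlg (intE E) →ₐ[intE E] PadicAlgCl p) (π : AutomorphicRep τ),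
    IsAssociated U E ι lam π ∧ π.IsUnramifiedAtP p ∧ 𝔭.asIdeal = RingHom.ker lam}

/-- The set `𝒞_𝔪` of classical crystalline points `𝔭 ⊆ 𝔪`. -/
def classicalCrystallineAt (𝔪 : Ideal (U.BigHeckeAlg (intE E))) :
    Set (PrimeSpectrum (U.BigHeckeAlg (intE E))) :=
  {𝔭 | 𝔭 ∈ classicalCrystalline U E ι ∧ 𝔭.asIdeal ≤ 𝔪}

end Eigensystem

/-! ### Conditions at `p` -/

/-- The prime `p` splits completely in the number field `L`. -/
def SplitsCompletely (p : ℕ) (L : Type*) [Field L] [NumberField L] : Prop :=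
  ∀ P : Ideal (𝓞 L), P.IsPrime → (p : 𝓞 L) ∈ P →
    P.ramificationIdx ℤ = 1 ∧ P.inertiaDeg ℤ = 1

/-- The quaternion algebra `D` over `L` splits at all places above `p`. -/
def IsSplitAbove (p : ℕ) (L D : Type*) [Field L] [NumberField L] [Ring D] [Algebra L D] : Prop :=
  ∀ w : HeightOneSpectrum (𝓞 L), AboveP p w →
    Nonempty ((w.adicCompletion L ⊗[L] D) ≃ₐ[w.adicCompletion L]
      Matrix (Fin 2) (Fin 2) (w.adicCompletion L))

end Unitary

end DefiniteUnitary

open DefiniteUnitary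

namespace DefiniteUnitary

open AlgHom (commutes)
open Algebra (ofId adjoin_induction adjoin lmul)
open Algebra.TensorProduct (tmul_mul_tmul includeRight)
open Filter (cofinite)
open Finset (smul_sum univ mem_univ sum_congr sum_eq_single range sum_nonneg single_le_sum Icc)
open Fintype (ofFinite card)
open FreeAlgebra (lift_ι_apply)
open Function (Injective Surjective)
open HasCompactSupport (of_compactSpace)
open Ideal (mem_span_singleton)
open Ideal.Quotient (eq_zero_iff_mem)
open InnerProductSpace (Core)
open IsLocalRing (residue)
open IsUltrametricDist (norm_add_le_max norm_sum_le_of_forall_le_of_nonneg)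
open LinearMap (mulLeft BilinForm mk₂)
open Localization (AtPrime)
open Module (finrank End Free finBasis Basis)
open Module.Finite (equiv iff_fg)
open MonoidHom (inr)
open MulAction (toPermHom)
open Padic (norm_p)
open PadicInt (toZModPow)
open PadicInt.Coe (ringHom)
open Prod (mk_mul_mk)
open Quotient (sound out_eq)
open QuotientGroup (out_eq')
open RingHom (id_apply ker)
open Set.Finite (mem_toFinset)
open Subalgebra (toSubmodule)
open Subgroup (quotientEquivProdOfLE mem_subgroupOf isClosed_of_isOpen)
open Submodule (span span_induction mem_top smul_mem span_le subset_span finiteDimensional_of_le mem_bot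
  mem_one mul_mem_mul)
open TopologicalSpace (induced)
open WithZero (exp exp_ne_zero exp_zero)

local notation "Pl(" F ")" => HeightOneSpectrum (𝓞 F)
local notation "PlAbove(" F "," p ")" => {v : HeightOneSpectrum (𝓞 F) // AboveP p v}
local notation "K_[" F "," v "]" => HeightOneSpectrum.adicCompletion F v
local notation "O_[" F "," v "]" => HeightOneSpectrum.adicCompletionIntegers F v
local notation "Mat₂(" k ")" => Matrix (Fin 2) (Fin 2) k
local notation "Ω_[" p "]" => PadicAlgCl p

variable {F 𝒦 D : Type*} [Field F] [NumberField F] [Field 𝒦] [NumberField 𝒦] [Algebra F 𝒦]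
  [Algebra.IsQuadraticExtension F 𝒦] [Ring D] [Algebra F D] [Algebra 𝒦 D]

section HeckeInvariants

variable {H X : Type*} [Group H] [Group X] (j : H →* X)

/-- Right translation of functions on `X` by `x`. -/
def rightTranslate (x : X) : (X → ℂ) →ₗ[ℂ] (X → ℂ) where
  toFun φ y := φ (y * x)
  map_add' _ _ := rfl
  map_smul' _ _ := rfl

theorem rightTranslate_mul (x y : X) (φ : X → ℂ) :
    rightTranslate (x * y) φ = rightTranslate x (rightTranslate y φ) := by
  funext z
  simp [rightTranslate, mul_assoc]

variable {j} {K : Subgroup H}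

theorem heckeFun_eq_sum {X A : Type*} [Group X] [AddCommMonoid A] {j : H →* X}
    {g : H} (hfin : (cosets K g).Finite) (f : X → A) (x : X) :
    heckeFun K j g f x = ∑ c ∈ hfin.toFinset, f (x * j c.out) :=
  finsum_mem_eq_finite_toFinset_sum _ hfin

/-- The `K`-invariants of the span of the translates of a Hecke stable space `M` of
`K`-invariant functions are contained in `M`. -/
theorem mem_of_mem_span_translates (M : Submodule ℂ (X → ℂ))
    (hM : ∀ φ ∈ M, ∀ x, ∀ k ∈ K, φ (x * j k) = φ x) (hfin : ∀ g, (cosets K g).Finite)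
    (hT : ∀ g, ∀ φ ∈ M, heckeFun K j g φ ∈ M) {ψ : X → ℂ}
    (hψ : ψ ∈ span ℂ {ψ | ∃ h, ∃ φ ∈ M, ψ = rightTranslate (j h) φ})
    (hψK : ∀ x, ∀ k ∈ K, ψ (x * j k) = ψ x) : ψ ∈ M := by
  have key : ∃ N : Subgroup K, N.FiniteIndex ∧ ∀ N' ≤ N, N'.FiniteIndex →
      ∑ᶠ q : K ⧸ N', rightTranslate (j (q.out : H)) ψ ∈ M := by
    clear hψK
    induction hψ using span_induction with
    | mem ψ h =>
      obtain ⟨h, φ, hφ, rfl⟩ := h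
      set N := MulAction.stabilizer K (h : H ⧸ K) with hN
      have e := MulAction.orbitEquivQuotientStabilizer K (h : H ⧸ K)
      have hfo : Finite (MulAction.orbit K (h : H ⧸ K)) := hfin h
      have hNf : Finite (K ⧸ N) := Finite.of_equiv _ e
      refine ⟨N, Subgroup.finiteIndex_of_finite_quotient, fun N' hN' hfi => ?_⟩
      have : Fintype (K ⧸ N') := ofFinite _
      have : Fintype (K ⧸ N) := ofFinite _
      have : Finite (N ⧸ N'.subgroupOf N) := by
        have : Finite ((K ⧸ N) × (N ⧸ N'.subgroupOf N)) :=
          Finite.of_equiv _ (quotientEquivProdOfLE hN')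
        exact Finite.prod_right (K ⧸ N)
      have : Fintype (N ⧸ N'.subgroupOf N) := ofFinite _
      have hterm : ∀ k : K, rightTranslate (j (k : H)) (rightTranslate (j h) φ) =
          rightTranslate (j (k • (h : H ⧸ K)).out) φ := by
        intro k
        funext x
        change φ (x * j k * j h) = φ (x * j ((k * h : H) : H ⧸ K).out)
        rw [out_invariant (hM φ hφ), map_mul, mul_assoc]
      have hout : ∀ q : K ⧸ N', (q.out • (h : H ⧸ K)) =
          ((quotientEquivProdOfLE hN' q).1.out • (h : H ⧸ K)) := by
        intro q
        have h1 : (quotientEquivProdOfLE hN' q).1 = ((q.out : K) : K ⧸ N) := by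
          conv_lhs => rw [← out_eq' q]
          rfl
        have h2 : (((quotientEquivProdOfLE hN' q).1.out : K) : K ⧸ N) =
            ((q.out : K) : K ⧸ N) := by rw [out_eq', h1]
        rw [QuotientGroup.eq] at h2
        have h3 := MulAction.mem_stabilizer_iff.mp h2
        rwa [mul_smul, inv_smul_eq_iff] at h3
      rw [finsum_eq_sum_of_fintype]
      simp only [hterm, hout]
      rw [Equiv.sum_comp (quotientEquivProdOfLE hN')
        (fun q => rightTranslate (j (q.1.out • (h : H ⧸ K)).out) φ), Fintype.sum_prod_type]
      simp only [Finset.sum_const]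
      rw [← smul_sum]
      refine Submodule.smul_of_tower_mem _ _ ?_
      have : ∑ q : K ⧸ N, rightTranslate (j (q.out • (h : H ⧸ K)).out) φ =
          heckeFun K j h φ := by
        funext x
        rw [heckeFun_eq_sum (hfin h), Finset.sum_apply, ← finsum_eq_sum_of_fintype,
          ← finsum_mem_eq_finite_toFinset_sum _ (hfin h), finsum_mem_def,
          ← finsum_mem_univ]
        rw [← finsum_mem_def]
        refine finsum_mem_eq_of_bijOn (fun q : K ⧸ N => q.out • (h : H ⧸ K)) ⟨?_, ?_, ?_⟩ ?_
        · intro q _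
          exact MulAction.mem_orbit _ _
        · intro q _ q' _ hq
          have h3 : (q.out)⁻¹ * q'.out ∈ N := by
            refine MulAction.mem_stabilizer_iff.mpr ?_
            rw [mul_smul, inv_smul_eq_iff]
            exact hq.symm
          rwa [← QuotientGroup.eq, out_eq', out_eq'] at h3
        · rintro c ⟨k, rfl⟩
          refine ⟨(k : K ⧸ N), trivial, ?_⟩
          have h2 : (((k : K ⧸ N).out : K) : K ⧸ N) = (k : K ⧸ N) := out_eq' _
          rw [QuotientGroup.eq] at h2
          have h3 := MulAction.mem_stabilizer_iff.mp h2
          rw [mul_smul, inv_smul_eq_iff] at h3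
          exact h3.symm
        · intro q _
          rfl
      rw [this]
      exact hT h φ hφ
    | zero => exact ⟨⊤, inferInstance, fun N' _ _ => by simp⟩
    | add a b _ _ ha hb =>
      obtain ⟨N₁, hf₁, h₁⟩ := ha
      obtain ⟨N₂, hf₂, h₂⟩ := hb
      refine ⟨N₁ ⊓ N₂, inferInstance, fun N' hN' hf => ?_⟩
      have : Finite (K ⧸ N') := inferInstance
      simp only [map_add]
      rw [finsum_add_distrib (Set.toFinite _) (Set.toFinite _)]
      exact M.add_mem (h₁ N' (hN'.trans inf_le_left) hf) (h₂ N' (hN'.trans inf_le_right) hf)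
    | smul c a _ ha =>
      obtain ⟨N₁, hf₁, h₁⟩ := ha
      refine ⟨N₁, hf₁, fun N' hN' hf => ?_⟩
      simp only [map_smul]
      rw [← smul_finsum]
      exact M.smul_mem _ (h₁ N' hN' hf)
  obtain ⟨N, hf, h⟩ := key
  have h1 := h N le_rfl hf
  have : Fintype (K ⧸ N) := ofFinite _
  have h2 : ∀ q : K ⧸ N, rightTranslate (j (q.out : H)) ψ = ψ := fun q =>
    funext fun x => hψK x _ q.out.2
  rw [finsum_eq_sum_of_fintype] at h1
  simp only [h2, Finset.sum_const, Finset.card_univ] at h1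
  rw [← Nat.cast_smul_eq_nsmul ℂ] at h1
  have h3 : (card (K ⧸ N) : ℂ) ≠ 0 := Nat.cast_ne_zero.mpr Fintype.card_ne_zero
  have := M.smul_mem (card (K ⧸ N) : ℂ)⁻¹ h1
  rwa [smul_smul, inv_mul_cancel₀ h3, one_smul] at this

end HeckeInvariants

section Weights

variable {G Γ : Type*} [Group G] [Group Γ]

open Classical in
theorem finsum_weight_symm {Z : Type*} (ρ : Γ →* Equiv.Perm Z) (χ : Z → ℂ)
    (hχ : χ.support.Finite) (hχΓ : ∀ z, {γ | χ (ρ γ z) ≠ 0}.Finite)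
    (hsum : ∀ z, ∑ᶠ γ, χ (ρ γ z) = 1) (F : Z → Z → ℂ)
    (hF : ∀ γ z w, F (ρ γ z) (ρ γ w) = F z w) (hrow : ∀ z, (F z).support.Finite)
    (hcol : ∀ w, (fun z => F z w).support.Finite) :
    ∑ᶠ z, χ z * ∑ᶠ w, F z w = ∑ᶠ w, χ w * ∑ᶠ z, F z w := by
  have aux : ∀ F : Z → Z → ℂ, (∀ z, (F z).support.Finite) →
      (fun t : Z × Z × Γ => χ t.1 * (χ (ρ t.2.2 t.2.1) * F t.1 t.2.1)).support.Finite ∧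
      ∑ᶠ z, χ z * ∑ᶠ w, F z w =
        ∑ᶠ t : Z × Z × Γ, χ t.1 * (χ (ρ t.2.2 t.2.1) * F t.1 t.2.1) := by
    intro F hrow
    have hfin : (fun t : Z × Z × Γ => χ t.1 * (χ (ρ t.2.2 t.2.1) * F t.1 t.2.1)).support.Finite := by
      refine (hχ.biUnion (t := fun z => (((hrow z).toFinset.biUnion
        (fun w => ((hχΓ w).toFinset.image fun γ => (z, w, γ))) : Finset (Z × Z × Γ)) :
          Set (Z × Z × Γ))) fun z _ => Finset.finite_toSet _).subset ?_
      rintro ⟨z, w, γ⟩ h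
      simp only [Function.mem_support, ne_eq, mul_eq_zero, not_or] at h
      simp only [Set.mem_iUnion]
      refine ⟨z, h.1, ?_⟩
      simp only [Finset.mem_coe, Finset.mem_biUnion, Finset.mem_image, mem_toFinset]
      exact ⟨w, h.2.2, γ, h.2.1, rfl⟩
    refine ⟨hfin, ?_⟩
    rw [finsum_curry _ hfin]
    refine finsum_congr fun z => ?_
    by_cases hz : χ z = 0
    · simp [hz]
    have hfin2 : (fun t : Z × Γ => χ z * (χ (ρ t.2 t.1) * F z t.1)).support.Finite := by
      refine (hfin.preimage (f := fun t : Z × Γ => (z, t.1, t.2)) ?_)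
      rintro ⟨a, b⟩ _ ⟨c, d⟩ _ h
      simpa using h
    rw [finsum_curry _ hfin2, mul_finsum]
    refine finsum_congr fun w => ?_
    rw [← mul_finsum]
    change _ = χ z * ∑ᶠ γ, χ (ρ γ w) * F z w
    rw [← finsum_mul, hsum, one_mul]
  rw [(aux F hrow).2, (aux (fun z w => F w z) hcol).2]
  let e : Z × Z × Γ ≃ Z × Z × Γ :=
    { toFun := fun t => (ρ t.2.2 t.2.1, ρ t.2.2 t.1, t.2.2⁻¹)
      invFun := fun t => (ρ t.2.2 t.2.1, ρ t.2.2 t.1, t.2.2⁻¹)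
      left_inv := by rintro ⟨z, w, γ⟩; simp
      right_inv := by rintro ⟨z, w, γ⟩; simp }
  rw [← finsum_comp_equiv e]
  refine finsum_congr ?_
  rintro ⟨z, w, γ⟩
  have h1 : ∀ z, (ρ γ)⁻¹ (ρ γ z) = z := fun z => (ρ γ).symm_apply_apply z
  simp only [e, Equiv.coe_fn_mk, hF, map_inv, h1]
  ring

variable (δ : Γ →* G) (K : Subgroup G)

/-- There are finitely many double cosets in `Γ \ G / K`. -/
def FiniteDoubleCosets : Prop := ∃ R : Finset G, ∀ x, ∃ γ, ∃ r ∈ R, ∃ k ∈ K, x = δ γ * r * k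

/-- The stabilizers in `Γ` of the points of `G / K` are finite. -/
def FiniteStabilizers : Prop := ∀ x, {γ | x⁻¹ * δ γ * x ∈ K}.Finite

/-- A finitely supported weight on `G / K` whose sum over every `Γ`-orbit is `1`. -/
structure Weight where
  toFun : G → ℝ
  right_invariant : ∀ x, ∀ k ∈ K, toFun (x * k) = toFun x
  nonneg : ∀ x, 0 ≤ toFun x
  finite : ∃ R : Finset G, ∀ x, toFun x ≠ 0 → ∃ r ∈ R, r⁻¹ * x ∈ K
  finite_orbit : ∀ x, {γ | toFun (δ γ * x) ≠ 0}.Finite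
  sum_eq_one : ∀ x, ∑ᶠ γ, toFun (δ γ * x) = 1

variable {δ K}

theorem FiniteDoubleCosets.of_relIndex {K' : Subgroup G} (h : FiniteDoubleCosets δ K)
    (hK : K'.relIndex K ≠ 0) : FiniteDoubleCosets δ K' := by
  classical
  obtain ⟨R, hR⟩ := h
  have : (K'.subgroupOf K).FiniteIndex := ⟨hK⟩
  have : Fintype (K ⧸ K'.subgroupOf K) := ofFinite _
  refine ⟨Finset.image₂ (fun r (q : K ⧸ K'.subgroupOf K) => r * (q.out : G)) R univ,
    fun x => ?_⟩
  obtain ⟨γ, r, hr, k, hk, rfl⟩ := hR x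
  set q : K ⧸ K'.subgroupOf K := ((⟨k, hk⟩ : K) : K ⧸ K'.subgroupOf K) with hq
  have h1 : ((q.out : K) : K ⧸ K'.subgroupOf K) = ((⟨k, hk⟩ : K) : K ⧸ K'.subgroupOf K) :=
    out_eq' q
  rw [QuotientGroup.eq, mem_subgroupOf] at h1
  refine ⟨γ, _, Finset.mem_image₂_of_mem hr (mem_univ q), _, h1, ?_⟩
  simp only [Subgroup.coe_mul, InvMemClass.coe_inv]
  group

theorem FiniteStabilizers.of_relIndex {K' : Subgroup G} (h : FiniteStabilizers δ K)
    (hK : K.relIndex K' ≠ 0) : FiniteStabilizers δ K' := by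
  intro x
  have : (K.subgroupOf K').FiniteIndex := ⟨hK⟩
  have hfin : Finite (K' ⧸ K.subgroupOf K') := inferInstance
  let Δ : Subgroup Γ := K'.comap ((MulAut.conj x⁻¹).toMonoidHom.comp δ)
  have hΔ : ∀ γ, γ ∈ Δ ↔ x⁻¹ * δ γ * x ∈ K' := fun γ => by
    simp [Δ, Subgroup.mem_comap]
  let f : Δ → K' ⧸ K.subgroupOf K' := fun γ => ((⟨x⁻¹ * δ γ * x, (hΔ γ).mp γ.2⟩ : K') : _ ⧸ _)
  have : Finite Δ := by
    refine Set.finite_univ_iff.mp ((Set.finite_univ (α := K' ⧸ K.subgroupOf K')).preimage'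
      (f := f) fun q _ => ?_)
    by_cases hq : ∃ γ₀, f γ₀ = q
    · obtain ⟨γ₀, rfl⟩ := hq
      refine Set.Finite.subset (((h x).preimage (f := fun γ : Δ => ((γ₀⁻¹ * γ : Δ) : Γ)) ?_)) ?_
      · intro a _ b _ hab
        simpa using hab
      · intro γ hγ
        have h1 : f γ₀ = f γ := hγ.symm
        rw [QuotientGroup.eq, mem_subgroupOf] at h1
        simp only [Set.mem_preimage, Set.mem_ofPred_eq]
        convert h1 using 1
        simp only [Subgroup.coe_mul, InvMemClass.coe_inv, map_mul, map_inv]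
        group
    · convert Set.finite_empty
      ext γ
      simp only [Set.mem_preimage, Set.mem_singleton_iff, Set.mem_empty_iff_false, iff_false]
      exact fun h => hq ⟨γ, h⟩
  have := Set.toFinite (Δ : Set Γ)
  refine this.subset fun γ hγ => (hΔ γ).mpr hγ

theorem exists_weight (h₁ : FiniteDoubleCosets δ K) (h₂ : FiniteStabilizers δ K) :
    ∃ χ : Weight δ K, ∀ x, ∃ q : ℚ, χ.toFun x = q := by
  classical
  obtain ⟨R, hR⟩ := h₁
  let c : G → ℝ := fun x => if ∃ r ∈ R, r⁻¹ * x ∈ K then 1 else 0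
  have hck : ∀ x, ∀ k ∈ K, c (x * k) = c x := by
    intro x k hk
    simp only [c]
    congr 1
    refine propext (exists_congr fun r => and_congr_right fun _ => ?_)
    rw [← mul_assoc]
    exact K.mul_mem_cancel_right hk
  have hc0 : ∀ x, c x ≠ 0 ↔ ∃ r ∈ R, r⁻¹ * x ∈ K := by
    intro x
    simp [c]
  have hfin : ∀ x, {γ | c (δ γ * x) ≠ 0}.Finite := by
    intro x
    have : {γ | c (δ γ * x) ≠ 0} = ⋃ r ∈ R, {γ | r⁻¹ * (δ γ * x) ∈ K} := by
      ext γ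
      simp only [Set.mem_ofPred_eq, hc0, Set.mem_iUnion, exists_prop]
    rw [this]
    refine R.finite_toSet.biUnion fun r _ => ?_
    by_cases hne : ∃ γ₀, r⁻¹ * (δ γ₀ * x) ∈ K
    · obtain ⟨γ₀, h0⟩ := hne
      refine ((h₂ x).preimage (f := fun γ => γ₀⁻¹ * γ) (mul_right_injective _).injOn).subset ?_
      intro γ hγ
      have := K.mul_mem (K.inv_mem h0) hγ
      simp only [Set.mem_preimage, Set.mem_ofPred_eq, map_mul, map_inv]
      convert this using 1
      group
    · convert Set.finite_empty
      ext γ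
      simp only [Set.mem_ofPred_eq, Set.mem_empty_iff_false, iff_false]
      exact fun h => hne ⟨γ, h⟩
  let m : G → ℝ := fun x => ∑ᶠ γ, c (δ γ * x)
  have hmk : ∀ x, ∀ k ∈ K, m (x * k) = m x := fun x k hk =>
    finsum_congr fun γ => by rw [← mul_assoc, hck _ k hk]
  have hmγ : ∀ γ x, m (δ γ * x) = m x := by
    intro γ x
    simp only [m]
    rw [← finsum_comp_equiv (Equiv.mulRight γ) (f := fun γ' => c (δ γ' * x))]
    refine finsum_congr fun γ' => ?_
    simp [mul_assoc]
  have hm0 : ∀ x, m x ≠ 0 := by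
    intro x
    obtain ⟨γ, r, hr, k, hk, h⟩ := hR x
    refine (lt_of_lt_of_le one_pos ?_).ne'
    have h1 : c (δ γ⁻¹ * x) = 1 := by
      have : ∃ r ∈ R, r⁻¹ * (δ γ⁻¹ * x) ∈ K := ⟨r, hr, by
        rw [h, map_inv]
        convert hk using 1
        group⟩
      simp only [c, if_pos this]
    rw [← h1]
    exact single_le_finsum γ⁻¹ (hfin x) fun γ => by simp only [c]; split_ifs <;> norm_num
  refine ⟨⟨fun x => c x / m x, ?_, ?_, ⟨R, ?_⟩, ?_, ?_⟩, fun x => ?_⟩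
  · intro x k hk
    rw [hck x k hk, hmk x k hk]
  · intro x
    refine div_nonneg (by simp only [c]; split_ifs <;> norm_num) (finsum_nonneg fun γ => ?_)
    simp only [c]
    split_ifs <;> norm_num
  · intro x hx
    exact (hc0 x).mp fun h => hx (by rw [h, zero_div])
  · intro x
    refine (hfin x).subset fun γ hγ h => hγ (by rw [h, zero_div])
  · intro x
    simp only [hmγ, div_eq_mul_inv]
    rw [← finsum_mul]
    exact mul_inv_cancel₀ (hm0 x)
  · have hcq : ∀ x, ∃ q : ℚ, c x = q := fun x => by
      simp only [c]
      split_ifs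
      · exact ⟨1, by simp⟩
      · exact ⟨0, by simp⟩
    choose c' hc' using hcq
    refine ⟨c' x / ∑ γ ∈ (hfin x).toFinset, c' (δ γ * x), ?_⟩
    have h1 : m x = ∑ γ ∈ (hfin x).toFinset, c (δ γ * x) :=
      finsum_eq_sum_of_support_toFinset_subset _ (hfin x) (by rfl)
    simp only [h1, hc']
    push_cast
    rfl

namespace Weight

variable (χ : Weight δ K)

theorem finite_support : {z : G ⧸ K | χ.toFun z.out ≠ 0}.Finite := by
  obtain ⟨R, hR⟩ := χ.finite
  refine (R.finite_toSet.image (fun r : G => (r : G ⧸ K))).subset fun z hz => ?_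
  obtain ⟨r, hr, h⟩ := hR _ hz
  refine ⟨r, hr, ?_⟩
  rwa [← QuotientGroup.eq, out_eq'] at h

theorem apply_out (x : G) : χ.toFun (x : G ⧸ K).out = χ.toFun x := by
  obtain ⟨k, hk, h⟩ := mk_mul_out (K := K) 1 (x : G ⧸ K) x rfl
  rw [one_mul, one_mul] at h
  rw [h, χ.right_invariant _ k hk]

theorem exists_ne_zero (x : G) : ∃ γ, χ.toFun (δ γ * x) ≠ 0 := by
  by_contra! h
  have := χ.sum_eq_one x
  simp [h] at this

theorem adjoint (F : G → G → ℂ) (hF₁ : ∀ x y, ∀ k ∈ K, F (x * k) y = F x y)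
    (hF₂ : ∀ x y, ∀ k ∈ K, F x (y * k) = F x y) (hF : ∀ γ x y, F (δ γ * x) (δ γ * y) = F x y)
    (hfin : ∀ g, (cosets K g).Finite) (g : G) :
    ∑ᶠ z : G ⧸ K, (χ.toFun z.out : ℂ) * ∑ᶠ c ∈ cosets K g, F z.out (z.out * c.out) =
    ∑ᶠ z : G ⧸ K, (χ.toFun z.out : ℂ) * ∑ᶠ c ∈ cosets K g⁻¹, F (z.out * c.out) z.out := by
  classical
  -- sums over cosets as sums over a relation
  let E : G ⧸ K → G ⧸ K → ℂ := fun z w =>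
    if ((z.out⁻¹ * w.out : G) : G ⧸ K) ∈ cosets K g then F z.out w.out else 0
  have hout : ∀ x : G, ∃ k ∈ K, (x : G ⧸ K).out = x * k := by
    intro x
    obtain ⟨k, hk, h⟩ := mk_mul_out (K := K) 1 (x : G ⧸ K) x rfl
    rw [one_mul, one_mul] at h
    exact ⟨k, hk, h⟩
  have hFout : ∀ x y : G, F (x : G ⧸ K).out (y : G ⧸ K).out = F x y := by
    intro x y
    obtain ⟨k, hk, h⟩ := hout x
    obtain ⟨l, hl, h'⟩ := hout y
    rw [h, h', hF₁ _ _ k hk, hF₂ _ _ l hl]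
  have hrel : ∀ x y x' y' : G, (x : G ⧸ K) = x' → (y : G ⧸ K) = y' →
      (((x⁻¹ * y : G) : G ⧸ K) ∈ cosets K g ↔ ((x'⁻¹ * y' : G) : G ⧸ K) ∈ cosets K g) := by
    have : ∀ x y x' y' : G, (x : G ⧸ K) = x' → (y : G ⧸ K) = y' →
        (((x⁻¹ * y : G) : G ⧸ K) ∈ cosets K g → ((x'⁻¹ * y' : G) : G ⧸ K) ∈ cosets K g) := by
      intro x y x' y' hx hy h
      rw [QuotientGroup.eq] at hx hy
      obtain ⟨a, ha, b, hb, h⟩ := mk_mem_cosets.mp h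
      refine mk_mem_cosets.mpr ⟨(x⁻¹ * x')⁻¹ * a, K.mul_mem (K.inv_mem hx) ha,
        b * (y⁻¹ * y'), K.mul_mem hb hy, ?_⟩
      calc x'⁻¹ * y' = (x⁻¹ * x')⁻¹ * (x⁻¹ * y) * (y⁻¹ * y') := by group
        _ = _ := by rw [h]; group
    exact fun x y x' y' hx hy => ⟨this x y x' y' hx hy, this x' y' x y hx.symm hy.symm⟩
  have hsym : ∀ x : G, (x : G ⧸ K) ∈ cosets K g ↔ ((x⁻¹ : G) : G ⧸ K) ∈ cosets K g⁻¹ := by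
    intro x
    rw [mk_mem_cosets, mk_mem_cosets]
    constructor
    · rintro ⟨a, ha, b, hb, rfl⟩
      exact ⟨b⁻¹, K.inv_mem hb, a⁻¹, K.inv_mem ha, by group⟩
    · rintro ⟨a, ha, b, hb, h⟩
      refine ⟨b⁻¹, K.inv_mem hb, a⁻¹, K.inv_mem ha, ?_⟩
      rw [← inv_inv x, h]
      group
  have hbij : ∀ (g : G) (z : G ⧸ K), Set.BijOn (fun c : G ⧸ K => ((z.out * c.out : G) : G ⧸ K))
      (cosets K g) {w | ((z.out⁻¹ * w.out : G) : G ⧸ K) ∈ cosets K g} := by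
    intro g z
    refine ⟨fun c hc => ?_, fun c _ c' _ h => ?_, fun w hw => ?_⟩
    · obtain ⟨k, hk, h⟩ := hout (z.out * c.out)
      simp only [Set.mem_ofPred_eq, h]
      rw [← out_eq' c] at hc
      convert hc using 1
      rw [QuotientGroup.eq]
      convert K.inv_mem hk using 1
      group
    · rw [QuotientGroup.eq] at h
      rw [← out_eq' c, ← out_eq' c', QuotientGroup.eq]
      convert h using 1
      group
    · refine ⟨_, hw, ?_⟩
      obtain ⟨k, hk, h⟩ := hout (z.out⁻¹ * w.out)
      simp only [h]
      rw [← out_eq' w, QuotientGroup.eq]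
      simp only [out_eq']
      convert K.inv_mem hk using 1
      group
  have hrow : ∀ z : G ⧸ K, ∑ᶠ c ∈ cosets K g, F z.out (z.out * c.out) = ∑ᶠ w, E z w := by
    intro z
    rw [finsum_mem_eq_of_bijOn _ (hbij g z) (g := fun w => F z.out w.out), finsum_mem_def]
    · refine finsum_congr fun w => ?_
      simp only [E, Set.indicator_apply, Set.mem_ofPred_eq]
    · intro c _
      conv_rhs => rw [← out_eq' z]
      exact (by rw [out_eq']; simpa using (hFout z.out (z.out * c.out)).symm)
  have hcol : ∀ w : G ⧸ K, ∑ᶠ c ∈ cosets K g⁻¹, F (w.out * c.out) w.out = ∑ᶠ z, E z w := by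
    intro w
    rw [finsum_mem_eq_of_bijOn _ (hbij g⁻¹ w) (g := fun z => F z.out w.out), finsum_mem_def]
    · refine finsum_congr fun z => ?_
      simp only [E, Set.indicator_apply, Set.mem_ofPred_eq]
      refine if_congr ?_ rfl rfl
      rw [hsym]
      simp
    · intro c _
      simpa using (hFout (w.out * c.out) w.out).symm
  simp only [hrow, hcol]
  let ρ : Γ →* Equiv.Perm (G ⧸ K) := (toPermHom G (G ⧸ K)).comp δ
  have hρ : ∀ γ (x : G), ρ γ (x : G ⧸ K) = ((δ γ * x : G) : G ⧸ K) := fun _ _ => rfl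
  have hχρ : ∀ γ (z : G ⧸ K), χ.toFun (ρ γ z).out = χ.toFun (δ γ * z.out) := by
    intro γ z
    conv_lhs => rw [← out_eq' z]
    rw [hρ, χ.apply_out]
  refine finsum_weight_symm ρ (fun z => (χ.toFun z.out : ℂ)) ?_ ?_ ?_ E ?_ ?_ ?_
  · simpa [Function.support] using χ.finite_support
  · intro z
    simpa [hχρ] using χ.finite_orbit z.out
  · intro z
    simp only [hχρ]
    have := congrArg (algebraMap ℝ ℂ) (χ.sum_eq_one z.out)
    rw [map_one] at this
    rw [← this]
    exact ((algebraMap ℝ ℂ).toAddMonoidHom.map_finsum (χ.finite_orbit z.out)).symm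
  · intro γ z w
    induction z using QuotientGroup.induction_on with | H x => ?_
    induction w using QuotientGroup.induction_on with | H y => ?_
    simp only [E, hρ, hFout, hF]
    refine if_congr ?_ rfl rfl
    rw [hrel _ _ _ _ (out_eq' _) (out_eq' _),
      hrel (x : G ⧸ K).out _ _ _ (out_eq' _) (out_eq' _)]
    have : (δ γ * x)⁻¹ * (δ γ * y) = x⁻¹ * y := by group
    rw [this]
  · intro z
    refine (((hfin g).image (fun c : G ⧸ K => ((z.out * c.out : G) : G ⧸ K)))).subset ?_
    intro w hw
    rw [(hbij g z).image_eq]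
    by_contra h
    exact hw (if_neg h)
  · intro w
    refine (((hfin g⁻¹).image (fun c : G ⧸ K => ((w.out * c.out : G) : G ⧸ K)))).subset ?_
    intro z hz
    rw [(hbij g⁻¹ w).image_eq]
    by_contra h
    refine hz (if_neg fun h' => h ?_)
    rw [hsym] at h'
    simpa using h'

end Weight

end Weights

section LinearAlgebra

theorem exists_orthogonal_decomposition {V : Type*} [AddCommGroup V] [Module ℂ V]
    (c : Core ℂ V) (A : Submodule ℂ V) [FiniteDimensional ℂ A] (v : V) :
    ∃ a ∈ A, ∀ b ∈ A, c.inner b (v - a) = 0 := by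
  letI : NormedAddCommGroup V := c.toNormedAddCommGroup
  letI : InnerProductSpace ℂ V := InnerProductSpace.ofCore c.toCore
  refine ⟨A.starProjection v, A.starProjection_apply_mem v, fun b hb => ?_⟩
  exact A.sub_starProjection_mem_orthogonal v b hb

theorem exists_common_eigenvector.{u} {ι : Type*} : ∀ (n : ℕ) (V : Type u) [AddCommGroup V] [Module ℂ V]
    [FiniteDimensional ℂ V], finrank ℂ V = n → ∀ (f : ι → End ℂ V),
    (∀ i j, f i * f j = f j * f i) → Nontrivial V → ∃ v ≠ 0, ∀ i, ∃ c : ℂ, f i v = c • v := by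
  intro n
  induction n using Nat.strong_induction_on with | _ n ih => ?_
  intro V _ _ _ hn f hf _
  by_cases h : ∀ i, ∃ c : ℂ, ∀ v, f i v = c • v
  · obtain ⟨v, hv⟩ := exists_ne (0 : V)
    exact ⟨v, hv, fun i => (h i).imp fun c hc => hc v⟩
  push Not at h
  obtain ⟨i, hi⟩ := h
  obtain ⟨c, hc⟩ := End.exists_eigenvalue (f i)
  set A := End.eigenspace (f i) c with hA
  have hst : ∀ j, ∀ v ∈ A, f j v ∈ A := by
    intro j v hv
    rw [hA, End.mem_eigenspace_iff] at hv ⊢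
    have := congrArg (fun g => g v) (hf i j)
    simp only [End.mul_apply] at this
    rw [this, hv, map_smul]
  have hlt : finrank ℂ A < n := by
    rw [← hn]
    refine Submodule.finrank_lt (lt_top_iff_ne_top.mpr fun h => ?_).ne
    obtain ⟨v, hv⟩ := hi c
    exact hv (End.mem_eigenspace_iff.mp (hA ▸ h ▸ mem_top))
  obtain ⟨v, hv, h⟩ := ih _ hlt A rfl (fun j => (f j).restrict (hst j))
    (fun j k => LinearMap.ext fun v => Subtype.ext (congrArg (fun g => g v.1) (hf j k)))
    (Submodule.nontrivial_iff_ne_bot.mpr hc)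
  refine ⟨v, fun h => hv (Subtype.ext h), fun j => (h j).imp fun c hc => ?_⟩
  exact congrArg Subtype.val hc

end LinearAlgebra

section Weights

variable {G Γ : Type*} [Group G] [Group Γ] {δ : Γ →* G} {K : Subgroup G}

theorem relIndex_ne_zero_of_isOpen [TopologicalSpace G] [IsTopologicalGroup G] {K K' : Subgroup G}
    (hK : IsCompact (K : Set G)) (hK' : IsOpen (K' : Set G)) : K'.relIndex K ≠ 0 := by
  have : CompactSpace K := isCompact_iff_compactSpace.mp hK
  have : Finite (K ⧸ K'.subgroupOf K) :=
    Subgroup.quotient_finite_of_isOpen _ (hK'.preimage continuous_subtype_val)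
  exact Subgroup.index_ne_zero_of_finite

theorem exists_eq_out_mul (K : Subgroup G) (x : G) : ∃ k ∈ K, (x : G ⧸ K).out = x * k := by
  obtain ⟨k, hk, h⟩ := mk_mul_out (K := K) 1 (x : G ⧸ K) x rfl
  rw [one_mul, one_mul] at h
  exact ⟨k, hk, h⟩

/-- A weight at level `K` is a weight at each level `K' ≤ K` of finite index. -/
def Weight.restrict (χ : Weight δ K) {K' : Subgroup G} (hK : K' ≤ K) (hi : K'.relIndex K ≠ 0) :
    Weight δ K' where
  toFun := χ.toFun
  right_invariant x k hk := χ.right_invariant x k (hK hk)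
  nonneg := χ.nonneg
  finite := by
    classical
    obtain ⟨R, hR⟩ := χ.finite
    have : (K'.subgroupOf K).FiniteIndex := ⟨hi⟩
    have : Fintype (K ⧸ K'.subgroupOf K) := ofFinite _
    refine ⟨Finset.image₂ (fun r (q : K ⧸ K'.subgroupOf K) => r * (q.out : G)) R univ,
      fun x hx => ?_⟩
    obtain ⟨r, hr, h⟩ := hR x hx
    obtain ⟨k, hk, e⟩ := exists_eq_out_mul (K'.subgroupOf K) ⟨r⁻¹ * x, h⟩
    refine ⟨_, Finset.mem_image₂_of_mem hr (mem_univ ((⟨r⁻¹ * x, h⟩ : K) : _ ⧸ _)), ?_⟩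
    rw [e]
    rw [mem_subgroupOf] at hk
    convert K'.inv_mem hk using 1
    simp only [Subgroup.coe_mul]
    group
  finite_orbit := χ.finite_orbit
  sum_eq_one := χ.sum_eq_one

end Weights

open MeasureTheory

section Forms

variable {Γ I G : Type*} [Group Γ] [Group I] [Group G] [TopologicalSpace I]

/-- A finite dimensional space of continuous functions on `I` which is stable under right
translations. -/
structure CoeffSpace (I : Type*) [Group I] [TopologicalSpace I] where
  space : Submodule ℂ (I → ℂ)
  finite : FiniteDimensional ℂ space
  continuous : ∀ w ∈ space, Continuous w
  right_mem : ∀ w ∈ space, ∀ h, (fun i => w (i * h)) ∈ space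

variable (ε : Γ →* I) (δ : Γ →* G) (W : CoeffSpace I) (K : Subgroup G)

/-- The functions on `Γ \ (I × G) / K` with coefficients in `W`. -/
def levelForms : Submodule ℂ (I × G → ℂ) where
  carrier := {φ | (∀ γ x, φ ((ε γ, δ γ) * x) = φ x) ∧ (∀ x, ∀ k ∈ K, φ (x * (1, k)) = φ x) ∧
    ∀ y, (fun i => φ (i, y)) ∈ W.space}
  zero_mem' := ⟨fun _ _ => rfl, fun _ _ _ => rfl, fun _ => W.space.zero_mem⟩
  add_mem' := fun ha hb => ⟨fun γ x => by simp only [Pi.add_apply, ha.1, hb.1],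
    fun x k hk => by simp only [Pi.add_apply, ha.2.1 x k hk, hb.2.1 x k hk],
    fun y => W.space.add_mem (ha.2.2 y) (hb.2.2 y)⟩
  smul_mem' := fun c f hf => ⟨fun γ x => by simp only [Pi.smul_apply, hf.1],
    fun x k hk => by simp only [Pi.smul_apply, hf.2.1 x k hk],
    fun y => W.space.smul_mem c (hf.2.2 y)⟩

variable {ε δ W K}

theorem levelForms_mono {K' : Subgroup G} (h : K' ≤ K) :
    levelForms ε δ W K ≤ levelForms ε δ W K' :=
  fun _ hφ => ⟨hφ.1, fun x k hk => hφ.2.1 x k (h hk), hφ.2.2⟩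

theorem levelForms_left {φ : I × G → ℂ} (hφ : φ ∈ levelForms ε δ W K) (γ : Γ) (i : I) (x : G) :
    φ (i, δ γ * x) = φ ((ε γ)⁻¹ * i, x) := by
  rw [← hφ.1 γ ((ε γ)⁻¹ * i, x), mk_mul_mk, mul_inv_cancel_left]

theorem finiteDimensional_levelForms (h : FiniteDoubleCosets δ K) :
    FiniteDimensional ℂ (levelForms ε δ W K) := by
  obtain ⟨R, hR⟩ := h
  have := W.finite
  let f : levelForms ε δ W K →ₗ[ℂ] (R → W.space) :=
    { toFun := fun φ r => ⟨fun i => φ.1 (i, r), φ.2.2.2 r⟩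
      map_add' := fun _ _ => rfl
      map_smul' := fun _ _ => rfl }
  refine Module.Finite.of_injective f ((injective_iff_map_eq_zero f).mpr fun φ hφ => ?_)
  refine Subtype.ext (funext fun x => ?_)
  obtain ⟨i, y⟩ := x
  obtain ⟨γ, r, hr, k, hk, rfl⟩ := hR y
  have h1 := φ.2.2.1 (i, δ γ * r) k hk
  rw [mk_mul_mk, mul_one] at h1
  rw [h1, levelForms_left φ.2]
  exact congrFun (congrArg Subtype.val (congrFun hφ ⟨r, hr⟩)) _

theorem translate_mem_levelForms {φ : I × G → ℂ} (hφ : φ ∈ levelForms ε δ W K) (h : I) :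
    rightTranslate (h, 1) φ ∈ levelForms ε δ W K := by
  refine ⟨fun γ x => ?_, fun x k hk => ?_, fun y => ?_⟩
  · change φ (_ * x * _) = φ (x * _)
    rw [mul_assoc, hφ.1]
  · change φ (x * (1, k) * (h, 1)) = φ (x * (h, 1))
    rw [← hφ.2.1 (x * (h, 1)) k hk, mul_assoc, mul_assoc]
    simp
  · change (fun i => φ ((i, y) * (h, 1))) ∈ W.space
    simpa using W.right_mem _ (hφ.2.2 y) h

theorem translate_mem_levelForms_conj {φ : I × G → ℂ} (hφ : φ ∈ levelForms ε δ W K) (g : G)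
    {K' : Subgroup G} (hK' : ∀ k ∈ K', g⁻¹ * k * g ∈ K) :
    rightTranslate ((1 : I), g) φ ∈ levelForms ε δ W K' := by
  refine ⟨fun γ x => ?_, fun x k hk => ?_, fun y => ?_⟩
  · change φ (_ * x * _) = φ (x * _)
    rw [mul_assoc, hφ.1]
  · change φ (x * (1, k) * (1, g)) = φ (x * (1, g))
    rw [← hφ.2.1 (x * (1, g)) _ (hK' k hk), mul_assoc, mul_assoc]
    congr 2
    simp [mul_assoc]
  · change (fun i => φ ((i, y) * (1, g))) ∈ W.space
    simpa using hφ.2.2 (y * g)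

theorem heckeFun_mem_levelForms {φ : I × G → ℂ} (hφ : φ ∈ levelForms ε δ W K)
    (hfin : ∀ g, (cosets K g).Finite) (g : G) :
    heckeFun K (inr I G) g φ ∈ levelForms ε δ W K := by
  refine ⟨fun γ x => heckeFun_left g _ (hφ.1 γ) x, fun x k hk => ?_, fun y => ?_⟩
  · exact heckeFun_right (j := inr I G) (fun x k hk => hφ.2.1 x k hk) g x k hk
  · simp only [heckeFun_eq_sum (hfin g)]
    have : (fun i => ∑ c ∈ (hfin g).toFinset, φ ((i, y) * inr I G c.out)) =
        ∑ c ∈ (hfin g).toFinset, fun i => φ (i, y * c.out) := by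
      funext i
      simp
    rw [this]
    exact sum_mem fun c _ => hφ.2.2 _

theorem heckeFun_mem_of_stable {Q : Submodule ℂ (I × G → ℂ)}
    (hQ : ∀ g, ∀ φ ∈ Q, rightTranslate g φ ∈ Q) {K : Subgroup G} {g : G}
    (hfin : (cosets K g).Finite) {φ : I × G → ℂ} (hφ : φ ∈ Q) :
    heckeFun K (inr I G) g φ ∈ Q := by
  have : heckeFun K (inr I G) g φ =
      ∑ c ∈ hfin.toFinset, rightTranslate (1, c.out) φ := by
    funext x
    rw [heckeFun_eq_sum hfin, Finset.sum_apply]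
    rfl
  rw [this]
  exact sum_mem fun c _ => hQ _ _ hφ

section Pairing

variable [IsTopologicalGroup I] [CompactSpace I] [MeasurableSpace I] [BorelSpace I]
  (μ : Measure I) [IsProbabilityMeasure μ] [μ.IsMulLeftInvariant] [μ.IsMulRightInvariant]
  [μ.IsOpenPosMeasure]

theorem exists_bi_invariant_measure (I : Type*) [Group I] [TopologicalSpace I]
    [IsTopologicalGroup I] [CompactSpace I] [MeasurableSpace I] [BorelSpace I] :
    ∃ μ : Measure I, IsProbabilityMeasure μ ∧ μ.IsMulLeftInvariant ∧ μ.IsMulRightInvariant ∧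
      μ.IsOpenPosMeasure := by
  let K₀ : TopologicalSpace.PositiveCompacts I := ⊤
  let μ := Measure.haarMeasure K₀
  have h1 : IsProbabilityMeasure μ := ⟨by
    have := Measure.haarMeasure_self (K₀ := K₀)
    simpa [K₀] using this⟩
  refine ⟨μ, h1, inferInstance, ⟨fun g => ?_⟩, inferInstance⟩
  have h2 : IsProbabilityMeasure (μ.map (· * g)) :=
    Measure.isProbabilityMeasure_map (measurable_mul_const g).aemeasurable
  have h3 : (μ.map (· * g)).IsHaarMeasure := inferInstance
  exact Measure.isHaarMeasure_eq_of_isProbabilityMeasure _ _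

variable (K) in
/-- The pairing of functions on `I × G` attached to a function `χ` on `G / K`. -/
noncomputable def pairing (χ : G → ℝ) (φ ψ : I × G → ℂ) : ℂ :=
  ∑ᶠ z : G ⧸ K, (χ z.out : ℂ) * ∫ i, star (φ (i, z.out)) * ψ (i, z.out) ∂μ

variable {μ}

theorem integrable_star_mul {f g : I → ℂ} (hf : Continuous f) (hg : Continuous g) :
    Integrable (fun i => star (f i) * g i) μ :=
  (Continuous.mul hf.star hg).integrable_of_hasCompactSupport
    (of_compactSpace _)

variable (χ : Weight δ K)

theorem levelForms_continuous {φ : I × G → ℂ} (hφ : φ ∈ levelForms ε δ W K) (y : G) :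
    Continuous fun i => φ (i, y) := W.continuous _ (hφ.2.2 y)

theorem pairing_support (F : G ⧸ K → ℂ) :
    (Function.support fun z : G ⧸ K => (χ.toFun z.out : ℂ) * F z).Finite := by
  refine χ.finite_support.subset fun z hz h => hz ?_
  simp [h]

theorem pairing_add_right {φ ψ ψ' : I × G → ℂ} (hφ : φ ∈ levelForms ε δ W K)
    (hψ : ψ ∈ levelForms ε δ W K) (hψ' : ψ' ∈ levelForms ε δ W K) :
    pairing K μ χ.toFun φ (ψ + ψ') = pairing K μ χ.toFun φ ψ + pairing K μ χ.toFun φ ψ' := by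
  unfold pairing
  rw [← finsum_add_distrib (pairing_support χ _) (pairing_support χ _)]
  refine finsum_congr fun z => ?_
  rw [← mul_add, ← integral_add]
  · simp only [Pi.add_apply, mul_add]
  · exact integrable_star_mul (levelForms_continuous hφ _) (levelForms_continuous hψ _)
  · exact integrable_star_mul (levelForms_continuous hφ _) (levelForms_continuous hψ' _)

theorem pairing_smul_right (φ ψ : I × G → ℂ) (c : ℂ) :
    pairing K μ χ.toFun φ (c • ψ) = c * pairing K μ χ.toFun φ ψ := by
  unfold pairing
  rw [mul_finsum]
  refine finsum_congr fun z => ?_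
  rw [mul_left_comm, ← integral_const_mul c]
  congr 2
  funext i
  simp only [Pi.smul_apply, smul_eq_mul]
  ring

theorem pairing_star (φ ψ : I × G → ℂ) :
    star (pairing K μ χ.toFun ψ φ) = pairing K μ χ.toFun φ ψ := by
  unfold pairing
  have h := (starRingEnd ℂ).toAddMonoidHom.map_finsum
    (pairing_support χ fun z : G ⧸ K => ∫ i, star (ψ (i, z.out)) * φ (i, z.out) ∂μ)
  refine Eq.trans h (finsum_congr fun z => ?_)
  change (starRingEnd ℂ) _ = _
  rw [map_mul, Complex.conj_ofReal, ← integral_conj]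
  congr 2
  funext i
  simp [mul_comm]

theorem pairing_self_term (φ : I × G → ℂ) (y : G) :
    ∫ i, star (φ (i, y)) * φ (i, y) ∂μ = ((∫ i, ‖φ (i, y)‖ ^ 2 ∂μ : ℝ) : ℂ) := by
  rw [← integral_complex_ofReal]
  congr 1
  funext i
  have := Complex.conj_mul' (φ (i, y))
  simpa using this

theorem pairing_self (φ : I × G → ℂ) : pairing K μ χ.toFun φ φ =
    ((∑ᶠ z : G ⧸ K, χ.toFun z.out * ∫ i, ‖φ (i, z.out)‖ ^ 2 ∂μ : ℝ) : ℂ) := by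
  unfold pairing
  simp only [pairing_self_term]
  symm
  have hs : (Function.support fun z : G ⧸ K =>
      χ.toFun z.out * ∫ i, ‖φ (i, z.out)‖ ^ 2 ∂μ).Finite := by
    refine χ.finite_support.subset fun z hz h => hz ?_
    simp [h]
  refine ((algebraMap ℝ ℂ).toAddMonoidHom.map_finsum hs).trans (finsum_congr fun z => ?_)
  simp

theorem eq_zero_of_pairing_self {φ : I × G → ℂ} (hφ : φ ∈ levelForms ε δ W K)
    (h : pairing K μ χ.toFun φ φ = 0) : φ = 0 := by
  rw [pairing_self, Complex.ofReal_eq_zero] at h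
  have hs : (Function.support fun z : G ⧸ K =>
      χ.toFun z.out * ∫ i, ‖φ (i, z.out)‖ ^ 2 ∂μ).Finite := by
    refine χ.finite_support.subset fun z hz h => hz ?_
    simp [h]
  have hnn : ∀ z : G ⧸ K, 0 ≤ χ.toFun z.out * ∫ i, ‖φ (i, z.out)‖ ^ 2 ∂μ := fun z =>
    mul_nonneg (χ.nonneg _) (integral_nonneg fun _ => by positivity)
  have hz : ∀ z : G ⧸ K, χ.toFun z.out * ∫ i, ‖φ (i, z.out)‖ ^ 2 ∂μ = 0 := by
    intro z
    refine le_antisymm ?_ (hnn z)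
    rw [← h]
    exact single_le_finsum z hs hnn
  have key : ∀ y, χ.toFun y ≠ 0 → ∀ i, φ (i, y) = 0 := by
    intro y hy i
    have h1 := hz (y : G ⧸ K)
    rw [χ.apply_out] at h1
    have h2 := (mul_eq_zero.mp h1).resolve_left hy
    obtain ⟨k, hk, e⟩ := exists_eq_out_mul K y
    have h4 : ∀ i, φ (i, (y : G ⧸ K).out) = φ (i, y) := fun i => by
      have := hφ.2.1 (i, y) k hk
      rwa [mk_mul_mk, mul_one, ← e] at this
    simp only [h4] at h2
    have hc : Continuous fun i => ‖φ (i, y)‖ ^ 2 := (levelForms_continuous hφ y).norm.pow 2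
    rw [integral_eq_zero_iff_of_nonneg (fun _ => by positivity)
      (hc.integrable_of_hasCompactSupport (of_compactSpace _))] at h2
    have h3 := (hc.ae_eq_iff_eq μ continuous_const).mp h2
    have h5 : ‖φ (i, y)‖ ^ 2 = 0 := congrFun h3 i
    simpa using h5
  funext ⟨i, y⟩
  obtain ⟨γ, hγ⟩ := χ.exists_ne_zero y
  have := key _ hγ (ε γ * i)
  rwa [levelForms_left hφ, inv_mul_cancel_left] at this

variable (ε W μ) in
/-- The inner product on `levelForms`. -/
noncomputable abbrev innerCore : Core ℂ (levelForms ε δ W K) where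
  inner φ ψ := pairing K μ χ.toFun φ.1 ψ.1
  conj_inner_symm φ ψ := pairing_star χ φ.1 ψ.1
  re_inner_nonneg φ := by
    rw [pairing_self]
    exact finsum_nonneg fun z => mul_nonneg (χ.nonneg _)
      (integral_nonneg fun _ => by positivity)
  add_left φ φ' ψ := by
    rw [← pairing_star, ← pairing_star χ φ.1, ← pairing_star χ φ'.1, ← star_add]
    congr 1
    exact pairing_add_right χ ψ.2 φ.2 φ'.2
  smul_left φ ψ c := by
    rw [← pairing_star, ← pairing_star χ φ.1]
    refine (congrArg star (pairing_smul_right χ ψ.1 φ.1 c)).trans ?_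
    simp
  definite φ h := Subtype.ext (eq_zero_of_pairing_self χ φ.2 h)

theorem exists_orthogonal_levelForms {A : Submodule ℂ (I × G → ℂ)} [FiniteDimensional ℂ A]
    (hA : A ≤ levelForms ε δ W K) {φ : I × G → ℂ} (hφ : φ ∈ levelForms ε δ W K) :
    ∃ a ∈ A, ∀ b ∈ A, pairing K μ χ.toFun b (φ - a) = 0 := by
  let A' := A.submoduleOf (levelForms ε δ W K)
  have : FiniteDimensional ℂ A' :=
    equiv (Submodule.submoduleOfEquivOfLe hA).symm
  obtain ⟨a, ha, h⟩ := exists_orthogonal_decomposition (innerCore ε W μ χ) A' ⟨φ, hφ⟩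
  exact ⟨a.1, ha, fun b hb => h ⟨b, hA hb⟩ hb⟩

theorem pairing_translate (φ ψ : I × G → ℂ) (h : I) :
    pairing K μ χ.toFun (rightTranslate (h, 1) φ) (rightTranslate (h, 1) ψ) =
      pairing K μ χ.toFun φ ψ := by
  unfold pairing
  refine finsum_congr fun z => ?_
  congr 1
  rw [← integral_mul_right_eq_self (μ := μ) (fun i => star (φ (i, z.out)) * ψ (i, z.out)) h]
  simp [rightTranslate]

theorem pairing_heckeFun {φ ψ : I × G → ℂ} (hφ : φ ∈ levelForms ε δ W K)
    (hψ : ψ ∈ levelForms ε δ W K) (hfin : ∀ g, (cosets K g).Finite) (g : G) :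
    pairing K μ χ.toFun φ (heckeFun K (inr I G) g ψ) =
      pairing K μ χ.toFun (heckeFun K (inr I G) g⁻¹ φ) ψ := by
  let F : G → G → ℂ := fun x y => ∫ i, star (φ (i, x)) * ψ (i, y) ∂μ
  have hint : ∀ x y, Integrable (fun i => star (φ (i, x)) * ψ (i, y)) μ := fun x y =>
    integrable_star_mul (levelForms_continuous hφ _) (levelForms_continuous hψ _)
  have hr : ∀ {φ : I × G → ℂ}, φ ∈ levelForms ε δ W K → ∀ i x, ∀ k ∈ K,
      φ (i, x * k) = φ (i, x) := by
    intro φ hφ i x k hk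
    have := hφ.2.1 (i, x) k hk
    rwa [mk_mul_mk, mul_one] at this
  have h := χ.adjoint F (fun x y k hk => by simp only [F, hr hφ _ _ k hk])
    (fun x y k hk => by simp only [F, hr hψ _ _ k hk])
    (fun γ x y => by
      simp only [F, levelForms_left hφ, levelForms_left hψ]
      exact integral_mul_left_eq_self (μ := μ) (fun i => star (φ (i, x)) * ψ (i, y)) (ε γ)⁻¹)
    hfin g
  convert h using 1
  · unfold pairing
    refine finsum_congr fun z => ?_
    congr 1
    rw [finsum_mem_eq_finite_toFinset_sum _ (hfin g), ← integral_finsetSum _ fun c _ => hint _ _]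
    congr 1
    funext i
    rw [heckeFun_eq_sum (hfin g), Finset.mul_sum]
    simp
  · unfold pairing
    refine finsum_congr fun z => ?_
    congr 1
    rw [finsum_mem_eq_finite_toFinset_sum _ (hfin g⁻¹),
      ← integral_finsetSum _ fun c _ => hint _ _]
    congr 1
    funext i
    rw [heckeFun_eq_sum (hfin g⁻¹), star_sum, Finset.sum_mul]
    simp

end Pairing

end Forms

open MeasureTheory

section Irreducible

variable {Γ I G : Type*} [Group Γ] [Group I] [Group G] [TopologicalSpace I]
  {ε : Γ →* I} {δ : Γ →* G} {W : CoeffSpace I} {K : Subgroup G}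
  [IsTopologicalGroup I] [CompactSpace I] [MeasurableSpace I] [BorelSpace I]
  {μ : Measure I} [IsProbabilityMeasure μ] [μ.IsMulLeftInvariant] [μ.IsMulRightInvariant]
  [μ.IsOpenPosMeasure]

/-- Hecke operators as linear maps. -/
noncomputable def heckeLin {H X : Type*} [Group H] [Group X] {K : Subgroup H} (j : H →* X)
    {g : H} (hfin : (cosets K g).Finite) : (X → ℂ) →ₗ[ℂ] (X → ℂ) where
  toFun := heckeFun K j g
  map_add' f f' := funext fun x => by
    simp only [heckeFun_eq_sum hfin, Pi.add_apply, Finset.sum_add_distrib]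
  map_smul' c f := funext fun x => by
    simp only [heckeFun_eq_sum hfin, Pi.smul_apply, smul_sum, id_apply]

theorem heckeLin_apply {H X : Type*} [Group H] [Group X] {K : Subgroup H} {j : H →* X}
    {g : H} (hfin : (cosets K g).Finite) (f : X → ℂ) : heckeLin j hfin f = heckeFun K j g f := rfl

variable (ε W μ) in
/-- The orthogonal complement of `A` in `levelForms`. -/
noncomputable def orthForms (χ : Weight δ K) (A : Submodule ℂ (I × G → ℂ)) :
    Submodule ℂ (I × G → ℂ) where
  carrier := {ψ | ψ ∈ levelForms ε δ W K ∧ ∀ b ∈ A, b ∈ levelForms ε δ W K →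
    pairing K μ χ.toFun b ψ = 0}
  zero_mem' := ⟨zero_mem _, fun b _ _ => by simp [pairing]⟩
  add_mem' := fun ha hb => ⟨add_mem ha.1 hb.1, fun c hc hc' => by
    rw [pairing_add_right χ hc' ha.1 hb.1, ha.2 c hc hc', hb.2 c hc hc', add_zero]⟩
  smul_mem' := fun c f hf => ⟨smul_mem _ _ hf.1, fun b hb hb' => by
    rw [pairing_smul_right, hf.2 b hb hb', mul_zero]⟩

variable {χ : Weight δ K} {A : Submodule ℂ (I × G → ℂ)}

theorem eq_zero_of_mem_orthForms {φ : I × G → ℂ} (h : φ ∈ A) (h' : φ ∈ orthForms ε W μ χ A) :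
    φ = 0 :=
  eq_zero_of_pairing_self χ h'.1 (h'.2 φ h h'.1)

theorem heckeFun_mem_orthForms (hfin : ∀ g, (cosets K g).Finite)
    (hA : ∀ g, ∀ φ ∈ A, φ ∈ levelForms ε δ W K → heckeFun K (inr I G) g φ ∈ A) (g : G)
    {φ : I × G → ℂ} (hφ : φ ∈ orthForms ε W μ χ A) :
    heckeFun K (inr I G) g φ ∈ orthForms ε W μ χ A :=
  ⟨heckeFun_mem_levelForms hφ.1 hfin g, fun b hb hb' => by
    rw [pairing_heckeFun χ hb' hφ.1 hfin]
    exact hφ.2 _ (hA _ _ hb hb') (heckeFun_mem_levelForms hb' hfin _)⟩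

theorem translate_mem_orthForms
    (hA : ∀ h : I, ∀ φ ∈ A, rightTranslate (h, 1) φ ∈ A) (h : I)
    {φ : I × G → ℂ} (hφ : φ ∈ orthForms ε W μ χ A) :
    rightTranslate (h, 1) φ ∈ orthForms ε W μ χ A :=
  ⟨translate_mem_levelForms hφ.1 h, fun b hb hb' => by
    have h1 : b = rightTranslate (h, 1) (rightTranslate (h⁻¹, 1) b) := by
      rw [← rightTranslate_mul, mk_mul_mk, mul_inv_cancel, mul_one]
      exact funext fun y => (congrArg b (mul_one y)).symm
    rw [h1, pairing_translate]
    exact hφ.2 _ (hA _ _ hb) (translate_mem_levelForms hb' _)⟩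

/-- A commuting family of Hecke operators which is stable under adjoints is diagonalizable. -/
theorem levelForms_le_span_eigenvectors (hδ : FiniteDoubleCosets δ K) (hs : FiniteStabilizers δ K)
    (hfin : ∀ g, (cosets K g).Finite) (𝒢 : Set G) (hinv : ∀ g ∈ 𝒢, g⁻¹ ∈ 𝒢)
    (hcomm : ∀ g ∈ 𝒢, ∀ g' ∈ 𝒢, ∀ φ ∈ levelForms ε δ W K,
      heckeFun K (inr I G) g (heckeFun K (inr I G) g' φ) =
      heckeFun K (inr I G) g' (heckeFun K (inr I G) g φ)) :
    levelForms ε δ W K ≤ span ℂ {φ | φ ∈ levelForms ε δ W K ∧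
      ∀ g ∈ 𝒢, ∃ c : ℂ, heckeFun K (inr I G) g φ = c • φ} := by
  obtain ⟨μ, _, _, _, _⟩ := exists_bi_invariant_measure I
  obtain ⟨χ, -⟩ := exists_weight hδ hs
  have := finiteDimensional_levelForms (ε := ε) (W := W) hδ
  set A := span ℂ {φ | φ ∈ levelForms ε δ W K ∧
      ∀ g ∈ 𝒢, ∃ c : ℂ, heckeFun K (inr I G) g φ = c • φ} with hA
  have hAV : A ≤ levelForms ε δ W K := span_le.mpr fun φ hφ => hφ.1
  have hAst : ∀ g ∈ 𝒢, ∀ φ ∈ A, heckeFun K (inr I G) g φ ∈ A := by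
    intro g hg
    have : A ≤ A.comap (heckeLin (inr I G) (hfin g)) := by
      refine span_le.mpr fun φ hφ => ?_
      obtain ⟨c, hc⟩ := hφ.2 g hg
      simp only [SetLike.mem_coe, Submodule.mem_comap, heckeLin_apply, hc]
      exact A.smul_mem c (subset_span hφ)
    exact this
  have hfA : FiniteDimensional ℂ A := finiteDimensional_of_le hAV
  set O := orthForms ε W μ χ A with hO
  have hOV : O ≤ levelForms ε δ W K := fun φ h => h.1
  have hfO : FiniteDimensional ℂ O := finiteDimensional_of_le hOV
  have hOst : ∀ g ∈ 𝒢, ∀ φ ∈ O, heckeFun K (inr I G) g φ ∈ O := by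
    intro g hg φ hφ
    refine ⟨heckeFun_mem_levelForms hφ.1 hfin g, fun b hb hb' => ?_⟩
    rw [pairing_heckeFun χ hb' hφ.1 hfin]
    exact hφ.2 _ (hAst _ (hinv g hg) _ hb) (heckeFun_mem_levelForms hb' hfin _)
  have hObot : O = ⊥ := by
    by_contra hne
    have hnt := Submodule.nontrivial_iff_ne_bot.mpr hne
    obtain ⟨v, hv, h⟩ := exists_common_eigenvector _ O rfl
      (fun g : 𝒢 => (heckeLin (inr I G) (hfin g.1)).restrict (hOst g g.2))
      (fun g g' => LinearMap.ext fun φ => Subtype.ext (hcomm g g.2 g' g'.2 φ (hOV φ.2))) hnt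
    have hvA : v.1 ∈ A := subset_span ⟨hOV v.2, fun g hg =>
      (h ⟨g, hg⟩).imp fun c hc => congrArg Subtype.val hc⟩
    exact hv (Subtype.ext (eq_zero_of_mem_orthForms hvA v.2))
  intro φ hφ
  obtain ⟨a, ha, h⟩ := exists_orthogonal_levelForms (μ := μ) χ hAV hφ
  have : φ - a ∈ O := ⟨sub_mem hφ (hAV ha), fun b hb _ => h b hb⟩
  rw [hObot, mem_bot, sub_eq_zero] at this
  rwa [this]

theorem levelForms_of_right {K' : Subgroup G} {φ : I × G → ℂ} (hφ : φ ∈ levelForms ε δ W K')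
    (h : ∀ x, ∀ k ∈ K, φ (x * (1, k)) = φ x) : φ ∈ levelForms ε δ W K :=
  ⟨hφ.1, h, hφ.2.2⟩

theorem sum_translate_mem_levelForms {K' : Subgroup G} [Fintype (K ⧸ K'.subgroupOf K)]
    {φ : I × G → ℂ} (hφ : φ ∈ levelForms ε δ W K') :
    ∑ b : K ⧸ K'.subgroupOf K, rightTranslate (1, (b.out : G)) φ ∈ levelForms ε δ W K := by
  refine levelForms_of_right (K' := ⊥) (sum_mem fun b _ =>
    translate_mem_levelForms_conj hφ _ fun k hk => ?_) fun x k hk => ?_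
  · rw [Subgroup.mem_bot] at hk
    simp [hk, K'.one_mem]
  · simp only [Finset.sum_apply]
    refine Fintype.sum_equiv (MulAction.toPerm (⟨k, hk⟩ : K)) _ _ fun b => ?_
    change φ (x * (1, k) * (1, (b.out : G))) = φ (x * ((1 : I), ((((⟨k, hk⟩ : K) • b).out : K) : G)))
    have h1 : (⟨k, hk⟩ : K) • b = ((⟨k, hk⟩ * b.out : K) : K ⧸ K'.subgroupOf K) := by
      conv_lhs => rw [← out_eq' b]
      rfl
    obtain ⟨l, hl, e⟩ := exists_eq_out_mul (K'.subgroupOf K) (⟨k, hk⟩ * b.out)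
    rw [h1, e]
    have := hφ.2.1 (x * (1, k) * (1, (b.out : G))) l hl
    rw [← this]
    simp [mul_assoc]

theorem pairing_eq_zero_of_sum_translate {K' : Subgroup G} (hK : K' ≤ K) (hi : K'.relIndex K ≠ 0)
    [Fintype (K ⧸ K'.subgroupOf K)] {φ ψ : I × G → ℂ} (hφ : φ ∈ levelForms ε δ W K')
    (hψ : ψ ∈ levelForms ε δ W K)
    (h : ∑ b : K ⧸ K'.subgroupOf K, rightTranslate ((1 : I), (b.out : G)) φ = 0) :
    pairing K' μ χ.toFun φ ψ = 0 := by
  let F : G → ℂ := fun x => (χ.toFun x : ℂ) * ∫ i, star (φ (i, x)) * ψ (i, x) ∂μ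
  have hψr : ∀ i x, ∀ k ∈ K, ψ (i, x * k) = ψ (i, x) := by
    intro i x k hk
    have := hψ.2.1 (i, x) k hk
    rwa [mk_mul_mk, mul_one] at this
  have hφr : ∀ i x, ∀ k ∈ K', φ (i, x * k) = φ (i, x) := by
    intro i x k hk
    have := hφ.2.1 (i, x) k hk
    rwa [mk_mul_mk, mul_one] at this
  have hF : ∀ x : G, F (x : G ⧸ K').out = F x := by
    intro x
    obtain ⟨k, hk, e⟩ := exists_eq_out_mul K' x
    simp only [F, e, hφr _ _ k hk, hψr _ _ k (hK hk), χ.right_invariant x k (hK hk)]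
  change ∑ᶠ z : G ⧸ K', F z.out = 0
  let e := quotientEquivProdOfLE hK
  have he : ∀ q, F (e.symm q).out = F (q.1.out * (q.2.out : G)) := by
    rintro ⟨a, b⟩
    conv_lhs => rw [← out_eq' b]
    exact hF _
  rw [← finsum_comp_equiv e.symm]
  simp only [he]
  have hsupp : (Function.support fun q : (G ⧸ K) × (K ⧸ K'.subgroupOf K) =>
      F (q.1.out * (q.2.out : G))).Finite := by
    refine ((χ.restrict hK hi).finite_support.preimage (f := e.symm)
      e.symm.injective.injOn).subset fun q hq => ?_
    simp only [Function.mem_support, ← he] at hq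
    simp only [Set.mem_preimage, Set.mem_ofPred_eq]
    intro h0
    refine hq ?_
    change χ.toFun _ = 0 at h0
    simp [F, h0]
  rw [finsum_curry _ hsupp]
  refine finsum_eq_zero_of_forall_eq_zero fun a => ?_
  rw [finsum_eq_sum_of_fintype]
  simp only [F, hψr _ _ _ (Subtype.prop _), χ.right_invariant _ _ (Subtype.prop _)]
  rw [← Finset.mul_sum, ← integral_finsetSum]
  · have : (fun i => ∑ b : K ⧸ K'.subgroupOf K, star (φ (i, a.out * (b.out : G))) *
        ψ (i, a.out)) = 0 := by
      funext i
      have h1 := congrFun h (i, a.out)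
      simp only [Finset.sum_apply] at h1
      have h2 : ∑ b : K ⧸ K'.subgroupOf K, φ (i, a.out * (b.out : G)) = 0 := by
        simpa [rightTranslate] using h1
      rw [← Finset.sum_mul, ← star_sum, h2]
      simp
    rw [this]
    simp
  · intro b _
    exact integrable_star_mul (levelForms_continuous hφ _) (levelForms_continuous hψ _)

variable [TopologicalSpace G] [IsTopologicalGroup G]

/-- A nonzero form of level `K` gives rise to an irreducible space of functions on `I × G`, in
which there is a nonzero form of level `K` with the same Hecke eigenvalues. -/
theorem exists_irreducible (hKo : IsOpen (K : Set G)) (hKc : IsCompact (K : Set G))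
    (hδ : FiniteDoubleCosets δ K) (hs : FiniteStabilizers δ K) {φ₀ : I × G → ℂ}
    (hφ₀ : φ₀ ∈ levelForms ε δ W K) (hne : φ₀ ≠ 0) :
    ∃ P : Submodule ℂ (I × G → ℂ),
      (∀ φ ∈ P, ∃ K' ≤ K, IsOpen (K' : Set G) ∧ φ ∈ levelForms ε δ W K') ∧
      (∀ g, ∀ φ ∈ P, rightTranslate g φ ∈ P) ∧
      (∀ Q ≤ P, (∀ g, ∀ φ ∈ Q, rightTranslate g φ ∈ Q) → Q = ⊥ ∨ Q = P) ∧
      ∃ φ ∈ P, φ ∈ levelForms ε δ W K ∧ φ ≠ 0 ∧ ∀ (g : G) (c : ℂ),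
        heckeFun K (inr I G) g φ₀ = c • φ₀ →
        heckeFun K (inr I G) g φ = c • φ := by
  obtain ⟨μ, _, _, _, _⟩ := exists_bi_invariant_measure I
  obtain ⟨χ, -⟩ := exists_weight hδ hs
  have hfin : ∀ g, (cosets K g).Finite := finite_cosets hKo hKc
  set V := levelForms ε δ W K with hV
  have hfV : FiniteDimensional ℂ V := finiteDimensional_levelForms (ε := ε) (W := W) hδ
  let S : Set (Submodule ℂ (I × G → ℂ)) := {N | N ≤ V ∧
    (∀ g, ∀ φ ∈ N, heckeFun K (inr I G) g φ ∈ N) ∧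
    (∀ h : I, ∀ φ ∈ N, rightTranslate (h, 1) φ ∈ N) ∧ ∃ b ∈ N, pairing K μ χ.toFun φ₀ b ≠ 0}
  have hS : V ∈ S := ⟨le_rfl, fun g φ hφ => heckeFun_mem_levelForms hφ hfin g,
    fun h φ hφ => translate_mem_levelForms hφ h, φ₀, hφ₀,
    fun h => hne (eq_zero_of_pairing_self χ hφ₀ h)⟩
  obtain ⟨N, ⟨hNV, hNT, hNR, b₀, hb₀, hb₀'⟩, hmin⟩ :=
    (measure fun N : Submodule ℂ (I × G → ℂ) => finrank ℂ N).wf.has_min S ⟨V, hS⟩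
  have hfN : FiniteDimensional ℂ N := finiteDimensional_of_le hNV
  have hmin' : ∀ N' ≤ N, N' ∈ S → N' = N := fun N' h h' =>
    Submodule.eq_of_le_of_finrank_le h (not_lt.mp (hmin N' h'))
  have hsimple : ∀ N' ≤ N, (∀ g, ∀ φ ∈ N', heckeFun K (inr I G) g φ ∈ N') →
      (∀ h : I, ∀ φ ∈ N', rightTranslate (h, 1) φ ∈ N') → N' = ⊥ ∨ N' = N := by
    intro N' hN' hT hR
    have hfN' : FiniteDimensional ℂ N' := finiteDimensional_of_le hN'
    obtain ⟨a, ha, hab⟩ := exists_orthogonal_levelForms (μ := μ) χ (hN'.trans hNV) (hNV hb₀)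
    by_cases h1 : pairing K μ χ.toFun φ₀ a = 0
    · left
      have h2 : N ⊓ orthForms ε W μ χ N' = N := by
        refine hmin' _ inf_le_left ⟨inf_le_left.trans hNV, fun g φ hφ => ⟨hNT g φ hφ.1, ?_⟩,
          fun h φ hφ => ⟨hNR h φ hφ.1, ?_⟩, b₀ - a, ⟨sub_mem hb₀ (hN' ha), ?_⟩, ?_⟩
        · exact heckeFun_mem_orthForms hfin (fun g φ hφ _ => hT g φ hφ) g hφ.2
        · exact translate_mem_orthForms hR h hφ.2
        · exact ⟨sub_mem (hNV hb₀) (hNV (hN' ha)), fun b hb _ => hab b hb⟩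
        · intro h3
          refine hb₀' ?_
          have := pairing_add_right (μ := μ) χ hφ₀ (sub_mem (hNV hb₀) (hNV (hN' ha)))
            (hNV (hN' ha))
          rwa [sub_add_cancel, h1, h3, add_zero] at this
      rw [eq_bot_iff]
      intro φ hφ
      have h3 := hN' hφ
      rw [← h2] at h3
      exact (mem_bot ℂ).mpr (eq_zero_of_mem_orthForms hφ h3.2)
    · right
      exact hmin' _ hN' ⟨hN'.trans hNV, hT, hR, a, ha, h1⟩
  let P : Submodule ℂ (I × G → ℂ) := span ℂ {ψ | ∃ g, ∃ φ ∈ N,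
    ψ = rightTranslate (inr I G g) φ}
  have hPst : ∀ g, ∀ φ ∈ P, rightTranslate g φ ∈ P := by
    rintro ⟨h, g⟩
    have : P ≤ P.comap (rightTranslate (h, g)) := by
      refine span_le.mpr ?_
      rintro _ ⟨g', φ, hφ, rfl⟩
      refine subset_span ⟨g * g', _, hNR h φ hφ, ?_⟩
      rw [← rightTranslate_mul, ← rightTranslate_mul]
      simp
    exact this
  have hPsm : ∀ φ ∈ P, ∃ K' ≤ K, IsOpen (K' : Set G) ∧ φ ∈ levelForms ε δ W K' := by
    intro φ hφ
    induction hφ using span_induction with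
    | mem ψ h =>
      obtain ⟨g, φ, hφ, rfl⟩ := h
      let C : Subgroup G := K.comap (MulAut.conj g⁻¹).toMonoidHom
      have hC : IsOpen (C : Set G) := by
        refine hKo.preimage (f := fun x : G => g⁻¹ * x * g⁻¹⁻¹) ?_
        fun_prop
      refine ⟨K ⊓ C, inf_le_left, hKo.inter hC,
        translate_mem_levelForms_conj (hNV hφ) g fun k hk => ?_⟩
      have : g⁻¹ * k * g⁻¹⁻¹ ∈ K := hk.2
      simpa using this
    | zero => exact ⟨K, le_rfl, hKo, zero_mem _⟩
    | add a b _ _ ha hb =>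
      obtain ⟨K₁, h₁, o₁, m₁⟩ := ha
      obtain ⟨K₂, h₂, o₂, m₂⟩ := hb
      exact ⟨K₁ ⊓ K₂, inf_le_left.trans h₁, o₁.inter o₂,
        add_mem (levelForms_mono inf_le_left m₁) (levelForms_mono inf_le_right m₂)⟩
    | smul c a _ ha =>
      obtain ⟨K₁, h₁, o₁, m₁⟩ := ha
      exact ⟨K₁, h₁, o₁, smul_mem _ _ m₁⟩
  have hNP : N ≤ P := fun φ hφ => subset_span ⟨1, φ, hφ, by
    funext x; simp [rightTranslate, MonoidHom.map_one]⟩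
  have hPK : P ⊓ V ≤ N := fun ψ hψ => mem_of_mem_span_translates N
    (fun φ hφ x k hk => (hNV hφ).2.1 x k hk) hfin hNT hψ.1 fun x k hk => hψ.2.2.1 x k hk
  refine ⟨P, hPsm, hPst, ?_, ?_⟩
  · intro Q hQP hQ
    have hQT : ∀ g, ∀ φ ∈ Q ⊓ V, heckeFun K (inr I G) g φ ∈ Q ⊓ V := fun g φ hφ =>
      ⟨heckeFun_mem_of_stable hQ (hfin g) hφ.1, heckeFun_mem_levelForms hφ.2 hfin g⟩
    rcases hsimple (Q ⊓ V) ((inf_le_inf_right V hQP).trans hPK) hQT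
      (fun h φ hφ => ⟨hQ _ _ hφ.1, translate_mem_levelForms hφ.2 h⟩) with h | h
    · left
      rw [eq_bot_iff]
      intro w hw
      obtain ⟨K', hK', ho, hwK⟩ := hPsm w (hQP hw)
      have hc' : IsCompact (K' : Set G) :=
        hKc.of_isClosed_subset (isClosed_of_isOpen K' ho) hK'
      have hfin' : ∀ g, (cosets K' g).Finite := finite_cosets ho hc'
      have hi : K'.relIndex K ≠ 0 := relIndex_ne_zero_of_isOpen hKc ho
      have : (K'.subgroupOf K).FiniteIndex := ⟨hi⟩
      have : Fintype (K ⧸ K'.subgroupOf K) := ofFinite _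
      set χ' := χ.restrict hK' hi with hχ'
      let M := orthForms ε W μ χ' Q
      have hNM : N ≤ M := by
        intro n hn
        refine ⟨levelForms_mono hK' (hNV hn), fun q hq hq' => ?_⟩
        refine pairing_eq_zero_of_sum_translate (χ := χ) hK' hi hq' (hNV hn) ?_
        have h1 : ∑ b : K ⧸ K'.subgroupOf K, rightTranslate ((1 : I), (b.out : G)) q ∈ Q ⊓ V :=
          ⟨sum_mem fun b _ => hQ _ _ hq, sum_translate_mem_levelForms hq'⟩
        rw [h] at h1
        exact (mem_bot ℂ).mp h1
      have hwM : w ∈ M := by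
        refine mem_of_mem_span_translates (j := inr I G) M
          (fun φ hφ x k hk => hφ.1.2.1 x k hk) hfin' (fun g φ hφ => ?_)
          (Submodule.span_mono ?_ (hQP hw)) fun x k hk => hwK.2.1 x k hk
        · exact heckeFun_mem_orthForms hfin'
            (fun g φ hφ _ => heckeFun_mem_of_stable hQ (hfin' g) hφ) g hφ
        · rintro _ ⟨g, φ, hφ, rfl⟩
          exact ⟨g, φ, hNM hφ, rfl⟩
      exact (mem_bot ℂ).mpr (eq_zero_of_mem_orthForms hw hwM)
    · right
      refine le_antisymm hQP (span_le.mpr ?_)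
      rintro _ ⟨g, φ, hφ, rfl⟩
      rw [← h] at hφ
      exact hQ _ _ hφ.1
  · obtain ⟨a, ha, hab⟩ := exists_orthogonal_levelForms (μ := μ) χ hNV hφ₀
    have hr : φ₀ - a ∈ orthForms ε W μ χ N :=
      ⟨sub_mem hφ₀ (hNV ha), fun b hb _ => hab b hb⟩
    refine ⟨a, hNP ha, hNV ha, ?_, ?_⟩
    · rintro rfl
      rw [sub_zero] at hr
      refine hb₀' ?_
      rw [← pairing_star, hr.2 b₀ hb₀ (hNV hb₀), star_zero]
    · intro g c hc
      have h1 : heckeFun K (inr I G) g a - c • a ∈ N :=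
        sub_mem (hNT g a ha) (N.smul_mem c ha)
      have h2 : heckeFun K (inr I G) g a - c • a ∈ orthForms ε W μ χ N := by
        have h3 := sub_mem (smul_mem _ c hr)
          (heckeFun_mem_orthForms hfin (fun g φ hφ _ => hNT g φ hφ) g hr)
        convert h3 using 1
        have h4 := (heckeLin (inr I G) (hfin g)).map_sub φ₀ a
        simp only [heckeLin_apply] at h4
        rw [h4, hc, smul_sub]
        abel
      exact sub_eq_zero.mp (eq_zero_of_mem_orthForms h1 h2)

end Irreducible

section Representations

variable [Module.Finite F D]
  {τ : Involution F 𝒦 D} {p : ℕ} {U : TameLevel τ p}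

/-- The diagonal embedding `G(ℚ) → G(ℝ)`. -/
noncomputable def Involution.diagInf (τ : Involution F 𝒦 D) : τ.points F →* τ.infinite :=
  MonoidHom.pi fun v : InfinitePlace F => τ.pointsMap (ofId F v.Completion)

theorem localEmb_mem_tame {v : {v : Pl(F) // ¬ AboveP p v}}
    {k : τ.localPoints v.1} (hk : k ∈ U.K v) : τ.localEmb v.1 k ∈ U.tame := by
  refine ⟨fun w => localEmb_ne (fun h : w.1 = v.1 => v.2 (by rw [← h]; exact w.2)) k,
    fun w => ?_⟩
  by_cases h : w = v
  · subst h
    rwa [localEmb_same]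
  · rw [localEmb_ne (fun h' => h (Subtype.ext h'))]
    exact (U.K w).one_mem

theorem tame_le_level (Kp : PLevel τ p) : U.tame ≤ U.level Kp := fun g hg => ⟨by
  convert Kp.1.one_mem using 1
  funext v
  exact hg.1 v, hg.2⟩

theorem heckeFun_level_eq {X A : Type*} [Group X] [AddCommMonoid A] (Kp : PLevel τ p)
    (j : τ.finAdelic →* X)
    (v : {v : Pl(F) // ¬ AboveP p v}) (g : τ.localPoints v.1) {f : X → A}
    (hf : ∀ x, ∀ k ∈ U.level Kp, f (x * j k) = f x) :
    heckeFun (U.level Kp) j (τ.localEmb v.1 g) f =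
      heckeFun (U.K v) (j.comp (τ.localEmb v.1)) g f := by
  funext x
  unfold heckeFun
  symm
  refine finsum_mem_eq_of_bijOn
    (fun c => ((τ.localEmb v.1 c.out : τ.finAdelic) : τ.finAdelic ⧸ U.level Kp))
    ⟨fun c hc => ?_, fun c _ c' _ h => ?_, fun q hq => ?_⟩ fun c _ => ?_
  · rw [← out_eq' c] at hc
    obtain ⟨a, ha, b, hb, e⟩ := mk_mem_cosets.mp hc
    refine mk_mem_cosets.mpr ⟨_, U.localEmb_mem_level Kp ha, _, U.localEmb_mem_level Kp hb, ?_⟩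
    rw [e, map_mul, map_mul]
  · rw [QuotientGroup.eq] at h
    have := h.2 v
    rwa [RestrictedProduct.mul_apply, RestrictedProduct.inv_apply, localEmb_same,
      localEmb_same, ← QuotientGroup.eq, out_eq', out_eq'] at this
  · obtain ⟨⟨k, hk⟩, rfl⟩ := hq
    refine ⟨((k v.1 * g : τ.localPoints v.1) : _ ⧸ U.K v), mk_mem_cosets.mpr
      ⟨k v.1, hk.2 v, 1, one_mem _, by rw [mul_one]⟩, ?_⟩
    obtain ⟨l, hl, e⟩ := exists_eq_out_mul (U.K v) (k v.1 * g)
    change ((τ.localEmb v.1 _ : τ.finAdelic) : _ ⧸ U.level Kp) =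
      ((k * τ.localEmb v.1 g : τ.finAdelic) : _ ⧸ U.level Kp)
    rw [e, QuotientGroup.eq]
    have h1 : τ.localEmb v.1 (k v.1) ∈ U.level Kp := U.localEmb_mem_level Kp (hk.2 v)
    have h3 : ((τ.localEmb v.1 (k v.1))⁻¹ * k) v.1 = 1 := by
      rw [RestrictedProduct.mul_apply, RestrictedProduct.inv_apply, localEmb_same,
        inv_mul_cancel]
    have h4 := (commute_localEmb h3 g).eq
    have h5 : (τ.localEmb v.1 (k v.1 * g * l))⁻¹ * (k * τ.localEmb v.1 g) =
        (τ.localEmb v.1 l)⁻¹ * ((τ.localEmb v.1 (k v.1))⁻¹ * k) := by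
      rw [map_mul, map_mul, mul_inv_rev, mul_inv_rev]
      calc _ = (τ.localEmb v.1 l)⁻¹ * (τ.localEmb v.1 g)⁻¹ *
          (((τ.localEmb v.1 (k v.1))⁻¹ * k) * τ.localEmb v.1 g) := by group
        _ = _ := by rw [h4]; group
    rw [h5]
    exact Subgroup.mul_mem _ (Subgroup.inv_mem _ (U.localEmb_mem_level Kp hl))
      (Subgroup.mul_mem _ (Subgroup.inv_mem _ h1) hk)
  · exact (out_invariant hf x _).symm

section

variable [IsTopologicalGroup τ.finAdelic] [CompactSpace τ.infinite]

/-- An eigenvector of the Hecke operators of tame level `U.tame` generates an irreducible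
automorphic representation, up to replacing it by another one with the same eigenvalues. -/
theorem exists_automorphicRep {W : CoeffSpace τ.infinite} (Kp : PLevel τ p)
    (hKo : IsOpen (U.level Kp : Set τ.finAdelic)) (hKc : IsCompact (U.level Kp : Set τ.finAdelic))
    (hδ : FiniteDoubleCosets τ.diagFin (U.level Kp))
    (hs : FiniteStabilizers τ.diagFin (U.level Kp)) {φ₀ : τ.infinite × τ.finAdelic → ℂ}
    (hφ₀ : φ₀ ∈ levelForms τ.diagInf τ.diagFin W (U.level Kp)) (hne : φ₀ ≠ 0) :
    ∃ π : AutomorphicRep τ, π.HasTameLevel U ∧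
      (∃ φ ∈ π.space, φ ≠ 0 ∧ ∀ x, ∀ k ∈ U.level Kp, φ (x * (1, k)) = φ x) ∧
      ∀ v (_ : IsHyperspecial τ v.1 (U.K v)) (g : τ.localPoints v.1) (c : ℂ),
        heckeFun (U.K v) ((inr τ.infinite τ.finAdelic).comp (τ.localEmb v.1)) g φ₀ =
          c • φ₀ → ∀ φ ∈ π.fixed U.tame,
        heckeFun (U.K v) ((inr τ.infinite τ.finAdelic).comp (τ.localEmb v.1)) g φ =
          c • φ := by
  borelize τ.infinite
  obtain ⟨P, hsm, hst, hirr, φ, hφP, hφK, hφ0, heig⟩ := exists_irreducible hKo hKc hδ hs hφ₀ hne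
  have hform : ∀ ψ ∈ P, IsAutomorphicForm τ ψ := by
    intro ψ hψ
    obtain ⟨K', hK', ho, h⟩ := hsm ψ hψ
    refine ⟨h.1, ⟨K', ho, h.2.1⟩, fun x => levelForms_continuous h x, ?_⟩
    have := finiteDimensional_levelForms (ε := τ.diagInf) (W := W)
      (hδ.of_relIndex (relIndex_ne_zero_of_isOpen hKc ho))
    refine finiteDimensional_of_le
      (S₂ := levelForms τ.diagInf τ.diagFin W K') (span_le.mpr ?_)
    rintro _ ⟨i, rfl⟩
    exact translate_mem_levelForms h i
  let π : AutomorphicRep τ :=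
    { space := P
      isAutomorphicForm := hform
      isStable := hst
      ne_bot := fun h => hφ0 ((mem_bot ℂ).mp (h ▸ hφP))
      irreducible := hirr }
  refine ⟨π, ?_, ⟨φ, hφP, hφ0, hφK.2.1⟩, ?_⟩
  · refine (Submodule.ne_bot_iff _).mpr ⟨φ, ⟨hφP, fun x k hk => ?_⟩, hφ0⟩
    exact hφK.2.1 x k (tame_le_level Kp hk)
  · intro v hv g c hc
    have hKfin := U.finite_cosets v
    set j := (inr τ.infinite τ.finAdelic).comp (τ.localEmb v.1) with hj
    have hcφ : heckeFun (U.K v) j g φ = c • φ := by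
      have h1 := heckeFun_level_eq (U := U) Kp (inr τ.infinite τ.finAdelic) v g
        (f := φ₀) hφ₀.2.1
      have h2 := heckeFun_level_eq (U := U) Kp (inr τ.infinite τ.finAdelic) v g
        (f := φ) hφK.2.1
      rw [hj, ← h2]
      exact heig _ c (h1.trans hc)
    obtain ⟨θ, hθ1, hθ2, hθ3⟩ := hv.exists_anti
    let M : Submodule ℂ (τ.infinite × τ.finAdelic → ℂ) :=
      { carrier := {ψ | ψ ∈ P ∧ (∀ x, ∀ k ∈ U.K v, ψ (x * j k) = ψ x) ∧
          heckeFun (U.K v) j g ψ = c • ψ}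
        zero_mem' := ⟨zero_mem _, fun _ _ _ => rfl, by
          rw [← heckeLin_apply (hKfin g), map_zero, smul_zero]⟩
        add_mem' := fun {a b} ha hb => ⟨add_mem ha.1 hb.1, fun x k hk => by
          simp only [Pi.add_apply, ha.2.1 x k hk, hb.2.1 x k hk], by
          rw [← heckeLin_apply (hKfin g), map_add, heckeLin_apply, heckeLin_apply, ha.2.2,
            hb.2.2, smul_add]⟩
        smul_mem' := fun d a ha => ⟨P.smul_mem d ha.1, fun x k hk => by
          simp only [Pi.smul_apply, ha.2.1 x k hk], by
          rw [← heckeLin_apply (hKfin g), map_smul, heckeLin_apply, ha.2.2, smul_comm]⟩ }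
    have hMmem : ∀ ψ, ψ ∈ M ↔ ψ ∈ P ∧ (∀ x, ∀ k ∈ U.K v, ψ (x * j k) = ψ x) ∧
        heckeFun (U.K v) j g ψ = c • ψ := fun _ => Iff.rfl
    have hcomm : ∀ y : τ.infinite × τ.finAdelic, (∀ h, Commute y (j h)) → ∀ ψ ∈ M,
        rightTranslate y ψ ∈ M := by
      intro y hy ψ hψ
      refine ⟨hst y ψ hψ.1, fun x k hk => ?_, ?_⟩
      · change ψ (x * j k * y) = ψ (x * y)
        rw [mul_assoc, ← (hy k).eq, ← mul_assoc, hψ.2.1 _ k hk]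
      · have : heckeFun (U.K v) j g (rightTranslate y ψ) =
            rightTranslate y (heckeFun (U.K v) j g ψ) := by
          funext x
          change _ = heckeFun (U.K v) j g ψ (x * y)
          rw [heckeFun_eq_sum (hKfin g), heckeFun_eq_sum (hKfin g)]
          refine sum_congr rfl fun d _ => ?_
          change ψ (x * j _ * y) = _
          rw [mul_assoc, ← (hy _).eq, ← mul_assoc]
        rw [this, hψ.2.2, map_smul]
    let S := span ℂ {ψ | ∃ h, ∃ φ ∈ M, ψ = rightTranslate (j h) φ}
    have hSP : S ≤ P := by
      refine span_le.mpr ?_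
      rintro _ ⟨h, ψ, hψ, rfl⟩
      exact hst _ _ hψ.1
    have hSst : ∀ y, ∀ ψ ∈ S, rightTranslate y ψ ∈ S := by
      rintro ⟨i, x⟩
      have : S ≤ S.comap (rightTranslate (i, x)) := by
        refine span_le.mpr ?_
        rintro _ ⟨h, ψ, hψ, rfl⟩
        set x' : τ.finAdelic := (τ.localEmb v.1 (x v.1))⁻¹ * x with hx'
        have hxv : x' v.1 = 1 := by
          rw [hx', RestrictedProduct.mul_apply, RestrictedProduct.inv_apply, localEmb_same,
            inv_mul_cancel]
        have hcm : ∀ h, Commute ((i, x') : τ.infinite × τ.finAdelic) (j h) := fun h =>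
          Prod.ext ((Commute.one_right i).eq) (commute_localEmb hxv h).eq
        have hdec : ((i, x) : τ.infinite × τ.finAdelic) = j (x v.1) * (i, x') := by
          refine Prod.ext ?_ ?_
          · simp [hj]
          · change x = τ.localEmb v.1 (x v.1) * x'
            rw [hx']
            group
        refine subset_span ⟨x v.1 * h, rightTranslate (i, x') ψ, hcomm _ hcm ψ hψ, ?_⟩
        rw [← rightTranslate_mul, ← rightTranslate_mul, hdec, map_mul, mul_assoc, mul_assoc,
          (hcm h).eq]
      exact this
    have hφM : φ ∈ M := ⟨hφP, fun x k hk => hφK.2.1 x _ (U.localEmb_mem_level Kp hk), hcφ⟩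
    have hS : S = P := by
      refine (hirr S hSP hSst).resolve_left fun h => hφ0 ?_
      have : φ ∈ S := subset_span ⟨1, φ, hφM, by
        funext x
        simp [rightTranslate]⟩
      rw [h] at this
      exact (mem_bot ℂ).mp this
    intro ψ hψ
    refine ((hMmem ψ).mp (mem_of_mem_span_translates (j := j) M (fun φ hφ => hφ.2.1) hKfin
      (fun g' φ hφ => ⟨?_, fun x k hk => heckeFun_right hφ.2.1 g' x k hk, ?_⟩)
      (hS ▸ hψ.1 : ψ ∈ S) fun x k hk => hψ.2 x _ (localEmb_mem_tame hk))).2.2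
    · have : heckeFun (U.K v) j g' φ = ∑ d ∈ (hKfin g').toFinset, rightTranslate (j d.out) φ := by
        funext x
        rw [heckeFun_eq_sum (hKfin g'), Finset.sum_apply]
        rfl
      rw [this]
      exact sum_mem fun d _ => hst _ _ hφ.1
    · rw [heckeFun_comm_of_anti θ hθ1 hθ2 hθ3 g g' (hKfin g) (hKfin g') hφ.2.1, hφ.2.2,
        ← heckeLin_apply (hKfin g'), map_smul, heckeLin_apply]

end

end Representations

section IntegersOfE

variable {p : ℕ} [Fact p.Prime] {E : IntermediateField ℚ_[p] Ω_[p]}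

theorem norm_le_one_iff_isIntegral (x : Ω_[p]) : ‖x‖ ≤ 1 ↔ IsIntegral ℤ_[p] x := by
  have hx : IsIntegral ℚ_[p] x := Algebra.IsIntegral.isIntegral x
  rw [← PadicAlgCl.spectralNorm_eq, spectralNorm, spectralValue_le_one_iff (minpoly.monic hx)]
  constructor
  · intro h
    have h1 : minpoly ℚ_[p] x ∈ Polynomial.lifts (algebraMap ℤ_[p] ℚ_[p]) := by
      refine (Polynomial.lifts_iff_coeff_lifts _).mpr fun n => ⟨⟨_, h n⟩, rfl⟩
    obtain ⟨q, hq, -, hm⟩ := Polynomial.lifts_and_natDegree_eq_and_monic h1 (minpoly.monic hx)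
    refine ⟨q, hm, ?_⟩
    have h2 := minpoly.aeval ℚ_[p] x
    rwa [← hq, Polynomial.aeval_map_algebraMap] at h2
  · intro h n
    rw [minpoly.isIntegrallyClosed_eq_field_fractions' ℚ_[p] h, Polynomial.coeff_map]
    exact PadicInt.norm_le_one _

theorem mem_intE_iff (x : E) : x ∈ intE E ↔ ‖x‖ ≤ 1 := by
  have : IsScalarTower ℤ_[p] E Ω_[p] := IsScalarTower.of_algebraMap_eq fun _ => rfl
  rw [mem_integralClosure_iff]
  refine Iff.trans ?_ (norm_le_one_iff_isIntegral (x : Ω_[p])).symm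
  exact (isIntegral_algHom_iff ((IsScalarTower.toAlgHom ℤ_[p] E Ω_[p]))
    (algebraMap E Ω_[p]).injective).symm

theorem norm_coe_intE_le_one (x : intE E) : ‖algebraMap (intE E) Ω_[p] x‖ ≤ 1 :=
  (mem_intE_iff x.1).mp x.2

end IntegersOfE

section HeckeAction

variable [Module.Finite F D]
  {τ : Involution F 𝒦 D} {p : ℕ} (U : TameLevel τ p)

namespace TameLevel

/-- The double cosets at the hyperspecial places. -/
structure HeckeIndex where
  place : {v : Pl(F) // ¬ AboveP p v}
  elt : τ.localPoints place.1
  isHyperspecial : IsHyperspecial τ place.1 (U.K place)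

variable {U} in
/-- The Hecke operator as a linear endomorphism of all functions on `G(𝔸_f)`. -/
noncomputable def heckeMap (R A : Type*) [CommRing R] [AddCommGroup A] [Module R A]
    (i : U.HeckeIndex) : End R (τ.finAdelic → A) where
  toFun := heckeFun (U.K i.place) (τ.localEmb i.place.1) i.elt
  map_add' f f' := funext fun x => by
    simp only [heckeFun_eq_sum (U.finite_cosets _ _), Pi.add_apply, Finset.sum_add_distrib]
  map_smul' c f := funext fun x => by
    simp only [heckeFun_eq_sum (U.finite_cosets _ _), Pi.smul_apply, smul_sum,
      id_apply]

theorem heckeMap_apply {R A : Type*} [CommRing R] [AddCommGroup A] [Module R A]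
    (i : U.HeckeIndex) (f : τ.finAdelic → A) (x : τ.finAdelic) : heckeMap R A i f x =
      ∑ c ∈ (U.finite_cosets i.place i.elt).toFinset, f (x * τ.localEmb i.place.1 c.out) :=
  heckeFun_eq_sum (U.finite_cosets _ _) f x

/-- The action of noncommutative polynomials in the Hecke operators. -/
noncomputable def heckeAct (R A : Type*) [CommRing R] [AddCommGroup A] [Module R A] :
    FreeAlgebra R U.HeckeIndex →ₐ[R] End R (τ.finAdelic → A) :=
  FreeAlgebra.lift R (heckeMap R A)

theorem heckeAct_ι (R A : Type*) [CommRing R] [AddCommGroup A] [Module R A] (i : U.HeckeIndex) :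
    U.heckeAct R A (FreeAlgebra.ι R i) = heckeMap R A i :=
  lift_ι_apply _ _

theorem heckeAct_comp {R A B : Type*} [CommRing R] [AddCommGroup A] [Module R A]
    [AddCommGroup B] [Module R B] (a : A →ₗ[R] B) (q : FreeAlgebra R U.HeckeIndex)
    (f : τ.finAdelic → A) : U.heckeAct R B q (fun x => a (f x)) =
      fun x => a (U.heckeAct R A q f x) := by
  induction q using FreeAlgebra.induction generalizing f with
  | grade0 r =>
    simp only [commutes, Module.algebraMap_end_apply]
    funext x
    simp
  | grade1 i =>
    rw [heckeAct_ι, heckeAct_ι]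
    funext x
    rw [heckeMap_apply, heckeMap_apply, map_sum]
  | mul q r hq hr => simp only [map_mul, End.mul_apply, hr, hq]
  | add q r hq hr =>
    simp only [map_add, LinearMap.add_apply, hr, hq]
    funext x
    simp

variable {U} in
/-- The function on `G(𝔸_f)` underlying an element of `H⁰(K)`. -/
def formVal {A : Type*} [CommRing A] {Kp : PLevel τ p} : U.H0 A Kp →ₗ[A] (τ.finAdelic → A) :=
  (U.forms A Kp).subtype

theorem exists_heckeAct_eq {A : Type*} [CommRing A] (Kp : PLevel τ p) (t : U.HeckeAlg A Kp) :
    ∃ q, ∀ f : U.H0 A Kp, formVal (t.1 f) = U.heckeAct A A q (formVal f) := by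
  obtain ⟨t, ht⟩ := t
  change ∃ q, ∀ f : U.H0 A Kp, formVal (t f) = U.heckeAct A A q (formVal f)
  induction ht using adjoin_induction with
  | mem t h =>
    obtain ⟨v, g, hv, rfl⟩ := h
    refine ⟨FreeAlgebra.ι A (⟨v, g, hv⟩ : U.HeckeIndex), fun f => ?_⟩
    rw [heckeAct_ι]
    rfl
  | algebraMap r =>
    refine ⟨algebraMap _ _ r, fun f => ?_⟩
    rw [commutes]
    exact map_smul formVal r f
  | add a b _ _ ha hb =>
    obtain ⟨q, hq⟩ := ha
    obtain ⟨r, hr⟩ := hb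
    refine ⟨q + r, fun f => ?_⟩
    rw [map_add, LinearMap.add_apply, LinearMap.add_apply, map_add, hq, hr]
  | mul a b _ _ ha hb =>
    obtain ⟨q, hq⟩ := ha
    obtain ⟨r, hr⟩ := hb
    refine ⟨q * r, fun f => ?_⟩
    rw [map_mul, End.mul_apply, End.mul_apply, hq, hr]

/-- A polynomial in the Hecke operators which represents `t` at level `Kp`. -/
def Represents {A : Type*} [CommRing A] (t : U.BigHeckeAlg A) (Kp : PLevel τ p)
    (q : FreeAlgebra A U.HeckeIndex) : Prop :=
  ∀ f : U.H0 A Kp, formVal ((t.1 Kp).1 f) = U.heckeAct A A q (formVal f)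

variable {U}

theorem exists_represents {A : Type*} [CommRing A] (t : U.BigHeckeAlg A) (Kp : PLevel τ p) :
    ∃ q, U.Represents t Kp q := U.exists_heckeAct_eq Kp (t.1 Kp)

namespace Represents

variable {A : Type*} [CommRing A] {t t' : U.BigHeckeAlg A} {Kp : PLevel τ p}
  {q q' : FreeAlgebra A U.HeckeIndex}

theorem mono (h : U.Represents t Kp q) {Kp' : PLevel τ p} (hK : Kp ≤ Kp') :
    U.Represents t Kp' q := by
  intro f
  have h1 := h (H0.incl U hK f)
  rwa [t.2 Kp' Kp hK f] at h1

theorem add (h : U.Represents t Kp q) (h' : U.Represents t' Kp q') :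
    U.Represents (t + t') Kp (q + q') := fun f => by
  rw [map_add, LinearMap.add_apply, ← h, ← h', ← map_add]
  rfl

theorem mul (h : U.Represents t Kp q) (h' : U.Represents t' Kp q') :
    U.Represents (t * t') Kp (q * q') := fun f => by
  rw [map_mul, End.mul_apply, ← h', ← h]
  rfl

theorem neg (h : U.Represents t Kp q) : U.Represents (-t) Kp (-q) := fun f => by
  rw [map_neg, LinearMap.neg_apply, ← h, ← map_neg]
  rfl

theorem sub (h : U.Represents t Kp q) (h' : U.Represents t' Kp q') :
    U.Represents (t - t') Kp (q - q') := by
  rw [sub_eq_add_neg, sub_eq_add_neg]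
  exact h.add h'.neg

theorem algebraMap (r : A) (Kp : PLevel τ p) :
    U.Represents (algebraMap A (U.BigHeckeAlg A) r) Kp (algebraMap _ _ r) := fun f => by
  rw [commutes]
  exact map_smul formVal r f

theorem heckeElt (i : U.HeckeIndex) (Kp : PLevel τ p) :
    U.Represents (U.heckeElt A i.place i.isHyperspecial i.elt) Kp (FreeAlgebra.ι A i) := fun f => by
  rw [heckeAct_ι]
  rfl

end Represents

/-- The intersection of two levels. -/
noncomputable def _root_.DefiniteUnitary.PLevel.inf (Kp Kp' : PLevel τ p) : PLevel τ p :=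
  ⟨Kp.1 ⊓ Kp'.1, Kp.2.1.inter Kp'.2.1, Kp.2.2.inter_right
    (isClosed_of_isOpen _ Kp'.2.1)⟩

theorem _root_.DefiniteUnitary.PLevel.inf_le_left (Kp Kp' : PLevel τ p) : Kp.inf Kp' ≤ Kp :=
  show Kp.1 ⊓ Kp'.1 ≤ Kp.1 from _root_.inf_le_left

theorem _root_.DefiniteUnitary.PLevel.inf_le_right (Kp Kp' : PLevel τ p) : Kp.inf Kp' ≤ Kp' :=
  show Kp.1 ⊓ Kp'.1 ≤ Kp'.1 from _root_.inf_le_right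

variable (U) in
/-- The double coset equivalence relation of level `Kp`. -/
def levelSetoid (Kp : PLevel τ p) : Setoid τ.finAdelic where
  r x y := ∃ γ, ∃ k ∈ U.level Kp, y = τ.diagFin γ * x * k
  iseqv :=
    { refl := fun x => ⟨1, 1, one_mem _, by simp⟩
      symm := by
        rintro x y ⟨γ, k, hk, rfl⟩
        exact ⟨γ⁻¹, k⁻¹, inv_mem hk, by rw [map_inv]; group⟩
      trans := by
        rintro x y z ⟨γ, k, hk, rfl⟩ ⟨γ', k', hk', rfl⟩
        exact ⟨γ' * γ, k * k', mul_mem hk hk', by rw [map_mul]; group⟩ }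

variable (U) in
/-- The set of double cosets `G(ℚ) \ G(𝔸_f) / K`. -/
abbrev Classes (Kp : PLevel τ p) : Type _ := Quotient (U.levelSetoid Kp)

theorem finite_classes {Kp : PLevel τ p} (h : FiniteDoubleCosets τ.diagFin (U.level Kp)) :
    Finite (U.Classes Kp) := by
  obtain ⟨R, hR⟩ := h
  refine Finite.of_surjective (fun r : R => (Quotient.mk (U.levelSetoid Kp) r.1)) fun c => ?_
  induction c using Quotient.inductionOn with | _ x => ?_
  obtain ⟨γ, r, hr, k, hk, e⟩ := hR x
  exact ⟨⟨r, hr⟩, sound ⟨γ, k, hk, e⟩⟩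

theorem mem_forms_iff_classes {A : Type*} [CommRing A] {Kp : PLevel τ p} {f : τ.finAdelic → A} :
    f ∈ U.forms A Kp ↔ ∀ x y, (Quotient.mk (U.levelSetoid Kp) x) = Quotient.mk _ y →
      f x = f y := by
  constructor
  · intro h x y hxy
    obtain ⟨γ, k, hk, rfl⟩ := Quotient.exact hxy
    rw [h.2 _ k hk, h.1]
  · intro h
    refine ⟨fun γ x => (h _ _ (sound ⟨γ, 1, one_mem _, by simp⟩)).symm, fun x k hk =>
      (h _ _ (sound ⟨1, k, hk, by simp⟩)).symm⟩

open Classical in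
/-- The characteristic function of a double coset. -/
noncomputable def indicatorForm (A : Type*) [CommRing A] {Kp : PLevel τ p} (c : U.Classes Kp) :
    U.H0 A Kp :=
  ⟨fun x => if Quotient.mk _ x = c then 1 else 0, mem_forms_iff_classes.mpr fun x y h => by
    rw [h]⟩

theorem formVal_mem {A : Type*} [CommRing A] {Kp : PLevel τ p} (f : U.H0 A Kp) :
    formVal f ∈ U.forms A Kp := f.2

theorem forms_apply_out {A : Type*} [CommRing A] {Kp : PLevel τ p} (f : U.H0 A Kp)
    (x : τ.finAdelic) :
    formVal f (Quotient.mk (U.levelSetoid Kp) x).out = formVal f x :=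
  mem_forms_iff_classes.mp (formVal_mem f) _ _ (out_eq _)

theorem formVal_indicatorForm {A : Type*} [CommRing A] {Kp : PLevel τ p} (c : U.Classes Kp)
    (x : τ.finAdelic) :
    formVal (indicatorForm A c) x = open Classical in
      if Quotient.mk (U.levelSetoid Kp) x = c then 1 else 0 := rfl

end TameLevel

end HeckeAction

section Eigensystems

variable [Module.Finite F D]
  {τ : Involution F 𝒦 D} {p : ℕ} [Fact p.Prime] {U : TameLevel τ p}
  {R : Type*} [CommRing R] [Algebra R Ω_[p]]

theorem norm_sub_le_max_of_ultrametric {A : Type*} [SeminormedAddCommGroup A] [IsUltrametricDist A]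
    (x y : A) : ‖x - y‖ ≤ max ‖x‖ ‖y‖ := by
  rw [sub_eq_add_neg, ← norm_neg y]
  exact norm_add_le_max _ _

namespace TameLevel

theorem norm_heckeAct_le (hR : ∀ r, ‖algebraMap R Ω_[p] r‖ ≤ 1) {B : ℝ} (hB : 0 ≤ B) (q : FreeAlgebra R U.HeckeIndex)
    (f : τ.finAdelic → Ω_[p]) (h : ∀ x, ‖f x‖ ≤ B) (x : τ.finAdelic) :
    ‖U.heckeAct R Ω_[p] q f x‖ ≤ B := by
  induction q using FreeAlgebra.induction generalizing f x with
  | grade0 r =>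
    simp only [commutes, Module.algebraMap_end_apply]
    rw [Pi.smul_apply, Algebra.smul_def, norm_mul]
    exact (mul_le_of_le_one_left (norm_nonneg _) (hR r)).trans (h x)
  | grade1 i =>
    rw [heckeAct_ι]
    rw [heckeMap_apply]
    exact norm_sum_le_of_forall_le_of_nonneg hB fun c _ => h _
  | mul q r hq hr =>
    rw [map_mul, End.mul_apply]
    exact hq _ (fun x => hr f h x) x
  | add q r hq hr =>
    rw [map_add, LinearMap.add_apply, Pi.add_apply]
    exact (norm_add_le_max _ _).trans (max_le (hq f h x) (hr f h x))

theorem norm_heckeAct_le_of_small (hR : ∀ r, ‖algebraMap R Ω_[p] r‖ ≤ 1) {Kp : PLevel τ p}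
    (hfin : FiniteDoubleCosets τ.diagFin (U.level Kp)) {ε B δ : ℝ} (hB : 0 ≤ B) (hδ : 0 ≤ δ)
    (hε : 0 ≤ ε)
    (f : τ.finAdelic → Ω_[p]) (hΓ : ∀ γ x, f (τ.diagFin γ * x) = f x)
    (hu : ∀ x, ∀ k ∈ U.level Kp, ‖f (x * k) - f x‖ ≤ ε) (hb : ∀ x, ‖f x‖ ≤ B)
    (q : FreeAlgebra R U.HeckeIndex)
    (hq : ∀ (c : U.Classes Kp) (x : τ.finAdelic), ‖algebraMap R Ω_[p]
      (U.heckeAct R R q (formVal (indicatorForm R c)) x)‖ ≤ δ)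
    (x : τ.finAdelic) :
    ‖U.heckeAct R Ω_[p] q f x‖ ≤ max ε (δ * B) := by
  classical
  have := finite_classes hfin
  have : Fintype (U.Classes Kp) := ofFinite _
  let h : τ.finAdelic → Ω_[p] := fun x => f (Quotient.mk (U.levelSetoid Kp) x).out
  have hh : h = ∑ c : U.Classes Kp, fun x =>
      (LinearMap.toSpanSingleton R Ω_[p] (f c.out))
        ((formVal (indicatorForm R c)) x) := by
    funext x
    simp [h, formVal_indicatorForm]
  have hr : ∀ x, ‖(f - h) x‖ ≤ ε := by
    intro x
    obtain ⟨γ, k, hk, e⟩ := Quotient.exact (out_eq (Quotient.mk (U.levelSetoid Kp) x))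
    have h1 : f x = f ((Quotient.mk (U.levelSetoid Kp) x).out * k) := by
      conv_lhs => rw [e, mul_assoc, hΓ]
    change ‖f x - h x‖ ≤ ε
    rw [h1]
    exact hu _ k hk
  have hsum : U.heckeAct R Ω_[p] q f x =
      U.heckeAct R Ω_[p] q (f - h) x +
      U.heckeAct R Ω_[p] q h x := by
    rw [← Pi.add_apply, ← map_add, sub_add_cancel]
  rw [hsum]
  refine (norm_add_le_max _ _).trans (max_le_max
    (norm_heckeAct_le hR hε q _ hr x) ?_)
  rw [hh, map_sum, Finset.sum_apply]
  refine norm_sum_le_of_forall_le_of_nonneg (by positivity) fun c _ => ?_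
  rw [heckeAct_comp]
  change ‖LinearMap.toSpanSingleton _ _ _ _‖ ≤ _
  rw [LinearMap.toSpanSingleton_apply, Algebra.smul_def, norm_mul]
  exact mul_le_mul (hq c x) (hb _) (norm_nonneg _) hδ

theorem heckeAct_eigen (c : U.HeckeIndex → Ω_[p]) (f : τ.finAdelic → Ω_[p])
    (heig : ∀ i, heckeMap R Ω_[p] i f = c i • f)
    (q : FreeAlgebra R U.HeckeIndex) :
    U.heckeAct R Ω_[p] q f = FreeAlgebra.lift R c q • f := by
  induction q using FreeAlgebra.induction with
  | grade0 r =>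
    simp only [commutes, Module.algebraMap_end_apply]
    funext x
    simp [Algebra.smul_def]
  | grade1 i =>
    rw [heckeAct_ι, lift_ι_apply]
    exact heig i
  | mul q r hq hr =>
    have hcomp : ∀ (a : Ω_[p]) (f : τ.finAdelic → Ω_[p]),
        U.heckeAct R Ω_[p] q (a • f) =
        a • U.heckeAct R Ω_[p] q f := fun a f =>
      U.heckeAct_comp (mulLeft R a) q f
    rw [map_mul, End.mul_apply, hr, hcomp, hq, map_mul, smul_smul, mul_comm]
  | add q r hq hr => rw [map_add, LinearMap.add_apply, hq, hr, map_add, add_smul]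

set_option maxHeartbeats 1000000 in
/-- An eigenfunction of the Hecke operators, uniformly continuous at `p`, defines a point of
`𝕋(K^p)`. -/
theorem exists_eigensystem [TopologicalSpace R] (hR : ∀ r, ‖algebraMap R Ω_[p] r‖ ≤ 1)
    (hRc : Continuous (algebraMap R Ω_[p])) (Kp₀ : PLevel τ p)
    (hfin : ∀ Kp, FiniteDoubleCosets τ.diagFin (U.level Kp))
    (f : τ.finAdelic → Ω_[p]) (hf : f ≠ 0) (hΓ : ∀ γ x, f (τ.diagFin γ * x) = f x)
    (hu : ∀ ε > 0, ∃ Kp, ∀ x, ∀ k ∈ U.level Kp, ‖f (x * k) - f x‖ ≤ ε)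
    (V : Submodule ℚ_[p] Ω_[p]) [FiniteDimensional ℚ_[p] V]
    (hVR : ∀ r : R, ∀ z ∈ V, r • z ∈ V) (hV : ∀ x, f x ∈ V)
    (c : U.HeckeIndex → Ω_[p])
    (heig : ∀ i, heckeMap R Ω_[p] i f = c i • f) :
    ∃ lam : U.BigHeckeAlg R →ₐ[R] Ω_[p], Continuous lam ∧
      (∀ i : U.HeckeIndex, lam (U.heckeElt R i.place i.isHyperspecial i.elt) = c i) ∧
      ∀ t, ∀ ε > 0, ∃ Kp, ∀ Kp' ≤ Kp, ∀ q, U.Represents t Kp' q →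
        ‖FreeAlgebra.lift R c q - lam t‖ ≤ ε := by
  classical
  obtain ⟨x₀, hx₀⟩ : ∃ x₀, f x₀ ≠ 0 := by
    by_contra! h
    exact hf (funext h)
  set Λ := FreeAlgebra.lift R c with hΛ
  have hΛf : ∀ q, U.heckeAct R Ω_[p] q f = Λ q • f := heckeAct_eigen c f heig
  set a := ‖f x₀‖ with ha
  have ha0 : 0 < a := norm_pos_iff.mpr hx₀
  obtain ⟨B, hB0, hB⟩ : ∃ B : ℝ, 0 < B ∧ ∀ x, ‖f x‖ ≤ B := by
    obtain ⟨Kp, hKp⟩ := hu 1 one_pos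
    have := finite_classes (hfin Kp)
    have : Fintype (U.Classes Kp) := ofFinite _
    obtain ⟨B, hB⟩ := (Set.finite_range fun c : U.Classes Kp => ‖f c.out‖).bddAbove
    refine ⟨max B 1, by positivity, fun x => ?_⟩
    obtain ⟨γ, k, hk, e⟩ := Quotient.exact (out_eq (Quotient.mk (U.levelSetoid Kp) x))
    have h1 : f x = (f ((Quotient.mk (U.levelSetoid Kp) x).out * k) -
        f (Quotient.mk (U.levelSetoid Kp) x).out) + f (Quotient.mk (U.levelSetoid Kp) x).out := by
      rw [sub_add_cancel]
      conv_lhs => rw [e, mul_assoc, hΓ]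
    rw [h1]
    refine (norm_add_le_max _ _).trans (max_le ?_ ?_)
    · exact (hKp _ k hk).trans (le_max_right _ _)
    · exact (hB ⟨_, rfl⟩).trans (le_max_left _ _)
  have est : ∀ ε > 0, ∃ Kp, ∃ δ > 0, ∀ q, (∀ (c : U.Classes Kp) (x : τ.finAdelic),
      ‖algebraMap R Ω_[p] (U.heckeAct R R q
        (formVal (indicatorForm R c)) x)‖ ≤ δ) → ‖Λ q‖ ≤ ε := by
    intro ε hε
    obtain ⟨Kp, hKp⟩ := hu (ε * a) (by positivity)
    refine ⟨Kp, ε * a / B, by positivity, fun q hq => ?_⟩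
    have h1 := norm_heckeAct_le_of_small hR (hfin Kp) hB0.le (by positivity) (by positivity) f hΓ
      hKp hB q hq x₀
    rw [hΛf, Pi.smul_apply, norm_smul, div_mul_cancel₀ _ hB0.ne', max_self] at h1
    exact le_of_mul_le_mul_right h1 ha0
  let 𝓕 : U.BigHeckeAlg R → Filter (FreeAlgebra R U.HeckeIndex) := fun t =>
    ⨅ Kp, .principal {q | U.Represents t Kp q}
  have : Nonempty (PLevel τ p) := ⟨Kp₀⟩
  have hb t : (𝓕 t).HasBasis (fun _ => True) fun Kp => {q | U.Represents t Kp q} :=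
    Filter.hasBasis_iInf_principal fun K₁ K₂ => ⟨K₁.inf K₂,
      fun _ h => h.mono (PLevel.inf_le_left _ _), fun _ h => h.mono (PLevel.inf_le_right _ _)⟩
  have hne t : (𝓕 t).NeBot := (hb t).neBot_iff.mpr fun {Kp} _ => exists_represents t Kp
  have hmem : ∀ (q : FreeAlgebra R U.HeckeIndex) (f' : τ.finAdelic → Ω_[p]),
      (∀ x, f' x ∈ V) → ∀ x, U.heckeAct R Ω_[p] q f' x ∈ V := by
    intro q
    induction q using FreeAlgebra.induction with
    | grade0 r =>
      intro f' hW x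
      simp only [commutes, Module.algebraMap_end_apply]
      exact hVR r _ (hW x)
    | grade1 i =>
      intro f' hW x
      rw [heckeAct_ι, heckeMap_apply]
      exact sum_mem fun d _ => hW _
    | mul q r hq hr =>
      intro f' hW x
      rw [map_mul, End.mul_apply]
      exact hq _ (hr f' hW) x
    | add q r hq hr =>
      intro f' hW x
      rw [map_add, LinearMap.add_apply]
      exact V.add_mem (hq f' hW x) (hr f' hW x)
  have hex : ∀ t, ∃ z, Filter.Tendsto Λ (𝓕 t) (nhds z) := by
    intro t
    let X : Submodule ℚ_[p] Ω_[p] := V.map (LinearMap.mulRight ℚ_[p] (f x₀)⁻¹)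
    have hc : Cauchy ((𝓕 t).map Λ) := by
      refine Metric.cauchy_iff.mpr ⟨inferInstance, fun ε hε => ?_⟩
      obtain ⟨Kp, δ, hδ, h⟩ := est (ε / 2) (by positivity)
      refine ⟨_, Filter.image_mem_map ((hb t).mem_of_mem (i := Kp) trivial), ?_⟩
      rintro _ ⟨q, hq, rfl⟩ _ ⟨q', hq', rfl⟩
      rw [dist_eq_norm, ← map_sub]
      refine (h _ fun c x => ?_).trans_lt (half_lt_self hε)
      rw [map_sub, LinearMap.sub_apply, ← hq, ← hq', sub_self]
      simpa using hδ.le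
    obtain ⟨z, -, hz⟩ := Submodule.complete_of_finiteDimensional X _ hc (Filter.le_principal_iff.mpr <|
      Filter.mem_map.mpr <| Filter.univ_mem' fun q => ⟨_, hmem q f hV x₀, by rw [hΛf]; simp [hx₀]⟩)
    exact ⟨z, hz⟩
  choose lam hlam using hex
  have hlim : ∀ t, ∀ ε > 0, ∃ Kp, ∀ Kp' ≤ Kp, ∀ q, U.Represents t Kp' q → ‖Λ q - lam t‖ ≤ ε := by
    intro t ε hε
    obtain ⟨Kp, -, h⟩ := ((hb t).tendsto_iff Metric.nhds_basis_closedBall).mp (hlam t) ε hε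
    exact ⟨Kp, fun Kp' hK q hq => by simpa [dist_eq_norm] using h q (hq.mono hK)⟩
  have hop : ∀ {t t' s} (o : FreeAlgebra R U.HeckeIndex → _ → _), (∀ Kp q q', U.Represents t Kp q →
      U.Represents t' Kp q' → U.Represents s Kp (o q q')) →
      Filter.Tendsto (fun q => Λ (o q.1 q.2)) (𝓕 t ×ˢ 𝓕 t') (nhds (lam s)) := fun o h =>
    (hlam _).comp ((((hb _).prod (hb _)).tendsto_iff (hb _)).mpr fun Kp _ =>
      ⟨(Kp, Kp), ⟨trivial, trivial⟩, fun q hq => h Kp _ _ hq.1 hq.2⟩)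
  have hpure : ∀ {t} q, (∀ Kp, U.Represents t Kp q) → lam t = Λ q := fun q h =>
    tendsto_nhds_unique ((hlam _).mono_left (Filter.pure_le_iff.mpr fun s hs =>
      (((hb _).mem_iff.mp hs).choose_spec.2 (h _)))) (tendsto_pure_nhds Λ q)
  have hlamalg : ∀ r, lam (algebraMap _ _ r) = algebraMap R _ r := fun r => by
    rw [hpure _ (Represents.algebraMap r), commutes]
  let lamHom : U.BigHeckeAlg R →ₐ[R] Ω_[p] :=
    { toFun := lam
      map_one' := by rw [← map_one (algebraMap R _), hlamalg, map_one]
      map_mul' := fun t t' => tendsto_nhds_unique (hop _ fun _ _ _ => Represents.mul) (by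
        simpa using ((hlam t).comp Filter.tendsto_fst).mul ((hlam t').comp Filter.tendsto_snd))
      map_zero' := by rw [← map_zero (algebraMap R _), hlamalg, map_zero]
      map_add' := fun t t' => tendsto_nhds_unique (hop _ fun _ _ _ => Represents.add) (by
        simpa using ((hlam t).comp Filter.tendsto_fst).add ((hlam t').comp Filter.tendsto_snd))
      commutes' := hlamalg }
  refine ⟨lamHom, ?_, fun i => ?_, hlim⟩
  · refine continuous_iff_continuousAt.mpr fun t₀ => Metric.tendsto_nhds.mpr fun ε hε => ?_
    obtain ⟨Kp, δ, hδ, h⟩ := est (ε / 2) (by positivity)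
    have := finite_classes (hfin Kp)
    have : Fintype (U.Classes Kp) := ofFinite _
    have hcont : ∀ (e : U.H0 R Kp) (x : τ.finAdelic),
        Continuous fun t : U.BigHeckeAlg R => algebraMap R Ω_[p]
          (formVal ((t.1 Kp).1 e) x) := by
      intro e x
      have h2 : Continuous (fun (t : U.BigHeckeAlg R) (Kp : PLevel τ p)
          (f : U.H0 R Kp) => formVal ((t.1 Kp).1 f)) := continuous_induced_dom
      exact hRc.comp
        ((continuous_apply x).comp ((continuous_apply e).comp ((continuous_apply Kp).comp h2)))
    have hev := Filter.eventually_all.mpr fun c : U.Classes Kp => Filter.eventually_all.mpr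
      fun d : U.Classes Kp => Metric.tendsto_nhds.mp
        ((hcont (indicatorForm R c) d.out).tendsto t₀) δ hδ
    filter_upwards [hev] with t ht
    obtain ⟨K₁, h₁⟩ := hlim t (ε / 2) (by positivity)
    obtain ⟨K₂, h₂⟩ := hlim t₀ (ε / 2) (by positivity)
    have hK := PLevel.inf_le_left (K₁.inf K₂) Kp
    obtain ⟨q, hq⟩ := exists_represents t ((K₁.inf K₂).inf Kp)
    obtain ⟨q₀, hq₀⟩ := exists_represents t₀ ((K₁.inf K₂).inf Kp)
    have h5 : ‖Λ (q - q₀)‖ ≤ ε / 2 := by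
      refine h _ fun c x => ?_
      have h8 := ht c (Quotient.mk _ x)
      rw [dist_eq_norm, forms_apply_out ((t.1 Kp).1 (indicatorForm R c)) x,
        forms_apply_out ((t₀.1 Kp).1 (indicatorForm R c)) x] at h8
      rw [map_sub, LinearMap.sub_apply, ← hq.mono (PLevel.inf_le_right _ _) (indicatorForm R c),
        ← hq₀.mono (PLevel.inf_le_right _ _) (indicatorForm R c), Pi.sub_apply, map_sub]
      exact h8.le
    change dist (lam t) (lam t₀) < ε
    rw [dist_eq_norm, show lam t - lam t₀ = Λ (q - q₀) - (Λ q - lam t) + (Λ q₀ - lam t₀) by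
      rw [map_sub]; ring]
    exact ((norm_add_le_max _ _).trans (max_le
      ((norm_sub_le_max_of_ultrametric _ _).trans (max_le h5
        (h₁ _ (hK.trans (PLevel.inf_le_left _ _)) q hq)))
      (h₂ _ (hK.trans (PLevel.inf_le_right _ _)) q₀ hq₀))).trans_lt (half_lt_self hε)
  · change lam _ = _
    rw [hpure _ (Represents.heckeElt i), hΛ, lift_ι_apply]

end TameLevel

end Eigensystems

/-! ### Polynomial functions on products of matrix algebras -/

section PolyFun

/-- A product of copies of the algebra of `2 × 2` matrices. -/
abbrev Mats (S k : Type*) : Type _ := S → Mat₂(k)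

/-- The coordinate functions. -/
def coordFun {S k : Type*} (a : S × Fin 2 × Fin 2) (y : Mats S k) : k := y a.1 a.2.1 a.2.2

variable (S k : Type*) [Field k]

/-- Affine functions. -/
def affineFun : Submodule k (Mats S k → k) :=
  span k ({1} ∪ Set.range coordFun)

/-- Polynomial functions of degree at most `d`. -/
def polyFun (d : ℕ) : Submodule k (Mats S k → k) := affineFun S k ^ d

/-- Polynomial functions. -/
def polyAlg : Subalgebra k (Mats S k → k) := adjoin k (Set.range coordFun)

variable {S k}

theorem one_mem_affineFun : (1 : Mats S k → k) ∈ affineFun S k :=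
  subset_span (Or.inl rfl)

theorem coordFun_mem_affineFun (a : S × Fin 2 × Fin 2) :
    (coordFun a : Mats S k → k) ∈ affineFun S k :=
  subset_span (Or.inr ⟨a, rfl⟩)

theorem one_le_affineFun : 1 ≤ affineFun S k :=
  Submodule.one_le.mpr one_mem_affineFun

theorem polyFun_mono {d e : ℕ} (h : d ≤ e) : polyFun S k d ≤ polyFun S k e :=
  pow_le_pow_right' one_le_affineFun h

theorem polyFun_le_polyAlg (d : ℕ) : polyFun S k d ≤ toSubmodule (polyAlg S k) := by
  have h : affineFun S k ≤ toSubmodule (polyAlg S k) := by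
    refine span_le.mpr ?_
    rintro f (rfl | ⟨a, rfl⟩)
    · exact one_mem (polyAlg S k)
    · exact Algebra.subset_adjoin ⟨a, rfl⟩
  induction d with
  | zero =>
    rw [polyFun, pow_zero, Submodule.one_le]
    exact one_mem (polyAlg S k)
  | succ d ih =>
    rw [polyFun, pow_succ]
    exact Submodule.mul_le.mpr fun f hf g hg =>
      (polyAlg S k).mul_mem (ih hf) (h hg)

theorem exists_mem_polyFun {f : Mats S k → k} (hf : f ∈ polyAlg S k) : ∃ d, f ∈ polyFun S k d := by
  induction hf using adjoin_induction with
  | mem f h =>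
    obtain ⟨a, rfl⟩ := h
    exact ⟨1, by rw [polyFun, pow_one]; exact coordFun_mem_affineFun a⟩
  | algebraMap c =>
    refine ⟨0, ?_⟩
    rw [polyFun, pow_zero]
    exact mem_one.mpr ⟨c, rfl⟩
  | add f g _ _ hf hg =>
    obtain ⟨d, hd⟩ := hf
    obtain ⟨e, he⟩ := hg
    exact ⟨max d e, add_mem (polyFun_mono (le_max_left _ _) hd)
      (polyFun_mono (le_max_right _ _) he)⟩
  | mul f g _ _ hf hg =>
    obtain ⟨d, hd⟩ := hf
    obtain ⟨e, he⟩ := hg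
    refine ⟨d + e, ?_⟩
    rw [polyFun, pow_add]
    exact mul_mem_mul hd he

theorem finiteDimensional_polyFun [Finite S] (d : ℕ) : FiniteDimensional k (polyFun S k d) := by
  have h : (affineFun S k).FG := Submodule.fg_span
    ((Set.finite_singleton _).union (Set.finite_range _))
  exact iff_fg.mpr (h.pow d)

theorem map_mem_polyFun {S' k' : Type*} [Field k'] (σ : k →+* k')
    (Φ : (Mats S k → k) →+* (Mats S' k' → k')) (hσ : ∀ c f, Φ (c • f) = σ c • Φ f)
    (hΦ : ∀ a, Φ (coordFun a) ∈ affineFun S' k') {d : ℕ} {f : Mats S k → k}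
    (hf : f ∈ polyFun S k d) : Φ f ∈ polyFun S' k' d := by
  have h : ∀ f ∈ affineFun S k, Φ f ∈ affineFun S' k' := by
    intro f hf
    induction hf using span_induction with
    | mem f h =>
      rcases h with rfl | ⟨a, rfl⟩
      · rw [map_one]
        exact one_mem_affineFun
      · exact hΦ a
    | zero => rw [map_zero]; exact zero_mem _
    | add f g _ _ hf hg => rw [map_add]; exact add_mem hf hg
    | smul c f _ hf => rw [hσ]; exact smul_mem _ _ hf
  induction d generalizing f with
  | zero =>
    rw [polyFun, pow_zero, mem_one] at hf
    obtain ⟨c, rfl⟩ := hf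
    rw [Algebra.algebraMap_eq_smul_one, hσ, map_one, polyFun, pow_zero]
    exact smul_mem _ _ (mem_one.mpr ⟨1, map_one _⟩)
  | succ d ih =>
    rw [polyFun, pow_succ] at hf
    rw [polyFun, pow_succ]
    induction hf using Submodule.mul_induction_on' with
    | mem_mul_mem f hf g hg => rw [map_mul]; exact mul_mem_mul (ih hf) (h g hg)
    | add f _ g _ hf hg => rw [map_add]; exact add_mem hf hg

/-- Precomposition as a ring homomorphism. -/
def precomp {X X' : Type*} (k : Type*) [Field k] (T : X' → X) : (X → k) →+* (X' → k) where
  toFun f x := f (T x)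
  map_one' := rfl
  map_mul' _ _ := rfl
  map_zero' := rfl
  map_add' _ _ := rfl

theorem comp_mem_polyFun {S' : Type*} {T : Mats S' k → Mats S k}
    (hT : ∀ a, (fun y => coordFun a (T y)) ∈ affineFun S' k) {d : ℕ} {f : Mats S k → k}
    (hf : f ∈ polyFun S k d) : (fun y => f (T y)) ∈ polyFun S' k d :=
  map_mem_polyFun (RingHom.id k) (precomp k T) (fun _ _ => rfl) hT hf

theorem left_mul_mem_polyFun (y₀ : Mats S k) {d : ℕ} {f : Mats S k → k}
    (hf : f ∈ polyFun S k d) : (fun y => f (y₀ * y)) ∈ polyFun S k d := by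
  refine comp_mem_polyFun (T := fun y => y₀ * y) (fun a => ?_) hf
  have : (fun y : Mats S k => coordFun a (y₀ * y)) =
      ∑ l, y₀ a.1 a.2.1 l • (coordFun (a.1, l, a.2.2) : Mats S k → k) := by
    funext y
    simp [coordFun, Matrix.mul_apply]
  rw [this]
  exact sum_mem fun l _ => smul_mem _ _ (coordFun_mem_affineFun _)

theorem right_mul_mem_polyFun (y₀ : Mats S k) {d : ℕ} {f : Mats S k → k}
    (hf : f ∈ polyFun S k d) : (fun y => f (y * y₀)) ∈ polyFun S k d := by
  refine comp_mem_polyFun (T := fun y => y * y₀) (fun a => ?_) hf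
  have : (fun y : Mats S k => coordFun a (y * y₀)) =
      ∑ l, y₀ a.1 l a.2.2 • (coordFun (a.1, a.2.1, l) : Mats S k → k) := by
    funext y
    simp [coordFun, Matrix.mul_apply, mul_comm]
  rw [this]
  exact sum_mem fun l _ => smul_mem _ _ (coordFun_mem_affineFun _)

/-- Entrywise application of a ring homomorphism. -/
def matsMap {k' : Type*} [Field k'] (σ : k →+* k') : Mats S k →+* Mats S k' where
  toFun y s := (y s).map σ
  map_one' := by funext s; exact Matrix.map_one σ (map_zero σ) (map_one σ)
  map_mul' x y := by funext s; exact Matrix.map_mul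
  map_zero' := by funext s; exact Matrix.map_zero σ (map_zero σ)
  map_add' x y := by funext s; exact Matrix.map_add σ (map_add σ) _ _

theorem matsMap_symm_apply {k' : Type*} [Field k'] (σ : k ≃+* k') (y : Mats S k') :
    matsMap (σ : k →+* k') (matsMap (σ.symm : k' →+* k) y) = y := by
  funext s
  ext i j
  simp [matsMap]

theorem matsMap_apply_symm {k' : Type*} [Field k'] (σ : k ≃+* k') (y : Mats S k) :
    matsMap (σ.symm : k' →+* k) (matsMap (σ : k →+* k') y) = y := by
  funext s
  ext i j
  simp [matsMap]

theorem transport_mem_polyFun {k' : Type*} [Field k'] (σ : k ≃+* k') {d : ℕ} {f : Mats S k → k}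
    (hf : f ∈ polyFun S k d) :
    (fun y => σ (f (matsMap (σ.symm : k' →+* k) y))) ∈ polyFun S k' d := by
  let Φ : (Mats S k → k) →+* (Mats S k' → k') :=
    { toFun := fun f y => σ (f (matsMap (σ.symm : k' →+* k) y))
      map_one' := funext fun _ => map_one σ
      map_mul' := fun _ _ => funext fun _ => map_mul σ _ _
      map_zero' := funext fun _ => map_zero σ
      map_add' := fun _ _ => funext fun _ => map_add σ _ _ }
  refine map_mem_polyFun (σ : k →+* k') Φ (fun c f => funext fun y => map_mul σ _ _)
    (fun a => ?_) hf
  convert coordFun_mem_affineFun (k := k') a using 1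
  funext y
  simp [Φ, coordFun, matsMap]

theorem continuous_of_mem_polyAlg [TopologicalSpace k] [IsTopologicalRing k] {f : Mats S k → k}
    (hf : f ∈ polyAlg S k) : Continuous f := by
  induction hf using adjoin_induction with
  | mem f h =>
    obtain ⟨a, rfl⟩ := h
    exact (continuous_apply_apply a.2.1 a.2.2).comp (continuous_apply a.1)
  | algebraMap c => exact continuous_const
  | add f g _ _ hf hg => exact hf.add hg
  | mul f g _ _ hf hg => exact hf.mul hg

theorem exists_finite_of_mem_polyAlg {k₀ : Type*} [Field k₀] [Algebra k₀ k] {f : Mats S k → k}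
    (hf : f ∈ polyAlg S k) : ∃ V : Submodule k₀ k, V.FG ∧
      ∀ y : Mats S k₀, f (matsMap (algebraMap k₀ k) y) ∈ V := by
  induction hf using adjoin_induction with
  | mem f h =>
    obtain ⟨a, rfl⟩ := h
    refine ⟨1, ⟨{1}, by simp [Submodule.one_eq_span]⟩, fun y => ?_⟩
    exact mem_one.mpr ⟨_, rfl⟩
  | algebraMap c =>
    exact ⟨span k₀ {c}, ⟨{c}, by simp⟩, fun y => Submodule.mem_span_singleton_self c⟩
  | add f g _ _ hf hg =>
    obtain ⟨V, hV, h⟩ := hf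
    obtain ⟨V', hV', h'⟩ := hg
    exact ⟨V ⊔ V', hV.sup hV', fun y => add_mem (Submodule.mem_sup_left (h y))
      (Submodule.mem_sup_right (h' y))⟩
  | mul f g _ _ hf hg =>
    obtain ⟨V, hV, h⟩ := hf
    obtain ⟨V', hV', h'⟩ := hg
    exact ⟨V * V', hV.mul hV', fun y => mul_mem_mul (h y) (h' y)⟩

theorem exists_lipschitz_of_mem_polyAlg {k : Type*} [NormedField k] [IsUltrametricDist k]
    {f : Mats S k → k} (hf : f ∈ polyAlg S k) (B : ℝ) : ∃ C, 0 ≤ C ∧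
      (∀ y : Mats S k, (∀ s i j, ‖y s i j‖ ≤ B) → ‖f y‖ ≤ C) ∧
      ∀ y y' : Mats S k, ∀ ε, 0 ≤ ε → (∀ s i j, ‖y s i j‖ ≤ B) → (∀ s i j, ‖y' s i j‖ ≤ B) →
        (∀ s i j, ‖y s i j - y' s i j‖ ≤ ε) → ‖f y - f y'‖ ≤ C * ε := by
  induction hf using adjoin_induction with
  | mem f h =>
    obtain ⟨a, rfl⟩ := h
    refine ⟨max 1 B, by positivity, fun y hy => (hy _ _ _).trans (le_max_right _ _),
      fun y y' ε hε hy hy' h => (h _ _ _).trans ?_⟩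
    exact le_mul_of_one_le_left hε (le_max_left _ _)
  | algebraMap c =>
    refine ⟨‖c‖, norm_nonneg c, fun y _ => le_rfl, fun y y' ε hε _ _ _ => ?_⟩
    change ‖c - c‖ ≤ _
    rw [sub_self, norm_zero]
    positivity
  | add f g _ _ hf hg =>
    obtain ⟨C, hC, h1, h2⟩ := hf
    obtain ⟨C', hC', h1', h2'⟩ := hg
    refine ⟨max C C', le_max_of_le_left hC, fun y hy => ?_, fun y y' ε hε hy hy' h => ?_⟩
    · exact (norm_add_le_max _ _).trans (max_le_max (h1 y hy) (h1' y hy))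
    · change ‖f y + g y - (f y' + g y')‖ ≤ _
      rw [add_sub_add_comm]
      refine (norm_add_le_max _ _).trans (max_le ?_ ?_)
      · exact (h2 y y' ε hε hy hy' h).trans (by gcongr; exact le_max_left _ _)
      · exact (h2' y y' ε hε hy hy' h).trans (by gcongr; exact le_max_right _ _)
  | mul f g _ _ hf hg =>
    obtain ⟨C, hC, h1, h2⟩ := hf
    obtain ⟨C', hC', h1', h2'⟩ := hg
    refine ⟨C * C', by positivity, fun y hy => ?_, fun y y' ε hε hy hy' h => ?_⟩
    · change ‖f y * g y‖ ≤ _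
      rw [norm_mul]
      exact mul_le_mul (h1 y hy) (h1' y hy) (norm_nonneg _) hC
    · change ‖f y * g y - f y' * g y'‖ ≤ _
      have : f y * g y - f y' * g y' = f y * (g y - g y') + (f y - f y') * g y' := by ring
      rw [this]
      refine (norm_add_le_max _ _).trans (max_le ?_ ?_)
      · rw [norm_mul, mul_assoc]
        exact mul_le_mul (h1 y hy) (h2' y y' ε hε hy hy' h) (norm_nonneg _) hC
      · rw [norm_mul]
        calc _ ≤ (C * ε) * C' := mul_le_mul (h2 y y' ε hε hy hy' h) (h1' y' hy') (norm_nonneg _)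
              (by positivity)
          _ = _ := by ring

end PolyFun

section Mahler

variable {p : ℕ} [Fact p.Prime]

theorem exists_polynomial_near (f : C(ℤ_[p], ℤ_[p])) {ε : ℝ} (hε : 0 < ε) :
    ∃ P : Polynomial ℚ_[p], ∀ x : ℤ_[p], ‖P.eval (x : ℚ_[p]) - (f x : ℚ_[p])‖ ≤ ε := by
  have h := (Metric.tendsto_nhds.mp (PadicInt.hasSum_mahler f) ε hε).exists
  obtain ⟨s, hs⟩ := h
  let a : ℕ → ℤ_[p] := fun n => (fwdDiff 1)^[n] f 0
  refine ⟨∑ n ∈ s, Polynomial.C ((a n : ℚ_[p]) / (n.factorial : ℚ_[p])) * descPochhammer ℚ_[p] n,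
    fun x => ?_⟩
  have h1 : ∀ n, (descPochhammer ℚ_[p] n).eval (x : ℚ_[p]) =
      (n.factorial : ℚ_[p]) * (Ring.choose x n : ℤ_[p]) := by
    intro n
    have h2 := Ring.descPochhammer_eq_factorial_smul_choose x n
    rw [← Polynomial.aeval_eq_smeval, ← Polynomial.eval_map_algebraMap,
      descPochhammer_map] at h2
    have h3 := congrArg (ringHom (p := p)) h2
    rw [← Polynomial.eval₂_at_apply, ← Polynomial.eval_map, descPochhammer_map] at h3
    rwa [nsmul_eq_mul, map_mul, map_natCast] at h3
  have h4 : (∑ n ∈ s, Polynomial.C ((a n : ℚ_[p]) / (n.factorial : ℚ_[p])) *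
      descPochhammer ℚ_[p] n).eval (x : ℚ_[p]) =
      (((∑ n ∈ s, PadicInt.mahlerTerm (a n) n : C(ℤ_[p], ℤ_[p])) x : ℤ_[p]) : ℚ_[p]) := by
    rw [Polynomial.eval_finsetSum, ContinuousMap.sum_apply]
    change _ = ringHom (∑ n ∈ s, _)
    rw [map_sum]
    refine sum_congr rfl fun n _ => ?_
    rw [Polynomial.eval_mul, Polynomial.eval_C, h1, PadicInt.mahlerTerm_apply, mahler_apply, smul_eq_mul,
      map_mul]
    have : (n.factorial : ℚ_[p]) ≠ 0 := Nat.cast_ne_zero.mpr n.factorial_ne_zero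
    change _ = ((Ring.choose x n : ℤ_[p]) : ℚ_[p]) * (a n : ℚ_[p])
    field_simp
  rw [h4, ← PadicInt.coe_sub, ← PadicInt.norm_def]
  have h5 := (ContinuousMap.norm_coe_le_norm
    ((∑ n ∈ s, PadicInt.mahlerTerm (a n) n : C(ℤ_[p], ℤ_[p])) - f) x)
  rw [dist_eq_norm] at hs
  exact h5.trans hs.le

variable {S X : Type*} (y : X → Mats S ℚ_[p])

/-- Functions on a set which are uniform limits of polynomial functions of matrices. -/
def IsApproximable (u : X → Ω_[p]) : Prop :=
  (∃ C, ∀ x, ‖u x‖ ≤ C) ∧ ∀ ε > 0, ∃ P ∈ polyAlg S Ω_[p],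
    ∀ x, ‖P (matsMap (algebraMap ℚ_[p] Ω_[p]) (y x)) - u x‖ ≤ ε

namespace IsApproximable

variable {y} {u u' : X → Ω_[p]}

theorem const (c : Ω_[p]) : IsApproximable y fun _ => c :=
  ⟨⟨‖c‖, fun _ => le_rfl⟩, fun ε hε => ⟨algebraMap _ _ c, Subalgebra.algebraMap_mem _ c, fun x => by
    change ‖c - c‖ ≤ ε
    rw [sub_self, norm_zero]
    exact hε.le⟩⟩

theorem add (h : IsApproximable y u) (h' : IsApproximable y u') :
    IsApproximable y fun x => u x + u' x := by
  obtain ⟨⟨C, hC⟩, ha⟩ := h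
  obtain ⟨⟨C', hC'⟩, ha'⟩ := h'
  refine ⟨⟨max C C', fun x => (norm_add_le_max _ _).trans
    (max_le_max (hC x) (hC' x))⟩, fun ε hε => ?_⟩
  obtain ⟨P, hP, h⟩ := ha ε hε
  obtain ⟨P', hP', h'⟩ := ha' ε hε
  refine ⟨P + P', add_mem hP hP', fun x => ?_⟩
  rw [Pi.add_apply, add_sub_add_comm]
  exact (norm_add_le_max _ _).trans (max_le (h x) (h' x))

theorem mul (h : IsApproximable y u) (h' : IsApproximable y u') :
    IsApproximable y fun x => u x * u' x := by
  obtain ⟨⟨C, hC⟩, ha⟩ := h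
  obtain ⟨⟨C', hC'⟩, ha'⟩ := h'
  refine ⟨⟨|C| * |C'|, fun x => ?_⟩, fun ε hε => ?_⟩
  · rw [norm_mul]
    exact mul_le_mul ((hC x).trans (le_abs_self _)) ((hC' x).trans (le_abs_self _))
      (norm_nonneg _) (abs_nonneg _)
  set B := 1 + |C| + |C'| with hB
  have hB0 : 0 < B := by positivity
  have hδ : 0 < min 1 (ε / B) := by positivity
  obtain ⟨P, hP, h⟩ := ha _ hδ
  obtain ⟨P', hP', h'⟩ := ha' _ hδ
  refine ⟨P * P', mul_mem hP hP', fun x => ?_⟩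
  set z := matsMap (algebraMap ℚ_[p] Ω_[p]) (y x)
  have h1 : (P * P') z - u x * u' x = P z * (P' z - u' x) + (P z - u x) * u' x := by
    rw [Pi.mul_apply]; ring
  have h2 : ‖P z‖ ≤ B := by
    rw [← sub_add_cancel (P z) (u x)]
    refine (norm_add_le _ _).trans ?_
    have := (h x).trans (min_le_left _ _)
    have := (hC x).trans (le_abs_self _)
    have := abs_nonneg C'
    linarith
  have h3 : ‖u' x‖ ≤ B := by
    have := (hC' x).trans (le_abs_self _)
    have := abs_nonneg C
    linarith
  rw [h1]
  refine (norm_add_le_max _ _).trans (max_le ?_ ?_)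
  · rw [norm_mul]
    calc _ ≤ B * (ε / B) := mul_le_mul h2 ((h' x).trans (min_le_right _ _)) (norm_nonneg _) hB0.le
      _ = ε := mul_div_cancel₀ _ hB0.ne'
  · rw [norm_mul]
    calc _ ≤ (ε / B) * B := mul_le_mul ((h x).trans (min_le_right _ _)) h3 (norm_nonneg _)
          (by positivity)
      _ = ε := div_mul_cancel₀ _ hB0.ne'

theorem sum {κ : Type*} (s : Finset κ) {u : κ → X → Ω_[p]}
    (h : ∀ i, IsApproximable y (u i)) : IsApproximable y fun x => ∑ i ∈ s, u i x := by
  classical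
  induction s using Finset.induction_on with
  | empty => simpa using const (y := y) 0
  | insert i s hi ih => simpa only [Finset.sum_insert hi] using (h i).add ih

theorem prod {κ : Type*} (s : Finset κ) {u : κ → X → Ω_[p]}
    (h : ∀ i, IsApproximable y (u i)) : IsApproximable y fun x => ∏ i ∈ s, u i x := by
  classical
  induction s using Finset.induction_on with
  | empty => simpa using const (y := y) 1
  | insert i s hi ih => simpa only [Finset.prod_insert hi] using (h i).mul ih

theorem of_continuous (hy : ∀ x s i j, ‖y x s i j‖ ≤ 1) (f : C(ℤ_[p], ℤ_[p]))
    (a : S × Fin 2 × Fin 2) : IsApproximable y fun x =>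
      algebraMap ℚ_[p] Ω_[p] (f ⟨y x a.1 a.2.1 a.2.2, hy x _ _ _⟩ : ℤ_[p]) := by
  refine ⟨⟨1, fun x => ?_⟩, fun ε hε => ?_⟩
  · rw [norm_algebraMap', ← PadicInt.norm_def]
    exact PadicInt.norm_le_one _
  · obtain ⟨P, hP⟩ := exists_polynomial_near f hε
    refine ⟨Polynomial.aeval (coordFun a) (P.map (algebraMap ℚ_[p] Ω_[p])), ?_,
      fun x => ?_⟩
    · exact Algebra.adjoin_mono (Set.singleton_subset_iff.mpr (Set.mem_range_self a))
        (Polynomial.aeval_mem_adjoin_singleton _ _)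
    · have h1 : ∀ z : Mats S Ω_[p], Polynomial.aeval (coordFun a)
          (P.map (algebraMap ℚ_[p] Ω_[p])) z =
          (P.map (algebraMap ℚ_[p] Ω_[p])).eval (coordFun a z) := fun z =>
        (Polynomial.aeval_algHom_apply (Pi.evalAlgHom Ω_[p] (fun _ => Ω_[p]) z)
          (coordFun a) _).symm.trans (by rw [Polynomial.coe_aeval_eq_eval]; rfl)
      rw [h1]
      change ‖(P.map (algebraMap ℚ_[p] Ω_[p])).eval
        (algebraMap ℚ_[p] Ω_[p] (y x a.1 a.2.1 a.2.2)) - _‖ ≤ ε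
      rw [Polynomial.eval_map, Polynomial.eval₂_at_apply, ← map_sub, norm_algebraMap']
      exact hP ⟨y x a.1 a.2.1 a.2.2, hy x _ _ _⟩

theorem of_locallyConstant [Fintype S] (hy : ∀ x s i j, ‖y x s i j‖ ≤ 1) (N : ℕ)
    (hu : ∀ x x', (∀ s i j, ‖y x s i j - y x' s i j‖ ≤ (p : ℝ) ^ (-N : ℤ)) → u x = u x') :
    IsApproximable y u := by
  classical
  have : NeZero (p ^ N) := ⟨pow_ne_zero _ (Fact.out : p.Prime).ne_zero⟩
  have hred : ∀ x x' : ℤ_[p], toZModPow N x = toZModPow N x' ↔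
      ‖x - x'‖ ≤ (p : ℝ) ^ (-N : ℤ) := fun x x' => by
    rw [← sub_eq_zero, ← map_sub, ← RingHom.mem_ker, PadicInt.ker_toZModPow,
      PadicInt.norm_le_pow_iff_mem_span_pow]
  let f : ZMod (p ^ N) → C(ℤ_[p], ℤ_[p]) := fun c =>
    ⟨fun x => if toZModPow N x = c then 1 else 0, by
      refine IsLocallyConstant.continuous ((IsLocallyConstant.iff_eventually_eq _).mpr fun x => ?_)
      have hp : (0 : ℝ) < (p : ℝ) ^ (-N : ℤ) :=
        zpow_pos (by exact_mod_cast (Fact.out : p.Prime).pos) _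
      filter_upwards [Metric.closedBall_mem_nhds x hp] with x' hx'
      rw [Metric.mem_closedBall, dist_eq_norm, ← hred] at hx'
      rw [hx']⟩
  let w : X → S × Fin 2 × Fin 2 → ℤ_[p] := fun x a => ⟨y x a.1 a.2.1 a.2.2, hy x _ _ _⟩
  let r : X → S × Fin 2 × Fin 2 → ZMod (p ^ N) := fun x a => toZModPow N (w x a)
  have hr : ∀ x x', r x = r x' → u x = u x' := fun x x' h => hu x x' fun s i j =>
    (hred (w x (s, i, j)) (w x' (s, i, j))).mp (congrFun h (s, i, j))
  let v : (S × Fin 2 × Fin 2 → ZMod (p ^ N)) → Ω_[p] := fun c =>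
    if h : ∃ x, r x = c then u h.choose else 0
  have hv : ∀ x, v (r x) = u x := fun x => by
    have h : ∃ x', r x' = r x := ⟨x, rfl⟩
    change (if h : ∃ x', r x' = r x then u h.choose else 0) = u x
    rw [dif_pos h]
    exact hr _ _ h.choose_spec
  have h1 : IsApproximable y fun x => ∑ c, v c * ∏ a,
      algebraMap ℚ_[p] Ω_[p] (f (c a) (w x a) : ℤ_[p]) :=
    sum _ fun c => (const (v c)).mul (prod _ fun a => of_continuous hy (f (c a)) a)
  convert h1 using 2 with x
  rw [sum_eq_single (r x)]
  · rw [hv, Finset.prod_eq_one, mul_one]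
    intro a _
    have : f (r x a) (w x a) = 1 := if_pos rfl
    rw [this, PadicInt.coe_one, map_one]
  · intro c _ hc
    obtain ⟨a, ha⟩ := Function.ne_iff.mp hc
    rw [Finset.prod_eq_zero (mem_univ a), mul_zero]
    have : f (c a) (w x a) = 0 := if_neg fun h => ha h.symm
    rw [this, PadicInt.coe_zero, map_zero]
  · exact fun h => absurd (mem_univ _) h

end IsApproximable

end Mahler

section AlgebraicForms

variable [Module.Finite F D]

/-- The component at `p` of an element of `G(𝔸_f)`. -/
def Involution.atP (τ : Involution F 𝒦 D) (p : ℕ) : τ.finAdelic →* τ.padicPoints p where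
  toFun x v := x v.1
  map_one' := rfl
  map_mul' _ _ := rfl

theorem inv_prime_pos (p : ℕ) [hp : Fact p.Prime] : 0 < (p : ℝ)⁻¹ :=
  inv_pos.mpr (Nat.cast_pos.mpr hp.out.pos)

theorem inv_prime_lt_one (p : ℕ) [hp : Fact p.Prime] : (p : ℝ)⁻¹ < 1 :=
  inv_lt_one_of_one_lt₀ (Nat.one_lt_cast.mpr hp.out.one_lt)

theorem finite_aboveP (F : Type*) [Field F] [NumberField F] (p : ℕ) [Fact p.Prime] :
    {v : Pl(F) | AboveP p v}.Finite := by
  have hp : (Ideal.span {(p : 𝓞 F)}) ≠ 0 := by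
    rw [Ne, Ideal.zero_eq_bot, Ideal.span_singleton_eq_bot]
    exact_mod_cast (Fact.out : p.Prime).ne_zero
  refine (Ideal.finite_factors hp).subset fun v hv => ?_
  rw [Set.mem_ofPred_eq, Ideal.dvd_span_singleton]
  exact hv

instance {F : Type*} [Field F] [NumberField F] {p : ℕ} [Fact p.Prime] :
    Finite PlAbove(F,p) :=
  (finite_aboveP F p).to_subtype

open Classical in
/-- The embedding of `G(ℚ_p)` in `G(𝔸_f)`. -/
noncomputable def Involution.embP (τ : Involution F 𝒦 D) (p : ℕ) [Fact p.Prime]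
    (z : τ.padicPoints p) : τ.finAdelic :=
  ⟨fun v => if h : AboveP p v then z ⟨v, h⟩ else 1, by
    refine (finite_aboveP F p).subset fun v hv => ?_
    by_contra h
    refine hv ?_
    change ((if h : AboveP p v then z ⟨v, h⟩ else 1 : τ.localPoints v)) ∈ τ.integralPoints v
    have h' : ¬ AboveP p v := h
    rw [dif_neg h']
    exact one_mem _⟩

variable {τ : Involution F 𝒦 D} {p : ℕ} [Fact p.Prime]

theorem embP_above (z : τ.padicPoints p) (v : PlAbove(F,p)) :
    τ.embP p z v.1 = z v :=
  dif_pos v.2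

theorem embP_not_above (z : τ.padicPoints p) {v : Pl(F)} (hv : ¬ AboveP p v) :
    τ.embP p z v = 1 :=
  dif_neg hv

theorem atP_embP (z : τ.padicPoints p) : τ.atP p (τ.embP p z) = z :=
  funext fun v => embP_above z v

theorem atP_localEmb {v : Pl(F)} (hv : ¬ AboveP p v) (g : τ.localPoints v) :
    τ.atP p (τ.localEmb v g) = 1 :=
  funext fun w => localEmb_ne (fun h : w.1 = v => hv (by rw [← h]; exact w.2)) g

theorem embP_mul (z z' : τ.padicPoints p) : τ.embP p (z * z') = τ.embP p z * τ.embP p z' := by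
  refine RestrictedProduct.ext _ _ fun v => ?_
  rw [RestrictedProduct.mul_apply]
  by_cases h : AboveP p v
  · rw [embP_above _ ⟨v, h⟩, embP_above _ ⟨v, h⟩, embP_above _ ⟨v, h⟩, Pi.mul_apply]
  · rw [embP_not_above _ h, embP_not_above _ h, embP_not_above _ h, one_mul]

variable {U : TameLevel τ p}

theorem embP_mem_level {Kp : PLevel τ p} {z : τ.padicPoints p} (hz : z ∈ Kp.1) :
    τ.embP p z ∈ U.level Kp :=
  ⟨by rwa [show (fun v : {v // AboveP p v} => τ.embP p z v.1) = z from atP_embP z],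
    fun v => by rw [embP_not_above _ v.2]; exact one_mem _⟩

theorem embP_inv_mul_mem_tame {Kp : PLevel τ p} {k : τ.finAdelic} (hk : k ∈ U.level Kp) :
    (τ.embP p (τ.atP p k))⁻¹ * k ∈ U.tame := by
  refine ⟨fun v => ?_, fun v => ?_⟩
  · rw [RestrictedProduct.mul_apply, RestrictedProduct.inv_apply, embP_above]
    exact inv_mul_cancel _
  · rw [RestrictedProduct.mul_apply, RestrictedProduct.inv_apply, embP_not_above _ v.2, inv_one,
      one_mul]
    exact hk.2 v

variable (τ p) in
/-- Compatible maps of the `p`-adic and of the archimedean points of `G` to products of matrix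
algebras. -/
structure AlgebraicModel (ι : ℂ ≃+* Ω_[p]) where
  S : Type*
  fintype : Fintype S
  loc : τ.padicPoints p →* Mats S ℚ_[p]
  inf : τ.infinite →* Mats S ℂ
  compat : ∀ γ, matsMap (ι : ℂ →+* Ω_[p]) (inf (τ.diagInf γ)) =
    matsMap (algebraMap ℚ_[p] Ω_[p]) (loc (τ.atP p (τ.diagFin γ)))
  continuous_inf : Continuous inf
  dense : ∀ d, ∀ P ∈ polyFun S ℂ d, (∀ i, P (inf i) = 0) → P = 0
  level : PLevel τ p
  K : ∀ v : PlAbove(F,p), Subgroup (τ.localPoints v.1)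
  hyperspecial : ∀ v, IsHyperspecial τ v.1 (K v)
  mem_level : ∀ z, z ∈ level.1 ↔ ∀ v, z v ∈ K v
  norm_le : ∀ z ∈ level.1, ∀ s i j, ‖loc z s i j‖ ≤ 1
  small : ∀ ε > 0, ∃ Kp ≤ level, ∀ k ∈ Kp.1, ∀ s i j,
    ‖loc k s i j - (1 : Mats S ℚ_[p]) s i j‖ ≤ ε
  separating : ∀ Kp : PLevel τ p, ∃ ε > 0, ∀ z ∈ level.1,
    (∀ s i j, ‖loc z s i j - (1 : Mats S ℚ_[p]) s i j‖ ≤ ε) → z ∈ Kp.1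

namespace AlgebraicModel

variable {ι : ℂ ≃+* Ω_[p]} (M : AlgebraicModel τ p ι)

instance : Fintype M.S := M.fintype

/-- The matrices attached to an element of `G(𝔸_f)`. -/
noncomputable def locP : τ.finAdelic →* Mats M.S Ω_[p] :=
  (matsMap (algebraMap ℚ_[p] Ω_[p])).toMonoidHom.comp (M.loc.comp (τ.atP p))

theorem locP_apply (x : τ.finAdelic) :
    M.locP x = matsMap (algebraMap ℚ_[p] Ω_[p]) (M.loc (τ.atP p x)) := rfl

theorem norm_locP_le {Kp : PLevel τ p} (hK : Kp ≤ M.level) {x : τ.finAdelic}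
    (hx : x ∈ U.level Kp) (s i j) : ‖M.locP x s i j‖ ≤ 1 := by
  have := M.norm_le (τ.atP p x) (hK hx.1) s i j
  rwa [← PadicAlgCl.norm_extends] at this

theorem norm_loc_sub_le {z z' : τ.padicPoints p} (hz : z ∈ M.level.1) {ε : ℝ} (hε : 0 ≤ ε)
    (h : ∀ s i j, ‖M.loc z s i j - M.loc z' s i j‖ ≤ ε) (s i j) :
    ‖M.loc (z⁻¹ * z') s i j - (1 : Mats M.S ℚ_[p]) s i j‖ ≤ ε := by
  have h1 : M.loc (z⁻¹ * z') s - (1 : Mats M.S ℚ_[p]) s = M.loc z⁻¹ s * (M.loc z' s - M.loc z s) := by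
    have h2 : M.loc z⁻¹ s * M.loc z s = 1 := by
      rw [← Pi.mul_apply, ← map_mul, inv_mul_cancel, map_one, Pi.one_apply]
    rw [map_mul, Pi.mul_apply, mul_sub, h2, Pi.one_apply]
  rw [← Matrix.sub_apply, h1, Matrix.mul_apply]
  refine norm_sum_le_of_forall_le_of_nonneg hε fun l _ => ?_
  rw [norm_mul, Matrix.sub_apply, norm_sub_rev]
  calc _ ≤ 1 * ε := mul_le_mul (M.norm_le _ (inv_mem hz) s i l) (h s l j) (norm_nonneg _) one_pos.le
    _ = ε := one_mul ε

theorem approx (Kp : PLevel τ p) (u : τ.padicPoints p → Ω_[p])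
    (hu : ∀ z, ∀ k ∈ Kp.1, u (z * k) = u z) {ε : ℝ} (hε : 0 < ε) :
    ∃ P ∈ polyAlg M.S Ω_[p], ∀ z ∈ M.level.1,
      ‖P (matsMap (algebraMap ℚ_[p] Ω_[p]) (M.loc z)) - u z‖ ≤ ε := by
  obtain ⟨δ, hδ, h⟩ := M.separating Kp
  have hp1 := inv_prime_lt_one p
  obtain ⟨N, hN⟩ := exists_pow_lt_of_lt_one hδ hp1
  have h1 := IsApproximable.of_locallyConstant (y := fun z : M.level.1 => M.loc z)
    (u := fun z => u z) (fun z => M.norm_le z.1 z.2) N fun z z' hzz' => by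
      have h2 : (z : τ.padicPoints p)⁻¹ * z' ∈ Kp.1 := by
        refine h _ (mul_mem (inv_mem z.2) z'.2) fun s i j => ?_
        refine M.norm_loc_sub_le z.2 hδ.le (fun s i j => (hzz' s i j).trans ?_) s i j
        rw [zpow_neg, zpow_natCast, ← inv_pow]
        exact hN.le
      rw [← hu z _ h2, mul_inv_cancel_left]
  obtain ⟨P, hP, hPu⟩ := h1.2 ε hε
  exact ⟨P, hP, fun z hz => hPu ⟨z, hz⟩⟩

theorem norm_pow_prime_sub_one_le {y : Mat₂(ℚ_[p])} {δ : ℝ}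
    (hδ : δ ≤ (p : ℝ)⁻¹) (h : ∀ i j, ‖(y - 1) i j‖ ≤ δ) (i j) : ‖(y ^ p - 1) i j‖ ≤ (p : ℝ)⁻¹ * δ := by
  have hp0 := inv_prime_pos p
  have hp1 := (inv_prime_lt_one p).le
  have hδ0 : 0 ≤ δ := (norm_nonneg _).trans (h 0 0)
  set N := y - 1 with hN
  have hpow : ∀ n i j, ‖(N ^ (n + 1)) i j‖ ≤ (p : ℝ)⁻¹ ^ n * δ := by
    intro n
    induction n with
    | zero => simpa using h
    | succ n ih =>
      intro i j
      rw [pow_succ', Matrix.mul_apply]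
      refine norm_sum_le_of_forall_le_of_nonneg (by positivity) fun l _ => ?_
      rw [norm_mul, pow_succ' (p : ℝ)⁻¹, mul_assoc]
      exact mul_le_mul ((h i l).trans hδ) (ih l j) (norm_nonneg _) hp0.le
  have h1 : y ^ p - 1 = ∑ n ∈ range p, (p.choose (n + 1)) • N ^ (n + 1) := by
    have : y = N + 1 := by rw [hN, sub_add_cancel]
    rw [this, (Commute.one_right N).add_pow, Finset.sum_range_succ']
    simp only [one_pow, mul_one, pow_zero, Nat.choose_zero_right, Nat.cast_one,
      add_sub_cancel_right]
    exact sum_congr rfl fun n _ => by rw [nsmul_eq_mul, Nat.cast_comm]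
  rw [h1, Matrix.sum_apply]
  refine norm_sum_le_of_forall_le_of_nonneg (by positivity) fun n hn => ?_
  rw [Matrix.smul_apply, nsmul_eq_mul, norm_mul]
  rcases Nat.eq_zero_or_pos n with rfl | hn0
  · rw [zero_add, Nat.choose_one_right, norm_p, pow_one]
    exact mul_le_mul_of_nonneg_left (h i j) hp0.le
  · obtain ⟨m, rfl⟩ := Nat.exists_eq_succ_of_ne_zero hn0.ne'
    calc _ ≤ 1 * ((p : ℝ)⁻¹ ^ (m + 1) * δ) :=
          mul_le_mul (IsUltrametricDist.norm_natCast_le_one ℚ_[p] _) (hpow (m + 1) i j)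
            (norm_nonneg _) one_pos.le
      _ ≤ (p : ℝ)⁻¹ * δ := by
          rw [one_mul, pow_succ', mul_assoc]
          exact mul_le_mul_of_nonneg_left (mul_le_of_le_one_left hδ0 (pow_le_one₀ hp0.le hp1)) hp0.le

theorem exists_proP (M : AlgebraicModel τ p ι) : ∃ K₀ : PLevel τ p, ∀ Kp : PLevel τ p, ∀ k ∈ K₀.1,
    ∃ n : ℕ, ∀ n' ≥ n, k ^ p ^ n' ∈ Kp.1 := by
  have hp0 := inv_prime_pos p
  have hp1 := inv_prime_lt_one p
  obtain ⟨K₀, hK₀, hs⟩ := M.small _ hp0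
  refine ⟨K₀, fun Kp k hk => ?_⟩
  obtain ⟨δ, hδ, h⟩ := M.separating Kp
  obtain ⟨n, hn⟩ := exists_pow_lt_of_lt_one hδ hp1
  refine ⟨n, fun n' hn' => h _ (pow_mem (hK₀ hk) _) fun s i j => ?_⟩
  have h1 : ∀ m : ℕ, ∀ i j, ‖(M.loc k s ^ p ^ m - 1) i j‖ ≤ (p : ℝ)⁻¹ ^ m * (p : ℝ)⁻¹ := by
    intro m
    induction m with
    | zero => simpa using hs k hk s
    | succ m ih =>
      intro i j
      rw [pow_succ, pow_mul]
      refine (norm_pow_prime_sub_one_le ?_ ih i j).trans (le_of_eq ?_)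
      · exact mul_le_of_le_one_left hp0.le (pow_le_one₀ hp0.le hp1.le)
      · rw [pow_succ']; ring
  have h2 := h1 n' i j
  rw [map_pow]
  refine le_trans h2 ?_
  calc (p : ℝ)⁻¹ ^ n' * (p : ℝ)⁻¹ ≤ (p : ℝ)⁻¹ ^ n * 1 :=
        mul_le_mul (pow_le_pow_of_le_one hp0.le hp1.le hn') hp1.le hp0.le (by positivity)
    _ ≤ δ := by rw [mul_one]; exact hn.le

variable (U) in
/-- Algebraic forms of degree `d` on `G(𝔸_f)`, with polynomial coefficients. -/
structure IsAlgForm (d : ℕ) (L : τ.finAdelic → Mats M.S Ω_[p] → Ω_[p]) :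
    Prop where
  poly : ∀ x, L x ∈ polyFun M.S Ω_[p] d
  left : ∀ γ x y, L (τ.diagFin γ * x) (M.locP (τ.diagFin γ) * y) = L x y
  right : ∀ x, ∀ k ∈ U.level M.level, L (x * k) = L x

/-- The `p`-adic function attached to an algebraic form. -/
noncomputable def padicForm (L : τ.finAdelic → Mats M.S Ω_[p] → Ω_[p])
    (x : τ.finAdelic) : Ω_[p] :=
  L x (M.locP x)

/-- The complex function attached to an algebraic form. -/
noncomputable def complexForm (L : τ.finAdelic → Mats M.S Ω_[p] → Ω_[p])
    (x : τ.infinite × τ.finAdelic) : ℂ :=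
  ι.symm (L x.2 (matsMap (ι : ℂ →+* Ω_[p]) (M.inf x.1)))

/-- Polynomial functions of degree at most `d` on `G(ℝ)`. -/
noncomputable def coeffSpace (d : ℕ) : CoeffSpace τ.infinite where
  space := (polyFun M.S ℂ d).map (LinearMap.funLeft ℂ ℂ M.inf)
  finite := by
    have := finiteDimensional_polyFun (S := M.S) (k := ℂ) d
    infer_instance
  continuous := by
    rintro _ ⟨P, hP, rfl⟩
    exact (continuous_of_mem_polyAlg (polyFun_le_polyAlg d hP)).comp M.continuous_inf
  right_mem := by
    rintro _ ⟨P, hP, rfl⟩ h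
    refine ⟨_, right_mul_mem_polyFun (M.inf h) hP, ?_⟩
    funext i
    simp [LinearMap.funLeft_apply]

variable {M}

theorem poly_ext {d : ℕ} {P P' : Mats M.S Ω_[p] → Ω_[p]}
    (hP : P ∈ polyFun M.S Ω_[p] d) (hP' : P' ∈ polyFun M.S Ω_[p] d)
    (h : ∀ i, P (matsMap (ι : ℂ →+* Ω_[p]) (M.inf i)) =
      P' (matsMap (ι : ℂ →+* Ω_[p]) (M.inf i))) : P = P' := by
  have h1 := transport_mem_polyFun ι.symm (sub_mem hP hP')
  have h2 := M.dense d _ h1 fun i => by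
    change ι.symm (P (matsMap (ι : ℂ →+* Ω_[p]) (M.inf i)) -
      P' (matsMap (ι : ℂ →+* Ω_[p]) (M.inf i))) = 0
    rw [h, sub_self, map_zero]
  funext y
  have h3 := congrFun h2 (matsMap (ι.symm : Ω_[p] →+* ℂ) y)
  change ι.symm ((P - P') (matsMap (ι : ℂ →+* Ω_[p])
    (matsMap (ι.symm : Ω_[p] →+* ℂ) y))) = 0 at h3
  rwa [matsMap_symm_apply, map_eq_zero, Pi.sub_apply, sub_eq_zero] at h3

variable {d : ℕ} {L : τ.finAdelic → Mats M.S Ω_[p] → Ω_[p]}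

theorem IsAlgForm.complexForm_mem (hL : M.IsAlgForm U d L) :
    M.complexForm L ∈ levelForms τ.diagInf τ.diagFin (M.coeffSpace d) (U.level M.level) := by
  refine ⟨fun γ x => ?_, fun x k hk => ?_, fun x => ?_⟩
  · obtain ⟨i, x⟩ := x
    change ι.symm (L (τ.diagFin γ * x) (matsMap _ (M.inf (τ.diagInf γ * i)))) = ι.symm (L x _)
    rw [map_mul, map_mul, M.compat, ← M.locP_apply, hL.left]
  · obtain ⟨i, x⟩ := x
    change ι.symm (L (x * k) (matsMap _ (M.inf (i * 1)))) = ι.symm (L x _)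
    rw [hL.right x k hk, mul_one]
  · exact ⟨_, transport_mem_polyFun ι.symm (hL.poly x), rfl⟩

theorem exists_isAlgForm {φ : τ.infinite × τ.finAdelic → ℂ}
    (hφ : φ ∈ levelForms τ.diagInf τ.diagFin (M.coeffSpace d) (U.level M.level)) :
    ∃ L, M.IsAlgForm U d L ∧ M.complexForm L = φ := by
  choose P hP hPφ using hφ.2.2
  have hPφ' : ∀ i x, P x (M.inf i) = φ (i, x) := fun i x => congrFun (hPφ x) i
  let L : τ.finAdelic → Mats M.S Ω_[p] → Ω_[p] := fun x y =>
    ι (P x (matsMap (ι.symm : Ω_[p] →+* ℂ) y))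
  have hL : ∀ x, L x ∈ polyFun M.S Ω_[p] d := fun x => transport_mem_polyFun ι (hP x)
  have hLφ : ∀ i x, L x (matsMap (ι : ℂ →+* Ω_[p]) (M.inf i)) = ι (φ (i, x)) := by
    intro i x
    change ι (P x (matsMap (ι.symm : Ω_[p] →+* ℂ) _)) = _
    rw [matsMap_apply_symm, hPφ']
  refine ⟨L, ⟨hL, fun γ x y => ?_, fun x k hk => ?_⟩, ?_⟩
  · refine congrFun (poly_ext (M := M) (left_mul_mem_polyFun _ (hL (τ.diagFin γ * x))) (hL x)
      fun i => ?_) y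
    rw [hLφ, M.locP_apply, ← M.compat, ← map_mul, ← map_mul, hLφ, ← hφ.1 γ (i, x)]
    rfl
  · refine poly_ext (M := M) (hL _) (hL x) fun i => ?_
    rw [hLφ, hLφ, ← hφ.2.1 (i, x) k hk, mk_mul_mk, mul_one]
  · funext ⟨i, x⟩
    change ι.symm (L x _) = _
    rw [hLφ, ι.symm_apply_apply]

theorem IsAlgForm.padicForm_left (hL : M.IsAlgForm U d L) (γ : τ.points F) (x : τ.finAdelic) :
    M.padicForm L (τ.diagFin γ * x) = M.padicForm L x := by
  unfold padicForm
  rw [map_mul, hL.left]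

theorem IsAlgForm.heckeMap_padicForm (hL : M.IsAlgForm U d L) (R : Type*) [CommRing R]
    [Algebra R Ω_[p]] (i : U.HeckeIndex) (c : ℂ)
    (hc : heckeFun (U.K i.place) ((inr τ.infinite τ.finAdelic).comp
      (τ.localEmb i.place.1)) i.elt (M.complexForm L) = c • M.complexForm L) :
    TameLevel.heckeMap R Ω_[p] i (M.padicForm L) = ι c • M.padicForm L := by
  funext x
  rw [TameLevel.heckeMap_apply]
  have h1 : ∑ q ∈ (U.finite_cosets i.place i.elt).toFinset,
      L (x * τ.localEmb i.place.1 q.out) = ι c • L x := by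
    refine poly_ext (M := M) (sum_mem fun q _ => hL.poly _) (smul_mem _ _ (hL.poly x))
      fun j => ?_
    have h2 := congrFun hc (j, x)
    rw [heckeFun_eq_sum (U.finite_cosets i.place i.elt)] at h2
    have h3 := congrArg ι h2
    rw [map_sum] at h3
    rw [Finset.sum_apply]
    refine Eq.trans (sum_congr rfl fun q _ => ?_) (h3.trans ?_)
    · change _ = ι (ι.symm (L _ (matsMap _ (M.inf (j * 1)))))
      rw [mul_one, ι.apply_symm_apply]
      rfl
    · change ι (c * ι.symm (L x _)) = ι c * L x _
      rw [map_mul, ι.apply_symm_apply]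
  have h4 := congrFun h1 (M.locP x)
  rw [Finset.sum_apply] at h4
  refine Eq.trans (sum_congr rfl fun q _ => ?_) h4
  have h5 : M.locP (τ.localEmb i.place.1 q.out) = 1 := by
    rw [locP_apply, atP_localEmb i.place.2, map_one, map_one]
  rw [padicForm, map_mul, h5, mul_one]

theorem IsAlgForm.exists_eigen_decomposition [IsTopologicalGroup τ.finAdelic]
    [CompactSpace τ.infinite]
    (hKo : IsOpen (U.level M.level : Set τ.finAdelic))
    (hKc : IsCompact (U.level M.level : Set τ.finAdelic))
    (hδ : FiniteDoubleCosets τ.diagFin (U.level M.level))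
    (hs : FiniteStabilizers τ.diagFin (U.level M.level)) (hL : M.IsAlgForm U d L) :
    ∃ (n : ℕ) (L' : Fin n → τ.finAdelic → Mats M.S Ω_[p] → Ω_[p]),
      L = ∑ j, L' j ∧ ∀ j, M.IsAlgForm U d (L' j) ∧ ∀ i : U.HeckeIndex, ∃ c : ℂ,
        heckeFun (U.K i.place) ((inr τ.infinite τ.finAdelic).comp
          (τ.localEmb i.place.1)) i.elt (M.complexForm (L' j)) = c • M.complexForm (L' j) := by
  borelize τ.infinite
  have hfin : ∀ g, (cosets (U.level M.level) g).Finite := finite_cosets hKo hKc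
  set V := levelForms τ.diagInf τ.diagFin (M.coeffSpace d) (U.level M.level) with hV
  let 𝒢 : Set τ.finAdelic := Set.range fun i : U.HeckeIndex => τ.localEmb i.place.1 i.elt
  have hloc : ∀ φ ∈ V, ∀ i : U.HeckeIndex, heckeFun (U.level M.level)
      (inr τ.infinite τ.finAdelic) (τ.localEmb i.place.1 i.elt) φ =
      heckeFun (U.K i.place) ((inr τ.infinite τ.finAdelic).comp
        (τ.localEmb i.place.1)) i.elt φ := fun φ hφ i =>
    heckeFun_level_eq M.level (inr τ.infinite τ.finAdelic) i.place i.elt hφ.2.1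
  have hspan := levelForms_le_span_eigenvectors (W := M.coeffSpace d) (ε := τ.diagInf) hδ hs hfin 𝒢
    (by
      rintro _ ⟨i, rfl⟩
      exact ⟨⟨i.place, i.elt⁻¹, i.isHyperspecial⟩, map_inv _ _⟩)
    (by
      rintro _ ⟨i, rfl⟩ _ ⟨j, rfl⟩ φ hφ
      rw [hloc φ hφ, hloc φ hφ, hloc _ (hloc φ hφ j ▸ heckeFun_mem_levelForms hφ hfin _),
        hloc _ (hloc φ hφ i ▸ heckeFun_mem_levelForms hφ hfin _)]
      obtain ⟨v, g, hv⟩ := i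
      obtain ⟨w, h, hw⟩ := j
      by_cases e : v = w
      · subst e
        obtain ⟨θ, h1, h2, h3⟩ := hv.exists_anti
        exact heckeFun_comm_of_anti θ h1 h2 h3 g h (U.finite_cosets v g) (U.finite_cosets v h)
          fun x k hk => hφ.2.1 x _ (U.localEmb_mem_level M.level hk)
      · refine heckeFun_comm g h (U.finite_cosets v g) (U.finite_cosets w h) fun a b => ?_
        exact Prod.ext rfl
          (commute_localEmb (localEmb_ne (fun h => e (Subtype.ext h.symm)) a) b).eq)
  obtain ⟨n, a, φ, hφ⟩ := Submodule.mem_span_set'.mp (hspan hL.complexForm_mem)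
  have hmem : ∀ j, a j • (φ j).1 ∈ V := fun j => smul_mem _ _ (φ j).2.1
  choose L' hL' hLφ using fun j => exists_isAlgForm (hmem j)
  refine ⟨n, L', ?_, fun j => ⟨hL' j, fun i => ?_⟩⟩
  · funext x
    rw [Finset.sum_apply]
    refine poly_ext (M := M) (hL.poly x) (sum_mem fun j _ => (hL' j).poly x) fun i => ?_
    apply ι.symm.injective
    rw [Finset.sum_apply, map_sum]
    have h1 := congrFun hφ (i, x)
    rw [Finset.sum_apply] at h1
    refine h1.symm.trans (sum_congr rfl fun j _ => ?_)
    exact (congrFun (hLφ j) (i, x)).symm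
  · obtain ⟨c, hc⟩ := (φ j).2.2 _ ⟨i, rfl⟩
    refine ⟨c, ?_⟩
    rw [hLφ, ← hloc _ (hmem j), ← heckeLin_apply (hfin _), map_smul, heckeLin_apply, hc,
      smul_comm]

end AlgebraicModel

end AlgebraicForms

section ClassicalPoints

variable [Module.Finite F D]
  {τ : Involution F 𝒦 D} {p : ℕ} [Fact p.Prime]

/-- Finiteness properties of the levels `K_p K^p`. -/
structure TameLevel.HasFiniteLevels (U : TameLevel τ p) : Prop where
  isOpen : ∀ Kp, IsOpen (U.level Kp : Set τ.finAdelic)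
  isCompact : ∀ Kp, IsCompact (U.level Kp : Set τ.finAdelic)
  finiteDoubleCosets : ∀ Kp, FiniteDoubleCosets τ.diagFin (U.level Kp)
  finiteStabilizers : ∀ Kp, FiniteStabilizers τ.diagFin (U.level Kp)

variable {U : TameLevel τ p}

namespace AlgebraicModel

variable {ι : ℂ ≃+* Ω_[p]} {M : AlgebraicModel τ p ι} {d : ℕ}
  {L : τ.finAdelic → Mats M.S Ω_[p] → Ω_[p]}

theorem IsAlgForm.exists_padicForm_eq (hL : M.IsAlgForm U d L) (hU : U.HasFiniteLevels) :
    ∃ R : Finset τ.finAdelic, ∀ x, ∃ r ∈ R, ∃ k₀ ∈ U.level M.level, ∀ k ∈ U.level M.level,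
      M.padicForm L (x * k) = L r (M.locP r * M.locP (k₀ * k)) := by
  obtain ⟨R, hR⟩ := hU.finiteDoubleCosets M.level
  refine ⟨R, fun x => ?_⟩
  obtain ⟨γ, r, hr, k₀, hk₀, rfl⟩ := hR x
  refine ⟨r, hr, k₀, hk₀, fun k hk => ?_⟩
  rw [mul_assoc, mul_assoc, hL.padicForm_left, padicForm, hL.right _ _ (mul_mem hk₀ hk), map_mul]

theorem IsAlgForm.exists_bound (hL : M.IsAlgForm U d L) (hU : U.HasFiniteLevels) :
    ∃ B, 0 < B ∧ ∀ x, ‖M.padicForm L x‖ ≤ B := by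
  obtain ⟨R, hR⟩ := hL.exists_padicForm_eq hU
  have h1 : ∀ r, (fun y => L r (M.locP r * y)) ∈ polyAlg M.S Ω_[p] := fun r =>
    polyFun_le_polyAlg d (left_mul_mem_polyFun _ (hL.poly r))
  choose C hC0 hC using fun r => exists_lipschitz_of_mem_polyAlg (h1 r) 1
  refine ⟨1 + ∑ r ∈ R, C r, add_pos_of_pos_of_nonneg one_pos (sum_nonneg fun r _ => hC0 r),
    fun x => ?_⟩
  obtain ⟨r, hr, k₀, hk₀, h⟩ := hR x
  have h2 := h 1 (one_mem _)
  rw [mul_one, mul_one] at h2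
  rw [h2]
  refine ((hC r).1 _ fun s i j => M.norm_locP_le le_rfl hk₀ s i j).trans ?_
  exact (single_le_sum (fun r _ => hC0 r) hr).trans (by linarith)

theorem IsAlgForm.exists_uniform (hL : M.IsAlgForm U d L) (hU : U.HasFiniteLevels) :
    ∀ ε > 0, ∃ Kp, ∀ x, ∀ k ∈ U.level Kp, ‖M.padicForm L (x * k) - M.padicForm L x‖ ≤ ε := by
  intro ε hε
  obtain ⟨R, hR⟩ := hL.exists_padicForm_eq hU
  have h1 : ∀ r, (fun y => L r (M.locP r * y)) ∈ polyAlg M.S Ω_[p] := fun r =>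
    polyFun_le_polyAlg d (left_mul_mem_polyFun _ (hL.poly r))
  choose C hC0 hC using fun r => exists_lipschitz_of_mem_polyAlg (h1 r) 1
  set B := 1 + ∑ r ∈ R, C r with hB
  have hB0 : 0 < B := add_pos_of_pos_of_nonneg one_pos (sum_nonneg fun r _ => hC0 r)
  obtain ⟨Kp, hKp, hs⟩ := M.small (ε / B) (by positivity)
  refine ⟨Kp, fun x k hk => ?_⟩
  obtain ⟨r, hr, k₀, hk₀, h⟩ := hR x
  have hk' : k ∈ U.level M.level := U.level_mono hKp hk
  have h2 := h 1 (one_mem _)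
  rw [mul_one, mul_one] at h2
  rw [h2, h k hk']
  have h3 : ∀ s i j, ‖M.locP (k₀ * k) s i j - M.locP k₀ s i j‖ ≤ ε / B := by
    intro s i j
    have h4 : M.locP (k₀ * k) s i j - M.locP k₀ s i j =
        ∑ l, M.locP k₀ s i l * (M.locP k s l j - (1 : Matrix (Fin 2) (Fin 2) _) l j) := by
      have : M.locP (k₀ * k) s - M.locP k₀ s = M.locP k₀ s * (M.locP k s - 1) := by
        rw [map_mul, Pi.mul_apply, mul_sub, mul_one]
      rw [← Matrix.sub_apply, this, Matrix.mul_apply]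
      rfl
    rw [h4]
    refine norm_sum_le_of_forall_le_of_nonneg (by positivity) fun l _ => ?_
    rw [norm_mul]
    have h5 : ‖M.locP k s l j - (1 : Mat₂(Ω_[p])) l j‖ ≤ ε / B := by
      have := hs (τ.atP p k) hk.1 s l j
      rw [← PadicAlgCl.norm_extends] at this
      have h6 : M.locP k s l j - (1 : Mat₂(Ω_[p])) l j =
          algebraMap ℚ_[p] Ω_[p] (M.loc (τ.atP p k) s l j -
            (1 : Mat₂(ℚ_[p])) l j) := by
        rw [map_sub, Matrix.one_apply, Matrix.one_apply, apply_ite (algebraMap _ _), map_one,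
          map_zero]
        rfl
      rw [h6]
      exact this
    calc _ ≤ 1 * (ε / B) := mul_le_mul (M.norm_locP_le le_rfl hk₀ s i l) h5 (norm_nonneg _) one_pos.le
      _ = _ := one_mul _
  refine ((hC r).2 _ _ (ε / B) (by positivity)
    (fun s i j => M.norm_locP_le le_rfl (mul_mem hk₀ hk') s i j)
    (fun s i j => M.norm_locP_le le_rfl hk₀ s i j) h3).trans ?_
  calc C r * (ε / B) ≤ B * (ε / B) := by
        gcongr
        exact (single_le_sum (fun r _ => hC0 r) hr).trans (by linarith)
    _ = ε := mul_div_cancel₀ _ hB0.ne'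

theorem IsAlgForm.exists_finite (hL : M.IsAlgForm U d L) (hU : U.HasFiniteLevels)
    (E : IntermediateField ℚ_[p] Ω_[p]) :
    ∃ V : Submodule E Ω_[p], V.FG ∧ ∀ x, M.padicForm L x ∈ V := by
  obtain ⟨R, hR⟩ := hL.exists_padicForm_eq hU
  have h1 : ∀ r, (fun y => L r (M.locP r * y)) ∈ polyAlg M.S Ω_[p] := fun r =>
    polyFun_le_polyAlg d (left_mul_mem_polyFun _ (hL.poly r))
  choose V hV h using fun r => exists_finite_of_mem_polyAlg (k₀ := E) (h1 r)
  refine ⟨⨆ r ∈ R, V r, Submodule.fg_biSup _ _ fun r _ => hV r, fun x => ?_⟩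
  obtain ⟨r, hr, k₀, hk₀, h'⟩ := hR x
  have h2 := h' 1 (one_mem _)
  rw [mul_one, mul_one] at h2
  rw [h2]
  exact Submodule.mem_iSup_of_mem r (Submodule.mem_iSup_of_mem hr
    (h r (matsMap (algebraMap ℚ_[p] E) (M.loc (τ.atP p k₀)))))

/-- An algebraic Hecke eigenform defines a classical crystalline point. -/
theorem IsAlgForm.exists_classicalCrystalline [IsTopologicalGroup τ.finAdelic]
    [CompactSpace τ.infinite] (hL : M.IsAlgForm U d L) (hU : U.HasFiniteLevels)
    (E : IntermediateField ℚ_[p] Ω_[p]) [FiniteDimensional ℚ_[p] E]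
    (hne : M.padicForm L ≠ 0) (heig : ∀ i : U.HeckeIndex, ∃ c : ℂ,
        heckeFun (U.K i.place) ((inr τ.infinite τ.finAdelic).comp
          (τ.localEmb i.place.1)) i.elt (M.complexForm L) = c • M.complexForm L) :
    ∃ (c : U.HeckeIndex → Ω_[p]) (lam : U.BigHeckeAlg (intE E) →ₐ[intE E] Ω_[p]),
      (∀ i, TameLevel.heckeMap (intE E) Ω_[p] i (M.padicForm L) =
        c i • M.padicForm L) ∧
      (∃ 𝔭 ∈ classicalCrystalline U E ι, 𝔭.asIdeal = ker lam) ∧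
      ∀ t, ∀ ε > 0, ∃ Kp, ∀ Kp' ≤ Kp, ∀ q, U.Represents t Kp' q →
        ‖FreeAlgebra.lift (intE E) c q - lam t‖ ≤ ε := by
  choose c hc using heig
  have hcp : ∀ i, TameLevel.heckeMap (intE E) Ω_[p] i (M.padicForm L) =
      ι (c i) • M.padicForm L := fun i => hL.heckeMap_padicForm (intE E) i (c i) (hc i)
  obtain ⟨V, hV, hVL⟩ := hL.exists_finite hU E
  have hV1 : Module.Finite E V := iff_fg.mpr hV
  have hV2 : FiniteDimensional ℚ_[p] V := Module.Finite.trans E V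
  have hV3 : FiniteDimensional ℚ_[p] (V.restrictScalars ℚ_[p]) := hV2
  obtain ⟨lam, hcont, hlam, happ⟩ := U.exists_eigensystem (R := intE E) norm_coe_intE_le_one
    (continuous_subtype_val.comp continuous_subtype_val) M.level hU.finiteDoubleCosets
    (M.padicForm L) hne hL.padicForm_left (hL.exists_uniform hU) (V.restrictScalars ℚ_[p])
    (fun r z hz => V.smul_mem (r : E) hz) hVL (fun i => ι (c i)) hcp
  refine ⟨fun i => ι (c i), lam, hcp, ?_, happ⟩
  have hne' : M.complexForm L ≠ 0 := by
    intro h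
    refine hne (funext fun x => ?_)
    have h1 : L x = 0 := by
      refine poly_ext (M := M) (hL.poly x) (zero_mem _) fun i => ?_
      have h2 := congrFun h (i, x)
      exact (map_eq_zero ι.symm).mp h2
    rw [padicForm, h1]
    rfl
  obtain ⟨π, hπ, ⟨φ, hφ, hφ0, hφK⟩, hπe⟩ := exists_automorphicRep M.level (hU.isOpen _)
    (hU.isCompact _) (hU.finiteDoubleCosets _) (hU.finiteStabilizers _) hL.complexForm_mem hne'
  have : (ker lam).IsPrime := RingHom.ker_isPrime _
  refine ⟨⟨ker lam, this⟩, ⟨lam, π, ⟨hcont, hπ, fun v hv g ψ hψ => ?_⟩,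
    ⟨M.K, M.hyperspecial, φ, hφ, hφ0, fun x k hk hk' => hφK x k ⟨?_, fun v => ?_⟩⟩, rfl⟩, rfl⟩
  · rw [hlam ⟨v, g, hv⟩, ι.symm_apply_apply]
    exact hπe v hv g _ (hc ⟨v, g, hv⟩) ψ hψ
  · exact (M.mem_level _).mpr hk
  · rw [hk' _ v.2]
    exact one_mem _

/-- Algebraic forms are dense among the functions of finite level. -/
theorem exists_isAlgForm_near (M : AlgebraicModel τ p ι) (hU : U.HasFiniteLevels) (Kp : PLevel τ p)
    (h : τ.finAdelic → Ω_[p]) (hΓ : ∀ γ x, h (τ.diagFin γ * x) = h x)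
    (hK : ∀ x, ∀ k ∈ U.level Kp, h (x * k) = h x) {ε : ℝ} (hε : 0 < ε) :
    ∃ d L, M.IsAlgForm U d L ∧ ∀ x, ‖M.padicForm L x - h x‖ ≤ ε := by
  classical
  let K₀ := U.level M.level
  obtain ⟨χ, hχ⟩ : ∃ χ : Weight τ.diagFin K₀, ∀ x, ∃ q : ℚ, χ.toFun x = q :=
    exists_weight (hU.finiteDoubleCosets M.level) (hU.finiteStabilizers M.level)
  choose q hq using hχ
  have hq0 : ∀ x, χ.toFun x = 0 ↔ q x = 0 := fun x => by rw [hq]; norm_cast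
  have hqr : ∀ x, ∀ k ∈ K₀, q (x * k) = q x := fun x k hk => by
    have := χ.right_invariant x k hk
    rw [hq, hq] at this
    exact_mod_cast this
  obtain ⟨R, hR⟩ := χ.finite
  obtain ⟨C, hC0, hC⟩ : ∃ C : ℝ, 0 < C ∧ ∀ x, ‖(q x : Ω_[p])‖ ≤ C := by
    have hs := fun r => norm_nonneg (q r : Ω_[p])
    refine ⟨1 + ∑ r ∈ R, ‖(q r : Ω_[p])‖, add_pos_of_pos_of_nonneg one_pos
      (sum_nonneg fun r _ => hs r), fun x => ?_⟩
    by_cases hx : χ.toFun x = 0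
    · rw [(hq0 x).mp hx, Rat.cast_zero, norm_zero]
      exact (add_pos_of_pos_of_nonneg one_pos (sum_nonneg fun r _ => hs r)).le
    · obtain ⟨r, hr, hrk⟩ := hR x hx
      have : q x = q r := by
        rw [← hqr r _ hrk, mul_inv_cancel_left]
      rw [this]
      exact (single_le_sum (fun r _ => hs r) hr).trans (by linarith)
  choose P hP hPa using fun c : τ.finAdelic ⧸ K₀ => M.approx Kp (fun z => h (c.out * τ.embP p z))
    (fun z k hk => by
      rw [embP_mul, ← mul_assoc]
      exact hK _ _ (embP_mem_level hk)) (show 0 < ε / C by positivity)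
  let N : τ.finAdelic ⧸ K₀ → Mats M.S Ω_[p] → Ω_[p] := fun c X =>
    P c (M.locP (c.out)⁻¹ * X)
  choose e he using fun c => exists_mem_polyFun (hP c)
  set d := ∑ r ∈ R, e (r : τ.finAdelic ⧸ K₀) with hd
  have hN : ∀ y, χ.toFun y ≠ 0 → N (y : τ.finAdelic ⧸ K₀) ∈ polyFun M.S Ω_[p] d := by
    intro y hy
    obtain ⟨r, hr, hrk⟩ := hR y hy
    have : (y : τ.finAdelic ⧸ K₀) = (r : τ.finAdelic ⧸ K₀) := (QuotientGroup.eq.mpr hrk).symm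
    rw [this]
    exact polyFun_mono (single_le_sum (f := fun r : τ.finAdelic =>
      e (r : τ.finAdelic ⧸ K₀)) (fun _ _ => Nat.zero_le _) hr) (left_mul_mem_polyFun _ (he _))
  let term : τ.finAdelic → Mats M.S Ω_[p] → Ω_[p] := fun y X =>
    (q y : Ω_[p]) * N (y : τ.finAdelic ⧸ K₀) X
  have hterm0 : ∀ y, χ.toFun y = 0 → term y = 0 := fun y hy => funext fun X => by
    change (q y : Ω_[p]) * _ = 0
    rw [(hq0 y).mp hy, Rat.cast_zero, zero_mul]
  let L : τ.finAdelic → Mats M.S Ω_[p] → Ω_[p] := fun x X =>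
    ∑ᶠ γ, term (τ.diagFin γ * x) (M.locP (τ.diagFin γ) * X)
  have hLsum : ∀ x X, L x X = ∑ γ ∈ (χ.finite_orbit x).toFinset,
      term (τ.diagFin γ * x) (M.locP (τ.diagFin γ) * X) := by
    intro x X
    refine finsum_eq_sum_of_support_subset _ fun γ hγ => ?_
    rw [Finset.mem_coe, mem_toFinset]
    intro h0
    exact hγ (congrFun (hterm0 _ h0) _)
  refine ⟨d, L, ⟨fun x => ?_, fun γ x y => ?_, fun x k hk => ?_⟩, fun x => ?_⟩
  · have : L x = ∑ γ ∈ (χ.finite_orbit x).toFinset,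
        (q (τ.diagFin γ * x) : Ω_[p]) • fun X => N (τ.diagFin γ * x : τ.finAdelic)
          (M.locP (τ.diagFin γ) * X) := by
      funext X
      rw [hLsum, Finset.sum_apply]
      rfl
    rw [this]
    refine sum_mem fun γ hγ => smul_mem _ _ (left_mul_mem_polyFun _ (hN _ ?_))
    exact (mem_toFinset _).mp hγ
  · refine (finsum_congr fun γ' => ?_).trans (finsum_comp_equiv (Equiv.mulRight γ)
      (f := fun γ' => term (τ.diagFin γ' * x) (M.locP (τ.diagFin γ') * y)))
    rw [Equiv.coe_mulRight, map_mul, map_mul, mul_assoc, mul_assoc]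
  · funext X
    refine finsum_congr fun γ => ?_
    change (q _ : Ω_[p]) * N _ _ = (q _ : Ω_[p]) * N _ _
    rw [← mul_assoc, hqr _ k hk]
    have : ((τ.diagFin γ * x * k : τ.finAdelic) : τ.finAdelic ⧸ K₀) =
        (τ.diagFin γ * x : τ.finAdelic) := by
      refine (QuotientGroup.eq.mpr ?_).symm
      rwa [inv_mul_cancel_left]
    rw [this]
  · have hsum : ∑ γ ∈ (χ.finite_orbit x).toFinset, (q (τ.diagFin γ * x) : Ω_[p]) = 1 := by
      have h1 := χ.sum_eq_one x
      rw [finsum_eq_sum_of_support_subset (s := (χ.finite_orbit x).toFinset) _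
        (fun γ hγ => by rw [Finset.mem_coe, mem_toFinset]; exact hγ)] at h1
      rw [sum_congr rfl fun γ _ => hq _] at h1
      have h2 : ∑ γ ∈ (χ.finite_orbit x).toFinset, q (τ.diagFin γ * x) = 1 :=
        Rat.cast_injective (α := ℝ) (by rw [Rat.cast_sum, Rat.cast_one]; exact h1)
      exact_mod_cast congrArg (Rat.cast : ℚ → Ω_[p]) h2
    have h3 : M.padicForm L x - h x = ∑ γ ∈ (χ.finite_orbit x).toFinset,
        (q (τ.diagFin γ * x) : Ω_[p]) * (N ((τ.diagFin γ * x : τ.finAdelic) :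
          τ.finAdelic ⧸ K₀) (M.locP (τ.diagFin γ * x)) - h x) := by
      simp only [mul_sub]
      rw [Finset.sum_sub_distrib, ← Finset.sum_mul, hsum, one_mul, padicForm, hLsum]
      simp only [map_mul]
      rfl
    rw [h3]
    refine norm_sum_le_of_forall_le_of_nonneg hε.le fun γ _ => ?_
    obtain ⟨k, hk, hy⟩ := exists_eq_out_mul K₀ (τ.diagFin γ * x)
    set c : τ.finAdelic ⧸ K₀ := ((τ.diagFin γ * x : τ.finAdelic) : τ.finAdelic ⧸ K₀) with hc
    have hy' : τ.diagFin γ * x = c.out * k⁻¹ := by rw [hy, mul_inv_cancel_right]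
    have h4 : N c (M.locP (τ.diagFin γ * x)) = P c (M.locP k⁻¹) := by
      change P c _ = _
      rw [hy', ← map_mul, inv_mul_cancel_left]
    have h5 : h x = h (c.out * τ.embP p (τ.atP p k⁻¹)) := by
      rw [← hΓ γ x, hy', ← hK (c.out * τ.embP p (τ.atP p k⁻¹)) _
        (tame_le_level Kp (embP_inv_mul_mem_tame (K₀.inv_mem hk))), mul_assoc,
        mul_inv_cancel_left]
    rw [h4, h5, norm_mul]
    calc _ ≤ C * (ε / C) := mul_le_mul (hC _) (hPa c _ (K₀.inv_mem hk).1) (norm_nonneg _) hC0.le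
      _ = ε := mul_div_cancel₀ _ hC0.ne'

end AlgebraicModel

theorem TameLevel.exists_le_of_finite {n : ℕ} (K₀ : PLevel τ p) (K : Fin n → PLevel τ p) :
    ∃ K' ≤ K₀, ∀ j, K' ≤ K j := by
  induction n with
  | zero => exact ⟨K₀, le_rfl, fun j => j.elim0⟩
  | succ n ih =>
    obtain ⟨K', h, h'⟩ := ih fun j => K j.succ
    refine ⟨K'.inf (K 0), (PLevel.inf_le_left _ _).trans h, fun j => ?_⟩
    induction j using Fin.cases with
    | zero => exact PLevel.inf_le_right _ _
    | succ j => exact (PLevel.inf_le_left _ _).trans (h' j)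

theorem TameLevel.eq_zero_of_formVal {A : Type*} [CommRing A] {t : U.BigHeckeAlg A}
    (h : ∀ (Kp : PLevel τ p) (f : U.H0 A Kp) x, formVal ((t.1 Kp).1 f) x = 0) : t = 0 :=
  Subtype.ext <| funext fun Kp => Subtype.ext <| LinearMap.ext fun f => Subtype.ext <|
    funext fun x => h Kp f x

/-- The classical crystalline points are dense in `Spec 𝕋(K^p)`. -/
theorem eq_zero_of_mem_classicalCrystalline [IsTopologicalGroup τ.finAdelic]
    [CompactSpace τ.infinite] {ι : ℂ ≃+* Ω_[p]} (M : AlgebraicModel τ p ι)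
    (hU : U.HasFiniteLevels) (E : IntermediateField ℚ_[p] Ω_[p])
    [FiniteDimensional ℚ_[p] E] {t : U.BigHeckeAlg (intE E)}
    (ht : ∀ 𝔭 ∈ classicalCrystalline U E ι, t ∈ 𝔭.asIdeal) : t = 0 := by
  refine TameLevel.eq_zero_of_formVal fun Kp h x => ?_
  have hinj : Injective (algebraMap (intE E) Ω_[p]) :=
    Subtype.val_injective.comp Subtype.val_injective
  apply hinj
  rw [map_zero, ← norm_le_zero_iff]
  refine le_of_forall_pos_le_add fun ε hε => ?_
  rw [zero_add]
  let a : intE E →ₗ[intE E] Ω_[p] := Algebra.linearMap _ _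
  have hmem := TameLevel.formVal_mem h
  obtain ⟨d, L, hL, hLh⟩ := M.exists_isAlgForm_near hU Kp (fun x => a (TameLevel.formVal h x))
    (fun γ x => by rw [hmem.1]) (fun x k hk => by rw [hmem.2 x k hk]) hε
  obtain ⟨n, L', hsum, hL'⟩ := hL.exists_eigen_decomposition (hU.isOpen _) (hU.isCompact _)
    (hU.finiteDoubleCosets _) (hU.finiteStabilizers _)
  have hj : ∀ j, ∃ Kj : PLevel τ p, ∀ K' ≤ Kj, ∀ q, U.Represents t K' q →
      ∀ x, ‖U.heckeAct (intE E) Ω_[p] q (M.padicForm (L' j)) x‖ ≤ ε := by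
    intro j
    by_cases h0 : M.padicForm (L' j) = 0
    · refine ⟨Kp, fun K' _ q _ x => ?_⟩
      rw [h0, map_zero, Pi.zero_apply, norm_zero]
      exact hε.le
    obtain ⟨c, lam, hc, ⟨𝔭, h𝔭, hlam⟩, happ⟩ :=
      (hL' j).1.exists_classicalCrystalline hU E h0 (hL' j).2
    have hlt : lam t = 0 := by
      have := ht 𝔭 h𝔭
      rwa [hlam] at this
    obtain ⟨B, hB0, hB⟩ := (hL' j).1.exists_bound hU
    obtain ⟨Kj, hKj⟩ := happ t (ε / B) (by positivity)
    refine ⟨Kj, fun K' hK' q hq x => ?_⟩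
    have h1 := hKj K' hK' q hq
    rw [hlt, sub_zero] at h1
    rw [TameLevel.heckeAct_eigen c _ hc, Pi.smul_apply, norm_smul]
    calc _ ≤ (ε / B) * B := mul_le_mul h1 (hB x) (norm_nonneg _) (by positivity)
      _ = ε := div_mul_cancel₀ _ hB0.ne'
  choose Kj hKj using hj
  obtain ⟨K', hK', hK'j⟩ := TameLevel.exists_le_of_finite Kp Kj
  obtain ⟨q, hq⟩ := TameLevel.exists_represents t K'
  have h1 : algebraMap (intE E) Ω_[p] (TameLevel.formVal ((t.1 Kp).1 h) x) =
      U.heckeAct (intE E) Ω_[p] q (fun x => a (TameLevel.formVal h x)) x := by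
    rw [TameLevel.heckeAct_comp, hq.mono hK' h]
    rfl
  have h2 : (fun x => a (TameLevel.formVal h x)) =
      ∑ j, M.padicForm (L' j) - (M.padicForm L - fun x => a (TameLevel.formVal h x)) := by
    have : M.padicForm L = ∑ j, M.padicForm (L' j) := by
      funext x
      rw [hsum, AlgebraicModel.padicForm, Finset.sum_apply, Finset.sum_apply, Finset.sum_apply]
      rfl
    rw [← this, sub_sub_cancel]
  rw [h1, h2, map_sub, map_sum, Pi.sub_apply, Finset.sum_apply]
  refine (DefiniteUnitary.norm_sub_le_max_of_ultrametric _ _).trans (max_le ?_ ?_)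
  · exact norm_sum_le_of_forall_le_of_nonneg hε.le
      fun j _ => hKj j K' (hK'j j) q hq x
  · exact U.norm_heckeAct_le (R := intE E) norm_coe_intE_le_one hε.le q
      (M.padicForm L - fun x => a (TameLevel.formVal h x)) hLh x

end ClassicalPoints

section CompactRings

variable {T : Type*} [CommRing T] [TopologicalSpace T] [IsTopologicalRing T] [CompactSpace T]
  [T2Space T]

theorem exists_idempotent_notMem (𝔪 : Ideal T) [𝔪.IsMaximal] {s : T} (hs : s ∉ 𝔪) :
    ∃ e ∈ closure (Set.range fun n : ℕ => s ^ (n + 1)), e * e = e ∧ e ∉ 𝔪 := by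
  let S : Subsemigroup T :=
    { carrier := Set.range fun n : ℕ => s ^ (n + 1)
      mul_mem' := by
        rintro _ _ ⟨a, rfl⟩ ⟨b, rfl⟩
        exact ⟨a + 1 + b, by rw [← pow_add]; congr 1⟩ }
  obtain ⟨e, heS, he⟩ := exists_idempotent_in_compact_subsemigroup
    (fun r : T => continuous_id.mul continuous_const) (S.topologicalClosure : Set T)
    ⟨s, subset_closure ⟨0, by simp⟩⟩ S.isClosed_topologicalClosure.isCompact
    (fun x hx y hy => S.topologicalClosure.mul_mem hx hy)
  refine ⟨e, heS, he, fun hem => ?_⟩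
  have h1 : MapClusterPt e ⊤ (fun n : ℕ => s ^ (n + 1)) := by
    rw [MapClusterPt, Filter.map_top]
    exact mem_closure_iff_clusterPt.mp heS
  obtain ⟨g, -, hg⟩ := mapClusterPt_iff_ultrafilter.mp h1
  obtain ⟨s', hs'⟩ := Ideal.Quotient.exists_inv (I := 𝔪)
    (a := Ideal.Quotient.mk 𝔪 s) (by rwa [Ne, eq_zero_iff_mem])
  obtain ⟨s', rfl⟩ := Ideal.Quotient.mk_surjective s'
  set z := s * s' * (1 - e) with hz
  have hlim : ∀ u : ℕ → T, ∃ w, Filter.Tendsto u g (nhds w) := fun u => by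
    obtain ⟨w, -, hw⟩ := isCompact_univ.ultrafilter_le_nhds (g.map u) (by simp)
    exact ⟨w, hw⟩
  obtain ⟨w, hw⟩ := hlim fun n => s' ^ (n + 1)
  obtain ⟨y, hy⟩ := hlim fun n => ∑ i ∈ range (n + 1), z ^ i
  have hidem : ∀ n : ℕ, (1 - e) ^ (n + 1) = 1 - e := by
    intro n
    induction n with
    | zero => simp
    | succ n ih => rw [pow_succ, ih]; linear_combination he
  have h2 : ∀ n : ℕ, (1 - z) * ∑ i ∈ range (n + 1), z ^ i =
      1 - s ^ (n + 1) * s' ^ (n + 1) * (1 - e) := fun n => by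
    rw [mul_neg_geom_sum, hz, mul_pow, mul_pow, hidem]
  have h3 := (tendsto_const_nhds (x := 1 - z)).mul hy
  simp only [h2] at h3
  have h4 : (1 - z) * y = 1 - e * w * (1 - e) := tendsto_nhds_unique h3
    (tendsto_const_nhds.sub ((hg.mul hw).mul tendsto_const_nhds))
  have h5 : (1 - z) * y = 1 := by rw [h4]; linear_combination w * he
  have h6 : 1 - z ∈ 𝔪 := by
    rw [← eq_zero_iff_mem] at hem ⊢
    rw [hz, map_sub, map_mul, map_mul, map_sub, hs', hem, map_one]
    ring
  exact (Ideal.ne_top_iff_one 𝔪).mp (Ideal.IsMaximal.ne_top ‹_›) (h5 ▸ 𝔪.mul_mem_right y h6)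

/-- In a compact ring with finitely many idempotents, some idempotent outside of a maximal ideal `𝔪`
lies in all the closed prime ideals which are not contained in `𝔪`. -/
theorem exists_idempotent_separating (hfin : {e : T | e * e = e}.Finite) (𝔪 : Ideal T)
    [𝔪.IsMaximal] : ∃ e ∉ 𝔪, ∀ 𝔭 : Ideal T, IsClosed (𝔭 : Set T) → ¬ 𝔭 ≤ 𝔪 → e ∈ 𝔭 := by
  classical
  set S := (hfin.subset (fun e he => he.1 : {e : T | e * e = e ∧ e ∉ 𝔪} ⊆ _)).toFinset with hS
  have hmem : ∀ e, e ∈ S ↔ e * e = e ∧ e ∉ 𝔪 := fun e => by rw [hS, mem_toFinset]; rfl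
  refine ⟨∏ e ∈ S, e, fun h => ?_, fun 𝔭 h𝔭 hle => ?_⟩
  · obtain ⟨e, he, h'⟩ := (Ideal.IsPrime.prod_mem_iff (p := 𝔪)).mp h
    exact ((hmem e).mp he).2 h'
  · obtain ⟨s, hs, hs'⟩ := Set.not_subset.mp hle
    obtain ⟨e, he, hee, hem⟩ := exists_idempotent_notMem 𝔪 hs'
    have h1 : e ∈ 𝔭 := by
      refine closure_minimal ?_ h𝔭 he
      rintro _ ⟨n, rfl⟩
      exact 𝔭.pow_mem_of_mem hs _ n.succ_pos
    exact 𝔭.mem_of_dvd (Finset.dvd_prod_of_mem _ ((hmem e).mpr ⟨hee, hem⟩)) h1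

theorem iInf_map_localization_eq_bot (𝔪 : Ideal T) [𝔪.IsMaximal] (C : Set (PrimeSpectrum T))
    {e : T} (he : e ∉ 𝔪) (heC : ∀ 𝔭 ∈ C, ¬ 𝔭.asIdeal ≤ 𝔪 → e ∈ 𝔭.asIdeal)
    (hC : ∀ t, (∀ 𝔭 ∈ C, t ∈ 𝔭.asIdeal) → t = 0) :
    (⨅ 𝔭 ∈ {𝔭 | 𝔭 ∈ C ∧ 𝔭.asIdeal ≤ 𝔪},
      𝔭.asIdeal.map (algebraMap T (AtPrime 𝔪))) = ⊥ ∧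
    Dense (PrimeSpectrum.comap (algebraMap T (AtPrime 𝔪)) ⁻¹'
      {𝔭 | 𝔭 ∈ C ∧ 𝔭.asIdeal ≤ 𝔪}) := by
  have hdisj : ∀ 𝔭 : PrimeSpectrum T, 𝔭.asIdeal ≤ 𝔪 →
      Disjoint (𝔪.primeCompl : Set T) 𝔭.asIdeal := fun 𝔭 h =>
    Set.disjoint_left.mpr fun x hx hx' => hx (h hx')
  have hcomap : ∀ 𝔭 : PrimeSpectrum T, 𝔭.asIdeal ≤ 𝔪 →
      (𝔭.asIdeal.map (algebraMap T (AtPrime 𝔪))).comap (algebraMap T _) =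
        𝔭.asIdeal := fun 𝔭 h =>
    IsLocalization.under_map_of_isPrime_disjoint 𝔪.primeCompl _ 𝔭.2 (hdisj 𝔭 h)
  have key : ∀ x : AtPrime 𝔪, (∀ 𝔭 ∈ {𝔭 | 𝔭 ∈ C ∧ 𝔭.asIdeal ≤ 𝔪},
      x ∈ 𝔭.asIdeal.map (algebraMap T (AtPrime 𝔪))) → x = 0 := by
    intro x hx
    obtain ⟨a, s, rfl⟩ := IsLocalization.exists_mk'_eq 𝔪.primeCompl x
    have h1 : e * a = 0 := by
      refine hC _ fun 𝔭 h𝔭 => ?_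
      by_cases h : 𝔭.asIdeal ≤ 𝔪
      · refine 𝔭.asIdeal.mul_mem_left _ ?_
        rw [← hcomap 𝔭 h, Ideal.mem_comap, ← IsLocalization.mk'_spec _ a s]
        exact Ideal.mul_mem_right _ _ (hx 𝔭 ⟨h𝔭, h⟩)
      · exact 𝔭.asIdeal.mul_mem_right _ (heC 𝔭 h𝔭 h)
    exact (IsLocalization.mk'_eq_zero_iff _ _).mpr ⟨⟨e, he⟩, h1⟩
  refine ⟨(Submodule.eq_bot_iff _).mpr fun x hx => key x fun 𝔭 h𝔭 => ?_, ?_⟩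
  · rw [Submodule.mem_iInf] at hx
    have := hx 𝔭
    rw [Submodule.mem_iInf] at this
    exact this h𝔭
  · rw [dense_iff_closure_eq, ← PrimeSpectrum.zeroLocus_vanishingIdeal_eq_closure]
    have h0 : PrimeSpectrum.vanishingIdeal (PrimeSpectrum.comap
        (algebraMap T (AtPrime 𝔪)) ⁻¹' {𝔭 | 𝔭 ∈ C ∧ 𝔭.asIdeal ≤ 𝔪}) = ⊥ := by
      refine (Submodule.eq_bot_iff _).mpr fun x hx => key x fun 𝔭 h𝔭 => ?_
      have hprime := IsLocalization.isPrime_of_isPrime_disjoint 𝔪.primeCompl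
        (AtPrime 𝔪) 𝔭.asIdeal 𝔭.2 (hdisj 𝔭 h𝔭.2)
      refine (PrimeSpectrum.mem_vanishingIdeal _ _).mp hx ⟨_, hprime⟩ ?_
      have : PrimeSpectrum.comap (algebraMap T (AtPrime 𝔪)) ⟨_, hprime⟩ = 𝔭 :=
        PrimeSpectrum.ext (hcomap 𝔭 h𝔭.2)
      rw [Set.mem_preimage, this]
      exact h𝔭
    rw [h0]
    exact PrimeSpectrum.zeroLocus_bot

end CompactRings

section HeckeTopology

variable [Module.Finite F D]
  {τ : Involution F 𝒦 D} {p : ℕ} {U : TameLevel τ p}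

namespace TameLevel

section

variable {A : Type*} [CommRing A] {Kp : PLevel τ p}

/-- Functions of finite level as functions on the set of double cosets. -/
noncomputable def formsEquiv (A : Type*) [CommRing A] (Kp : PLevel τ p) :
    U.H0 A Kp ≃ₗ[A] (U.Classes Kp → A) where
  toFun f c := formVal f c.out
  map_add' _ _ := rfl
  map_smul' _ _ := rfl
  invFun g := ⟨fun x => g (Quotient.mk _ x), mem_forms_iff_classes.mpr fun x y h => by rw [h]⟩
  left_inv f := Subtype.ext <| funext fun x => forms_apply_out f x
  right_inv g := funext fun c => congrArg g (out_eq c)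

theorem eq_sum_indicatorForm [Fintype (U.Classes Kp)] (f : U.H0 A Kp) :
    f = ∑ c, formVal f c.out • indicatorForm A c := by
  classical
  refine (formsEquiv A Kp).injective (funext fun d => ?_)
  rw [map_sum, Finset.sum_apply, sum_eq_single d]
  · rw [map_smul, Pi.smul_apply]
    change _ = formVal f d.out • formVal (indicatorForm A d) d.out
    rw [formVal_indicatorForm, if_pos (out_eq d), smul_eq_mul, mul_one]
    rfl
  · intro c _ hc
    rw [map_smul, Pi.smul_apply]
    change formVal f c.out • formVal (indicatorForm A c) d.out = 0
    rw [formVal_indicatorForm, if_neg (fun h => hc ((out_eq d).symm.trans h).symm),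
      smul_zero]
  · exact fun h => absurd (mem_univ _) h

end

variable {R : Type*} [CommRing R] [TopologicalSpace R] [IsTopologicalRing R]

variable (U R) in
/-- The coordinates on the Hecke algebra. -/
def heckeCoord (t : U.BigHeckeAlg R) (Kp : PLevel τ p) (f : U.H0 R Kp) : τ.finAdelic → R :=
  formVal ((t.1 Kp).1 f)

theorem isInducing_heckeCoord : Topology.IsInducing (heckeCoord U R) := ⟨rfl⟩

theorem injective_heckeCoord : Injective (heckeCoord U R) := fun s t h =>
  Subtype.ext <| funext fun Kp => Subtype.ext <| LinearMap.ext fun f => Subtype.ext <|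
    congrFun (congrFun h Kp) f

theorem continuous_heckeCoord (Kp : PLevel τ p) (f : U.H0 R Kp) (x : τ.finAdelic) :
    Continuous fun t : U.BigHeckeAlg R => heckeCoord U R t Kp f x :=
  (continuous_apply x).comp ((continuous_apply f).comp ((continuous_apply Kp).comp
    isInducing_heckeCoord.continuous))

theorem continuous_to_bigHeckeAlg {X : Type*} [TopologicalSpace X] {g : X → U.BigHeckeAlg R}
    (h : ∀ Kp f x, Continuous fun a => heckeCoord U R (g a) Kp f x) : Continuous g :=
  isInducing_heckeCoord.continuous_iff.mpr <| continuous_pi fun Kp => continuous_pi fun f =>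
    continuous_pi fun x => h Kp f x

theorem isTopologicalRing_bigHeckeAlg
    (hfin : ∀ Kp, FiniteDoubleCosets τ.diagFin (U.level Kp)) :
    IsTopologicalRing (U.BigHeckeAlg R) where
  continuous_add := continuous_to_bigHeckeAlg fun Kp f x =>
    ((continuous_heckeCoord Kp f x).comp continuous_fst).add
      ((continuous_heckeCoord Kp f x).comp continuous_snd)
  continuous_mul := continuous_to_bigHeckeAlg fun Kp f x => by
    have := finite_classes (hfin Kp)
    have : Fintype (U.Classes Kp) := ofFinite _
    have h1 : ∀ s t : U.BigHeckeAlg R, heckeCoord U R (s * t) Kp f x =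
        ∑ c : U.Classes Kp, heckeCoord U R t Kp f c.out *
          heckeCoord U R s Kp (indicatorForm R c) x := by
      intro s t
      change formVal ((s.1 Kp).1 ((t.1 Kp).1 f)) x = _
      conv_lhs => rw [eq_sum_indicatorForm ((t.1 Kp).1 f)]
      rw [map_sum, map_sum, Finset.sum_apply]
      refine sum_congr rfl fun c _ => ?_
      rw [map_smul, map_smul]
      rfl
    simp only [h1]
    exact continuous_finsetSum _ fun c _ =>
      ((continuous_heckeCoord Kp f _).comp continuous_snd).mul
        ((continuous_heckeCoord Kp _ x).comp continuous_fst)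
  continuous_neg := continuous_to_bigHeckeAlg fun Kp f x => (continuous_heckeCoord Kp f x).neg

theorem t2Space_bigHeckeAlg [T2Space R] : T2Space (U.BigHeckeAlg R) :=
  T2Space.of_injective_continuous injective_heckeCoord isInducing_heckeCoord.continuous

theorem compactSpace_bigHeckeAlg [T2Space R] [CompactSpace R] [IsNoetherianRing R]
    (hfin : ∀ Kp, FiniteDoubleCosets τ.diagFin (U.level Kp)) :
    CompactSpace (U.BigHeckeAlg R) := by
  let C : ∀ Kp : PLevel τ p, Set (U.H0 R Kp → τ.finAdelic → R) := fun Kp =>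
    Set.range fun (t : U.HeckeAlg R Kp) f => formVal (t.1 f)
  have hC : ∀ Kp, IsClosed (C Kp) := by
    intro Kp
    have := finite_classes (hfin Kp)
    have : Fintype (U.Classes Kp) := ofFinite _
    have h1 : Module.Finite R (U.H0 R Kp) := equiv (formsEquiv R Kp).symm
    have h2 : Free R (U.H0 R Kp) := Free.of_equiv (formsEquiv R Kp).symm
    have h3 : IsNoetherian R (End R (U.H0 R Kp)) :=
      isNoetherian_of_isNoetherianRing_of_finite R _
    obtain ⟨n, g, hg⟩ := Submodule.fg_iff_exists_fin_generating_family.mp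
      (h3.noetherian (toSubmodule (adjoin R (U.heckeOps R Kp))))
    have h4 : C Kp = Set.range fun (a : Fin n → R) (f : U.H0 R Kp) (x : τ.finAdelic) =>
        ∑ i, a i * formVal (g i f) x := by
      have h5 : ∀ t : End R (U.H0 R Kp), t ∈ adjoin R (U.heckeOps R Kp) ↔
          ∃ a : Fin n → R, ∑ i, a i • g i = t := fun t => by
        rw [← Subalgebra.mem_toSubmodule, ← hg, Submodule.mem_span_range_iff_exists_fun]
      have h6 : ∀ a : Fin n → R, (fun (f : U.H0 R Kp) (x : τ.finAdelic) =>
          ∑ i, a i * formVal (g i f) x) = fun f => formVal ((∑ i, a i • g i) f) := by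
        intro a
        funext f x
        rw [LinearMap.sum_apply, map_sum, Finset.sum_apply]
        rfl
      ext φ
      constructor
      · rintro ⟨⟨t, ht⟩, rfl⟩
        obtain ⟨a, rfl⟩ := (h5 t).mp ht
        exact ⟨a, h6 a⟩
      · rintro ⟨a, rfl⟩
        exact ⟨⟨_, (h5 _).mpr ⟨a, rfl⟩⟩, (h6 a).symm⟩
    rw [h4]
    refine (isCompact_range ?_).isClosed
    exact continuous_pi fun f => continuous_pi fun x => continuous_finsetSum _ fun i _ =>
      (continuous_apply i).mul continuous_const
  have hrange : Set.range (heckeCoord U R) = {φ | ∀ Kp, φ Kp ∈ C Kp} ∩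
      {φ | ∀ (Kp Kp' : PLevel τ p) (h : Kp' ≤ Kp) (f : U.H0 R Kp), φ Kp' (H0.incl U h f) =
        φ Kp f} := by
    ext φ
    constructor
    · rintro ⟨t, rfl⟩
      refine ⟨fun Kp => ⟨t.1 Kp, rfl⟩, fun Kp Kp' h f => ?_⟩
      exact congrArg (fun f => formVal f) (t.2 Kp Kp' h f)
    · rintro ⟨h, h'⟩
      choose t ht using h
      refine ⟨⟨t, fun Kp Kp' hK f => Subtype.ext ?_⟩, funext ht⟩
      have h1 := h' Kp Kp' hK f
      rwa [← ht, ← ht] at h1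
  have hclosed : IsClosed (Set.range (heckeCoord U R)) := by
    rw [hrange]
    refine IsClosed.inter ?_ ?_
    · have : {φ : ∀ Kp : PLevel τ p, U.H0 R Kp → τ.finAdelic → R | ∀ Kp, φ Kp ∈ C Kp} =
          Set.univ.pi C := by
        ext φ
        simp only [Set.mem_pi, Set.mem_univ, true_imp_iff, Set.mem_ofPred_eq]
      rw [this]
      exact isClosed_set_pi fun Kp _ => hC Kp
    · simp only [Set.ofPred_forall]
      refine isClosed_iInter fun Kp => isClosed_iInter fun Kp' => isClosed_iInter fun h =>
        isClosed_iInter fun f => isClosed_eq ?_ ?_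
      · exact (continuous_apply (H0.incl U h f)).comp (continuous_apply Kp')
      · exact (continuous_apply f).comp (continuous_apply Kp)
  exact (Topology.IsClosedEmbedding.mk ⟨isInducing_heckeCoord, injective_heckeCoord⟩
    hclosed).compactSpace

section Idempotents

theorem heckeAct_right_translate {R A : Type*} [CommRing R] [AddCommGroup A] [Module R A]
    (q : FreeAlgebra R U.HeckeIndex) {y : τ.finAdelic}
    (hy : ∀ (v : {v : Pl(F) // ¬ AboveP p v}) g, Commute y (τ.localEmb v.1 g))
    (f : τ.finAdelic → A) :
    U.heckeAct R A q (fun x => f (x * y)) = fun x => U.heckeAct R A q f (x * y) := by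
  induction q using FreeAlgebra.induction generalizing f with
  | grade0 r =>
    simp only [commutes, Module.algebraMap_end_apply]
    rfl
  | grade1 i =>
    rw [heckeAct_ι]
    funext x
    rw [heckeMap_apply, heckeMap_apply]
    refine sum_congr rfl fun c _ => ?_
    rw [mul_assoc, mul_assoc, (hy _ _).eq]
  | mul q r hq hr => simp only [map_mul, End.mul_apply, hr, hq]
  | add q r hq hr =>
    simp only [map_add, LinearMap.add_apply, hr, hq]
    rfl

theorem commute_embP_localEmb [Fact p.Prime] (z : τ.padicPoints p)
    (v : {v : Pl(F) // ¬ AboveP p v}) (g : τ.localPoints v.1) :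
    Commute (τ.embP p z) (τ.localEmb v.1 g) :=
  commute_localEmb (embP_not_above z v.2) g

theorem commute_embP_of_mem_tame [Fact p.Prime] (z : τ.padicPoints p) {k : τ.finAdelic}
    (hk : k ∈ U.tame) : Commute (τ.embP p z) k := by
  refine RestrictedProduct.ext _ _ fun v => ?_
  rw [RestrictedProduct.mul_apply, RestrictedProduct.mul_apply]
  by_cases h : AboveP p v
  · rw [hk.1 ⟨v, h⟩, mul_one, one_mul]
  · rw [embP_not_above _ h, mul_one, one_mul]

/-- An idempotent of the Hecke algebra in characteristic `p` which vanishes at a pro-`p` level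
vanishes at all levels. -/
theorem heckeAct_eq_zero_of_proP [Fact p.Prime] {R A : Type*} [CommRing R] [CommRing A]
    [Module R A] (hA : ∀ a : A, p • a = 0) {K₀ Kp : PLevel τ p}
    (hK₀ : ∀ k ∈ K₀.1, ∃ n : ℕ, ∀ n' ≥ n, k ^ p ^ n' ∈ Kp.1) (q : FreeAlgebra R U.HeckeIndex)
    (h₀ : ∀ f ∈ U.forms A K₀, U.heckeAct R A q f = 0) {f : τ.finAdelic → A}
    (hf : f ∈ U.forms A Kp) (hq : U.heckeAct R A q f = f) : f = 0 := by
  by_contra hne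
  let ρ : K₀.1 → (τ.finAdelic → A) →+ (τ.finAdelic → A) := fun k =>
    { toFun := fun g x => g (x * τ.embP p k)
      map_zero' := rfl
      map_add' := fun _ _ => rfl }
  have hρ1 : ∀ g, ρ 1 g = g := fun g => funext fun x => by
    change g (x * τ.embP p (1 : K₀.1)) = _
    have : τ.embP p ((1 : K₀.1) : τ.padicPoints p) = 1 := by
      have := embP_mul (τ := τ) (p := p) 1 1
      rwa [mul_one, left_eq_mul] at this
    rw [this, mul_one]
  have hρm : ∀ k k' g, ρ (k * k') g = ρ k (ρ k' g) := fun k k' g => funext fun x => by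
    change g (x * τ.embP p (k * k' : K₀.1)) = g (x * τ.embP p k * τ.embP p k')
    rw [Subgroup.coe_mul, embP_mul, mul_assoc]
  have hρf : ∀ k : K₀.1, (k : τ.padicPoints p) ∈ Kp.1 → ρ k f = f := fun k hk =>
    funext fun x => hf.2 x _ (embP_mem_level hk)
  -- the translates of `f`
  let T := Set.range fun k => ρ k f
  have hfin : T.Finite := by
    have hidx : Kp.1.relIndex K₀.1 ≠ 0 := relIndex_ne_zero_of_isOpen K₀.2.2 Kp.2.1
    have : (Kp.1.subgroupOf K₀.1).FiniteIndex := ⟨hidx⟩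
    have h1 : T ⊆
        Set.range fun c : K₀.1 ⧸ Kp.1.subgroupOf K₀.1 => ρ c.out f := by
      rintro _ ⟨k, rfl⟩
      refine ⟨(k : K₀.1 ⧸ Kp.1.subgroupOf K₀.1), ?_⟩
      have h2 : ((k : K₀.1 ⧸ Kp.1.subgroupOf K₀.1).out : K₀.1 ⧸ Kp.1.subgroupOf K₀.1) = k :=
        out_eq' _
      rw [eq_comm, QuotientGroup.eq, mem_subgroupOf] at h2
      change ρ _ f = ρ k f
      conv_lhs => rw [← mul_inv_cancel_left k (Quotient.out _), hρm, hρf _ h2]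
    exact (Set.finite_range _).subset h1
  let X : AddSubgroup (τ.finAdelic → A) := AddSubgroup.closure T
  have hpX : ∀ g : X, p • g = 0 := fun g => Subtype.ext <| funext fun x => hA _
  have hXfin : Finite X := by
    have h1 : Module.Finite ℤ X := by
      rw [Module.Finite.iff_addGroup_fg]
      have : Finite T := hfin
      exact AddGroup.closure_finite_fg _
    refine Module.finite_of_fg_torsion X fun g => ⟨⟨(p : ℤ), ?_⟩, ?_⟩
    · exact mem_nonZeroDivisors_of_ne_zero (by exact_mod_cast (Fact.out : p.Prime).ne_zero)
    · change (p : ℤ) • g = 0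
      rw [natCast_zsmul, hpX]
  have hρX k : X ≤ X.comap (ρ k) := (AddSubgroup.closure_le _).mpr <| by
    rintro _ ⟨k', rfl⟩
    exact AddSubgroup.subset_closure ⟨k * k', hρm _ _ _⟩
  letI : MulAction K₀.1 X :=
    { smul := fun k g => ⟨ρ k g.1, hρX k g.2⟩
      one_smul := fun g => Subtype.ext (hρ1 g.1)
      mul_smul := fun k k' g => Subtype.ext (hρm k k' g.1) }
  have hsmul : ∀ (k : K₀.1) (g : X), ((k • g : X) : τ.finAdelic → A) = ρ k g.1 := fun _ _ => rfl
  have hP : IsPGroup p (toPermHom K₀.1 X).range := by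
    rintro ⟨_, k, rfl⟩
    obtain ⟨n, hn⟩ : ∃ n : ℕ, ∀ g ∈ T, ρ (k ^ p ^ n) g = g := by
      have h1 : ∀ g ∈ T, ∃ n : ℕ, ∀ n' ≥ n, ρ (k ^ p ^ n') g = g := by
        rintro _ ⟨k', rfl⟩
        obtain ⟨n, hn⟩ := hK₀ _ (k'⁻¹ * k * k').2
        refine ⟨n, fun n' hn' => ?_⟩
        have h2 : k ^ p ^ n' = k' * (k'⁻¹ * k * k') ^ p ^ n' * k'⁻¹ := by
          have : k'⁻¹ * k * k' = k'⁻¹ * k * k'⁻¹⁻¹ := by rw [inv_inv]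
          rw [this, conj_pow, inv_inv]
          group
        change ρ _ (ρ k' f) = ρ k' f
        rw [← hρm, h2, inv_mul_cancel_right, hρm, hρf _ (hn n' hn')]
      choose! n hn using h1
      obtain ⟨N, hN⟩ := (hfin.image n).bddAbove
      exact ⟨N, fun g hg => hn g hg N (hN ⟨g, hg, rfl⟩)⟩
    refine ⟨n, Subtype.ext (Equiv.ext fun g => ?_)⟩
    have h2 : ∀ g ∈ X, ρ (k ^ p ^ n) g = g :=
      AddMonoidHom.eqOn_closure (f := ρ _) (g := AddMonoidHom.id _) hn
    change ((toPermHom K₀.1 X k) ^ p ^ n) g = g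
    rw [← map_pow]
    exact Subtype.ext (h2 g.1 g.2)
  have hfX : f ∈ X := AddSubgroup.subset_closure ⟨1, hρ1 f⟩
  have hcard : p ∣ Nat.card X := by
    have h1 : addOrderOf (⟨f, hfX⟩ : X) = p :=
      addOrderOf_eq_prime (hpX _) fun h => hne (congrArg Subtype.val h)
    rw [← h1]
    exact addOrderOf_dvd_natCard _
  obtain ⟨b, hb, hb0⟩ := hP.exists_fixed_point_of_prime_dvd_card_of_fixed_point X hcard
    (a := 0) (by
      rintro ⟨_, k, rfl⟩
      exact Subtype.ext (map_zero (ρ k)))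
  have hbq : ∀ g ∈ X, U.heckeAct R A q g = g ∧ (∀ γ x, g (τ.diagFin γ * x) = g x) ∧
      ∀ x, ∀ k ∈ U.tame, g (x * k) = g x := by
    intro g hg
    induction hg using AddSubgroup.closure_induction with
    | mem g hg =>
      obtain ⟨k, rfl⟩ := hg
      refine ⟨?_, fun γ x => ?_, fun x t ht => ?_⟩
      · have := heckeAct_right_translate q (commute_embP_localEmb (k : τ.padicPoints p)) f
        rwa [hq] at this
      · change f (_ * _ * _) = f _
        rw [mul_assoc, hf.1]
      · change f (x * t * _) = f (x * _)
        rw [mul_assoc, ← (commute_embP_of_mem_tame _ ht).eq, ← mul_assoc,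
          hf.2 _ _ (tame_le_level Kp ht)]
    | zero => exact ⟨map_zero _, fun _ _ => rfl, fun _ _ _ => rfl⟩
    | add a b _ _ ha hb =>
      refine ⟨by rw [map_add, ha.1, hb.1], fun γ x => ?_, fun x t ht => ?_⟩
      · rw [Pi.add_apply, ha.2.1, hb.2.1, Pi.add_apply]
      · rw [Pi.add_apply, ha.2.2 x t ht, hb.2.2 x t ht, Pi.add_apply]
    | neg a _ ha =>
      refine ⟨by rw [map_neg, ha.1], fun γ x => ?_, fun x t ht => ?_⟩
      · rw [Pi.neg_apply, ha.2.1, Pi.neg_apply]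
      · rw [Pi.neg_apply, ha.2.2 x t ht, Pi.neg_apply]
  obtain ⟨h1, h2, h3⟩ := hbq b.1 b.2
  refine hb0 (Subtype.ext ?_).symm
  rw [← h1]
  refine h₀ b.1 ⟨h2, fun x k hk => ?_⟩
  have h4 := congrArg Subtype.val (hb ⟨_, ⟨τ.atP p k, hk.1⟩, rfl⟩)
  have h5 : ∀ x, b.1 (x * τ.embP p (τ.atP p k)) = b.1 x := congrFun h4
  rw [← h5 x, ← h3 (x * τ.embP p (τ.atP p k)) _ (embP_inv_mul_mem_tame hk), mul_assoc,
    mul_inv_cancel_left]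

/-- Elements of the Hecke algebra which vanish modulo `a` at level `Kp`. -/
def vanishingModulo {R : Type*} [CommRing R] (a : R) (Kp : PLevel τ p) :
    Ideal (U.BigHeckeAlg R) where
  carrier := {t | ∀ f : U.H0 R Kp, ∃ g : U.H0 R Kp, (t.1 Kp).1 f = a • g}
  zero_mem' := fun f => ⟨0, (smul_zero a).symm⟩
  add_mem' := by
    intro s t hs ht f
    obtain ⟨g, hg⟩ := hs f
    obtain ⟨g', hg'⟩ := ht f
    exact ⟨g + g', by rw [smul_add, ← hg, ← hg']; rfl⟩
  smul_mem' := by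
    intro s t ht f
    obtain ⟨g, hg⟩ := ht f
    refine ⟨(s.1 Kp).1 g, ?_⟩
    change (s.1 Kp).1 ((t.1 Kp).1 f) = _
    rw [hg, map_smul]

theorem exists_smul_eq {R : Type*} [CommRing R] {a : R} (hreg : ∀ x, a * x = 0 → x = 0)
    {Kp : PLevel τ p} (f : U.H0 R Kp) (h : ∀ x, a ∣ formVal f x) : ∃ g : U.H0 R Kp, f = a • g := by
  choose g hg using h
  refine ⟨⟨g, mem_forms_iff_classes.mpr fun x y hxy => ?_⟩, Subtype.ext (funext hg)⟩
  have h1 := mem_forms_iff_classes.mp (formVal_mem f) x y hxy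
  rw [hg, hg] at h1
  exact sub_eq_zero.mp (hreg _ (by rw [mul_sub, h1, sub_self]))

theorem eq_zero_of_idempotent [Fact p.Prime] {R : Type*} [CommRing R]
    (hreg : ∀ x : R, (p : R) * x = 0 → x = 0) (hsep : ∀ x : R, (∀ n, (p : R) ^ n ∣ x) → x = 0)
    {K₀ : PLevel τ p}
    (hK₀ : ∀ Kp : PLevel τ p, ∀ k ∈ K₀.1, ∃ n : ℕ, ∀ n' ≥ n, k ^ p ^ n' ∈ Kp.1)
    {e : U.BigHeckeAlg R} (he : e * e = e) (h₀ : e ∈ vanishingModulo (p : R) K₀) : e = 0 := by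
  set I := Ideal.span {(p : R)} with hI
  have hmk : ∀ r : R, Ideal.Quotient.mk I r = 0 ↔ (p : R) ∣ r := fun r => by
    rw [eq_zero_iff_mem, hI, mem_span_singleton]
  let a : R →ₗ[R] R ⧸ I := Submodule.mkQ I
  have hlift : ∀ (Kp : PLevel τ p), ∀ f ∈ U.forms (R ⧸ I) Kp, ∃ g : U.H0 R Kp,
      f = fun x => a (formVal g x) := by
    intro Kp f hf
    refine ⟨⟨fun x => (f x).out, mem_forms_iff_classes.mpr fun x y h => ?_⟩, funext fun x => ?_⟩
    · rw [mem_forms_iff_classes.mp hf x y h]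
    · exact (Ideal.Quotient.mk_out (f x)).symm
  have hee : ∀ Kp (f : U.H0 R Kp), (e.1 Kp).1 ((e.1 Kp).1 f) = (e.1 Kp).1 f := by
    intro Kp f
    change ((e * e).1 Kp).1 f = _
    rw [he]
  have hdvd : ∀ Kp (f : U.H0 R Kp), ∃ g : U.H0 R Kp, (e.1 Kp).1 f = (p : R) • g := by
    intro Kp f
    refine exists_smul_eq hreg _ fun x => ?_
    have hle : Kp.inf K₀ ≤ Kp := PLevel.inf_le_left _ _
    obtain ⟨q, hq⟩ := exists_represents e (Kp.inf K₀)
    have hq0 := hq.mono (PLevel.inf_le_right Kp K₀)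
    set f' := H0.incl U hle f with hf'
    have h1 := heckeAct_eq_zero_of_proP (A := R ⧸ I) (fun x => ?_) (hK₀ (Kp.inf K₀)) q
      (fun g hg => ?_) (f := fun x => a (formVal ((e.1 (Kp.inf K₀)).1 f') x)) ?_ ?_
    · have h2 := congrFun h1 x
      rw [e.2 Kp (Kp.inf K₀) hle f] at h2
      exact (hmk _).mp h2
    · obtain ⟨r, rfl⟩ := Ideal.Quotient.mk_surjective x
      rw [← map_nsmul, nsmul_eq_mul]
      exact (hmk _).mpr (dvd_mul_right _ _)
    · obtain ⟨g, rfl⟩ := hlift K₀ g hg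
      obtain ⟨g', hg'⟩ := h₀ g
      rw [heckeAct_comp, ← hq0, hg']
      funext x
      exact (hmk _).mpr (dvd_mul_right _ _)
    · have := formVal_mem ((e.1 (Kp.inf K₀)).1 f')
      exact ⟨fun γ x => congrArg a (this.1 γ x), fun x k hk => congrArg a (this.2 x k hk)⟩
    · rw [heckeAct_comp, ← hq, hee]
  refine eq_zero_of_formVal fun Kp f x => hsep _ fun n => ?_
  induction n generalizing f with
  | zero => rw [pow_zero]; exact one_dvd _
  | succ n ih =>
    obtain ⟨g, hg⟩ := hdvd Kp f
    rw [← hee, hg, map_smul, map_smul, pow_succ', Pi.smul_apply, smul_eq_mul]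
    exact mul_dvd_mul_left _ (ih g)

theorem finite_idempotents [Fact p.Prime] {R : Type*} [CommRing R]
    (hreg : ∀ x : R, (p : R) * x = 0 → x = 0) (hsep : ∀ x : R, (∀ n, (p : R) ^ n ∣ x) → x = 0)
    [Finite (R ⧸ Ideal.span {(p : R)})] {K₀ : PLevel τ p}
    (hfin : FiniteDoubleCosets τ.diagFin (U.level K₀))
    (hK₀ : ∀ Kp : PLevel τ p, ∀ k ∈ K₀.1, ∃ n : ℕ, ∀ n' ≥ n, k ^ p ^ n' ∈ Kp.1) :
    {e : U.BigHeckeAlg R | e * e = e}.Finite := by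
  have := finite_classes hfin
  have : Fintype (U.Classes K₀) := ofFinite _
  let φ : U.BigHeckeAlg R → U.Classes K₀ → U.Classes K₀ → R ⧸ Ideal.span {(p : R)} :=
    fun t c d => Ideal.Quotient.mk _ (formVal ((t.1 K₀).1 (indicatorForm R c)) d.out)
  have key : ∀ e e' : U.BigHeckeAlg R, e * e = e → e' * e' = e' → φ e = φ e' → e = e * e' := by
    intro e e' he he' h
    have h1 : e - e' ∈ vanishingModulo (p : R) K₀ := by
      intro f
      refine exists_smul_eq hreg _ fun x => ?_
      change (p : R) ∣ formVal ((e.1 K₀).1 f - (e'.1 K₀).1 f) x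
      rw [eq_sum_indicatorForm f, map_sum, map_sum, ← Finset.sum_sub_distrib, map_sum,
        Finset.sum_apply]
      refine Finset.dvd_sum fun c _ => ?_
      rw [map_smul, map_smul, ← smul_sub, map_smul, Pi.smul_apply, smul_eq_mul]
      refine Dvd.dvd.mul_left ?_ _
      have h2 := congrFun (congrFun h c) (Quotient.mk _ x)
      rw [Ideal.Quotient.eq, mem_span_singleton] at h2
      rw [map_sub, Pi.sub_apply, ← forms_apply_out _ x, ← forms_apply_out (((e'.1 K₀).1) _) x]
      exact h2
    have h2 : e * (e - e') = e - e * e' := by linear_combination he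
    have h3 : e - e * e' = 0 := by
      refine eq_zero_of_idempotent hreg hsep hK₀ ?_ (h2 ▸ Ideal.mul_mem_left _ e h1)
      linear_combination (1 - 2 * e' + e' * e') * he + e * he'
    exact sub_eq_zero.mp h3
  refine Set.Finite.of_finite_image (f := φ) (Set.toFinite _) fun e he e' he' h => ?_
  rw [key e e' he he' h, mul_comm]
  exact (key e' e he' he h.symm).symm

end Idempotents

end TameLevel

end HeckeTopology

section IntegersOfE

variable {p : ℕ} [Fact p.Prime] (E : IntermediateField ℚ_[p] Ω_[p])
  [FiniteDimensional ℚ_[p] E]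

theorem compactSpace_intE : CompactSpace (intE E) := by
  have h1 : ProperSpace E := FiniteDimensional.proper ℚ_[p] E
  have h2 : ((intE E : Subalgebra ℤ_[p] E) : Set E) = Metric.closedBall 0 1 := by
    ext x
    rw [mem_closedBall_zero_iff]
    exact mem_intE_iff x
  have h3 : IsCompact ((intE E : Subalgebra ℤ_[p] E) : Set E) := by
    rw [h2]
    exact isCompact_closedBall 0 1
  exact isCompact_iff_compactSpace.mp h3

theorem isNoetherianRing_intE : IsNoetherianRing (intE E) :=
  IsIntegralClosure.isNoetherianRing ℤ_[p] ℚ_[p] E (intE E)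

theorem natCast_intE_dvd {a x : intE E} (ha : a ≠ 0) (h : ‖(x : E)‖ ≤ ‖(a : E)‖) : a ∣ x := by
  have ha' : (a : E) ≠ 0 := fun h => ha (Subtype.ext h)
  refine ⟨⟨(a : E)⁻¹ * x, (mem_intE_iff _).mpr ?_⟩, Subtype.ext ?_⟩
  · rw [norm_mul, norm_inv]
    exact inv_mul_le_one_of_le₀ h (norm_nonneg _)
  · exact (mul_inv_cancel_left₀ ha' _).symm

theorem norm_natCast_intE : ‖((p : intE E) : E)‖ = (p : ℝ)⁻¹ := by
  have h1 : ((p : intE E) : E) = algebraMap ℚ_[p] E (p : ℚ_[p]) := by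
    rw [map_natCast]
    rfl
  rw [h1, norm_algebraMap', norm_p]

theorem natCast_intE_ne_zero : (p : intE E) ≠ 0 := by
  intro h
  have := norm_natCast_intE E
  rw [h] at this
  have hp := inv_prime_pos p
  rw [← this] at hp
  exact lt_irrefl _ (hp.trans_eq norm_zero)

theorem finite_intE_quotient : Finite (intE E ⧸ Ideal.span {(p : intE E)}) := by
  have := compactSpace_intE E
  refine AddSubgroup.quotient_finite_of_isOpen (Ideal.span {(p : intE E)}).toAddSubgroup ?_
  have hp := inv_prime_pos p
  refine AddSubgroup.isOpen_of_mem_nhds (g := 0) _ ?_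
  have h1 : Continuous fun x : intE E => ‖(x : E)‖ := continuous_norm.comp continuous_subtype_val
  have h2 : {x : intE E | ‖(x : E)‖ < (p : ℝ)⁻¹} ∈ nhds (0 : intE E) := by
    refine (isOpen_lt h1 continuous_const).mem_nhds ?_
    change ‖(0 : E)‖ < _
    rwa [norm_zero]
  refine Filter.mem_of_superset h2 fun x hx => ?_
  change x ∈ Ideal.span {(p : intE E)}
  rw [mem_span_singleton]
  exact natCast_intE_dvd E (natCast_intE_ne_zero E) (by rw [norm_natCast_intE]; exact le_of_lt hx)

theorem eq_zero_of_forall_pow_dvd {x : intE E} (h : ∀ n, (p : intE E) ^ n ∣ x) : x = 0 := by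
  have hp1 := inv_prime_lt_one p
  have hp0 : (0 : ℝ) ≤ (p : ℝ)⁻¹ := inv_nonneg.mpr (Nat.cast_nonneg p)
  have h1 : ∀ n : ℕ, ‖(x : E)‖ ≤ ((p : ℝ)⁻¹) ^ n := by
    intro n
    obtain ⟨y, rfl⟩ := h n
    change ‖((p : intE E) : E) ^ n * (y : E)‖ ≤ _
    rw [norm_mul, norm_pow, norm_natCast_intE]
    exact mul_le_of_le_one_right (pow_nonneg hp0 n) ((mem_intE_iff _).mp y.2)
  have h2 : ‖(x : E)‖ ≤ 0 :=
    ge_of_tendsto' (tendsto_pow_atTop_nhds_zero_of_lt_one hp0 hp1) h1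
  exact Subtype.ext (norm_le_zero_iff.mp h2)

end IntegersOfE

section Localization

variable [Module.Finite F D]
  {τ : Involution F 𝒦 D} {p : ℕ} [Fact p.Prime] {U : TameLevel τ p}

theorem iInf_classicalCrystallineAt_eq_bot_and_dense [IsTopologicalGroup τ.finAdelic]
    [CompactSpace τ.infinite] {ι : ℂ ≃+* Ω_[p]} (M : AlgebraicModel τ p ι)
    (hU : U.HasFiniteLevels)
    (E : IntermediateField ℚ_[p] Ω_[p]) [FiniteDimensional ℚ_[p] E]
    (𝔪 : Ideal (U.BigHeckeAlg (intE E))) [𝔪.IsMaximal] :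
    (⨅ 𝔭 ∈ classicalCrystallineAt U E ι 𝔪,
      𝔭.asIdeal.map (algebraMap _ (AtPrime 𝔪))) = ⊥ ∧
    Dense (PrimeSpectrum.comap (algebraMap _ (AtPrime 𝔪)) ⁻¹'
      classicalCrystallineAt U E ι 𝔪) := by
  obtain ⟨K₀, hK₀⟩ := M.exists_proP
  have h1 := compactSpace_intE E
  have h2 := isNoetherianRing_intE E
  have h3 := finite_intE_quotient E
  have h4 : IsTopologicalRing (U.BigHeckeAlg (intE E)) :=
    TameLevel.isTopologicalRing_bigHeckeAlg hU.finiteDoubleCosets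
  have h5 : T2Space (U.BigHeckeAlg (intE E)) := TameLevel.t2Space_bigHeckeAlg
  have h6 : CompactSpace (U.BigHeckeAlg (intE E)) :=
    TameLevel.compactSpace_bigHeckeAlg hU.finiteDoubleCosets
  have h7 := TameLevel.finite_idempotents (U := U) (R := intE E)
    (fun x hx => (mul_eq_zero.mp hx).resolve_left (natCast_intE_ne_zero E))
    (fun x hx => eq_zero_of_forall_pow_dvd E hx) (hU.finiteDoubleCosets K₀) hK₀
  obtain ⟨e, he, heC⟩ := exists_idempotent_separating h7 𝔪
  refine iInf_map_localization_eq_bot 𝔪 (classicalCrystalline U E ι) he (fun 𝔭 h𝔭 => heC _ ?_)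
    fun t ht => eq_zero_of_mem_classicalCrystalline M hU E ht
  obtain ⟨lam, π, hlam, -, hker⟩ := h𝔭
  rw [hker]
  exact isClosed_singleton.preimage hlam.1

end Localization

section LocalIntegers

variable {F : Type*} [Field F] [NumberField F] (v : Pl(F))

theorem valued_algebraMap (a : F) :
    Valued.v (algebraMap F K_[F,v] a) = v.valuation F a :=
  HeightOneSpectrum.valuedAdicCompletion_eq_valuation' v a

theorem valued_algebraMap_int (a : 𝓞 F) :
    Valued.v (algebraMap (𝓞 F) K_[F,v] a) = v.intValuation a := by
  rw [IsScalarTower.algebraMap_apply (𝓞 F) F K_[F,v], valued_algebraMap,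
    HeightOneSpectrum.valuation_of_algebraMap]

theorem isOpen_valued_sub_lt (x : K_[F,v]) {c : K_[F,v]} :
    IsOpen {y : K_[F,v] | Valued.v (y - x) < Valued.v c} := by
  have h2 := (Valued.isOpen_ball K_[F,v] (Valued.v.restrict c)).preimage
    (continuous_id.sub continuous_const : Continuous fun y => y - x)
  convert h2 using 1
  ext y
  simp [Valuation.restrict_lt_iff]

theorem exists_valued_sub_lt (x : K_[F,v]) {c : K_[F,v]} (hc : c ≠ 0) :
    ∃ a : F, Valued.v (algebraMap F K_[F,v] a - x) < Valued.v c := by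
  obtain ⟨a, ha⟩ := (HeightOneSpectrum.denseRange_algebraMap F v).exists_mem_open
    (isOpen_valued_sub_lt v x (c := c)) ⟨x, by simpa [zero_lt_iff] using hc⟩
  exact ⟨a, ha⟩

theorem exists_int_valued_sub_lt {x : K_[F,v]} (hx : x ∈ O_[F,v])
    {c : K_[F,v]} (hc : c ≠ 0) (hc1 : Valued.v c ≤ 1) :
    ∃ a : 𝓞 F, Valued.v (algebraMap (𝓞 F) K_[F,v] a - x) < Valued.v c := by
  obtain ⟨b, hb⟩ := exists_valued_sub_lt v x hc
  have hb1 : v.valuation F b ≤ 1 := by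
    rw [← valued_algebraMap]
    have : algebraMap F K_[F,v] b = (algebraMap F K_[F,v] b - x) + x := by
      ring
    rw [this]
    exact (Valuation.map_add _ _ _).trans (max_le (hb.le.trans hc1)
      ((HeightOneSpectrum.mem_adicCompletionIntegers _ _ _).mp hx))
  obtain ⟨a, ha⟩ := v.exists_valuation_sub_lt_of_integer hb1
    (Units.mk0 (Valued.v c) ((Valuation.ne_zero_iff _).mpr hc))
  refine ⟨a, ?_⟩
  have e : algebraMap (𝓞 F) K_[F,v] a - x =
      algebraMap F K_[F,v] (algebraMap (𝓞 F) F a - b) +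
      (algebraMap F K_[F,v] b - x) := by
    rw [map_sub, ← IsScalarTower.algebraMap_apply]
    ring
  rw [e]
  refine Valuation.map_add_lt _ ?_ hb
  rw [valued_algebraMap]
  exact ha

instance compactSpace_integers : CompactSpace O_[F,v] := by
  have h1 : Finite (𝓞 F ⧸ v.asIdeal) := v.asIdeal.finiteQuotientOfFreeOfNeBot v.ne_bot
  have hmem : ∀ x : O_[F,v],
      residue _ x = 0 ↔ Valued.v (x : K_[F,v]) < 1 := fun x => by
    rw [IsLocalRing.residue_eq_zero_iff]
    exact Valuation.mem_maximalIdeal_iff _ Valued.v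
  have hfin : Finite (IsLocalRing.ResidueField O_[F,v]) := by
    let f : 𝓞 F →+* IsLocalRing.ResidueField O_[F,v] :=
      (residue _).comp (algebraMap _ _)
    refine Finite.of_surjective (Ideal.Quotient.lift v.asIdeal f fun a ha => ?_) ?_
    · refine (hmem _).mpr ?_
      change Valued.v (algebraMap (𝓞 F) K_[F,v] a) < 1
      rwa [valued_algebraMap_int, HeightOneSpectrum.intValuation_lt_one_iff_mem]
    · intro y
      obtain ⟨x, rfl⟩ := IsLocalRing.residue_surjective y
      obtain ⟨a, ha⟩ := exists_int_valued_sub_lt v x.2 one_ne_zero (by simp)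
      refine ⟨Ideal.Quotient.mk _ a, ?_⟩
      rw [Ideal.Quotient.lift_mk]
      change residue _ (algebraMap _ _ a) = _
      rw [← sub_eq_zero, ← map_sub, hmem]
      rwa [map_one] at ha
  have hcl : IsClosed (O_[F,v] : Set K_[F,v]) :=
    Valued.isClosed_integer K_[F,v]
  have hcomplete : CompleteSpace O_[F,v] := hcl.completeSpace_coe
  exact (Valued.integer.compactSpace_iff_completeSpace_and_isDiscreteValuationRing_and_finite_residueField
    (K := K_[F,v])).mpr
    ⟨hcomplete, inferInstanceAs (IsDiscreteValuationRing O_[F,v]), hfin⟩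

theorem isOpen_integers : IsOpen (O_[F,v] : Set K_[F,v]) :=
  Valued.isOpen_integer K_[F,v]

end LocalIntegers

section Points

variable (τ : Involution F 𝒦 D) {R : Type*} [CommRing R] [Algebra F R]

/-- The inclusion `U(R) → R ⊗ D`. -/
def Involution.val (g : τ.points R) : R ⊗[F] D := (g : (R ⊗[F] D)ˣ)

theorem Involution.ext_val (g : τ.points R) : τ.ext R (τ.val g) = ((g : (R ⊗[F] D)ˣ)⁻¹ : (R ⊗[F] D)ˣ) := by
  have h : τ.ext R (g : (R ⊗[F] D)ˣ) * (g : (R ⊗[F] D)ˣ) = 1 := g.2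
  rw [← Units.mul_eq_one_iff_eq_inv]
  exact h

theorem Involution.val_inv (g : τ.points R) : τ.val g⁻¹ = τ.ext R (τ.val g) :=
  (τ.ext_val g).symm

theorem Involution.val_mul (g h : τ.points R) : τ.val (g * h) = τ.val g * τ.val h := rfl

theorem Involution.ext_val_mul (g : τ.points R) : τ.ext R (τ.val g) * τ.val g = 1 := g.2

theorem Involution.val_mul_ext (g : τ.points R) : τ.val g * τ.ext R (τ.val g) = 1 := by
  rw [τ.ext_val]
  exact Units.mul_inv _

theorem Involution.val_injective : Injective (τ.val (R := R)) :=
  fun _ _ h => Subtype.ext (Units.ext h)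

variable {τ} in
/-- The point of `U(R)` defined by `x` with `x⋆ x = x x⋆ = 1`. -/
noncomputable def Involution.mkPoint (x : R ⊗[F] D) (h : τ.ext R x * x = 1) (h' : x * τ.ext R x = 1) :
    τ.points R := ⟨⟨x, τ.ext R x, h', h⟩, h⟩

end Points

section Topology

variable {F D : Type*} [Field F] [Ring D] [Algebra F D] [Module.Finite F D]
  (R : Type*) [CommRing R] [Algebra F R] [TopologicalSpace R] [IsTopologicalRing R]

instance isModuleTopology_tensor : IsModuleTopology R (R ⊗[F] D) := ⟨rfl⟩

instance isTopologicalRing_tensor : IsTopologicalRing (R ⊗[F] D) :=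
  IsModuleTopology.isTopologicalRing R (R ⊗[F] D)

instance continuousSMul_tensor : ContinuousSMul R (R ⊗[F] D) :=
  IsModuleTopology.toContinuousSMul R (R ⊗[F] D)

variable {R} in
theorem continuous_of_linear {N : Type*} [AddCommGroup N] [Module R N] [TopologicalSpace N]
    [ContinuousAdd N] [ContinuousSMul R N] (f : (R ⊗[F] D) →ₗ[R] N) : Continuous f :=
  IsModuleTopology.continuous_of_linearMap f

/-- The coordinates of `R ⊗ D` with respect to the fixed basis of `D`. -/
noncomputable def coordHomeo :
    (R ⊗[F] D) ≃ₜ (Fin (finrank F D) → R) where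
  toEquiv := ((finBasis F D).baseChange R).equivFun.toEquiv
  continuous_toFun := by
    have := continuous_of_linear (N := Fin (finrank F D) → R)
      ((finBasis F D).baseChange R).equivFun.toLinearMap
    exact this
  continuous_invFun := by
    have := IsModuleTopology.continuous_of_linearMap (R := R)
      (((finBasis F D).baseChange R).equivFun.symm.toLinearMap :
      (Fin (finrank F D) → R) →ₗ[R] (R ⊗[F] D))
    exact this

theorem coordHomeo_apply (x : R ⊗[F] D) :
    coordHomeo R x = ((finBasis F D).baseChange R).repr x := rfl

instance [T2Space R] : T2Space (R ⊗[F] D) := (coordHomeo (F := F) (D := D) R).symm.t2Space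

variable {R}

theorem continuous_of_semilinear {N S : Type*} [CommRing S] [AddCommGroup N] [Module S N]
    [TopologicalSpace S] [TopologicalSpace N] [ContinuousAdd N] [ContinuousSMul S N] {g : R →+* S}
    (hg : Continuous g) (f : (R ⊗[F] D) →ₛₗ[g] N) : Continuous f := by
  have h1 : ∀ x, f x = ∑ i, g (coordHomeo R x i) • f (1 ⊗ₜ finBasis F D i) := fun x => by
    conv_lhs => rw [← ((finBasis F D).baseChange R).sum_repr x]
    rw [map_sum]
    refine sum_congr rfl fun i _ => ?_
    rw [map_smulₛₗ, Basis.baseChange_apply]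
    rfl
  rw [funext h1]
  refine continuous_finsetSum _ fun i _ => ?_
  exact (hg.comp ((continuous_apply i).comp (coordHomeo R).continuous)).smul continuous_const

variable {𝒦 : Type*} [NumberField F] [Field 𝒦] [NumberField 𝒦] [Algebra F 𝒦]
  [Algebra.IsQuadraticExtension F 𝒦] [Algebra 𝒦 D] (τ : Involution F 𝒦 D)

theorem Involution.continuous_ext : Continuous (τ.ext R) := continuous_of_linear _

theorem Involution.continuous_val : Continuous (τ.val (R := R)) :=
  Units.continuous_val.comp continuous_subtype_val

theorem Involution.isInducing_val : Topology.IsInducing (τ.val (R := R)) := by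
  refine ⟨le_antisymm τ.continuous_val.le_induced ?_⟩
  have h1 : @Continuous _ _ (induced (τ.val (R := R)) inferInstance) _
      (fun g : τ.points R => (g : (R ⊗[F] D)ˣ)) := by
    letI := induced (τ.val (R := R)) inferInstance
    have h2 : Continuous (τ.val (R := R)) := continuous_induced_dom
    refine Units.continuous_iff.mpr ⟨h2, ?_⟩
    refine (τ.continuous_ext.comp h2).congr fun g => ?_
    exact τ.ext_val g
  exact continuous_iff_le_induced.mp h1

theorem Involution.isClosedEmbedding_val [T2Space R] :
    Topology.IsClosedEmbedding (τ.val (R := R)) := by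
  refine ⟨⟨τ.isInducing_val, τ.val_injective⟩, ?_⟩
  have h : Set.range (τ.val (R := R)) =
      {x | τ.ext R x * x = 1} ∩ {x | x * τ.ext R x = 1} := by
    ext x
    constructor
    · rintro ⟨g, rfl⟩
      exact ⟨τ.ext_val_mul g, τ.val_mul_ext g⟩
    · rintro ⟨h, h'⟩
      exact ⟨Involution.mkPoint x h h', rfl⟩
  rw [h]
  exact (isClosed_eq (τ.continuous_ext.mul continuous_id) continuous_const).inter
    (isClosed_eq (continuous_id.mul τ.continuous_ext) continuous_const)

end Topology

section Levels

variable [Module.Finite F D]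
  (τ : Involution F 𝒦 D) (v : Pl(F))

theorem mem_latticeAt {x : K_[F,v] ⊗[F] D} :
    x ∈ latticeAt F D v ↔ ∀ i, coordHomeo _ x i ∈ O_[F,v] := by
  constructor
  · intro hx
    induction hx using span_induction with
    | mem x hx =>
      obtain ⟨j, rfl⟩ := hx
      intro i
      beta_reduce
      rw [coordHomeo_apply, ← Basis.baseChange_apply, Basis.repr_self]
      by_cases h : j = i
      · subst h
        rw [Finsupp.single_eq_same]
        exact one_mem _
      · rw [Finsupp.single_eq_of_ne' h]
        exact zero_mem _
    | zero => intro i; simp [coordHomeo_apply, zero_mem]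
    | add x y _ _ hx hy =>
      intro i
      rw [coordHomeo_apply, map_add, Finsupp.add_apply]
      exact add_mem (hx i) (hy i)
    | smul a x _ hx =>
      intro i
      rw [coordHomeo_apply]
      change ((finBasis F D).baseChange _).repr ((a : K_[F,v]) • x) i ∈ _
      rw [map_smul, Finsupp.smul_apply]
      exact mul_mem a.2 (hx i)
  · intro h
    rw [← ((finBasis F D).baseChange K_[F,v]).sum_repr x]
    refine sum_mem fun i _ => ?_
    rw [Basis.baseChange_apply]
    exact (latticeAt F D v).smul_mem ⟨_, h i⟩ (subset_span ⟨i, rfl⟩)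

theorem isOpen_latticeAt : IsOpen (latticeAt F D v : Set (K_[F,v] ⊗[F] D)) := by
  have h : (latticeAt F D v : Set (K_[F,v] ⊗[F] D)) =
      ⋂ i, {x | coordHomeo _ x i ∈ O_[F,v]} := by
    ext x
    simp [mem_latticeAt]
  rw [h]
  exact isOpen_iInter_of_finite fun i => (isOpen_integers v).preimage
    ((continuous_apply i).comp (coordHomeo K_[F,v]).continuous)

theorem isCompact_latticeAt : IsCompact (latticeAt F D v : Set (K_[F,v] ⊗[F] D)) := by
  have h : (latticeAt F D v : Set (K_[F,v] ⊗[F] D)) =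
      (coordHomeo K_[F,v]).symm ''
        Set.univ.pi fun _ => (O_[F,v] : Set K_[F,v]) := by
    ext x
    rw [(coordHomeo K_[F,v]).symm.image_eq_preimage_symm]
    simp [mem_latticeAt]
  rw [h]
  exact (isCompact_univ_pi fun _ => isCompact_iff_compactSpace.mpr (compactSpace_integers v)).image
    (coordHomeo K_[F,v]).symm.continuous

theorem mem_latticeAt_of_basis {g : K_[F,v] ⊗[F] D}
    (h : ∀ i, g * 1 ⊗ₜ finBasis F D i ∈ latticeAt F D v) {x : K_[F,v] ⊗[F] D}
    (hx : x ∈ latticeAt F D v) : g * x ∈ latticeAt F D v := by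
  induction hx using span_induction with
  | mem x hx =>
    obtain ⟨i, rfl⟩ := hx
    exact h i
  | zero => simp
  | add x y _ _ hx hy => rw [mul_add]; exact add_mem hx hy
  | smul a x _ hx => rw [mul_smul_comm]; exact (latticeAt F D v).smul_mem a hx

theorem mem_integralPoints {g : τ.localPoints v} : g ∈ τ.integralPoints v ↔
    (∀ i, τ.val g * 1 ⊗ₜ finBasis F D i ∈ latticeAt F D v) ∧
    ∀ i, τ.val g⁻¹ * 1 ⊗ₜ finBasis F D i ∈ latticeAt F D v :=
  ⟨fun h => ⟨fun i => h.1 _ (subset_span ⟨i, rfl⟩),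
    fun i => h.2 _ (subset_span ⟨i, rfl⟩)⟩,
    fun h => ⟨fun _ hx => mem_latticeAt_of_basis v h.1 hx,
      fun _ hx => mem_latticeAt_of_basis v h.2 hx⟩⟩

theorem isOpen_integralPoints : IsOpen (τ.integralPoints v : Set (τ.localPoints v)) := by
  have h : (τ.integralPoints v : Set (τ.localPoints v)) =
      (⋂ i, {g | τ.val g * 1 ⊗ₜ finBasis F D i ∈ latticeAt F D v}) ∩
      ⋂ i, {g | τ.val g⁻¹ * 1 ⊗ₜ finBasis F D i ∈ latticeAt F D v} := by
    ext g
    simp [mem_integralPoints]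
  rw [h]
  exact (isOpen_iInter_of_finite fun i => (isOpen_latticeAt v).preimage
      (τ.continuous_val.mul continuous_const)).inter
    (isOpen_iInter_of_finite fun i => (isOpen_latticeAt v).preimage
      ((τ.continuous_val.comp continuous_inv).mul continuous_const))

instance : Fact (∀ v, IsOpen (τ.integralPoints v : Set (τ.localPoints v))) :=
  ⟨isOpen_integralPoints τ⟩

theorem isCompact_of_val_mem {C : Set (K_[F,v] ⊗[F] D)} (hC : IsCompact C)
    {K : Subgroup (τ.localPoints v)} (hK : IsOpen (K : Set (τ.localPoints v)))
    (h : ∀ g ∈ K, τ.val g ∈ C) : IsCompact (K : Set (τ.localPoints v)) :=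
  (τ.isClosedEmbedding_val.isCompact_preimage hC).of_isClosed_subset
    (isClosed_of_isOpen K hK) h

theorem isCompact_integralPoints : IsCompact (τ.integralPoints v : Set (τ.localPoints v)) := by
  let c := ((finBasis F D).repr 1 : Fin (finrank F D) → F)
  have hC : IsCompact ((fun y : Fin (finrank F D) → K_[F,v] ⊗[F] D =>
      ∑ i, algebraMap F K_[F,v] (c i) • y i) ''
      Set.univ.pi fun _ => (latticeAt F D v : Set (K_[F,v] ⊗[F] D))) :=
    (isCompact_univ_pi fun _ => isCompact_latticeAt v).image
      (continuous_finsetSum _ fun i _ => (continuous_const_smul (algebraMap F K_[F,v] (c i))).comp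
        (continuous_apply i))
  refine isCompact_of_val_mem τ v hC (isOpen_integralPoints τ v) fun g hg => ?_
  refine ⟨fun i => τ.val g * 1 ⊗ₜ finBasis F D i,
    fun i _ => ((mem_integralPoints τ v).mp hg).1 i, ?_⟩
  simp only [← mul_smul_comm, ← Finset.mul_sum]
  convert mul_one _
  rw [Algebra.TensorProduct.one_def]
  conv_rhs => rw [← (finBasis F D).sum_repr 1, TensorProduct.tmul_sum]
  refine sum_congr rfl fun i _ => ?_
  rw [← TensorProduct.smul_tmul, TensorProduct.smul_tmul', smul_eq_mul, mul_one, Algebra.smul_def,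
    mul_one]

variable {p : ℕ} {τ} (U : TameLevel τ p) (Kp : PLevel τ p)

theorem TameLevel.isOpen_level : IsOpen (U.level Kp : Set τ.finAdelic) := by
  have hfin := U.eventually_eq
  rw [Filter.eventually_cofinite] at hfin
  refine Subgroup.isOpen_of_mem_nhds _ (g := 1) ?_
  have h1 : IsOpen {g : τ.finAdelic | ∀ v, g v ∈ τ.integralPoints v} :=
    RestrictedProduct.isOpen_forall_mem (isOpen_integralPoints τ)
  have h2 : IsOpen (⋂ v ∈ {v | ¬ U.K v = τ.integralPoints v.1},
      {g : τ.finAdelic | g v.1 ∈ U.K v}) :=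
    hfin.isOpen_biInter fun v _ => (U.isOpen' v).preimage (RestrictedProduct.continuous_eval v.1)
  have h3 : IsOpen {g : τ.finAdelic | (fun v : {v // AboveP p v} => g v.1) ∈ Kp.1} :=
    Kp.2.1.preimage (continuous_pi fun v => RestrictedProduct.continuous_eval v.1)
  refine Filter.mem_of_superset (((h1.inter h2).inter h3).mem_nhds
    ⟨⟨fun v => one_mem _, ?_⟩, Kp.1.one_mem⟩) ?_
  · simp only [Set.mem_iInter]
    exact fun v _ => (U.K v).one_mem
  · rintro g ⟨⟨h1, h2⟩, h3⟩
    refine ⟨h3, fun v => ?_⟩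
    by_cases hv : U.K v = τ.integralPoints v.1
    · rw [hv]
      exact h1 v.1
    · simp only [Set.mem_iInter] at h2
      exact h2 v hv

theorem TameLevel.isCompact_level [Fact p.Prime] : IsCompact (U.level Kp : Set τ.finAdelic) := by
  classical
  have hfin := U.eventually_eq
  rw [Filter.eventually_cofinite] at hfin
  have hp := finite_aboveP F p
  have : CompactSpace Kp.1 := isCompact_iff_compactSpace.mp Kp.2.2
  have : ∀ v, CompactSpace (U.K v) := fun v => isCompact_iff_compactSpace.mp (U.isCompact' v)
  let T : Set Pl(F) :=
    {v | ∃ h : ¬ AboveP p v, U.K ⟨v, h⟩ = τ.integralPoints v}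
  have hT : cofinite ≤ Filter.principal T := by
    rw [Filter.le_principal_iff, Filter.mem_cofinite]
    refine (Set.Finite.union hp (hfin.image Subtype.val)).subset ?_
    intro v hv
    by_cases h : AboveP p v
    · exact Or.inl h
    · exact Or.inr ⟨⟨v, h⟩, fun h' => hv ⟨h, h'⟩, rfl⟩
  let f : Kp.1 × (∀ v, U.K v) → ∀ v, τ.localPoints v := fun k v =>
    if h : AboveP p v then k.1.1 ⟨v, h⟩ else (k.2 ⟨v, h⟩).1
  have hf : ∀ k v, v ∈ T → f k v ∈ τ.integralPoints v := by
    rintro k v ⟨h, hv⟩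
    simp only [f, dif_neg h, ← hv]
    exact (k.2 ⟨v, h⟩).2
  have hfc : Continuous f := by
    refine continuous_pi fun v => ?_
    by_cases h : AboveP p v
    · simp only [f, dif_pos h]
      exact (continuous_apply _).comp (continuous_subtype_val.comp continuous_fst)
    · simp only [f, dif_neg h]
      exact continuous_subtype_val.comp ((continuous_apply _).comp continuous_snd)
  let g : Kp.1 × (∀ v, U.K v) → Πʳ v : Pl(F),
      [τ.localPoints v, τ.integralPoints v]_[Filter.principal T] :=
    fun k => ⟨f k, Filter.eventually_principal.mpr (hf k)⟩
  have hg : Continuous g := RestrictedProduct.continuous_rng_of_principal.mpr hfc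
  have hc : IsCompact (Set.range fun k => RestrictedProduct.inclusion _ _ hT (g k)) :=
    isCompact_range ((RestrictedProduct.continuous_inclusion hT).comp hg)
  refine hc.of_isClosed_subset (isClosed_of_isOpen _ (U.isOpen_level Kp)) fun x hx => ?_
  refine ⟨⟨⟨_, hx.1⟩, fun v => ⟨_, hx.2 v⟩⟩, ?_⟩
  refine RestrictedProduct.ext _ _ fun v => ?_
  change f _ v = x v
  by_cases h : AboveP p v
  · simp only [f, dif_pos h]
  · simp only [f, dif_neg h]

variable (τ) in
/-- The subgroup `∏ U(F_v)_Λ` of `G(𝔸_f)` of all adelic points stabilizing the fixed lattice. -/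
def Involution.integralAdelic : Subgroup τ.finAdelic where
  carrier := {g | ∀ v, g v ∈ τ.integralPoints v}
  one_mem' := fun v => one_mem (τ.integralPoints v)
  mul_mem' := fun ha hb v => mul_mem (ha v) (hb v)
  inv_mem' := fun ha v => inv_mem (ha v)

theorem isOpen_integralAdelic : IsOpen (τ.integralAdelic : Set τ.finAdelic) :=
  RestrictedProduct.isOpen_forall_mem (isOpen_integralPoints τ)

theorem isCompact_integralAdelic : IsCompact (τ.integralAdelic : Set τ.finAdelic) := by
  have : ∀ v, CompactSpace (τ.integralPoints v) :=
    fun v => isCompact_iff_compactSpace.mp (isCompact_integralPoints τ v)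
  have hc := isCompact_range (RestrictedProduct.isEmbedding_structureMap
    (R := fun v => τ.localPoints v) (A := fun v => (τ.integralPoints v : Set (τ.localPoints v)))
    (𝓕 := cofinite)).continuous
  convert hc using 1
  ext x
  constructor
  · exact fun hx => ⟨fun v => ⟨x v, hx v⟩, rfl⟩
  · rintro ⟨y, rfl⟩ v
    exact (y v).2

theorem TameLevel.hasFiniteLevels [Fact p.Prime]
    (h₁ : FiniteDoubleCosets τ.diagFin τ.integralAdelic)
    (h₂ : FiniteStabilizers τ.diagFin τ.integralAdelic) : U.HasFiniteLevels where
  isOpen Kp := U.isOpen_level Kp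
  isCompact Kp := U.isCompact_level Kp
  finiteDoubleCosets Kp := h₁.of_relIndex
    (relIndex_ne_zero_of_isOpen isCompact_integralAdelic (U.isOpen_level Kp))
  finiteStabilizers Kp := h₂.of_relIndex
    (relIndex_ne_zero_of_isOpen (U.isCompact_level Kp) isOpen_integralAdelic)

end Levels

section Lattices

open MeasureTheory Metric

variable {ι : Type} [Fintype ι]

theorem infDist_span_lt [DecidableEq ι] {C m : ℝ} (hC : 0 ≤ C) (hm : 0 < m)
    (b : Basis ι ℝ (ι → ℝ))
    (hb : |(Matrix.of b).det| ≤ C)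
    (hmin : ∀ l ∈ span ℤ (Set.range b), l ≠ 0 → m ≤ ‖l‖) (v : ι → ℝ) :
    infDist v (span ℤ (Set.range b) : Set (ι → ℝ)) <
      (C / m ^ card ι + 2) * m := by
  set L := span ℤ (Set.range b) with hL
  have hne : (L : Set (ι → ℝ)).Nonempty := ⟨0, zero_mem L⟩
  by_contra! hD
  set K : ℕ := ⌊C / m ^ card ι⌋₊ + 1 with hK
  have hKC : C < K * m ^ card ι := by
    rw [← div_lt_iff₀ (by positivity), hK]
    exact_mod_cast Nat.lt_floor_add_one _
  have hKD : K * m ≤ infDist v L := by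
    refine le_trans (mul_le_mul_of_nonneg_right ?_ hm.le) hD
    have := Nat.floor_le (a := C / m ^ card ι) (by positivity)
    rw [hK]
    push_cast
    linarith
  have hinv : ∀ x : ι → ℝ, ∀ l ∈ L, infDist (l + x) L =
      infDist x L := by
    have key : ∀ x : ι → ℝ, ∀ l ∈ L, infDist (l + x) L ≤
        infDist x L := fun x l hl => by
      refine (le_infDist hne).mpr fun y hy => ?_
      refine (infDist_le_dist_of_mem (add_mem hl hy : l + y ∈ L)).trans ?_
      rw [dist_add_left]
    intro x l hl
    refine le_antisymm (key x l hl) ?_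
    have := key (l + x) (-l) (neg_mem hl)
    rwa [neg_add_cancel_left] at this
  have hw : ∀ k : Fin K, ∃ w : ι → ℝ, infDist w L = k * m := fun k => by
    have hc : ContinuousOn (fun t : ℝ => infDist (t • v) L) (Set.Icc 0 1) :=
      ((continuous_infDist_pt _).comp (continuous_id.smul continuous_const)).continuousOn
    have := intermediate_value_Icc zero_le_one hc
    have h0 : infDist ((0 : ℝ) • v) L = 0 := by
      rw [zero_smul]
      exact infDist_zero_of_mem (zero_mem L)
    obtain ⟨t, -, ht⟩ := this (a := k * m) ⟨by rw [h0]; positivity, by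
      rw [one_smul]
      refine le_trans (mul_le_mul_of_nonneg_right ?_ hm.le) hKD
      exact_mod_cast k.2.le⟩
    exact ⟨t • v, ht⟩
  choose w hw using hw
  have hsep : ∀ k l : Fin K, ∀ x y : ι → ℝ, x ∈ ball (w k) (m / 2) → y ∈ ball (w l) (m / 2) →
      infDist x L = infDist y L → k = l := by
    intro k l x y hx hy h
    have h1 : ∀ k x, x ∈ ball (w k) (m / 2) →
        |infDist x L - k * m| < m / 2 := fun k x hx => by
      rw [← hw k, abs_lt]
      have a1 := infDist_le_infDist_add_dist (s := (L : Set (ι → ℝ))) (x := x) (y := w k)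
      have a2 := infDist_le_infDist_add_dist (s := (L : Set (ι → ℝ))) (x := w k) (y := x)
      rw [mem_ball] at hx
      rw [dist_comm (w k) x] at a2
      constructor <;> linarith
    have h2 := h1 k x hx
    have h3 := h1 l y hy
    rw [h, abs_lt] at h2
    rw [abs_lt] at h3
    have h4 : |((k : ℕ) : ℝ) - (l : ℕ)| < 1 := by
      rw [abs_lt]
      constructor <;> nlinarith
    have h5 : |((k : ℕ) : ℤ) - (l : ℕ)| < 1 := by exact_mod_cast h4
    rw [Int.abs_lt_one_iff] at h5
    exact Fin.ext (by omega)
  have hvol : volume (⋃ k, ball (w k) (m / 2)) = ENNReal.ofReal (K * m ^ card ι) := by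
    rw [measure_iUnion]
    · simp only [Real.volume_pi_ball _ (half_pos hm), tsum_fintype, Finset.sum_const,
        Finset.card_univ, Fintype.card_fin]
      rw [mul_div_cancel₀ m two_ne_zero, ENNReal.ofReal_mul (by positivity), nsmul_eq_mul,
        ENNReal.ofReal_natCast]
    · intro k l hkl
      refine Set.disjoint_left.mpr fun x hx hy => hkl (hsep k l x x hx hy rfl)
    · exact fun k => measurableSet_ball
  have hlt : volume (ZSpan.fundamentalDomain b) < volume (⋃ k, ball (w k) (m / 2)) := by
    rw [hvol, ZSpan.volume_fundamentalDomain]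
    exact (ENNReal.ofReal_lt_ofReal_iff (by positivity)).mpr (hb.trans_lt hKC)
  have : Countable (span ℤ (Set.range b)).toAddSubgroup :=
    inferInstanceAs (Countable (span ℤ (Set.range b)))
  obtain ⟨x, y, hxy, hd⟩ := exists_pair_mem_lattice_not_disjoint_vadd
    (ZSpan.isAddFundamentalDomain' b volume)
    (MeasurableSet.iUnion fun k => measurableSet_ball).nullMeasurableSet hlt
  rw [Set.not_disjoint_iff] at hd
  obtain ⟨z, ⟨x', hx', ex⟩, ⟨y', hy', ey⟩⟩ := hd
  obtain ⟨k, hk⟩ := Set.mem_iUnion.mp hx'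
  obtain ⟨l, hl⟩ := Set.mem_iUnion.mp hy'
  have ex' : (x : ι → ℝ) + x' = z := ex
  have ey' : (y : ι → ℝ) + y' = z := ey
  have hkl : k = l := hsep k l x' y' hk hl (by
    rw [← hinv x' x x.2, ← hinv y' y y.2, ex', ey'])
  subst hkl
  refine (hmin (x - y) (sub_mem x.2 y.2) (fun h => hxy (Subtype.ext (sub_eq_zero.mp h)))).not_gt ?_
  have h6 : (x : ι → ℝ) - y = y' - x' := by rw [sub_eq_sub_iff_add_eq_add, ex', ← ey', add_comm]
  rw [h6, ← dist_eq_norm]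
  refine (dist_triangle_right _ _ (w k)).trans_lt ?_
  rw [mem_ball] at hk hl
  linarith

theorem exists_generators_real [DecidableEq ι] {C m : ℝ} (hC : 0 ≤ C) (hm : 0 < m) :
    ∃ (Q : Type) (_ : Finite Q) (ρ : ℝ), ∀ b : Basis ι ℝ (ι → ℝ),
      |(Matrix.of b).det| ≤ C →
      (∀ l ∈ span ℤ (Set.range b), l ≠ 0 → m ≤ ‖l‖) →
      ∃ s : Q → ι → ℝ, span ℤ (Set.range s) = span ℤ (Set.range b) ∧
        ∀ q, ‖s q‖ ≤ ρ := by
  set r := (C / m ^ card ι + 2) * m with hr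
  have hr0 : 0 < r := by positivity
  set B : ℤ := ⌈2 * (4 * r) / m⌉ + 1 with hB
  refine ⟨ι → Icc (-B) B, inferInstance, 4 * r, fun b hb hmin => ?_⟩
  classical
  set L := span ℤ (Set.range b) with hL
  have hcov := infDist_span_lt hC hm b hb hmin
  have hne : (L : Set (ι → ℝ)).Nonempty := ⟨0, zero_mem L⟩
  let S : Set (ι → ℝ) := {l | l ∈ L ∧ ‖l‖ ≤ 4 * r}
  have hgen : ∀ N : ℕ, ∀ l ∈ L, ‖l‖ ≤ 4 * r * (4 / 3) ^ N → l ∈ span ℤ S := by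
    intro N
    induction N with
    | zero =>
      intro l hl h
      exact subset_span ⟨hl, by simpa using h⟩
    | succ N ih =>
      intro l hl h
      by_cases hs : ‖l‖ ≤ 4 * r
      · exact subset_span ⟨hl, hs⟩
      push Not at hs
      obtain ⟨x, hx, hd⟩ := (infDist_lt_iff hne).mp (hcov ((1 / 2 : ℝ) • l))
      rw [dist_eq_norm] at hd
      have hhalf : ‖(1 / 2 : ℝ) • l‖ = ‖l‖ / 2 := by
        rw [norm_smul, Real.norm_of_nonneg (by norm_num)]; ring
      have hN : ‖l‖ / 2 + r ≤ 4 * r * (4 / 3) ^ N := by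
        rw [pow_succ] at h
        linarith
      have hx1 : ‖x‖ ≤ ‖l‖ / 2 + r := by
        have : x = (1 / 2 : ℝ) • l - ((1 / 2 : ℝ) • l - x) := by abel
        rw [this]
        refine (norm_sub_le _ _).trans ?_
        rw [hhalf]
        linarith
      have hx2 : ‖l - x‖ ≤ ‖l‖ / 2 + r := by
        have : l - x = (1 / 2 : ℝ) • l + ((1 / 2 : ℝ) • l - x) := by
          rw [← add_sub_assoc, ← add_smul]; norm_num
        rw [this]
        refine (norm_add_le _ _).trans ?_
        rw [hhalf]
        linarith
      have := add_mem (ih x hx (hx1.trans hN)) (ih (l - x) (sub_mem hl hx) (hx2.trans hN))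
      rwa [add_sub_cancel] at this
  let fl : (ι → ℝ) → ι → ℤ := fun l i => ⌊2 * l i / m⌋
  have hfl : ∀ l ∈ S, ∀ i, fl l i ∈ Icc (-B) B := by
    rintro l ⟨-, hl⟩ i
    have h1 : |l i| ≤ 4 * r := (norm_le_pi_norm l i).trans hl
    rw [abs_le] at h1
    have h2 := Int.le_ceil (2 * (4 * r) / m)
    rw [Finset.mem_Icc]
    constructor
    · rw [Int.le_floor, hB]
      push_cast
      have : -(2 * (4 * r) / m) ≤ 2 * l i / m := by
        rw [← neg_div]
        gcongr
        linarith
      linarith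
    · refine Int.floor_le_iff.mpr ?_
      rw [hB]
      push_cast
      have : 2 * l i / m ≤ 2 * (4 * r) / m := by
        gcongr
        linarith
      linarith
  have hinj : ∀ l ∈ S, ∀ l' ∈ S, fl l = fl l' → l = l' := by
    rintro l ⟨hl, -⟩ l' ⟨hl', -⟩ h
    by_contra hne
    refine (hmin (l - l') (sub_mem hl hl') (sub_ne_zero.mpr hne)).not_gt ?_
    refine (pi_norm_lt_iff hm).mpr fun i => ?_
    have h1 := Int.abs_sub_lt_one_of_floor_eq_floor (congrFun h i)
    rw [← sub_div, ← mul_sub, abs_div, abs_of_pos hm, div_lt_one hm, abs_mul,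
      abs_of_pos two_pos] at h1
    rw [Pi.sub_apply, Real.norm_eq_abs]
    have := abs_nonneg (l i - l' i)
    linarith
  let s : (ι → Icc (-B) B) → ι → ℝ := fun q =>
    if h : ∃ l ∈ S, fl l = fun i => (q i : ℤ) then h.choose else 0
  have hs : ∀ q, s q ∈ S := fun q => by
    by_cases h : ∃ l ∈ S, fl l = fun i => (q i : ℤ)
    · simp only [s, dif_pos h]
      exact h.choose_spec.1
    · simp only [s, dif_neg h]
      exact ⟨zero_mem L, by rw [norm_zero]; positivity⟩
  have hs' : ∀ l ∈ S, ∃ q, s q = l := fun l hl => by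
    have h : ∃ l' ∈ S, fl l' = fun i => ((⟨fl l i, hfl l hl i⟩ : Icc (-B) B) : ℤ) :=
      ⟨l, hl, rfl⟩
    refine ⟨fun i => ⟨fl l i, hfl l hl i⟩, ?_⟩
    simp only [s]
    rw [dif_pos h]
    exact hinj _ h.choose_spec.1 _ hl h.choose_spec.2
  refine ⟨s, le_antisymm ?_ ?_, fun q => (hs q).2⟩
  · rw [span_le]
    rintro _ ⟨q, rfl⟩
    exact (hs q).1
  · have hSs : S ⊆ Set.range s := fun l hl => hs' l hl
    intro l hl
    obtain ⟨N, hN⟩ := pow_unbounded_of_one_lt (‖l‖ / (4 * r)) (by norm_num : (1 : ℝ) < 4 / 3)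
    refine Submodule.span_mono hSs (hgen N l hl ?_)
    rw [div_lt_iff₀ (by positivity)] at hN
    linarith

end Lattices

section RationalLattices

variable {W : Type*} [AddCommGroup W] [Module ℚ W]

theorem exists_diagonal_basis [FiniteDimensional ℚ W] (β : BilinForm ℚ W)
    (hsymm : ∀ x y, β x y = β y x) (hpos : ∀ x, x ≠ 0 → 0 < β x x) :
    ∃ (n : ℕ) (e : Basis (Fin n) ℚ W) (c : Fin n → ℚ), (∀ i, 0 < c i) ∧
      ∀ x y, β x y = ∑ i, c i * (e.repr x i * e.repr y i) := by
  have : Invertible (2 : ℚ) := invertibleOfNonzero two_ne_zero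
  obtain ⟨e, he⟩ := BilinForm.exists_orthogonal_basis (B := β) ⟨fun x y => hsymm x y⟩
  refine ⟨_, e, fun i => β (e i) (e i), fun i => hpos _ (e.ne_zero i), fun x y => ?_⟩
  conv_lhs => rw [← e.sum_repr x, ← e.sum_repr y]
  simp only [map_sum, LinearMap.sum_apply, map_smul, LinearMap.smul_apply, smul_eq_mul]
  refine sum_congr rfl fun i _ => ?_
  rw [sum_eq_single i]
  · ring
  · intro j _ hj
    have : β (e j) (e i) = 0 := he hj
    rw [this]
    ring
  · simp

variable {n : ℕ} (e : Basis (Fin n) ℚ W)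

theorem finite_bounded_mem {L : Submodule ℤ W} (hL : L.FG) (R : ℚ) :
    {w | w ∈ L ∧ ∀ i, |e.repr w i| ≤ R}.Finite := by
  obtain ⟨S, rfl⟩ := hL
  -- a common denominator of the coordinates
  let N : ℕ := ∏ w ∈ S, ∏ i, (e.repr w i).den
  have hN : 0 < N := Finset.prod_pos fun w _ => Finset.prod_pos fun i _ => (e.repr w i).pos
  have hint : ∀ w ∈ span ℤ (S : Set W), ∀ i, ∃ z : ℤ, (N : ℚ) * e.repr w i = z := by
    intro w hw i
    induction hw using span_induction with
    | mem w hw =>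
      obtain ⟨k, hk⟩ : (e.repr w i).den ∣ N :=
        (Finset.dvd_prod_of_mem (fun i => (e.repr w i).den) (mem_univ i)).trans
          (Finset.dvd_prod_of_mem (fun w => ∏ i, (e.repr w i).den) hw)
      refine ⟨k * (e.repr w i).num, ?_⟩
      rw [hk]
      push_cast
      conv_lhs => rw [mul_right_comm, mul_comm ((e.repr w i).den : ℚ), Rat.mul_den_eq_num, mul_comm]
    | zero => exact ⟨0, by simp⟩
    | add x y _ _ hx hy =>
      obtain ⟨a, ha⟩ := hx
      obtain ⟨b, hb⟩ := hy
      exact ⟨a + b, by rw [map_add, Finsupp.add_apply, mul_add, ha, hb]; push_cast; rfl⟩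
    | smul k x _ hx =>
      obtain ⟨a, ha⟩ := hx
      refine ⟨k * a, ?_⟩
      rw [← Int.cast_smul_eq_zsmul ℚ, map_smul, Finsupp.smul_apply, smul_eq_mul]
      push_cast
      rw [← ha]
      ring
  choose! z hz using hint
  refine Set.Finite.of_finite_image (f := z)
    ((Set.Finite.pi' fun i : Fin n => Set.finite_Icc (-⌈N * R⌉) ⌈N * R⌉).subset ?_) ?_
  · rintro _ ⟨w, ⟨hw, hb⟩, rfl⟩ i
    have h1 := hb i
    have h2 := hz w hw i
    have h3 : |(z w i : ℚ)| ≤ N * R := by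
      rw [← h2, abs_mul, Nat.abs_cast]
      gcongr
    rw [← Int.cast_abs] at h3
    have h4 : |z w i| ≤ ⌈N * R⌉ := by
      exact_mod_cast h3.trans (Int.le_ceil _)
    rwa [abs_le] at h4
  · rintro w ⟨hw, -⟩ w' ⟨hw', -⟩ h
    refine e.repr.injective (Finsupp.ext fun i => ?_)
    have h1 := hz w hw i
    rw [h, ← hz w' hw' i] at h1
    exact mul_left_cancel₀ (by exact_mod_cast hN.ne') h1

/-- A lattice in a rational vector space has a basis. -/

theorem exists_basis_of_lattice (e : Basis (Fin n) ℚ W) [FiniteDimensional ℚ W] {L : Submodule ℤ W} (hL : L.FG)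
    (hspan : span ℚ (L : Set W) = ⊤) :
    ∃ b : Basis (Fin n) ℚ W, span ℤ (Set.range b) = L := by
  have : Module.Finite ℤ L := iff_fg.mpr hL
  have : Module.IsTorsionFree ℤ W := Module.IsTorsionFree.trans_faithfulSMul ℤ ℚ W
  have : Free ℤ L := inferInstance
  let c := Free.chooseBasis ℤ L
  have h1 : LinearIndependent ℤ fun i => (c i : W) :=
    c.linearIndependent.map' L.subtype (Submodule.ker_subtype L)
  have h2 : LinearIndependent ℚ fun i => (c i : W) :=
    (LinearIndependent.iff_fractionRing ℤ ℚ).mp h1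
  have h3 : span ℤ (Set.range fun i => (c i : W)) = L := by
    have : (Set.range fun i => (c i : W)) = L.subtype '' Set.range c := by
      rw [← Set.range_comp]; rfl
    rw [this, Submodule.span_image, c.span_eq, Submodule.map_top, Submodule.range_subtype]
  have h4 : ⊤ ≤ span ℚ (Set.range fun i => (c i : W)) := by
    rw [← hspan, span_le]
    intro w hw
    have hw' : w ∈ span ℤ (Set.range fun i => (c i : W)) := by rw [h3]; exact hw
    exact Submodule.span_subset_span ℤ ℚ _ hw'
  let b := Basis.mk h2 h4
  let b' := b.reindex (b.indexEquiv e)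
  refine ⟨b', ?_⟩
  rw [Basis.range_reindex, Basis.coe_mk, h3]

/-- A lattice which is almost self-dual for a positive definite form is generated by a set of
vectors which is bounded, and whose cardinality is bounded, independently of the lattice. -/
theorem exists_generators [FiniteDimensional ℚ W] {c : Fin n → ℚ} (hc : ∀ i, 0 < c i)
    {β : BilinForm ℚ W}
    (hβ : ∀ x y, β x y = ∑ i, c i * (e.repr x i * e.repr y i)) {M : ℕ} (hM : 0 < M) :
    ∃ (Q : Type) (_ : Finite Q) (R : ℚ), ∀ L : Submodule ℤ W, L.FG →
      span ℚ (L : Set W) = ⊤ →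
      (∀ x ∈ L, ∀ y ∈ L, ∃ z : ℤ, M * β x y = z) →
      (∀ x, (∀ y ∈ L, ∃ z : ℤ, β x y = z) → (M : ℤ) • x ∈ L) →
      ∃ s : Q → W, span ℤ (Set.range s) = L ∧ ∀ q i, |e.repr (s q) i| ≤ R := by
  classical
  have hpos : ∀ x, x ≠ 0 → 0 < β x x := fun x hx => by
    rw [hβ]
    have : ∃ i, e.repr x i ≠ 0 := by
      by_contra! h
      exact hx (e.repr.map_eq_zero_iff.mp (Finsupp.ext h))
    obtain ⟨i, hi⟩ := this
    refine Finset.sum_pos' (fun i _ => mul_nonneg (hc i).le (mul_self_nonneg _)) ⟨i, mem_univ i, ?_⟩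
    exact mul_pos (hc i) (mul_self_pos.mpr hi)
  have hsymm : ∀ x y, β x y = β y x := fun x y => by
    rw [hβ, hβ]
    exact sum_congr rfl fun i _ => by ring
  have hnd : β.Nondegenerate := by
    have h0 : ∀ x, (∀ y, β x y = 0) → x = 0 := fun x h => by
      by_contra hx
      exact (hpos x hx).ne' (h x)
    exact ⟨h0, fun x h => h0 x fun y => by rw [hsymm]; exact h y⟩
  set P : ℚ := ∏ i, c i with hP
  have hP0 : 0 < P := Finset.prod_pos fun i _ => hc i
  set C : ℚ := 1 + M ^ n / P with hC
  set c' : ℚ := ∑ i, c i with hc'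
  have hc'0 : 0 ≤ c' := sum_nonneg fun i _ => (hc i).le
  have hM' : (0 : ℚ) < M := by exact_mod_cast hM
  set m : ℚ := 1 / (1 + M * (c' + 1)) with hm
  have hm0 : 0 < m := by positivity
  have hm1 : m ≤ 1 := by
    rw [hm]
    exact div_le_one_of_le₀ (by nlinarith [mul_nonneg hM'.le hc'0]) (by positivity)
  have hmc : M * (c' * m) < 1 := by
    rw [hm, ← mul_div_assoc, ← mul_div_assoc, mul_one, div_lt_one (by positivity)]
    nlinarith
  obtain ⟨Q, hQ, ρ, h⟩ := exists_generators_real (ι := Fin n) (C := (C : ℝ)) (m := (m : ℝ))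
    (by have : 0 ≤ C := by positivity
        exact_mod_cast this) (by exact_mod_cast hm0)
  obtain ⟨R, hR⟩ := exists_rat_gt ρ
  refine ⟨Q, hQ, R, fun L hfg hspan hint hdual => ?_⟩
  obtain ⟨b, hb⟩ := exists_basis_of_lattice e hfg hspan
  have hbL : ∀ i, b i ∈ L := fun i => by rw [← hb]; exact subset_span ⟨i, rfl⟩
  -- the determinant
  let A : Matrix (Fin n) (Fin n) ℚ := Matrix.of fun i k => e.repr (b i) k
  let G : Matrix (Fin n) (Fin n) ℚ := Matrix.of fun i j => β (b i) (b j)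
  have hG : G = A * Matrix.diagonal c * A.transpose := by
    ext i j
    rw [Matrix.mul_apply]
    simp only [G, Matrix.of_apply, hβ, Matrix.mul_diagonal, Matrix.transpose_apply, A]
    exact sum_congr rfl fun k _ => by ring
  have hdetG : G.det = A.det * A.det * P := by
    rw [hG, Matrix.det_mul, Matrix.det_mul, Matrix.det_transpose, Matrix.det_diagonal]
    ring
  let bd := β.dualBasis hnd b
  have hbd : ∀ i j, β (bd i) (b j) = if j = i then 1 else 0 :=
    BilinForm.apply_dualBasis_left hnd b
  have hbdL : ∀ i, (M : ℤ) • bd i ∈ L := fun i => by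
    refine hdual _ fun y hy => ?_
    rw [← hb] at hy
    induction hy using span_induction with
    | mem y hy =>
      obtain ⟨j, rfl⟩ := hy
      rw [hbd]
      split_ifs
      · exact ⟨1, by simp⟩
      · exact ⟨0, by simp⟩
    | zero => exact ⟨0, by simp⟩
    | add x y _ _ hx hy =>
      obtain ⟨z, hz⟩ := hx
      obtain ⟨z', hz'⟩ := hy
      exact ⟨z + z', by rw [map_add, hz, hz']; push_cast; rfl⟩
    | smul k x _ hx =>
      obtain ⟨z, hz⟩ := hx
      exact ⟨k * z, by rw [map_zsmul, hz, zsmul_eq_mul]; push_cast; rfl⟩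
  have hcomb : ∀ i, ∃ a : Fin n → ℤ, ∑ k, a k • b k = (M : ℤ) • bd i := fun i => by
    have := hbdL i
    rw [← hb] at this
    exact (Submodule.mem_span_range_iff_exists_fun ℤ).mp this
  choose a ha using hcomb
  have hCG : (Matrix.of a).map (Int.cast : ℤ → ℚ) * G = (M : ℚ) • (1 : Matrix (Fin n) (Fin n) ℚ) := by
    ext i j
    have h1 : β ((M : ℤ) • bd i) (b j) = if j = i then (M : ℚ) else 0 := by
      rw [map_zsmul, LinearMap.smul_apply, hbd]
      split_ifs <;> simp
    rw [← ha, map_sum, LinearMap.sum_apply] at h1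
    simp only [map_zsmul, LinearMap.smul_apply, zsmul_eq_mul] at h1
    simp only [Matrix.mul_apply, Matrix.map_apply, Matrix.of_apply, G, h1, Matrix.smul_apply,
      Matrix.one_apply, eq_comm (a := j), smul_eq_mul]
    split_ifs <;> simp
  have hdet : ((Matrix.of a).det : ℚ) * G.det = M ^ n := by
    have := congrArg Matrix.det hCG
    rw [Matrix.det_mul, Matrix.det_smul, Matrix.det_one, mul_one, Fintype.card_fin] at this
    rw [← this]
    congr 1
    exact Int.cast_det (Matrix.of a)
  have hdetA : |A.det| ≤ C := by
    have h1 : (Matrix.of a).det ≠ 0 := by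
      intro h0
      rw [h0, Int.cast_zero, zero_mul] at hdet
      exact (pow_pos hM' n).ne hdet
    have h2 : (1 : ℚ) ≤ |((Matrix.of a).det : ℚ)| := by
      exact_mod_cast Int.one_le_abs h1
    have h3 : |A.det| * |A.det| * P ≤ M ^ n := by
      have h4 : |A.det| * |A.det| * P = |G.det| := by
        rw [hdetG, abs_mul, abs_mul, abs_of_pos hP0]
      have h5 : (M : ℚ) ^ n = |((Matrix.of a).det : ℚ)| * |G.det| := by
        rw [← abs_mul, hdet, abs_of_pos (pow_pos hM' n)]
      rw [h4, h5]
      exact le_mul_of_one_le_left (abs_nonneg _) h2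
    rw [← le_div_iff₀ hP0] at h3
    rw [hC]
    nlinarith [abs_nonneg A.det]
  -- passage to real coordinates
  let Φ : W →+ (Fin n → ℝ) :=
    { toFun := fun w i => (e.repr w i : ℝ)
      map_zero' := by ext; simp
      map_add' := fun x y => by ext; simp }
  have hΦ : ∀ w i, Φ w i = (e.repr w i : ℝ) := fun _ _ => rfl
  have hΦinj : Injective Φ := fun x y h => by
    refine e.repr.injective (Finsupp.ext fun i => ?_)
    have := congrFun h i
    rw [hΦ, hΦ] at this
    exact_mod_cast this
  have hAR : Matrix.of (fun i => Φ (b i)) = A.map (Rat.castHom ℝ) := by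
    ext i k
    rfl
  have hAdet : (Matrix.of (fun i => Φ (b i))).det = (A.det : ℝ) := by
    rw [hAR]
    exact (RingHom.map_det (Rat.castHom ℝ) A).symm
  have hA0 : A.det ≠ 0 := by
    intro h0
    rw [h0, zero_mul, zero_mul] at hdetG
    rw [hdetG, mul_zero] at hdet
    exact (pow_pos hM' n).ne hdet
  have hli : LinearIndependent ℝ fun i => Φ (b i) := by
    have h1 : IsUnit (Matrix.of (fun i => Φ (b i))) := by
      rw [Matrix.isUnit_iff_isUnit_det, hAdet]
      exact (isUnit_iff_ne_zero.mpr (by exact_mod_cast hA0))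
    exact Matrix.linearIndependent_rows_iff_isUnit.mpr h1
  let bR : Basis (Fin n) ℝ (Fin n → ℝ) :=
    basisOfLinearIndependentOfCardEqFinrank' _ hli (by simp)
  have hbR : (bR : Fin n → Fin n → ℝ) = fun i => Φ (b i) := by
    simp [bR]
  have hspanR : ∀ {κ : Type} (s : κ → W), span ℤ (Set.range fun q => Φ (s q)) =
      (span ℤ (Set.range s)).map Φ.toIntLinearMap := fun s => by
    rw [Submodule.map_span, ← Set.range_comp]
    rfl
  have hLR : span ℤ (Set.range bR) = L.map Φ.toIntLinearMap := by
    rw [hbR, hspanR, hb]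
  obtain ⟨s, hs, hsρ⟩ := h bR (by
      rw [hbR, hAdet, ← Rat.cast_abs]
      exact_mod_cast hdetA) (by
    rw [hLR]
    rintro _ ⟨w, hw, rfl⟩ hw0
    have hw0' : w ≠ 0 := by
      rintro rfl
      exact hw0 (map_zero _)
    by_contra! hlt
    have h1 : ∀ i, |e.repr w i| < m := fun i => by
      have := (norm_le_pi_norm (Φ w) i).trans_lt hlt
      rw [hΦ, Real.norm_eq_abs, ← Rat.cast_abs] at this
      exact_mod_cast this
    obtain ⟨z, hz⟩ := hint w hw w hw
    have h2 : 0 < M * β w w := mul_pos hM' (hpos w hw0')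
    have h3 : (1 : ℚ) ≤ M * β w w := by
      rw [hz] at h2 ⊢
      have : 0 < z := by exact_mod_cast h2
      exact_mod_cast this
    have h4 : β w w ≤ c' * m := by
      rw [hβ, hc', Finset.sum_mul]
      refine Finset.sum_le_sum fun i _ => mul_le_mul_of_nonneg_left ?_ (hc i).le
      rw [← abs_mul_abs_self]
      have := h1 i
      nlinarith [abs_nonneg (e.repr w i)]
    nlinarith)
  have hsL : ∀ q, ∃ w ∈ L, Φ w = s q := fun q => by
    have : s q ∈ L.map Φ.toIntLinearMap := by
      rw [← hLR, ← hs]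
      exact subset_span ⟨q, rfl⟩
    exact this
  choose t ht hts using hsL
  refine ⟨t, ?_, fun q i => ?_⟩
  · have h1 : (span ℤ (Set.range t)).map Φ.toIntLinearMap = L.map Φ.toIntLinearMap := by
      rw [← hspanR, ← hLR, ← hs]
      congr 2
      exact funext hts
    exact Submodule.map_injective_of_injective (f := Φ.toIntLinearMap) hΦinj h1
  · have h1 := (norm_le_pi_norm (s q) i).trans ((hsρ q).trans hR.le)
    rw [← hts, hΦ, Real.norm_eq_abs, ← Rat.cast_abs] at h1
    exact_mod_cast h1

end RationalLattices

/-- The trace of the left regular representation. -/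
noncomputable def regTrace (R A : Type*) [CommRing R] [Ring A] [Algebra R A] : A →ₗ[R] R :=
  LinearMap.trace R A ∘ₗ (lmul R A).toLinearMap

theorem regTrace_apply {R A : Type*} [CommRing R] [Ring A] [Algebra R A] (a : A) :
    regTrace R A a = LinearMap.trace R A (lmul R A a) := rfl

theorem regTrace_mul_comm {R A : Type*} [CommRing R] [Ring A] [Algebra R A] (a b : A) :
    regTrace R A (a * b) = regTrace R A (b * a) := by
  rw [regTrace_apply, regTrace_apply, map_mul (lmul R A), map_mul (lmul R A),
    LinearMap.trace_mul_comm]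

theorem isUnit_of_isUnit_lmul {R A : Type*} [CommRing R] [Ring A] [Algebra R A] {a : A}
    (h : IsUnit (lmul R A a)) : IsUnit a := by
  obtain ⟨h1, h2⟩ := (End.isUnit_iff _).mp h
  obtain ⟨b, hb⟩ := h2 1
  have hb : a * b = 1 := hb
  refine ⟨⟨a, b, hb, h1 ?_⟩, rfl⟩
  change a * (b * a) = a * 1
  rw [← mul_assoc, hb, one_mul, mul_one]

section InvariantForm

open MeasureTheory

variable {A : Type*} [AddCommGroup A] [Module ℝ A] [FiniteDimensional ℝ A]

theorem exists_invariant_form {G : Type*} [Group G] [TopologicalSpace G] [IsTopologicalGroup G]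
    [CompactSpace G] (ρ : G →* End ℝ A)
    (hρ : ∀ a (f : A →ₗ[ℝ] ℝ), Continuous fun g => f (ρ g a)) :
    ∃ B : BilinForm ℝ A, (∀ a b, B a b = B b a) ∧ (∀ a, a ≠ 0 → 0 < B a a) ∧
      ∀ g a b, B (ρ g a) (ρ g b) = B a b := by
  letI : MeasurableSpace G := borel G
  haveI : BorelSpace G := ⟨rfl⟩
  let e := finBasis ℝ A
  let c : G → A → A → ℝ := fun g a b => ∑ i, e.repr (ρ g⁻¹ a) i * e.repr (ρ g⁻¹ b) i
  have hc : ∀ a b, Continuous fun g => c g a b := fun a b => by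
    refine continuous_finsetSum _ fun i _ => ?_
    exact ((hρ a (e.coord i)).comp continuous_inv).mul ((hρ b (e.coord i)).comp continuous_inv)
  have hint : ∀ a b, Integrable (fun g => c g a b) (Measure.haar : Measure G) := fun a b =>
    (hc a b).integrable_of_hasCompactSupport (of_compactSpace _)
  have hadd : ∀ g a a' b, c g (a + a') b = c g a b + c g a' b := fun g a a' b => by
    simp only [c, map_add, Finsupp.add_apply, add_mul, Finset.sum_add_distrib]
  have hsmul : ∀ g (r : ℝ) a b, c g (r • a) b = r * c g a b := fun g r a b => by
    simp only [c, map_smul, Finsupp.smul_apply, smul_eq_mul, Finset.mul_sum, mul_assoc]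
  have hsymm : ∀ g a b, c g a b = c g b a := fun g a b => by
    simp only [c, mul_comm]
  let B : BilinForm ℝ A := mk₂ ℝ
    (fun a b => ∫ g, c g a b ∂(Measure.haar : Measure G))
    (fun a a' b => by simp only [hadd]; exact integral_add (hint _ _) (hint _ _))
    (fun r a b => by simp only [hsmul]; exact integral_const_mul _ _)
    (fun a b b' => by
      simp only [hsymm _ a, hadd]; exact integral_add (hint _ _) (hint _ _))
    (fun r a b => by simp only [hsymm _ a, hsmul]; exact integral_const_mul _ _)
  have hB : ∀ a b, B a b = ∫ g, c g a b ∂(Measure.haar : Measure G) := fun _ _ => rfl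
  refine ⟨B, fun a b => by simp only [hB, hsymm _ a], fun a ha => ?_, fun h a b => ?_⟩
  · rw [hB]
    refine Continuous.integral_pos_of_hasCompactSupport_nonneg_nonzero (x := 1) (hc a a)
      (of_compactSpace _) (fun g => sum_nonneg fun i _ => mul_self_nonneg _) ?_
    have : ∃ i, e.repr a i ≠ 0 := by
      by_contra! h
      exact ha (e.repr.map_eq_zero_iff.mp (Finsupp.ext h))
    obtain ⟨i, hi⟩ := this
    refine (Finset.sum_pos' (fun i _ => mul_self_nonneg _) ⟨i, mem_univ i, ?_⟩).ne'
    rw [inv_one, map_one]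
    exact mul_self_pos.mpr hi
  · rw [hB, hB, ← integral_mul_left_eq_self (fun g => c g a b) h⁻¹]
    refine integral_congr_ae (Filter.Eventually.of_forall fun g => ?_)
    have : (h⁻¹ * g)⁻¹ = g⁻¹ * h := by group
    simp only [c, this, map_mul, End.mul_apply]

theorem trace_sq_of_skew (B : BilinForm ℝ A) (hsymm : ∀ a b, B a b = B b a)
    (hpos : ∀ a, a ≠ 0 → 0 < B a a) (L : End ℝ A) (hL : ∀ a b, B (L a) b = - B a (L b)) :
    LinearMap.trace ℝ A (L * L) ≤ 0 ∧ (LinearMap.trace ℝ A (L * L) = 0 → L = 0) := by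
  have : Invertible (2 : ℝ) := invertibleOfNonzero two_ne_zero
  obtain ⟨e, he⟩ := BilinForm.exists_orthogonal_basis (B := B) ⟨fun x y => hsymm x y⟩
  have hee : ∀ i, 0 < B (e i) (e i) := fun i => hpos _ (e.ne_zero i)
  have hcoord : ∀ a i, e.repr a i = B a (e i) / B (e i) (e i) := fun a i => by
    rw [eq_div_iff (hee i).ne']
    conv_rhs => rw [← e.sum_repr a]
    rw [map_sum, LinearMap.sum_apply, sum_eq_single i]
    · simp
    · intro j _ hj
      have : B (e j) (e i) = 0 := he hj
      simp [this]
    · simp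
  have htr : LinearMap.trace ℝ A (L * L) = -∑ i, B (L (e i)) (L (e i)) / B (e i) (e i) := by
    rw [LinearMap.trace_eq_matrix_trace ℝ e, Matrix.trace, ← Finset.sum_neg_distrib]
    refine sum_congr rfl fun i _ => ?_
    rw [Matrix.diag_apply, LinearMap.toMatrix_apply, hcoord, End.mul_apply, hL, neg_div]
  have hnn : ∀ i, 0 ≤ B (L (e i)) (L (e i)) / B (e i) (e i) := fun i => by
    refine div_nonneg ?_ (hee i).le
    by_cases h : L (e i) = 0
    · simp [h]
    · exact (hpos _ h).le
  rw [htr]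
  refine ⟨by simpa using sum_nonneg fun i _ => hnn i, fun h => e.ext fun i => ?_⟩
  rw [neg_eq_zero, Finset.sum_eq_zero_iff_of_nonneg fun i _ => hnn i] at h
  by_contra h0
  exact (div_pos (hpos _ h0) (hee i)).ne' (h i (mem_univ i))

end InvariantForm

section Positivity

variable [Module.Finite F D]
  (τ : Involution F 𝒦 D)

section

variable {k : Type*} [Field k] [Algebra F k]

theorem exists_cayley {X : k ⊗[F] D} (hX : τ.ext k X = -X) (s : k)
    (h : IsUnit (1 + s • X)) : ∃ g : τ.points k, τ.val g * (1 + s • X) = 1 - s • X := by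
  obtain ⟨y, hy⟩ := h
  have h1 : τ.ext k (1 + s • X) = 1 - s • X := by
    rw [map_add, τ.ext_one, map_smul, hX, smul_neg, sub_eq_add_neg]
  have h2 : τ.ext k (1 - s • X) = 1 + s • X := by rw [← h1, τ.ext_ext]
  have h3 : (1 - s • X) * (1 + s • X) = (1 + s • X) * (1 - s • X) := by
    simp only [sub_mul, mul_sub, add_mul, mul_add, one_mul, mul_one]
    abel
  have h4 : τ.ext k (y⁻¹ : (k ⊗[F] D)ˣ) * (1 - s • X) = 1 := by
    rw [← h1, ← hy, ← τ.ext_mul, Units.mul_inv, τ.ext_one]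
  have h5 : (1 - s • X) * τ.ext k (y⁻¹ : (k ⊗[F] D)ˣ) = 1 := by
    rw [← h1, ← hy, ← τ.ext_mul, Units.inv_mul, τ.ext_one]
  have h6 : (1 - s • X) * ((y⁻¹ : (k ⊗[F] D)ˣ) : k ⊗[F] D) =
      ((y⁻¹ : (k ⊗[F] D)ˣ) : k ⊗[F] D) * (1 - s • X) := by
    have : Commute (1 - s • X) (y : k ⊗[F] D) := by rw [hy]; exact h3
    exact this.units_inv_right
  have h7 : τ.ext k ((1 - s • X) * ((y⁻¹ : (k ⊗[F] D)ˣ) : k ⊗[F] D)) =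
      τ.ext k (y⁻¹ : (k ⊗[F] D)ˣ) * (1 + s • X) := by rw [τ.ext_mul, h2]
  have e1 : ((y⁻¹ : (k ⊗[F] D)ˣ) : k ⊗[F] D) * (1 + s • X) = 1 := by rw [← hy, Units.inv_mul]
  have e2 : (1 + s • X) * ((y⁻¹ : (k ⊗[F] D)ˣ) : k ⊗[F] D) = 1 := by rw [← hy, Units.mul_inv]
  refine ⟨Involution.mkPoint ((1 - s • X) * ((y⁻¹ : (k ⊗[F] D)ˣ) : k ⊗[F] D)) ?_ ?_, ?_⟩
  · rw [h7, h6, mul_assoc, ← mul_assoc (1 + s • X), e2, one_mul, h4]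
  · rw [h7]
    have e3 : Commute (1 + s • X) (τ.ext k (y⁻¹ : (k ⊗[F] D)ˣ)) := by
      have h8 : τ.ext k (y⁻¹ : (k ⊗[F] D)ˣ) = ((⟨1 - s • X, _, h5, h4⟩ : (k ⊗[F] D)ˣ)⁻¹ : (k ⊗[F] D)ˣ) := rfl
      rw [h8]
      have : Commute (1 + s • X) ((⟨1 - s • X, _, h5, h4⟩ : (k ⊗[F] D)ˣ) : k ⊗[F] D) := h3.symm
      exact this.units_inv_right
    rw [← e3.eq, mul_assoc, ← mul_assoc _ (1 + s • X), e1, one_mul, h5]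
  · change (1 - s • X) * ((y⁻¹ : (k ⊗[F] D)ˣ) : k ⊗[F] D) * (1 + s • X) = _
    rw [mul_assoc, e1, mul_one]

end

section Real

variable [Algebra F ℝ] [CompactSpace (τ.points ℝ)]

theorem trace_sq_skew {X : ℝ ⊗[F] D} (hX : τ.ext ℝ X = -X) :
    regTrace ℝ (ℝ ⊗[F] D) (X * X) ≤ 0 ∧
      (regTrace ℝ (ℝ ⊗[F] D) (X * X) = 0 → X = 0) := by
  let ρ : τ.points ℝ →* End ℝ (ℝ ⊗[F] D) :=
    { toFun := fun g => mulLeft ℝ (τ.val g)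
      map_one' := LinearMap.ext fun a => one_mul a
      map_mul' := fun g h => LinearMap.ext fun a => mul_assoc _ _ a }
  have hρ : ∀ g a, ρ g a = τ.val g * a := fun _ _ => rfl
  obtain ⟨B, hsymm, hpos, hinv⟩ := exists_invariant_form ρ fun a f =>
    (continuous_of_linear f).comp (τ.continuous_val.mul continuous_const)
  obtain ⟨μ, hμ⟩ := ((End.finite_spectrum (mulLeft ℝ X)).union
    (Set.finite_singleton (0 : ℝ))).exists_notMem
  rw [Set.mem_union, not_or, Set.mem_singleton_iff, spectrum.notMem_iff] at hμ
  obtain ⟨hμ, hμ0⟩ := hμ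
  have hs : IsUnit (1 + (-μ⁻¹) • X) := by
    refine isUnit_of_isUnit_lmul (R := ℝ) ?_
    have h1 : lmul ℝ (ℝ ⊗[F] D) (1 + (-μ⁻¹) • X) = Units.mk0 μ⁻¹ (inv_ne_zero hμ0) •
        (algebraMap ℝ (End ℝ (ℝ ⊗[F] D)) μ - mulLeft ℝ X) := by
      refine LinearMap.ext fun a => ?_
      change (1 + (-μ⁻¹) • X) * a = μ⁻¹ • (μ • a - X * a)
      rw [smul_sub, smul_smul, inv_mul_cancel₀ hμ0, one_smul, add_mul, one_mul, neg_smul, neg_mul,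
        smul_mul_assoc, sub_eq_add_neg]
    rw [h1]
    exact hμ.smul _
  obtain ⟨g, hg⟩ := exists_cayley τ hX _ hs
  have hs0 : -μ⁻¹ ≠ 0 := neg_ne_zero.mpr (inv_ne_zero hμ0)
  set s := -μ⁻¹
  have hskew : ∀ a b, B (mulLeft ℝ X a) b = - B a (mulLeft ℝ X b) := by
    intro a b
    have h1 := hinv g ((1 + s • X) * a) ((1 + s • X) * b)
    rw [hρ, hρ, ← mul_assoc, ← mul_assoc, hg] at h1
    simp only [sub_mul, add_mul, one_mul, smul_mul_assoc, map_sub, map_add, map_smul,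
      LinearMap.sub_apply, LinearMap.add_apply, LinearMap.smul_apply, smul_eq_mul] at h1
    simp only [LinearMap.mulLeft_apply]
    have h2 : s * (B (X * a) b + B a (X * b)) = 0 := by linarith
    have h3 := (mul_eq_zero.mp h2).resolve_left hs0
    linarith
  have h := trace_sq_of_skew B hsymm hpos _ hskew
  have e : mulLeft ℝ X * mulLeft ℝ X = lmul ℝ (ℝ ⊗[F] D) (X * X) :=
    LinearMap.ext fun a => (mul_assoc X X a).symm
  rw [e] at h
  refine ⟨h.1, fun h0 => ?_⟩
  have := LinearMap.congr_fun (h.2 h0) 1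
  simpa using this

theorem trace_ext_mul_pos {z : 𝒦} {a : F} (hz : conj F 𝒦 z = -z) (hza : z * z = algebraMap F 𝒦 a)
    (ha : algebraMap F ℝ a < 0) [IsScalarTower F 𝒦 D] {x : ℝ ⊗[F] D} (hx : x ≠ 0) :
    0 < regTrace ℝ (ℝ ⊗[F] D) (τ.ext ℝ x * x) := by
  set S := (1 / 2 : ℝ) • (x + τ.ext ℝ x) with hS
  set X := (1 / 2 : ℝ) • (x - τ.ext ℝ x) with hXX
  have hxSX : x = S + X := by
    rw [hS, hXX, ← smul_add]
    have : x + τ.ext ℝ x + (x - τ.ext ℝ x) = (2 : ℝ) • x := by rw [two_smul]; abel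
    rw [this, smul_smul]
    norm_num
  have hτS : τ.ext ℝ S = S := by
    rw [hS, map_smul, map_add, τ.ext_ext, add_comm]
  have hτX : τ.ext ℝ X = -X := by
    rw [hXX, map_smul, map_sub, τ.ext_ext, ← smul_neg, neg_sub]
  let i : ℝ ⊗[F] D := 1 ⊗ₜ algebraMap 𝒦 D z
  have hi : ∀ y, i * y = y * i := fun y => by
    induction y with
    | zero => simp
    | add y y' h h' => rw [mul_add, add_mul, h, h']
    | tmul r d =>
      simp only [i, tmul_mul_tmul, one_mul, mul_one, Algebra.commutes]
  have hii : i * i = algebraMap ℝ _ (algebraMap F ℝ a) := by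
    simp only [i, tmul_mul_tmul, one_mul, ← map_mul, hza]
    rw [← IsScalarTower.algebraMap_apply, Algebra.TensorProduct.algebraMap_apply,
      Algebra.algebraMap_eq_smul_one, ← TensorProduct.smul_tmul, Algebra.smul_def, mul_one]
    rfl
  have hτi : τ.ext ℝ i = -i := by
    have : τ.toLinearMap (algebraMap 𝒦 D z) = algebraMap 𝒦 D (conj F 𝒦 z) := τ.map_algebraMap' z
    simp only [i, Involution.ext_tmul, this, hz, map_neg, TensorProduct.tmul_neg]
  have h1 := trace_sq_skew τ (X := i * S) (by rw [τ.ext_mul, hτi, hτS, mul_neg, ← hi])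
  have h2 := trace_sq_skew τ hτX
  have e1 : i * S * (i * S) = (algebraMap F ℝ a) • (S * S) := by
    rw [mul_assoc, ← mul_assoc S i S, ← hi S, ← mul_assoc, ← mul_assoc, hii, mul_assoc, Algebra.smul_def]
  rw [e1, map_smul, smul_eq_mul] at h1
  have e2 : regTrace ℝ (ℝ ⊗[F] D) (τ.ext ℝ x * x) =
      regTrace ℝ (ℝ ⊗[F] D) (S * S) - regTrace ℝ (ℝ ⊗[F] D) (X * X) := by
    have e3 : τ.ext ℝ x * x = S * S - X * X + (S * X - X * S) := by
      rw [hxSX, map_add, hτS, hτX]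
      noncomm_ring
    have e4 : regTrace ℝ (ℝ ⊗[F] D) (S * X) = regTrace ℝ (ℝ ⊗[F] D) (X * S) := by
      exact regTrace_mul_comm _ _
    rw [e3, map_add, map_sub, map_sub, e4, sub_self, add_zero]
  rw [e2]
  by_cases hX0 : X = 0
  · have hS0 : S ≠ 0 := by
      rintro hS0
      exact hx (by rw [hxSX, hX0, hS0, add_zero])
    have hiS : i * S ≠ 0 := fun h => by
      have : (algebraMap F ℝ a) • S = 0 := by
        rw [Algebra.smul_def, ← hii, mul_assoc, h, mul_zero]
      exact hS0 ((smul_eq_zero.mp this).resolve_left ha.ne)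
    have h3 : algebraMap F ℝ a * regTrace ℝ (ℝ ⊗[F] D) (S * S) < 0 :=
      lt_of_le_of_ne h1.1 fun h => hiS (h1.2 h)
    rw [hX0, mul_zero, map_zero, sub_zero]
    nlinarith
  · have h3 : regTrace ℝ (ℝ ⊗[F] D) (X * X) < 0 :=
      lt_of_le_of_ne h2.1 fun h => hX0 (h2.2 h)
    nlinarith [h1.1]

end Real

theorem exists_skew : ∃ z : 𝒦, z ≠ 0 ∧ conj F 𝒦 z = -z ∧ ∃ a : F, z * z = algebraMap F 𝒦 a := by
  obtain ⟨y, hy⟩ : ∃ z : 𝒦, conj F 𝒦 z ≠ z := by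
    by_contra! h
    exact conj_ne_one F 𝒦 (AlgEquiv.ext h)
  have hc : conj F 𝒦 (y - conj F 𝒦 y) = -(y - conj F 𝒦 y) := by
    rw [map_sub, conj_conj, neg_sub]
  refine ⟨y - conj F 𝒦 y, sub_ne_zero.mpr hy.symm, hc, ?_⟩
  have := (IsGalois.mem_range_algebraMap_iff_fixed (F := F) (E := 𝒦)
    ((y - conj F 𝒦 y) * (y - conj F 𝒦 y))).mpr fun f => by
      rcases eq_one_or_eq_conj f with rfl | rfl
      · rfl
      · rw [map_mul, hc, neg_mul_neg]
  obtain ⟨a, ha⟩ := this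
  exact ⟨a, ha.symm⟩

theorem skew_sq_neg [IsTotallyComplex 𝒦] (φ : F →+* ℝ) {z : 𝒦} {a : F} (hz0 : z ≠ 0)
    (hz : conj F 𝒦 z = -z) (hza : z * z = algebraMap F 𝒦 a) : φ a < 0 := by
  by_contra! ha
  letI : Algebra F ℂ := (Complex.ofRealHom.comp φ).toAlgebra
  have hF : ∀ x : F, algebraMap F ℂ x = (φ x : ℂ) := fun _ => rfl
  let ψ : 𝒦 →ₐ[F] ℂ := IsAlgClosed.lift
  have hψF : ∀ x : F, ψ (algebraMap F 𝒦 x) = (φ x : ℂ) := fun x => ψ.commutes x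
  have hsq : ψ z * ψ z = ((Real.sqrt (φ a) : ℝ) : ℂ) * ((Real.sqrt (φ a) : ℝ) : ℂ) := by
    rw [← map_mul, hza, hψF, ← Complex.ofReal_mul, Real.mul_self_sqrt ha]
  have hreal : ∃ r : ℝ, ψ z = r := by
    rcases mul_self_eq_mul_self_iff.mp hsq with h | h
    · exact ⟨_, h⟩
    · exact ⟨-Real.sqrt (φ a), by rw [h]; push_cast; rfl⟩
  obtain ⟨r, hr⟩ := hreal
  have hfix : ∀ y : 𝒦, conj F 𝒦 y = y → ∃ b : F, algebraMap F 𝒦 b = y := fun y hy =>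
    (IsGalois.mem_range_algebraMap_iff_fixed (F := F) (E := 𝒦) y).mpr fun f => by
      rcases eq_one_or_eq_conj f with rfl | rfl
      · rfl
      · exact hy
  have h2 : (2 : 𝒦) ≠ 0 := two_ne_zero
  have hall : ∀ y, star (ψ y) = ψ y := fun y => by
    obtain ⟨b, hb⟩ := hfix ((y + conj F 𝒦 y) / 2) (by
      rw [map_div₀, map_add, conj_conj, add_comm, map_ofNat])
    obtain ⟨c, hc⟩ := hfix ((y - conj F 𝒦 y) / (2 * z)) (by
      rw [map_div₀, map_sub, conj_conj, map_mul, hz, map_ofNat, mul_neg, div_neg, ← neg_div, neg_sub])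
    have hy : y = algebraMap F 𝒦 b + algebraMap F 𝒦 c * z := by
      rw [hb, hc]
      field_simp
      ring
    rw [hy, map_add, map_mul, hψF, hψF, hr]
    simp
  have h := IsTotallyComplex.isComplex (InfinitePlace.mk (ψ : 𝒦 →+* ℂ))
  rw [InfinitePlace.isComplex_mk_iff] at h
  exact h (RingHom.ext hall)

omit [NumberField F] in
theorem continuous_map_tensor {R S : Type*} [CommRing R] [Algebra F R] [TopologicalSpace R]
    [IsTopologicalRing R] [CommRing S] [Algebra F S] [TopologicalSpace S] [IsTopologicalRing S]
    {f : R →ₐ[F] S} (hf : Continuous f) :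
    Continuous (Algebra.TensorProduct.map f (AlgHom.id F D)) :=
  continuous_of_semilinear (g := f.toRingHom) hf
    { toFun := Algebra.TensorProduct.map f (AlgHom.id F D)
      map_add' := map_add _
      map_smul' := fun c x => by
        rw [Algebra.smul_def, map_mul, Algebra.smul_def]
        congr 1 }

theorem Involution.continuous_pointsMap {R S : Type*} [CommRing R] [Algebra F R]
    [TopologicalSpace R] [IsTopologicalRing R] [CommRing S] [Algebra F S] [TopologicalSpace S]
    [IsTopologicalRing S] {f : R →ₐ[F] S} (hf : Continuous f) : Continuous (τ.pointsMap f) :=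
  τ.isInducing_val.continuous_iff.mpr ((continuous_map_tensor hf).comp τ.continuous_val)

theorem extensionEmbedding_algebraMap (u : InfinitePlace F) (x : F) :
    InfinitePlace.Completion.extensionEmbedding u (algebraMap F u.Completion x) = u.embedding x :=
  InfinitePlace.Completion.extensionEmbedding_coe u ((WithAbs.equiv u.1).symm x)

theorem regTrace_star_mul_pos [IsTotallyComplex 𝒦] [IsScalarTower F 𝒦 D]
    [hcomp : CompactSpace τ.infinite] (φ : F →+* ℝ) {d : D} (hd : d ≠ 0) :
    0 < φ (regTrace F D (τ.toLinearMap d * d)) := by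
  let u := InfinitePlace.mk (Complex.ofRealHom.comp φ)
  have hreal : ComplexEmbedding.IsReal (Complex.ofRealHom.comp φ) := by
    refine RingHom.ext fun x => ?_
    simp [ComplexEmbedding.conjugate]
  have hu : u.IsReal := InfinitePlace.isReal_iff.mpr (by
    rw [InfinitePlace.embedding_mk_eq_of_isReal hreal]
    exact hreal)
  letI : Algebra F ℝ := φ.toAlgebra
  let r := InfinitePlace.Completion.extensionEmbeddingOfIsReal hu
  have hr : ∀ x : F, r (algebraMap F u.Completion x) = φ x := fun x => by
    have h1 := InfinitePlace.Completion.extensionEmbeddingOfIsReal_apply hu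
      (algebraMap F u.Completion x)
    rw [extensionEmbedding_algebraMap, InfinitePlace.embedding_mk_eq_of_isReal hreal] at h1
    exact Complex.ofReal_injective h1
  let f : u.Completion →ₐ[F] ℝ := { r with commutes' := hr }
  have hfc : Continuous f := (InfinitePlace.Completion.isometry_extensionEmbeddingOfIsReal hu).continuous
  have hbij := InfinitePlace.Completion.bijective_extensionEmbeddingOfIsReal hu
  let fe : u.Completion ≃ₐ[F] ℝ := AlgEquiv.ofBijective f hbij
  have : CompactSpace (τ.points u.Completion) :=
    (Function.surjective_eval (β := fun v : InfinitePlace F => τ.points v.Completion)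
      u).compactSpace (continuous_apply u)
  have hcont : Continuous (τ.pointsMap f) := τ.continuous_pointsMap hfc
  have hsurj : Surjective (τ.pointsMap f) := fun g => by
    refine ⟨τ.pointsMap (fe.symm : ℝ →ₐ[F] u.Completion) g, ?_⟩
    refine τ.val_injective ?_
    change Algebra.TensorProduct.map f (AlgHom.id F D) (Algebra.TensorProduct.map
      (fe.symm : ℝ →ₐ[F] u.Completion) (AlgHom.id F D) (τ.val g)) = τ.val g
    induction τ.val g with
    | zero => simp
    | add x y hx hy => rw [map_add, map_add, hx, hy]
    | tmul r d =>
      simp only [Algebra.TensorProduct.map_tmul, AlgHom.id_apply]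
      congr 1
      exact fe.apply_symm_apply r
  have : CompactSpace (τ.points ℝ) := hsurj.compactSpace hcont
  obtain ⟨z, hz0, hz, a, hza⟩ := exists_skew (F := F) (𝒦 := 𝒦)
  have h := trace_ext_mul_pos τ hz hza (skew_sq_neg φ hz0 hz hza) (x := 1 ⊗ₜ[F] d) (by
    have := Algebra.TensorProduct.includeRight_injective (R := F) (A := ℝ) (B := D)
      (algebraMap F ℝ).injective
    exact fun h => hd (this (h.trans (map_zero _).symm)))
  have e : ∀ y : D, regTrace ℝ (ℝ ⊗[F] D) (1 ⊗ₜ y) = φ (regTrace F D y) := fun y => by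
    rw [regTrace_apply, regTrace_apply]
    have h1 : lmul ℝ (ℝ ⊗[F] D) (1 ⊗ₜ y) = (lmul F D y).baseChange ℝ := by
      ext x
      simp
    rw [h1, LinearMap.trace_baseChange]
    rfl
  rwa [Involution.ext_tmul, tmul_mul_tmul, one_mul, e] at h

end Positivity

section LocalScaling

variable {F : Type*} [Field F] [NumberField F] (v : Pl(F))

theorem exists_pow_mul_mem_integers {a : 𝓞 F} (ha : a ∈ v.asIdeal) (c : K_[F,v]) :
    ∃ k : ℕ, ∀ k' ≥ k, algebraMap (𝓞 F) K_[F,v] a ^ k' * c ∈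
      O_[F,v] := by
  by_cases hc : c = 0
  · exact ⟨0, fun k _ => by rw [hc, mul_zero]; exact zero_mem _⟩
  have h1 : v.intValuation a < 1 := (v.intValuation_lt_one_iff_mem a).mpr ha
  have hc' : (Valued.v c)⁻¹ ≠ 0 := inv_ne_zero ((Valuation.ne_zero_iff _).mpr hc)
  obtain ⟨k, hk⟩ := exists_pow_lt₀ h1 (Units.mk0 _ hc')
  refine ⟨k, fun k' hk' => ?_⟩
  rw [HeightOneSpectrum.mem_adicCompletionIntegers, map_mul, map_pow, valued_algebraMap_int,
    ← le_mul_inv_iff₀ (zero_lt_iff.mpr ((Valuation.ne_zero_iff _).mpr hc)), one_mul]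
  exact (pow_le_pow_right_of_le_one' h1.le hk').trans hk.le

variable {D : Type*} [Ring D] [Algebra F D] [Module.Finite F D]

theorem coordHomeo_smul (c : K_[F,v]) (y : K_[F,v] ⊗[F] D) (i) :
    coordHomeo _ (c • y) i = c * coordHomeo _ y i := by
  simp only [coordHomeo_apply, map_smul, Finsupp.smul_apply, smul_eq_mul]

theorem smul_mem_latticeAt {c : K_[F,v]} (hc : c ∈ O_[F,v])
    {y : K_[F,v] ⊗[F] D} (hy : y ∈ latticeAt F D v) : c • y ∈ latticeAt F D v :=
  (latticeAt F D v).smul_mem ⟨c, hc⟩ hy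

theorem exists_pow_smul_mem_latticeAt {a : 𝓞 F} (ha : a ∈ v.asIdeal)
    (y : K_[F,v] ⊗[F] D) :
    ∃ k : ℕ, algebraMap (𝓞 F) K_[F,v] a ^ k • y ∈ latticeAt F D v := by
  choose k hk using fun i => exists_pow_mul_mem_integers v ha (coordHomeo _ y i)
  refine ⟨∑ i, k i, (mem_latticeAt v).mpr fun i => ?_⟩
  rw [coordHomeo_smul]
  exact hk i _ (single_le_sum (fun i _ => Nat.zero_le (k i)) (mem_univ i))

theorem exists_nat_smul_mem_latticeAt (y : K_[F,v] ⊗[F] D) :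
    ∃ n : ℕ, n ≠ 0 ∧ (n : K_[F,v]) • y ∈ latticeAt F D v := by
  obtain ⟨k, hk⟩ := exists_pow_smul_mem_latticeAt v (Ideal.absNorm_mem v.asIdeal) y
  refine ⟨Ideal.absNorm v.asIdeal ^ k, pow_ne_zero _ ?_, ?_⟩
  · rw [Ideal.absNorm_ne_zero_iff]
    exact v.asIdeal.finiteQuotientOfFreeOfNeBot v.ne_bot
  · rw [map_natCast] at hk
    exact_mod_cast hk

theorem exists_nat_smul_mem (y : ∀ v : Pl(F), K_[F,v] ⊗[F] D)
    (hy : ∀ᶠ v in cofinite, y v ∈ latticeAt F D v) :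
    ∃ n : ℕ, n ≠ 0 ∧ ∀ v, (n : K_[F,v]) • y v ∈ latticeAt F D v := by
  classical
  choose n hn0 hn using fun v => exists_nat_smul_mem_latticeAt v (y v)
  rw [Filter.eventually_cofinite] at hy
  refine ⟨∏ v ∈ hy.toFinset, n v, Finset.prod_ne_zero_iff.mpr fun v _ => hn0 v, fun v => ?_⟩
  by_cases h : y v ∈ latticeAt F D v
  · exact smul_mem_latticeAt v (natCast_mem _ _) h
  · rw [← Finset.mul_prod_erase _ _ (hy.mem_toFinset.mpr h), mul_comm, Nat.cast_mul, mul_smul]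
    exact smul_mem_latticeAt v (natCast_mem _ _) (hn v)

theorem eventually_tmul_mem (d : D) :
    ∀ᶠ v : Pl(F) in cofinite,
      (1 : K_[F,v]) ⊗ₜ[F] d ∈ latticeAt F D v := by
  filter_upwards [eventually_mem_lattice (1 ⊗ₜ[F] d)] with v hv
  simpa using hv

theorem denseRange_tmul : DenseRange fun d : D => (1 : K_[F,v]) ⊗ₜ[F] d := by
  have h1 : DenseRange (Pi.map fun (_ : Fin (finrank F D)) =>
      (algebraMap F K_[F,v] : F → K_[F,v])) :=
    DenseRange.piMap fun _ => HeightOneSpectrum.denseRange_algebraMap F v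
  have h2 := (coordHomeo (F := F) (D := D) K_[F,v]).symm.surjective.denseRange.comp h1
    (coordHomeo K_[F,v]).symm.continuous
  refine h2.mono ?_
  rintro _ ⟨c, rfl⟩
  refine ⟨∑ i, c i • finBasis F D i, ?_⟩
  change _ = (coordHomeo K_[F,v]).symm _
  rw [Homeomorph.eq_symm_apply]
  funext i
  rw [coordHomeo_apply, Basis.baseChange_repr_tmul, Basis.repr_sum_self,
    Algebra.smul_def, mul_one]
  rfl

end LocalScaling

section AdelicLattice

variable [Module.Finite F D]
  {τ : Involution F 𝒦 D}

/-- The lattice `D ∩ ∏ x_v Λ_v` defined by an adelic point `x`. -/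
def latticeOf (x : τ.finAdelic) : Submodule ℤ D where
  carrier := {d | ∀ v, τ.val (x v)⁻¹ * (1 ⊗ₜ d) ∈ latticeAt F D v}
  zero_mem' := fun v => by simp
  add_mem' := fun ha hb v => by
    rw [TensorProduct.tmul_add, mul_add]
    exact add_mem (ha v) (hb v)
  smul_mem' := fun n d hd v => by
    rw [TensorProduct.tmul_smul, mul_smul_comm]
    exact zsmul_mem (hd v) n

theorem mem_latticeOf {x : τ.finAdelic} {d : D} :
    d ∈ latticeOf x ↔ ∀ v, τ.val (x v)⁻¹ * (1 ⊗ₜ d) ∈ latticeAt F D v := Iff.rfl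

theorem tmul_algebraMap_smul (v : Pl(F)) (z : F) (d : D) :
    (1 : K_[F,v]) ⊗ₜ[F] (z • d) = algebraMap F K_[F,v] z • (1 ⊗ₜ[F] d) := by
  rw [← TensorProduct.smul_tmul, TensorProduct.smul_tmul', smul_eq_mul, mul_one, Algebra.smul_def,
    mul_one]

theorem algebraMap_int_mem (v : Pl(F)) (z : 𝓞 F) :
    algebraMap F K_[F,v] (z : F) ∈ O_[F,v] := by
  rw [HeightOneSpectrum.mem_adicCompletionIntegers, valued_algebraMap]
  exact v.valuation_le_one z

theorem int_smul_mem_latticeOf {x : τ.finAdelic} {d : D} (hd : d ∈ latticeOf x) (z : 𝓞 F) :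
    (z : F) • d ∈ latticeOf x := fun v => by
  rw [tmul_algebraMap_smul, mul_smul_comm]
  exact smul_mem_latticeAt v (algebraMap_int_mem v z) (hd v)

theorem eventually_mem_integralPoints (x : τ.finAdelic) :
    ∀ᶠ v in cofinite, x v ∈ τ.integralPoints v := x.2

theorem exists_nat_smul_mul_mem (x : τ.finAdelic) : ∃ n : ℕ, n ≠ 0 ∧ ∀ v,
    ∀ y ∈ latticeAt F D v, (n : K_[F,v]) • (τ.val (x v) * y) ∈ latticeAt F D v := by
  choose n hn0 hn using fun i => exists_nat_smul_mem
    (fun v => τ.val (x v) * 1 ⊗ₜ finBasis F D i) (by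
      filter_upwards [eventually_mem_integralPoints x] with v hv
      exact ((mem_integralPoints τ v).mp hv).1 i)
  refine ⟨∏ i, n i, Finset.prod_ne_zero_iff.mpr fun i _ => hn0 i, fun v y hy => ?_⟩
  rw [← smul_mul_assoc]
  refine mem_latticeAt_of_basis v (fun i => ?_) hy
  rw [smul_mul_assoc, ← Finset.mul_prod_erase _ _ (mem_univ i), mul_comm, Nat.cast_mul,
    mul_smul]
  exact smul_mem_latticeAt v (natCast_mem _ _) (hn i v)

theorem mul_mem_of_latticeOf_subset (x : τ.finAdelic) (v : Pl(F))
    {W : Submodule O_[F,v] (K_[F,v] ⊗[F] D)}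
    (hW : IsOpen (W : Set (K_[F,v] ⊗[F] D)))
    (h : ∀ d ∈ latticeOf x, 1 ⊗ₜ d ∈ W) {y : K_[F,v] ⊗[F] D}
    (hy : y ∈ latticeAt F D v) : τ.val (x v) * y ∈ W := by
  classical
  have hinv : ∀ z, τ.val (x v)⁻¹ * (τ.val (x v) * z) = z := fun z => by
    rw [← mul_assoc, ← τ.val_mul, inv_mul_cancel]
    exact one_mul z
  have hO : IsOpen ({z | z - τ.val (x v) * y ∈ W} ∩
      {z | τ.val (x v)⁻¹ * z ∈ latticeAt F D v}) :=
    (hW.preimage (continuous_id.sub continuous_const)).inter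
      ((isOpen_latticeAt v).preimage (continuous_const.mul continuous_id))
  obtain ⟨d, hd1, hd2⟩ := (denseRange_tmul v).exists_mem_open hO ⟨τ.val (x v) * y, by
    simp, by simpa [hinv] using hy⟩
  have hfin : ∀ᶠ w : Pl(F) in cofinite,
      τ.val (x w)⁻¹ * 1 ⊗ₜ d ∈ latticeAt F D w := by
    filter_upwards [eventually_mem_integralPoints x, eventually_tmul_mem (F := F) d] with w h1 h2
    exact h1.2 _ h2
  rw [Filter.eventually_cofinite] at hfin
  have hex : ∀ w : Pl(F), w ≠ v → ∃ a ∈ w.asIdeal, a ∉ v.asIdeal := by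
    intro w hw
    by_contra! hle
    exact hw (HeightOneSpectrum.ext (w.isMaximal.eq_of_le v.isPrime.ne_top hle))
  have hs : ∀ w, ∃ s : 𝓞 F, s ∉ v.asIdeal ∧ (w ≠ v →
      algebraMap (𝓞 F) K_[F,w] s • (τ.val (x w)⁻¹ * 1 ⊗ₜ d) ∈ latticeAt F D w) := by
    intro w
    by_cases hw : w = v
    · exact ⟨1, v.isPrime.one_notMem, fun h => (h hw).elim⟩
    · obtain ⟨a, ha, hav⟩ := hex w hw
      obtain ⟨k, hk⟩ := exists_pow_smul_mem_latticeAt w ha (τ.val (x w)⁻¹ * 1 ⊗ₜ d)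
      exact ⟨a ^ k, fun h => hav (v.isPrime.mem_of_pow_mem _ h), fun _ => by rwa [map_pow]⟩
  choose s hsv hs using hs
  set t := ∏ w ∈ hfin.toFinset, s w with ht
  have htv : t ∉ v.asIdeal := by
    rw [ht, v.isPrime.prod_mem_iff]
    rintro ⟨w, -, hw⟩
    exact hsv w hw
  have htd : (t : F) • d ∈ latticeOf x := fun w => by
    rw [tmul_algebraMap_smul, mul_smul_comm]
    by_cases hw : τ.val (x w)⁻¹ * 1 ⊗ₜ d ∈ latticeAt F D w
    · exact smul_mem_latticeAt w (algebraMap_int_mem w t) hw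
    · have hwv : w ≠ v := by
        rintro rfl
        exact hw hd2
      rw [ht, ← Finset.mul_prod_erase _ _ (hfin.mem_toFinset.mpr hw), mul_comm,
        ← IsScalarTower.algebraMap_apply, map_mul, mul_smul, IsScalarTower.algebraMap_apply (𝓞 F) F]
      exact smul_mem_latticeAt w (algebraMap_int_mem w _) (hs w hwv)
  have h1 := h _ htd
  rw [tmul_algebraMap_smul, ← IsScalarTower.algebraMap_apply] at h1
  have ht1 : Valued.v (algebraMap (𝓞 F) K_[F,v] t) = 1 := by
    rw [valued_algebraMap_int, HeightOneSpectrum.intValuation_eq_one_iff]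
    exact htv
  have ht0 : algebraMap (𝓞 F) K_[F,v] t ≠ 0 := by
    rw [← Valuation.ne_zero_iff Valued.v, ht1]
    exact one_ne_zero
  have h2 := W.smul_mem ⟨(algebraMap (𝓞 F) K_[F,v] t)⁻¹, by
    rw [HeightOneSpectrum.mem_adicCompletionIntegers, map_inv₀, ht1, inv_one]⟩ h1
  have h3 : (1 : K_[F,v]) ⊗ₜ[F] d ∈ W := by
    convert h2 using 1
    change (1 : K_[F,v]) ⊗ₜ[F] d = (algebraMap (𝓞 F) K_[F,v] t)⁻¹ •
      (algebraMap (𝓞 F) K_[F,v] t • ((1 : K_[F,v]) ⊗ₜ[F] d))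
    rw [smul_smul, inv_mul_cancel₀ ht0, one_smul]
  have h4 := sub_mem h3 hd1
  rwa [sub_sub_cancel] at h4

end AdelicLattice

section Denominators

variable {F : Type*} [Field F] [NumberField F]

theorem exists_nat_mul_integral {κ : Type*} [Finite κ] (f : κ → F) :
    ∃ n : ℕ, n ≠ 0 ∧ ∀ i, ∃ z : 𝓞 F, (z : F) = n * f i := by
  cases nonempty_fintype κ
  classical
  have h1 : ∀ i, ∃ n : ℕ, n ≠ 0 ∧ ∃ z : 𝓞 F, (z : F) = n * f i := fun i => by
    obtain ⟨y, hy0, hy⟩ := ((IsFractionRing.isAlgebraic_iff ℤ ℚ F).mpr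
      (Algebra.IsAlgebraic.isAlgebraic (R := ℚ) (f i))).exists_integral_multiple
    refine ⟨y.natAbs, Int.natAbs_ne_zero.mpr hy0, ?_⟩
    rcases Int.natAbs_eq y with h | h
    · refine ⟨⟨y • f i, hy⟩, ?_⟩
      change y • f i = _
      conv_lhs => rw [h]
      simp [zsmul_eq_mul]
    · refine ⟨⟨-(y • f i), hy.neg⟩, ?_⟩
      change -(y • f i) = _
      conv_lhs => rw [h]
      simp [zsmul_eq_mul]
  choose n hn0 z hz using h1
  refine ⟨∏ i, n i, Finset.prod_ne_zero_iff.mpr fun i _ => hn0 i, fun i => ?_⟩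
  refine ⟨(∏ j ∈ univ.erase i, n j : ℕ) * z i, ?_⟩
  have h := hz i
  change algebraMap (𝓞 F) F (z i) = _ at h
  change algebraMap (𝓞 F) F _ = _
  rw [← Finset.mul_prod_erase _ _ (mem_univ i), map_mul, map_natCast, h]
  push_cast
  ring

theorem exists_integral_of_trace : ∃ n : ℕ, n ≠ 0 ∧ ∀ y : F,
    (∀ w : 𝓞 F, ∃ k : ℤ, Algebra.trace ℚ F (w * y) = k) → ∃ z : 𝓞 F, (z : F) = n * y := by
  let b := integralBasis F
  let b' := (Algebra.traceForm ℚ F).dualBasis (traceForm_nondegenerate ℚ F) b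
  obtain ⟨n, hn0, hn⟩ := exists_nat_mul_integral b'
  choose z hz using hn
  refine ⟨n, hn0, fun y hy => ?_⟩
  choose k hk using hy
  have h1 : ∀ i, b'.repr y i = k (RingOfIntegers.basis F i) := fun i => by
    rw [BilinForm.dualBasis_repr_apply, ← hk, Algebra.traceForm_apply, mul_comm,
      integralBasis_apply]
  refine ⟨∑ i, k (RingOfIntegers.basis F i) * z i, ?_⟩
  conv_rhs => rw [← b'.sum_repr y]
  change algebraMap (𝓞 F) F _ = _
  rw [Finset.mul_sum, map_sum]
  refine sum_congr rfl fun i _ => ?_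
  have h := hz i
  change algebraMap (𝓞 F) F (z i) = _ at h
  rw [map_mul, map_intCast, h, h1, Algebra.smul_def, map_intCast]
  ring

theorem exists_int_of_forall_mem {y : F} (h : ∀ v : Pl(F),
    algebraMap F K_[F,v] y ∈ O_[F,v]) :
    ∃ z : 𝓞 F, (z : F) = y :=
  HeightOneSpectrum.mem_integers_of_valuation_le_one F y fun v => by
    rw [← valued_algebraMap]
    exact h v

end Denominators

section Functional

variable [Module.Finite F D]
  (τ : Involution F 𝒦 D) (T : D →ₗ[F] F)

/-- The extension of scalars of a linear form. -/
noncomputable def extForm (k : Type*) [CommRing k] [Algebra F k] : k ⊗[F] D →ₗ[k] k :=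
  (TensorProduct.AlgebraTensorModule.rid F k k).toLinearMap ∘ₗ T.baseChange k

theorem extForm_tmul (k : Type*) [CommRing k] [Algebra F k] (r : k) (d : D) :
    extForm T k (r ⊗ₜ d) = r * algebraMap F k (T d) := by
  simp [extForm, Algebra.smul_def, mul_comm]

variable (v : Pl(F))

theorem sum_coordHomeo (y : K_[F,v] ⊗[F] D) :
    ∑ i, coordHomeo _ y i • ((1 : K_[F,v]) ⊗ₜ[F] finBasis F D i) = y := by
  conv_rhs => rw [← ((finBasis F D).baseChange K_[F,v]).sum_repr y]
  refine sum_congr rfl fun i _ => ?_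
  rw [Basis.baseChange_apply]
  rfl

/-- The Gram matrix of the fixed basis. -/
noncomputable def gramMatrix : Matrix (Fin (finrank F D)) (Fin (finrank F D)) F :=
  Matrix.of fun i j => T (τ.toLinearMap (finBasis F D i) * finBasis F D j)

theorem extForm_star_mul_basis (y : K_[F,v] ⊗[F] D) (j) :
    extForm T _ (τ.ext _ y * 1 ⊗ₜ finBasis F D j) =
      ∑ i, coordHomeo _ y i * algebraMap F _ (gramMatrix τ T i j) := by
  conv_lhs => rw [← sum_coordHomeo v y]
  simp only [map_sum, map_smul, Finset.sum_mul, smul_mul_assoc, Involution.ext_tmul,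
    tmul_mul_tmul, mul_one, extForm_tmul, one_mul, smul_eq_mul, gramMatrix,
    Matrix.of_apply]

theorem exists_extForm_mem : ∃ n : ℕ, n ≠ 0 ∧ ∀ (v : Pl(F)),
    ∀ y ∈ latticeAt F D v, ∀ y' ∈ latticeAt F D v,
      (n : K_[F,v]) * extForm T _ (τ.ext _ y * y') ∈ O_[F,v] := by
  obtain ⟨n, hn0, hn⟩ := exists_nat_mul_integral fun q : _ × _ => gramMatrix τ T q.1 q.2
  refine ⟨n, hn0, fun v y hy y' hy' => ?_⟩
  rw [mem_latticeAt] at hy hy'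
  rw [← sum_coordHomeo v y', Finset.mul_sum, map_sum, Finset.mul_sum]
  refine sum_mem fun j _ => ?_
  rw [mul_smul_comm, map_smul, extForm_star_mul_basis, smul_eq_mul, mul_left_comm, Finset.mul_sum]
  refine mul_mem (hy' j) (sum_mem fun i _ => ?_)
  obtain ⟨z, hz⟩ := hn (i, j)
  rw [mul_left_comm]
  refine mul_mem (hy i) ?_
  have h := algebraMap_int_mem v z
  rwa [hz, map_mul, map_natCast] at h

theorem exists_mem_of_extForm (hT : ∀ d, T (τ.toLinearMap d * d) = 0 → d = 0) :
    ∃ n : ℕ, n ≠ 0 ∧ ∀ (v : Pl(F)) (c : K_[F,v])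
      (y : K_[F,v] ⊗[F] D),
      (∀ j, c * extForm T _ (τ.ext _ y * 1 ⊗ₜ finBasis F D j) ∈
        O_[F,v]) → (n * c) • y ∈ latticeAt F D v := by
  have hdet : (gramMatrix τ T).det ≠ 0 := by
    intro h0
    obtain ⟨x, hx0, hx⟩ := Matrix.exists_vecMul_eq_zero_iff.mpr h0
    set d := ∑ i, x i • finBasis F D i with hd
    have h1 : ∀ j, T (τ.toLinearMap d * finBasis F D j) = 0 := fun j => by
      have := congrFun hx j
      simp only [Matrix.vecMul, dotProduct, gramMatrix, Matrix.of_apply, Pi.zero_apply] at this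
      rw [hd, map_sum, Finset.sum_mul, map_sum, ← this]
      refine sum_congr rfl fun i _ => ?_
      rw [map_smul, smul_mul_assoc, map_smul, smul_eq_mul]
    have h2 : T (τ.toLinearMap d * d) = 0 := by
      conv_lhs =>
        enter [2, 2]
        rw [hd]
      rw [Finset.mul_sum, map_sum]
      refine Finset.sum_eq_zero fun j _ => ?_
      rw [mul_smul_comm, map_smul, h1, smul_zero]
    have h3 := hT d h2
    refine hx0 (funext fun i => ?_)
    have h4 := (finBasis F D).repr_sum_self x
    rw [← hd, h3, map_zero] at h4
    exact (congrFun h4 i).symm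
  have hunit : IsUnit (gramMatrix τ T).det := isUnit_iff_ne_zero.mpr hdet
  obtain ⟨n, hn0, hn⟩ := exists_nat_mul_integral fun q : _ × _ => (gramMatrix τ T)⁻¹ q.1 q.2
  refine ⟨n, hn0, fun v c y h => (mem_latticeAt v).mpr fun i => ?_⟩
  have h1 : coordHomeo _ y i = ∑ j, extForm T _ (τ.ext _ y * 1 ⊗ₜ finBasis F D j) *
      algebraMap F K_[F,v] ((gramMatrix τ T)⁻¹ j i) := by
    simp only [extForm_star_mul_basis, Finset.sum_mul]
    rw [Finset.sum_comm]
    have h2 : ∀ k, ∑ j, coordHomeo _ y k * algebraMap F K_[F,v] (gramMatrix τ T k j) *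
        algebraMap F K_[F,v] ((gramMatrix τ T)⁻¹ j i) =
        coordHomeo _ y k * algebraMap F K_[F,v] ((1 : Matrix _ _ F) k i) := fun k => by
      rw [← Matrix.mul_nonsing_inv _ hunit, Matrix.mul_apply, map_sum, Finset.mul_sum]
      exact sum_congr rfl fun j _ => by rw [map_mul, mul_assoc]
    simp only [h2]
    rw [sum_eq_single i]
    · simp
    · intro k _ hk
      simp [Matrix.one_apply_ne hk]
    · simp
  rw [coordHomeo_smul, h1, Finset.mul_sum]
  refine sum_mem fun j _ => ?_
  obtain ⟨z, hz⟩ := hn (j, i)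
  have h3 := algebraMap_int_mem v z
  rw [hz, map_mul, map_natCast] at h3
  have := mul_mem (h j) h3
  convert this using 1
  ring

theorem star_mul_of_point {k : Type*} [CommRing k] [Algebra F k] (g : τ.points k)
    (y y' : k ⊗[F] D) : τ.ext k (τ.val g * y) * (τ.val g * y') = τ.ext k y * y' := by
  rw [τ.ext_mul, mul_assoc, ← mul_assoc _ (τ.val g), τ.ext_val_mul, one_mul]

end Functional

section LatticeProperties

variable [Module.Finite F D]
  {τ : Involution F 𝒦 D}

theorem val_mul_val_inv_mul {k : Type*} [CommRing k] [Algebra F k] (g : τ.points k)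
    (y : k ⊗[F] D) : τ.val g * (τ.val g⁻¹ * y) = y := by
  rw [← mul_assoc, ← τ.val_mul, mul_inv_cancel]
  exact one_mul y

theorem tmul_nat_smul (v : Pl(F)) (n : ℕ) (d : D) :
    (1 : K_[F,v]) ⊗ₜ[F] (n • d) = (n : K_[F,v]) • (1 ⊗ₜ[F] d) := by
  rw [TensorProduct.tmul_smul, Nat.cast_smul_eq_nsmul]

theorem mem_latticeOf_one {d : D} : d ∈ latticeOf (1 : τ.finAdelic) ↔
    ∀ i, ∃ z : 𝓞 F, (z : F) = (finBasis F D).repr d i := by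
  have h : ∀ v : Pl(F), τ.val ((1 : τ.finAdelic) v)⁻¹ * (1 ⊗ₜ d) =
      (1 : K_[F,v]) ⊗ₜ[F] d := fun v => by
    have : ((1 : τ.finAdelic) v)⁻¹ = 1 := inv_one
    rw [this]
    exact one_mul _
  simp only [mem_latticeOf, h, mem_latticeAt, coordHomeo_apply, Basis.baseChange_repr_tmul,
    Algebra.smul_def, mul_one]
  constructor
  · exact fun hd i => exists_int_of_forall_mem fun v => hd v i
  · intro hd v i
    obtain ⟨z, hz⟩ := hd i
    rw [← hz]
    exact algebraMap_int_mem v z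

theorem latticeOf_one_fg : (latticeOf (1 : τ.finAdelic)).FG := by
  let f : (Fin (finrank F D) → 𝓞 F) →ₗ[ℤ] D :=
    { toFun := fun z => ∑ i, (z i : F) • finBasis F D i
      map_add' := fun x y => by simp [add_smul, Finset.sum_add_distrib]
      map_smul' := fun n x => by
        rw [id_apply, smul_sum]
        refine sum_congr rfl fun i _ => ?_
        change algebraMap (𝓞 F) F (n • x i) • _ = n • algebraMap (𝓞 F) F (x i) • _
        rw [map_zsmul (algebraMap (𝓞 F) F), smul_assoc] }
  have : latticeOf (1 : τ.finAdelic) = LinearMap.range f := by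
    ext d
    rw [mem_latticeOf_one]
    constructor
    · intro h
      choose z hz using h
      refine ⟨z, ?_⟩
      change ∑ i, (z i : F) • finBasis F D i = d
      simp only [hz]
      exact (finBasis F D).sum_repr d
    · rintro ⟨z, rfl⟩ i
      refine ⟨z i, ?_⟩
      change _ = (finBasis F D).repr (∑ i, (z i : F) • finBasis F D i) i
      rw [Basis.repr_sum_self]
  rw [this]
  exact iff_fg.mp (Module.Finite.range f)

theorem exists_nat_smul_mem_one (x : τ.finAdelic) :
    ∃ n : ℕ, n ≠ 0 ∧ (∀ d ∈ latticeOf x, n • d ∈ latticeOf (1 : τ.finAdelic)) ∧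
      ∀ d ∈ latticeOf (1 : τ.finAdelic), n • d ∈ latticeOf x := by
  obtain ⟨n, hn0, hn⟩ := exists_nat_smul_mul_mem x
  obtain ⟨n', hn0', hn'⟩ := exists_nat_smul_mul_mem x⁻¹
  have h1 : ∀ v (y : K_[F,v] ⊗[F] D), τ.val ((1 : τ.finAdelic) v)⁻¹ * y = y :=
    fun v y => by
      have : ((1 : τ.finAdelic) v)⁻¹ = 1 := inv_one
      rw [this]
      exact one_mul _
  refine ⟨n * n', mul_ne_zero hn0 hn0', fun d hd v => ?_, fun d hd v => ?_⟩
  · have h2 := hn v _ (hd v)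
    rw [val_mul_val_inv_mul] at h2
    rw [h1, tmul_nat_smul, Nat.cast_mul, mul_comm, mul_smul]
    exact smul_mem_latticeAt v (natCast_mem _ _) h2
  · have h3 := hd v
    rw [h1] at h3
    have h2 := hn' v _ h3
    rw [tmul_nat_smul, Nat.cast_mul, mul_smul_comm, mul_smul]
    exact smul_mem_latticeAt v (natCast_mem _ _) h2

variable [Module ℚ D]

theorem latticeOf_fg (x : τ.finAdelic) : (latticeOf x).FG := by
  obtain ⟨n, hn0, h, -⟩ := exists_nat_smul_mem_one x
  have : IsNoetherian ℤ (latticeOf (1 : τ.finAdelic)) := isNoetherian_of_fg_of_noetherian _ latticeOf_one_fg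
  let f : D →ₗ[ℤ] D := LinearMap.lsmul ℤ D n
  have hf : Injective f := fun a b hab => by
    have h1 : (n : ℤ) • a = (n : ℤ) • b := hab
    rw [natCast_zsmul, natCast_zsmul, ← Nat.cast_smul_eq_nsmul ℚ, ← Nat.cast_smul_eq_nsmul ℚ] at h1
    exact smul_right_injective D (r := (n : ℚ)) (by exact_mod_cast hn0) h1
  have h2 : ((latticeOf x).map f).FG := by
    have h3 : (latticeOf x).map f ≤ latticeOf (1 : τ.finAdelic) := by
      rintro _ ⟨d, hd, rfl⟩
      change (n : ℤ) • d ∈ _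
      rw [natCast_zsmul]
      exact h d hd
    have h4 := IsNoetherian.noetherian (((latticeOf x).map f).comap (latticeOf (1 : τ.finAdelic)).subtype)
    have h5 := h4.map (latticeOf (1 : τ.finAdelic)).subtype
    rwa [Submodule.map_comap_subtype, inf_eq_right.mpr h3] at h5
  exact Submodule.fg_of_fg_map_injective f hf h2

theorem span_latticeOf (x : τ.finAdelic) : span ℚ (latticeOf x : Set D) = ⊤ := by
  rw [eq_top_iff]
  intro d _
  obtain ⟨n, hn0, -, h⟩ := exists_nat_smul_mem_one x
  obtain ⟨m, hm0, hm⟩ := exists_nat_mul_integral fun i => (finBasis F D).repr d i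
  have h1 : m • d ∈ latticeOf (1 : τ.finAdelic) := mem_latticeOf_one.mpr fun i => by
    obtain ⟨z, hz⟩ := hm i
    exact ⟨z, by
      rw [← Nat.cast_smul_eq_nsmul F, map_smul, Finsupp.smul_apply, smul_eq_mul, hz]⟩
  have h2 := subset_span (R := ℚ) (h _ h1)
  have h3 := (span ℚ (latticeOf x : Set D)).smul_mem ((n * m : ℕ) : ℚ)⁻¹ h2
  rwa [smul_smul, ← Nat.cast_smul_eq_nsmul ℚ, smul_smul, inv_mul_cancel₀ (by
    exact_mod_cast mul_ne_zero hn0 hm0), one_smul] at h3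

end LatticeProperties

section TraceForm

/-- The linear form `d ↦ tr (d + d⋆)`. -/
noncomputable def Involution.starTrace (τ : Involution F 𝒦 D) : D →ₗ[F] F :=
  regTrace F D + regTrace F D ∘ₗ τ.toLinearMap

variable {τ : Involution F 𝒦 D}

theorem Involution.star_star (d : D) : τ.toLinearMap (τ.toLinearMap d) = d := τ.map_map' d

theorem Involution.star_mul (a b : D) :
    τ.toLinearMap (a * b) = τ.toLinearMap b * τ.toLinearMap a := τ.map_mul' a b

theorem starTrace_star (d : D) : τ.starTrace (τ.toLinearMap d) = τ.starTrace d := by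
  simp only [Involution.starTrace, LinearMap.add_apply, LinearMap.comp_apply,
    Involution.star_star]
  rw [add_comm]

theorem starTrace_pos [IsTotallyComplex 𝒦] [IsScalarTower F 𝒦 D] [Module.Finite F D]
    [CompactSpace τ.infinite] (φ : F →+* ℝ) {d : D} (hd : d ≠ 0) :
    0 < φ (τ.starTrace (τ.toLinearMap d * d)) := by
  simp only [Involution.starTrace, LinearMap.add_apply, LinearMap.comp_apply,
    Involution.star_mul, Involution.star_star, map_add]
  have := regTrace_star_mul_pos τ φ hd
  linarith

variable [Module ℚ D] [IsScalarTower ℚ F D]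

theorem rat_smul_eq (q : ℚ) (d : D) : q • d = algebraMap ℚ F q • d :=
  (algebraMap_smul F q d).symm

/-- The form `(a, b) ↦ Tr_{F/ℚ} (tr (a⋆ b + b⋆ a))`. -/
noncomputable def Involution.ratForm (τ : Involution F 𝒦 D) : BilinForm ℚ D :=
  mk₂ ℚ (fun a b => Algebra.trace ℚ F (τ.starTrace (τ.toLinearMap a * b)))
    (fun a a' b => by rw [map_add, add_mul, map_add, map_add])
    (fun c a b => by
      rw [rat_smul_eq (F := F), map_smul, smul_mul_assoc, map_smul, algebraMap_smul, map_smul])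
    (fun a b b' => by rw [mul_add, map_add, map_add])
    (fun c a b => by
      rw [rat_smul_eq (F := F), mul_smul_comm, map_smul, algebraMap_smul, map_smul])

theorem ratForm_apply (a b : D) :
    τ.ratForm a b = Algebra.trace ℚ F (τ.starTrace (τ.toLinearMap a * b)) := rfl

theorem ratForm_symm (a b : D) : τ.ratForm a b = τ.ratForm b a := by
  rw [ratForm_apply, ← starTrace_star, Involution.star_mul, Involution.star_star]
  rfl

theorem trace_pos_of_totallyReal [IsTotallyReal F] {y : F} (hy : ∀ φ : F →+* ℝ, 0 < φ y) :
    0 < Algebra.trace ℚ F y := by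
  have h := trace_eq_sum_embeddings ℂ (K := ℚ) (x := y)
  have h1 : ∀ σ : F →ₐ[ℚ] ℂ, ∃ r : ℝ, 0 < r ∧ σ y = r := fun σ => by
    have hr : ComplexEmbedding.IsReal (σ : F →+* ℂ) :=
      IsTotallyReal.complexEmbedding_isReal _
    refine ⟨hr.embedding y, hy _, ?_⟩
    exact (hr.coe_embedding_apply y).symm
  choose r hr0 hr using h1
  simp only [hr] at h
  rw [← Complex.ofReal_sum] at h
  have h2 : algebraMap ℚ ℂ (Algebra.trace ℚ F y) = ((Algebra.trace ℚ F y : ℚ) : ℝ) := by simp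
  rw [h2, Complex.ofReal_inj] at h
  have : Nonempty (F →ₐ[ℚ] ℂ) := ⟨IsAlgClosed.lift⟩
  have h3 : 0 < ∑ σ : F →ₐ[ℚ] ℂ, r σ := Finset.sum_pos (fun σ _ => hr0 σ) Finset.univ_nonempty
  rw [← h] at h3
  exact_mod_cast h3

theorem starTrace_ne_zero [IsTotallyReal F] [IsTotallyComplex 𝒦] [IsScalarTower F 𝒦 D]
    [Module.Finite F D] [CompactSpace τ.infinite] {d : D}
    (hd : τ.starTrace (τ.toLinearMap d * d) = 0) : d = 0 := by
  by_contra h0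
  have := trace_pos_of_totallyReal fun φ => starTrace_pos (τ := τ) φ h0
  rw [hd, map_zero] at this
  exact lt_irrefl _ this

theorem ratForm_pos [IsTotallyReal F] [IsTotallyComplex 𝒦] [IsScalarTower F 𝒦 D]
    [Module.Finite F D] [CompactSpace τ.infinite] {d : D} (hd : d ≠ 0) : 0 < τ.ratForm d d :=
  trace_pos_of_totallyReal fun φ => starTrace_pos φ hd

variable [Module.Finite F D]

theorem exists_ratForm_integral : ∃ n : ℕ, n ≠ 0 ∧ ∀ x : τ.finAdelic, ∀ d ∈ latticeOf x,
    ∀ d' ∈ latticeOf x, ∃ z : ℤ, n * τ.ratForm d d' = z := by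
  obtain ⟨n, hn0, hn⟩ := exists_extForm_mem τ τ.starTrace
  refine ⟨n, hn0, fun x d hd d' hd' => ?_⟩
  obtain ⟨z, hz⟩ := exists_int_of_forall_mem (y := n * τ.starTrace (τ.toLinearMap d * d'))
    fun v => by
      have h := hn v _ (hd v) _ (hd' v)
      rw [star_mul_of_point, Involution.ext_tmul, tmul_mul_tmul, one_mul,
        extForm_tmul, one_mul] at h
      rwa [map_mul, map_natCast]
  refine ⟨Algebra.trace ℤ (𝓞 F) z, ?_⟩
  rw [ratForm_apply]
  have h := Algebra.coe_trace_int z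
  rw [hz, ← nsmul_eq_mul, map_nsmul, nsmul_eq_mul] at h
  exact h.symm

theorem continuous_extForm (T : D →ₗ[F] F) (v : Pl(F)) :
    Continuous (extForm T K_[F,v]) :=
  continuous_of_linear _

theorem exists_ratForm_dual [IsTotallyReal F] [IsTotallyComplex 𝒦] [IsScalarTower F 𝒦 D]
    [CompactSpace τ.infinite] : ∃ n : ℕ, n ≠ 0 ∧ ∀ x : τ.finAdelic, ∀ a : D,
    (∀ d ∈ latticeOf x, ∃ z : ℤ, τ.ratForm a d = z) → n • a ∈ latticeOf x := by
  obtain ⟨n₀, hn₀, h₀⟩ := exists_integral_of_trace (F := F)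
  obtain ⟨n₁, hn₁, h₁⟩ := exists_mem_of_extForm τ τ.starTrace fun d => starTrace_ne_zero
  refine ⟨n₁ * n₀, mul_ne_zero hn₁ hn₀, fun x a ha v => ?_⟩
  rw [tmul_nat_smul, mul_smul_comm, Nat.cast_mul]
  refine h₁ v _ _ fun j => ?_
  let W : Submodule O_[F,v] (K_[F,v] ⊗[F] D) :=
    { carrier := {y | (n₀ : K_[F,v]) *
        extForm τ.starTrace _ (τ.ext _ (1 ⊗ₜ a) * y) ∈ O_[F,v]}
      zero_mem' := by
        change _ ∈ O_[F,v]
        rw [mul_zero, map_zero, mul_zero]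
        exact zero_mem _
      add_mem' := fun {y y'} hy hy' => by
        change _ ∈ O_[F,v]
        rw [mul_add, map_add, mul_add]
        exact add_mem hy hy'
      smul_mem' := fun c y hy => by
        change _ * extForm _ _ (_ * ((c : K_[F,v]) • y)) ∈ O_[F,v]
        rw [mul_smul_comm, map_smul, smul_eq_mul, mul_left_comm]
        exact mul_mem c.2 hy }
  have hW : IsOpen (W : Set (K_[F,v] ⊗[F] D)) :=
    (isOpen_integers v).preimage (continuous_const.mul
      ((continuous_extForm _ v).comp (continuous_const.mul continuous_id)))
  have h2 := mul_mem_of_latticeOf_subset x v hW (fun d hd => by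
    change _ * extForm _ _ (τ.ext _ (1 ⊗ₜ a) * 1 ⊗ₜ d) ∈ O_[F,v]
    rw [Involution.ext_tmul, tmul_mul_tmul, one_mul, extForm_tmul, one_mul]
    obtain ⟨z, hz⟩ := h₀ (τ.starTrace (τ.toLinearMap a * d)) fun w => by
      obtain ⟨k, hk⟩ := ha _ (int_smul_mem_latticeOf hd w)
      refine ⟨k, ?_⟩
      rw [← hk, ratForm_apply, mul_smul_comm, map_smul, smul_eq_mul]
    have h3 := algebraMap_int_mem v z
    rwa [hz, map_mul, map_natCast] at h3)
    (subset_span ⟨j, rfl⟩ : (1 : K_[F,v]) ⊗ₜ[F] finBasis F D j ∈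
      latticeAt F D v)
  have h3 := star_mul_of_point τ (x v) (τ.val (x v)⁻¹ * (1 ⊗ₜ[F] a)) (1 ⊗ₜ finBasis F D j)
  rw [val_mul_val_inv_mul] at h3
  rw [← h3]
  exact h2

variable (τ) in
theorem exists_star_mul_mem : ∃ n : ℕ, n ≠ 0 ∧ ∀ x : τ.finAdelic, ∀ d ∈ latticeOf x,
    ∀ d' ∈ latticeOf x, n • (τ.toLinearMap d * d') ∈ latticeOf (1 : τ.finAdelic) := by
  let b := finBasis F D
  obtain ⟨n, hn0, hn⟩ := exists_nat_mul_integral fun q : (_ × _) × _ =>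
    b.repr (τ.toLinearMap (b q.1.1) * b q.1.2) q.2
  have hbase : ∀ (v : Pl(F)) i j, (n : K_[F,v]) •
      ((1 : K_[F,v]) ⊗ₜ[F] (τ.toLinearMap (b i) * b j)) ∈ latticeAt F D v :=
    fun v i j => by
      refine (mem_latticeAt v).mpr fun k => ?_
      obtain ⟨z, hz⟩ := hn ((i, j), k)
      have h := algebraMap_int_mem v z
      rw [hz, map_mul, map_natCast] at h
      rw [coordHomeo_smul, coordHomeo_apply, Basis.baseChange_repr_tmul, Algebra.smul_def,
        mul_one]
      exact h
  have hloc : ∀ (v : Pl(F)), ∀ y ∈ latticeAt F D v, ∀ y' ∈ latticeAt F D v,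
      (n : K_[F,v]) • (τ.ext _ y * y') ∈ latticeAt F D v := fun v y hy y' hy' => by
    rw [mem_latticeAt] at hy hy'
    rw [← sum_coordHomeo v y', ← sum_coordHomeo v y]
    simp only [map_sum, map_smul, Finset.sum_mul, Finset.mul_sum, smul_sum, smul_mul_assoc,
      mul_smul_comm, Involution.ext_tmul, tmul_mul_tmul, one_mul]
    refine sum_mem fun i _ => sum_mem fun j _ => ?_
    rw [smul_comm (n : K_[F,v]), smul_comm (n : K_[F,v])]
    exact smul_mem_latticeAt v (hy' _) (smul_mem_latticeAt v (hy _) (hbase v _ _))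
  refine ⟨n, hn0, fun x d hd d' hd' v => ?_⟩
  have h := hloc v _ (hd v) _ (hd' v)
  rw [star_mul_of_point, Involution.ext_tmul, tmul_mul_tmul, one_mul] at h
  have h1 : ((1 : τ.finAdelic) v)⁻¹ = 1 := inv_one
  rw [h1, tmul_nat_smul]
  change 1 * _ ∈ _
  rwa [one_mul]

end TraceForm

section Bounded

variable {W : Type*} [AddCommGroup W] [Module ℚ W] {n : ℕ} (e : Basis (Fin n) ℚ W)

theorem exists_bilinear_bound (f : W →ₗ[ℚ] W →ₗ[ℚ] W) (R : ℚ) : ∃ R' : ℚ, ∀ x y,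
    (∀ i, |e.repr x i| ≤ R) → (∀ i, |e.repr y i| ≤ R) → ∀ i, |e.repr (f x y) i| ≤ R' := by
  refine ⟨∑ q : Fin n × Fin n × Fin n, R * (R * |e.repr (f (e q.1) (e q.2.1)) q.2.2|),
    fun x y hx hy k => ?_⟩
  have h1 : e.repr (f x y) k =
      ∑ i, ∑ j, e.repr x i * (e.repr y j * e.repr (f (e i) (e j)) k) := by
    conv_lhs => rw [← e.sum_repr x, ← e.sum_repr y]
    simp only [map_sum, map_smul, LinearMap.sum_apply, LinearMap.smul_apply, Finsupp.coe_finsetSum,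
      Finset.sum_apply, Finsupp.smul_apply, smul_eq_mul]
    simp only [Finset.mul_sum]
    rw [Finset.sum_comm]
    refine sum_congr rfl fun i _ => ?_
    exact sum_congr rfl fun j _ => mul_left_comm _ _ _
  rw [h1, ← Finset.sum_product']
  refine (Finset.abs_sum_le_sum_abs _ _).trans ?_
  have hR : ∀ i : Fin n, 0 ≤ R := fun i => (abs_nonneg _).trans (hx i)
  calc _ ≤ ∑ q : Fin n × Fin n, R * (R * |e.repr (f (e q.1) (e q.2)) k|) := by
        refine Finset.sum_le_sum fun q _ => ?_
        rw [abs_mul, abs_mul]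
        have := hR q.1
        gcongr
        · exact hx _
        · exact hy _
    _ ≤ _ := by
        have hle := Finset.sum_le_sum_of_subset_of_nonneg (s := univ.image
          fun q : Fin n × Fin n => (q.1, q.2, k)) (Finset.subset_univ _)
          (f := fun q : Fin n × Fin n × Fin n => R * (R * |e.repr (f (e q.1) (e q.2.1)) q.2.2|))
          fun q _ _ => mul_nonneg (hR q.1) (mul_nonneg (hR q.1) (abs_nonneg _))
        rwa [Finset.sum_image] at hle
        rintro ⟨a, b⟩ _ ⟨a', b'⟩ _ h
        simp only [Prod.mk.injEq, and_true] at h ⊢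
        exact h

end Bounded

section RationalPoints

variable {τ : Involution F 𝒦 D}

/-- The element of `D` underlying a point of `U(F)`. -/
noncomputable def Involution.ratVal (γ : τ.points F) : D := Algebra.TensorProduct.lid F D (τ.val γ)

theorem tmul_ratVal (γ : τ.points F) : (1 : F) ⊗ₜ[F] τ.ratVal γ = τ.val γ :=
  (Algebra.TensorProduct.lid F D).injective (by simp [Involution.ratVal])

theorem ratVal_injective : Injective (τ.ratVal) := fun a b h =>
  τ.val_injective (by rw [← tmul_ratVal, ← tmul_ratVal, h])

theorem star_ratVal_mul (γ : τ.points F) : τ.toLinearMap (τ.ratVal γ) * τ.ratVal γ = 1 := by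
  have h := τ.ext_val_mul γ
  rw [← tmul_ratVal, Involution.ext_tmul, tmul_mul_tmul, one_mul] at h
  have := congrArg (Algebra.TensorProduct.lid F D) h
  simpa using this

/-- The point of `U(F)` attached to `c` with `c⋆ c = c c⋆ = 1`. -/
noncomputable def Involution.ratPoint (c : D) (h : τ.toLinearMap c * c = 1)
    (h' : c * τ.toLinearMap c = 1) : τ.points F :=
  Involution.mkPoint (1 ⊗ₜ[F] c)
    (by rw [Involution.ext_tmul, tmul_mul_tmul, h, one_mul]; rfl)
    (by rw [Involution.ext_tmul, tmul_mul_tmul, h', one_mul]; rfl)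

theorem val_pointsMap {k : Type*} [CommRing k] [Algebra F k] (γ : τ.points F) :
    τ.val (τ.pointsMap (ofId F k) γ) = 1 ⊗ₜ[F] τ.ratVal γ := by
  change Algebra.TensorProduct.map (ofId F k) (AlgHom.id F D) (τ.val γ) = _
  rw [← tmul_ratVal, Algebra.TensorProduct.map_tmul, map_one]
  rfl

theorem val_pointsMap_ratPoint {k : Type*} [CommRing k] [Algebra F k] (c : D)
    (h : τ.toLinearMap c * c = 1) (h' : c * τ.toLinearMap c = 1) :
    τ.val (τ.pointsMap (ofId F k) (Involution.ratPoint c h h')) = 1 ⊗ₜ[F] c := by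
  change Algebra.TensorProduct.map (ofId F k) (AlgHom.id F D) (1 ⊗ₜ[F] c) = _
  rw [Algebra.TensorProduct.map_tmul, map_one]
  rfl

variable [Module.Finite F D]

theorem diagFin_apply (γ : τ.points F) (v : Pl(F)) :
    τ.diagFin γ v = τ.pointsMap (ofId F K_[F,v]) γ := rfl

theorem isOpen_comap_mul (v : Pl(F)) (z : K_[F,v] ⊗[F] D) :
    IsOpen (((latticeAt F D v).comap
      (mulLeft O_[F,v] z) : Submodule _ _) :
      Set (K_[F,v] ⊗[F] D)) :=
  (isOpen_latticeAt v).preimage (continuous_const.mul continuous_id)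

theorem mem_basis (v : Pl(F)) (i) :
    (1 : K_[F,v]) ⊗ₜ[F] finBasis F D i ∈ latticeAt F D v :=
  subset_span ⟨i, rfl⟩

theorem inv_mul_mul_mem_integralAdelic {x y : τ.finAdelic} {c : D}
    (h : τ.toLinearMap c * c = 1) (h' : c * τ.toLinearMap c = 1)
    (hxy : ∀ d ∈ latticeOf x, c * d ∈ latticeOf y)
    (hyx : ∀ d ∈ latticeOf y, τ.toLinearMap c * d ∈ latticeOf x) :
    y⁻¹ * τ.diagFin (Involution.ratPoint c h h') * x ∈ τ.integralAdelic := by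
  intro v
  rw [mem_integralPoints]
  have h1 := fun i => mul_mem_of_latticeOf_subset x v
    (isOpen_comap_mul v (τ.val (y v)⁻¹ * (1 ⊗ₜ c))) (fun d hd => by
      change τ.val (y v)⁻¹ * (1 ⊗ₜ c) * 1 ⊗ₜ d ∈ latticeAt F D v
      rw [mul_assoc, tmul_mul_tmul, one_mul]
      exact hxy d hd v) (mem_basis v i)
  have h2 := fun i => mul_mem_of_latticeOf_subset y v
    (isOpen_comap_mul v (τ.val (x v)⁻¹ * (1 ⊗ₜ τ.toLinearMap c))) (fun d hd => by
      change τ.val (x v)⁻¹ * (1 ⊗ₜ τ.toLinearMap c) * 1 ⊗ₜ d ∈ latticeAt F D v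
      rw [mul_assoc, tmul_mul_tmul, one_mul]
      exact hyx d hd v) (mem_basis v i)
  have e1 : τ.val ((y⁻¹ * τ.diagFin (Involution.ratPoint c h h') * x) v) =
      τ.val (y v)⁻¹ * (1 ⊗ₜ c) * τ.val (x v) := by
    rw [RestrictedProduct.mul_apply, RestrictedProduct.mul_apply, RestrictedProduct.inv_apply,
      τ.val_mul, τ.val_mul, diagFin_apply, val_pointsMap_ratPoint]
  have e2 : τ.val ((y⁻¹ * τ.diagFin (Involution.ratPoint c h h') * x) v)⁻¹ =
      τ.val (x v)⁻¹ * (1 ⊗ₜ τ.toLinearMap c) * τ.val (y v) := by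
    rw [τ.val_inv, e1, τ.ext_mul, τ.ext_mul, ← τ.val_inv, ← τ.val_inv, inv_inv,
      Involution.ext_tmul, mul_assoc]
  rw [e1, e2]
  refine ⟨fun i => ?_, fun i => ?_⟩
  · rw [mul_assoc]
    exact h1 i
  · rw [mul_assoc]
    exact h2 i

theorem mul_mem_latticeOf {x : τ.finAdelic} {γ : τ.points F}
    (h : x⁻¹ * τ.diagFin γ * x ∈ τ.integralAdelic) {d : D} (hd : d ∈ latticeOf x) :
    τ.ratVal γ * d ∈ latticeOf x := fun v => by
  have h1 := (h v).1 _ (hd v)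
  change τ.val ((x⁻¹ * τ.diagFin γ * x) v) * _ ∈ _ at h1
  rwa [RestrictedProduct.mul_apply, RestrictedProduct.mul_apply, RestrictedProduct.inv_apply,
    τ.val_mul, τ.val_mul, diagFin_apply, val_pointsMap, mul_assoc, val_mul_val_inv_mul,
    mul_assoc, tmul_mul_tmul, one_mul] at h1

end RationalPoints

theorem exists_finset_representatives {X Y : Type*} (f : X → Y) (h : (Set.range f).Finite) :
    ∃ R : Finset X, ∀ x, ∃ r ∈ R, f x = f r := by
  classical
  choose g hg using fun y : Set.range f => y.2
  have := h.to_subtype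
  refine ⟨(Set.finite_range g).toFinset, fun x => ⟨g ⟨f x, x, rfl⟩, ?_, (hg ⟨f x, x, rfl⟩).symm⟩⟩
  rw [mem_toFinset]
  exact ⟨_, rfl⟩

section ClassNumber

variable {F 𝒦 D : Type*} [Field F] [NumberField F] [IsTotallyReal F] [Field 𝒦] [NumberField 𝒦]
  [IsTotallyComplex 𝒦] [Algebra F 𝒦]
  [Algebra.IsQuadraticExtension F 𝒦] [Ring D] [Algebra F D] [Algebra 𝒦 D] [IsScalarTower F 𝒦 D]
  [Module.Finite F D] {τ : Involution F 𝒦 D} [CompactSpace τ.infinite]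

/-- Two families of generators with the same Gram matrix differ by a rational point. -/
theorem exists_isometry [Module ℚ D] [IsScalarTower ℚ F D] [FiniteDimensional ℚ D]
    {Q : Type*} {s s' : Q → D} (hs : span ℚ (Set.range s) = ⊤)
    (h : ∀ q q', τ.toLinearMap (s q) * s q' = τ.toLinearMap (s' q) * s' q') :
    ∃ c : D, τ.toLinearMap c * c = 1 ∧ c * τ.toLinearMap c = 1 ∧ ∀ q, c * s q = s' q := by
  classical
  let φ := Finsupp.linearCombination ℚ s
  let φ' := Finsupp.linearCombination ℚ s'
  have hτ : ∀ (q : ℚ) (d : D), τ.toLinearMap (q • d) = q • τ.toLinearMap d := fun q d => by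
    rw [rat_smul_eq (F := F), map_smul, ← rat_smul_eq]
  have hmul : ∀ (q : ℚ) (a b : D), (q • a) * b = q • (a * b) := fun q a b => by
    rw [rat_smul_eq (F := F), smul_mul_assoc, ← rat_smul_eq]
  have hmul' : ∀ (q : ℚ) (a b : D), a * (q • b) = q • (a * b) := fun q a b => by
    rw [rat_smul_eq (F := F), mul_smul_comm, ← rat_smul_eq]
  have hφ : ∀ a b, τ.toLinearMap (φ' a) * φ' b = τ.toLinearMap (φ a) * φ b := fun a b => by
    simp only [φ, φ', Finsupp.linearCombination_apply, Finsupp.sum, map_sum, Finset.sum_mul,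
      Finset.mul_sum, hτ, hmul, hmul', h]
  have hsurj : LinearMap.range φ = ⊤ := by rw [Finsupp.range_linearCombination, hs]
  obtain ⟨g, hg⟩ := LinearMap.exists_rightInverse_of_surjective φ hsurj
  have hg' : ∀ u, φ (g u) = u := fun u => LinearMap.congr_fun hg u
  have hker : ∀ a, φ a = 0 → φ' a = 0 := fun a ha => by
    refine starTrace_ne_zero (τ := τ) ?_
    rw [hφ, ha, mul_zero, map_zero]
  let f : D →ₗ[ℚ] D := φ' ∘ₗ g
  have hfs : ∀ q, f (s q) = s' q := fun q => by
    have h1 : φ (g (s q) - Finsupp.single q 1) = 0 := by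
      rw [map_sub, hg', Finsupp.linearCombination_single, one_smul, sub_self]
    have h2 := hker _ h1
    rw [map_sub, sub_eq_zero] at h2
    refine h2.trans ?_
    rw [Finsupp.linearCombination_single, one_smul]
  have hf : ∀ u w, τ.toLinearMap (f u) * f w = τ.toLinearMap u * w := fun u w => by
    have := hφ (g u) (g w)
    rwa [hg', hg'] at this
  set c := f 1 with hc
  have h1 : ∀ u, τ.toLinearMap c * f u = u := fun u => by
    rw [hf]
    have : τ.toLinearMap (1 : D) = 1 := by
      have h := τ.star_mul (τ.toLinearMap 1) 1
      rwa [mul_one, τ.star_star, mul_one, eq_comm] at h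
    rw [this, one_mul]
  have hinj : Injective f := fun a b hab => by rw [← h1 a, ← h1 b, hab]
  have hsurj' : Surjective f := LinearMap.injective_iff_surjective.mp hinj
  have h2 : ∀ y, τ.toLinearMap c * y = 0 → y = 0 := fun y hy => by
    obtain ⟨u, rfl⟩ := hsurj' y
    rw [h1] at hy
    rw [hy, map_zero]
  have h3 : τ.toLinearMap c * c = 1 := h1 1
  refine ⟨c, h3, ?_, fun q => ?_⟩
  · rw [← sub_eq_zero]
    refine h2 _ ?_
    rw [mul_sub, ← mul_assoc, h3, one_mul, mul_one, sub_self]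
  · rw [← sub_eq_zero, ← hfs]
    refine h2 _ ?_
    rw [mul_sub, ← mul_assoc, h3, one_mul, h1, sub_self]

variable (τ)

theorem finite_class_number :
    FiniteDoubleCosets τ.diagFin τ.integralAdelic ∧
      FiniteStabilizers τ.diagFin τ.integralAdelic := by
  letI : Module ℚ D := Module.compHom D (algebraMap ℚ F)
  haveI : IsScalarTower ℚ F D := ⟨fun q a d => by
    change (q • a) • d = algebraMap ℚ F q • a • d
    rw [smul_smul]
    congr 1
    exact Algebra.smul_def q a⟩
  haveI : FiniteDimensional ℚ D := Module.Finite.trans F D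
  obtain ⟨n, e, c, hc, he⟩ := exists_diagonal_basis τ.ratForm ratForm_symm
    fun d hd => ratForm_pos hd
  constructor
  · obtain ⟨n₁, hn₁, h₁⟩ := exists_ratForm_integral (τ := τ)
    obtain ⟨n₂, hn₂, h₂⟩ := exists_ratForm_dual (τ := τ)
    obtain ⟨n₃, hn₃, h₃⟩ := exists_star_mul_mem τ
    obtain ⟨Q, hQ, R, hgen⟩ := exists_generators e hc he
      (Nat.pos_of_ne_zero (mul_ne_zero hn₁ hn₂))
    choose s hspan hR using fun x : τ.finAdelic => hgen (latticeOf x) (latticeOf_fg x)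
      (span_latticeOf x)
      (fun d hd d' hd' => by
        obtain ⟨z, hz⟩ := h₁ x d hd d' hd'
        refine ⟨n₂ * z, ?_⟩
        push_cast
        rw [← hz]
        ring)
      (fun d hd => by
        have := h₂ x d hd
        rw [natCast_zsmul, mul_smul]
        exact (latticeOf x).smul_of_tower_mem n₁ this)
    have hmem : ∀ x q, s x q ∈ latticeOf x := fun x q => by
      rw [← hspan]
      exact subset_span ⟨q, rfl⟩
    have hspanQ : ∀ x, span ℚ (Set.range (s x)) = ⊤ := fun x => by
      rw [eq_top_iff, ← span_latticeOf x, span_le]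
      have h : latticeOf x ≤ (span ℚ (Set.range (s x))).restrictScalars ℤ := by
        conv_lhs => rw [← hspan x]
        rw [span_le]
        exact subset_span
      exact h
    let f : D →ₗ[ℚ] D →ₗ[ℚ] D := mk₂ ℚ (fun a b => n₃ • (τ.toLinearMap a * b))
      (fun a a' b => by rw [map_add, add_mul, smul_add])
      (fun c a b => by
        rw [rat_smul_eq (F := F), map_smul, smul_mul_assoc, ← rat_smul_eq, smul_comm])
      (fun a b b' => by rw [mul_add, smul_add])
      (fun c a b => by rw [rat_smul_eq (F := F), mul_smul_comm, ← rat_smul_eq, smul_comm])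
    obtain ⟨R', hR'⟩ := exists_bilinear_bound e f R
    have hfin := finite_bounded_mem e (latticeOf_fg (1 : τ.finAdelic)) R'
    let gram : τ.finAdelic → Q → Q → D := fun x q q' => n₃ • (τ.toLinearMap (s x q) * s x q')
    have hrange : (Set.range gram).Finite := by
      refine (Set.Finite.pi' fun q => Set.Finite.pi' fun q' => hfin).subset ?_
      rintro _ ⟨x, rfl⟩ q q'
      exact ⟨h₃ x _ (hmem x q) _ (hmem x q'), hR' _ _ (hR x q) (hR x q')⟩
    obtain ⟨R₀, hR₀⟩ := exists_finset_representatives gram hrange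
    refine ⟨R₀, fun x => ?_⟩
    obtain ⟨r, hr, hxr⟩ := hR₀ x
    obtain ⟨c, hc1, hc2, hcs⟩ := exists_isometry (τ := τ) (s := s r) (s' := s x) (hspanQ r)
      fun q q' => by
        have h := congrFun (congrFun hxr q) q'
        simp only [gram] at h
        rw [← Nat.cast_smul_eq_nsmul ℚ, ← Nat.cast_smul_eq_nsmul ℚ] at h
        exact (smul_right_injective D (r := (n₃ : ℚ)) (by exact_mod_cast hn₃) h).symm
    have hmap : ∀ d ∈ latticeOf r, c * d ∈ latticeOf x := fun d hd => by
      rw [← hspan r] at hd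
      induction hd using span_induction with
      | mem d hd =>
        obtain ⟨q, rfl⟩ := hd
        rw [hcs]
        exact hmem x q
      | zero => rw [mul_zero]; exact zero_mem _
      | add a b _ _ ha hb => rw [mul_add]; exact add_mem ha hb
      | smul m a _ ha => rw [mul_smul_comm]; exact smul_mem _ m ha
    have hmap' : ∀ d ∈ latticeOf x, τ.toLinearMap c * d ∈ latticeOf r := fun d hd => by
      rw [← hspan x] at hd
      induction hd using span_induction with
      | mem d hd =>
        obtain ⟨q, rfl⟩ := hd
        rw [← hcs, ← mul_assoc, hc1, one_mul]
        exact hmem r q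
      | zero => rw [mul_zero]; exact zero_mem _
      | add a b _ _ ha hb => rw [mul_add]; exact add_mem ha hb
      | smul m a _ ha => rw [mul_smul_comm]; exact smul_mem _ m ha
    have key := inv_mul_mul_mem_integralAdelic hc1 hc2 hmap hmap'
    refine ⟨Involution.ratPoint c hc1 hc2, r, hr, _, τ.integralAdelic.inv_mem key, ?_⟩
    group
  · intro x
    obtain ⟨n₁, hn₁, -, h₁⟩ := exists_nat_smul_mem_one x
    obtain ⟨m, hm0, hm⟩ := exists_nat_mul_integral fun i => (finBasis F D).repr (1 : D) i
    have hm1 : n₁ • m • (1 : D) ∈ latticeOf x := h₁ _ <| mem_latticeOf_one.mpr fun i => by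
      obtain ⟨z, hz⟩ := hm i
      exact ⟨z, by rw [← Nat.cast_smul_eq_nsmul F, map_smul, Finsupp.smul_apply, smul_eq_mul, hz]⟩
    set u := n₁ • m • (1 : D) with hu
    set B := τ.ratForm u u with hB
    have hB0 : 0 ≤ B := by
      by_cases h : u = 0
      · rw [hB, h, map_zero]
      · exact (ratForm_pos h).le
    have hfin := finite_bounded_mem e (latticeOf_fg x) (1 + ∑ i, B / c i)
    have hinj : Injective fun γ : τ.points F => τ.ratVal γ * u := fun a b hab => by
      refine ratVal_injective ?_
      simp only [hu, mul_smul_comm, mul_one, ← Nat.cast_smul_eq_nsmul ℚ] at hab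
      exact smul_right_injective D (r := (m : ℚ)) (by exact_mod_cast hm0)
        (smul_right_injective D (r := (n₁ : ℚ)) (by exact_mod_cast hn₁) hab)
    refine (hfin.preimage hinj.injOn).subset fun γ hγ => ⟨mul_mem_latticeOf hγ hm1, fun i => ?_⟩
    set w := τ.ratVal γ * u with hw
    have h1 : τ.ratForm w w = B := by
      rw [ratForm_apply, hw, Involution.star_mul, mul_assoc, ← mul_assoc _ (τ.ratVal γ),
        star_ratVal_mul, one_mul]
      rfl
    rw [he] at h1
    have h2 : c i * (e.repr w i * e.repr w i) ≤ B := by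
      rw [← h1]
      exact single_le_sum (f := fun i => c i * (e.repr w i * e.repr w i))
        (fun j _ => mul_nonneg (hc j).le (mul_self_nonneg _)) (mem_univ i)
    have h3 : e.repr w i * e.repr w i ≤ B / c i := by
      rw [le_div_iff₀ (hc i), mul_comm]
      exact h2
    have h4 : B / c i ≤ ∑ i, B / c i :=
      single_le_sum (f := fun i => B / c i) (fun j _ => div_nonneg hB0 (hc j).le)
        (mem_univ i)
    have h5 : |e.repr w i| ≤ 1 + e.repr w i * e.repr w i := by
      rw [abs_le]
      constructor <;> nlinarith [sq_nonneg (e.repr w i + 1), sq_nonneg (e.repr w i - 1)]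
    linarith

end ClassNumber

section PadicHom

theorem exists_pow_dvd_sub {p : ℕ} {O : Type*} [CommRing O] (h : ∀ x : O, ∃ m : ℤ, (p : O) ∣ x - m) (n : ℕ) (x : O) :
    ∃ m : ℤ, (p : O) ^ n ∣ x - m := by
  induction n with
  | zero => exact ⟨0, by simp⟩
  | succ n ih =>
    obtain ⟨m, y, hy⟩ := ih
    obtain ⟨k, z, hz⟩ := h y
    refine ⟨m + p ^ n * k, z, ?_⟩
    push_cast
    linear_combination hy + (p : O) ^ n * hz

variable {p : ℕ} [hp : Fact p.Prime] {O : Type*} [CommRing O] [IsDomain O] [CharZero O]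

theorem pow_dvd_intCast (hp' : ¬ IsUnit (p : O)) (n : ℕ) (m : ℤ) :
    (p : O) ^ n ∣ m ↔ (p : ℤ) ^ n ∣ m := by
  refine ⟨fun h => ?_, fun h => by
    have := map_dvd (Int.castRingHom O) h
    rwa [map_pow, map_natCast] at this⟩
  induction n generalizing m with
  | zero => simp
  | succ n ih =>
    have h1 : (p : ℤ) ∣ m := by
      by_contra hm
      obtain ⟨a, b, hab⟩ := (Nat.prime_iff_prime_int.mp hp.out).irreducible.coprime_iff_not_dvd.mpr hm
      refine hp' (isUnit_of_dvd_one ?_)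
      have := congrArg (Int.cast : ℤ → O) hab
      push_cast at this
      rw [← this]
      exact dvd_add (Dvd.intro_left _ rfl)
        (((pow_succ' (p : O) n ▸ Dvd.intro _ rfl).trans h).mul_left _)
    obtain ⟨k, rfl⟩ := h1
    have hp0 : (p : O) ≠ 0 := by exact_mod_cast hp.out.ne_zero
    push_cast at h
    rw [pow_succ', mul_dvd_mul_iff_left hp0] at h
    rw [pow_succ']
    exact mul_dvd_mul_left _ (ih k h)

theorem exists_padicInt_hom (hp' : ¬ IsUnit (p : O)) (h : ∀ x : O, ∃ m : ℤ, (p : O) ∣ x - m) :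
    ∃ ψ : O →+* ℤ_[p], ∀ n x, (p : ℤ_[p]) ^ n ∣ ψ x ↔ (p : O) ^ n ∣ x := by
  have hmk : ∀ n (x : O), Ideal.Quotient.mk (Ideal.span {(p : O) ^ n}) x = 0 ↔ (p : O) ^ n ∣ x :=
    fun n x => by rw [eq_zero_iff_mem, mem_span_singleton]
  have hchar : ∀ n, CharP (O ⧸ Ideal.span {(p : O) ^ n}) (p ^ n) := fun n => ⟨fun m => by
    rw [← map_natCast (Ideal.Quotient.mk (Ideal.span {(p : O) ^ n})), hmk, ← Int.cast_natCast m,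
      pow_dvd_intCast hp']
    exact_mod_cast Iff.rfl⟩
  let g : ∀ n, ZMod (p ^ n) →+* O ⧸ Ideal.span {(p : O) ^ n} := fun n => ZMod.castHom dvd_rfl _
  have hg : ∀ n, Function.Bijective (g n) := fun n => by
    refine ⟨ZMod.castHom_injective _, fun y => ?_⟩
    obtain ⟨x, rfl⟩ := Ideal.Quotient.mk_surjective y
    obtain ⟨m, hm⟩ := exists_pow_dvd_sub h n x
    refine ⟨m, ?_⟩
    rw [map_intCast, ← map_intCast (Ideal.Quotient.mk (Ideal.span {(p : O) ^ n})), eq_comm,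
      ← sub_eq_zero, ← map_sub, hmk]
    exact hm
  let f : ∀ n, O →+* ZMod (p ^ n) := fun n =>
    ((RingEquiv.ofBijective (g n) (hg n)).symm : (O ⧸ Ideal.span {(p : O) ^ n}) →+* ZMod (p ^ n)).comp (Ideal.Quotient.mk _)
  have hf0 : ∀ n x, f n x = 0 ↔ (p : O) ^ n ∣ x := fun n x => by
    rw [← hmk]
    exact map_eq_zero_iff _ (RingEquiv.ofBijective (g n) (hg n)).symm.injective
  have hf : ∀ n x (m : ℤ), (p : O) ^ n ∣ x - m → f n x = m := fun n x m hm => by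
    rw [← sub_eq_zero, ← map_intCast (f n), ← map_sub, hf0]
    exact hm
  have hcompat : ∀ k₁ k₂ (hk : k₁ ≤ k₂),
      (ZMod.castHom (pow_dvd_pow p hk) (ZMod (p ^ k₁))).comp (f k₂) = f k₁ := fun k₁ k₂ hk =>
    RingHom.ext fun x => by
      obtain ⟨m, hm⟩ := exists_pow_dvd_sub h k₂ x
      rw [RingHom.comp_apply, hf k₂ x m hm, map_intCast,
        hf k₁ x m ((pow_dvd_pow _ hk).trans hm)]
  refine ⟨PadicInt.lift hcompat, fun n x => ?_⟩
  rw [← hf0, ← PadicInt.lift_spec hcompat n, RingHom.comp_apply, ← RingHom.mem_ker,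
    PadicInt.ker_toZModPow, mem_span_singleton]

end PadicHom

section DegreeOne

variable {L : Type*} [Field L] [NumberField L] {p : ℕ} [hp : Fact p.Prime]
  {w : Pl(L)}

/-- `w` is unramified of residual degree one over `p`. -/
structure IsDegreeOne (p : ℕ) (w : Pl(L)) : Prop where
  above : AboveP p w
  ramificationIdx : w.asIdeal.ramificationIdx ℤ = 1
  inertiaDeg : w.asIdeal.inertiaDeg ℤ = 1

theorem IsDegreeOne.liesOver (h : IsDegreeOne p w) : w.asIdeal.LiesOver (Ideal.span {(p : ℤ)}) := by
  have : (Ideal.span {(p : ℤ)}).IsMaximal := PrincipalIdealRing.isMaximal_of_irreducible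
    (Nat.prime_iff_prime_int.mp hp.out).irreducible
  refine ⟨this.eq_of_le Ideal.IsPrime.ne_top' ?_⟩
  rw [Ideal.span_singleton_le_iff_mem, Ideal.mem_comap, map_natCast]
  exact h.above

theorem IsDegreeOne.exists_sub_mem (h : IsDegreeOne p w) (x : 𝓞 L) : ∃ m : ℤ, x - m ∈ w.asIdeal := by
  have := h.liesOver
  have hm : (Ideal.span {(p : ℤ)}).IsMaximal := PrincipalIdealRing.isMaximal_of_irreducible
    (Nat.prime_iff_prime_int.mp hp.out).irreducible
  letI := Ideal.Quotient.field (Ideal.span {(p : ℤ)})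
  have h1 := Ideal.inertiaDeg_eq_of_isMaximal (Ideal.span {(p : ℤ)}) w.asIdeal
  rw [h.inertiaDeg] at h1
  have h2 : (⊥ : Subalgebra (ℤ ⧸ Ideal.span {(p : ℤ)}) (𝓞 L ⧸ w.asIdeal)) = ⊤ :=
    Subalgebra.bot_eq_top_of_finrank_eq_one h1.symm
  have h3 : Ideal.Quotient.mk w.asIdeal x ∈
      (⊥ : Subalgebra (ℤ ⧸ Ideal.span {(p : ℤ)}) (𝓞 L ⧸ w.asIdeal)) := h2 ▸ Algebra.mem_top
  obtain ⟨y, hy⟩ := Algebra.mem_bot.mp h3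
  obtain ⟨m, rfl⟩ := Ideal.Quotient.mk_surjective y
  refine ⟨m, Ideal.Quotient.eq.mp ?_⟩
  rw [← hy, ← eq_intCast (algebraMap ℤ (𝓞 L)) m]
  rfl

theorem IsDegreeOne.valued (h : IsDegreeOne p w) :
    Valued.v (p : K_[L,w]) = exp (-1 : ℤ) := by
  have h0 := h.liesOver
  have h1 := Ideal.ramificationIdx'_eq_ramificationIdx (Ideal.span {(p : ℤ)}) w.asIdeal
    (by simpa using hp.out.ne_zero)
  rw [h.ramificationIdx] at h1
  have hv : w.intValuation (p : 𝓞 L) = exp (-1 : ℤ) := by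
    have hle := fun n => w.intValuation_le_pow_iff_mem (p : 𝓞 L) n
    refine le_antisymm ((hle 1).mpr (by rw [pow_one]; exact h.above)) (not_lt.mp fun hlt => ?_)
    have h2 : (p : 𝓞 L) ∈ w.asIdeal ^ 2 := by
      have hne : w.intValuation (p : 𝓞 L) ≠ 0 :=
        w.intValuation_ne_zero _ (by exact_mod_cast hp.out.ne_zero)
      rw [← hle, ← WithZero.log_le_iff_le_exp hne]
      have := (WithZero.log_lt_iff_lt_exp hne).mpr hlt
      push_cast
      lia
    have h3 : Ideal.map (algebraMap ℤ (𝓞 L)) (Ideal.span {(p : ℤ)}) ≤ w.asIdeal ^ 2 := by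
      rw [Ideal.map_span, Set.image_singleton, Ideal.span_singleton_le_iff_mem]
      simpa using h2
    have hbdd : BddAbove {n | Ideal.map (algebraMap ℤ (𝓞 L)) (Ideal.span {(p : ℤ)}) ≤
        w.asIdeal ^ n} := by
      by_contra hb
      rw [Ideal.ramificationIdx', Nat.sSup_of_not_bddAbove hb] at h1
      exact zero_ne_one h1
    have h4 : 2 ≤ (Ideal.span {(p : ℤ)}).ramificationIdx' w.asIdeal := le_csSup hbdd h3
    lia
  rw [← hv, ← valued_algebraMap_int, map_natCast (algebraMap (𝓞 L) K_[L,w])]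

theorem IsDegreeOne.exists_dvd_sub (h : IsDegreeOne p w) (x : O_[L,w]) :
    ∃ m : ℤ, (p : O_[L,w]) ∣ x - m := by
  obtain ⟨a, ha⟩ := exists_int_valued_sub_lt w x.2 one_ne_zero (by simp)
  obtain ⟨m, hm⟩ := h.exists_sub_mem a
  refine ⟨m, ?_⟩
  have hp0 : (p : K_[L,w]) ≠ 0 := by
    rw [← (Valued.v : Valuation K_[L,w] _).ne_zero_iff, h.valued]
    exact exp_ne_zero
  have h1 : Valued.v ((x : K_[L,w]) - m) < 1 := by
    have h2 : Valued.v (algebraMap (𝓞 L) K_[L,w] (a - m)) < 1 := by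
      rw [valued_algebraMap_int]
      exact (w.intValuation_lt_one_iff_mem _).mpr hm
    have h3 : (x : K_[L,w]) - m = algebraMap (𝓞 L) K_[L,w] (a - m) -
        (algebraMap (𝓞 L) K_[L,w] a - x) := by
      rw [map_sub, map_intCast]
      ring
    rw [h3]
    rw [map_one] at ha
    exact (Valuation.map_sub_lt _ h2 ha)
  refine ⟨⟨((x : K_[L,w]) - m) / p, ?_⟩, Subtype.ext ?_⟩
  · rw [HeightOneSpectrum.mem_adicCompletionIntegers, map_div₀, h.valued]
    refine div_le_one_of_le₀ ?_ zero_le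
    rwa [← WithZero.lt_mul_exp_iff_le exp_ne_zero, ← WithZero.exp_add, neg_add_cancel,
      exp_zero]
  · push_cast
    exact (mul_div_cancel₀ _ hp0).symm

theorem IsDegreeOne.exists_hom (h : IsDegreeOne p w) : ∃ Ψ : K_[L,w] →+* ℚ_[p],
    ∀ x, ‖Ψ x‖ ≤ 1 ↔ x ∈ O_[L,w] := by
  have hp0 : (p : K_[L,w]) ≠ 0 := by
    rw [← (Valued.v : Valuation K_[L,w] _).ne_zero_iff, h.valued]
    exact exp_ne_zero
  have : CharZero K_[L,w] := charZero_of_injective_algebraMap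
    (algebraMap L K_[L,w]).injective
  have : CharZero O_[L,w] :=
    ⟨fun a b hab => by exact_mod_cast congrArg Subtype.val hab⟩
  have hcast : ∀ n : ℕ, ((p : O_[L,w]) ^ n : O_[L,w]) =
      (p : K_[L,w]) ^ n := fun n => by push_cast; rfl
  obtain ⟨ψ, hψ⟩ := exists_padicInt_hom (p := p) (O := O_[L,w]) (fun hu => by
    obtain ⟨y, hy⟩ := hu.exists_right_inv
    have h1 := congrArg (fun z : O_[L,w] =>
      Valued.v (z : K_[L,w])) hy
    have h2 : Valued.v (y : K_[L,w]) ≤ 1 := y.2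
    push_cast at h1
    rw [map_mul, h.valued, map_one] at h1
    have h3 := mul_le_of_le_one_right' (a := (exp (-1 : ℤ))) h2
    rw [h1, ← exp_zero, WithZero.exp_le_exp] at h3
    lia) h.exists_dvd_sub
  have hdiv : ∀ n (x : O_[L,w]), (p : O_[L,w]) ^ n ∣ x ↔
      (x : K_[L,w]) / p ^ n ∈ O_[L,w] := fun n x => by
    constructor
    · rintro ⟨y, rfl⟩
      push_cast
      rw [mul_div_cancel_left₀ _ (pow_ne_zero n hp0)]
      exact y.2
    · intro hx
      refine ⟨⟨_, hx⟩, Subtype.ext ?_⟩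
      push_cast
      exact (mul_div_cancel₀ _ (pow_ne_zero n hp0)).symm
  have hfrac : ∀ x : K_[L,w], ∃ (n : ℕ) (y : O_[L,w]),
      x = y / p ^ n := fun x => by
    obtain ⟨n, hn⟩ := exists_pow_mul_mem_integers w (a := (p : 𝓞 L)) h.above x
    have := hn n le_rfl
    rw [map_natCast] at this
    exact ⟨n, ⟨_, this⟩, by rw [mul_div_cancel_left₀ _ (pow_ne_zero n hp0)]⟩
  have hinj : Injective (ringHom.comp ψ) := by
    refine (injective_iff_map_eq_zero _).mpr fun x hx => ?_
    have h0 : ψ x = 0 := Subtype.ext hx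
    by_contra hx0
    have hx0' : (x : K_[L,w]) ≠ 0 := fun h => hx0 (Subtype.ext h)
    obtain ⟨n, hn⟩ := exists_pow_mul_mem_integers w (a := (p : 𝓞 L)) h.above
      ((x : K_[L,w])⁻¹)
    have h1 := hn n le_rfl
    obtain ⟨z, hz⟩ := (hψ (n + 1) x).mp (h0 ▸ dvd_zero _)
    have h2 : (p : K_[L,w]) * (((p : K_[L,w]) ^ n * (x : K_[L,w])⁻¹) *
        z) = 1 := by
      have := congrArg Subtype.val hz
      push_cast at this
      rw [pow_succ'] at this
      field_simp
      exact this.symm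
    rw [map_natCast] at h1
    have h3 := congrArg Valued.v h2
    rw [map_mul, h.valued, map_one] at h3
    have h4 := mul_le_of_le_one_right' (a := (exp (-1 : ℤ))) (mul_mem h1 z.2)
    rw [h3, ← exp_zero, WithZero.exp_le_exp] at h4
    lia
  let Ψ : K_[L,w] →+* ℚ_[p] := IsFractionRing.lift hinj
  refine ⟨Ψ, fun x => ?_⟩
  obtain ⟨n, y, rfl⟩ := hfrac x
  have hy : Ψ y = ψ y := IsFractionRing.lift_algebraMap hinj y
  rw [← hdiv, ← hψ, map_div₀, hy, map_pow, map_natCast, norm_div, norm_pow, norm_p,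
    ← mem_span_singleton, ← PadicInt.norm_le_pow_iff_mem_span_pow, inv_pow, div_inv_eq_mul,
    zpow_neg, zpow_natCast, ← le_div_iff₀ (by have := hp.out.pos; positivity), one_div]
  rfl

end DegreeOne

section PadicEmbedding

variable {L : Type*} [Field L] [NumberField L] {p : ℕ} [hp : Fact p.Prime]
  {w : Pl(L)} (h : IsDegreeOne p w) {Ψ : K_[L,w] →+* ℚ_[p]}
  (hΨ : ∀ x, ‖Ψ x‖ ≤ 1 ↔ x ∈ O_[L,w])

include h hΨ

theorem norm_le_pow_iff (n : ℕ) (x : K_[L,w]) :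
    ‖Ψ x‖ ≤ (p : ℝ) ^ (-n : ℤ) ↔ Valued.v x ≤ exp (-n : ℤ) := by
  have hpn : (0 : ℝ) < p ^ n := by have := hp.out.pos; positivity
  have h1 := hΨ (x / p ^ n)
  rw [HeightOneSpectrum.mem_adicCompletionIntegers, map_div₀, map_div₀, map_pow, map_pow, h.valued,
    map_natCast, norm_div, norm_pow, norm_p, div_le_one₀ (pow_pos (inv_pos.mpr (by exact_mod_cast hp.out.pos)) _),
    ← WithZero.exp_nsmul, div_le_one₀ (by simp), inv_pow, nsmul_eq_mul, mul_neg_one] at h1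
  rwa [zpow_neg, zpow_natCast]

theorem continuous_padic : Continuous Ψ := by
  refine continuous_of_continuousAt_zero Ψ ?_
  rw [ContinuousAt, map_zero, Metric.tendsto_nhds]
  intro ε hε
  obtain ⟨n, hn⟩ := exists_pow_lt_of_lt_one hε (inv_lt_one_of_one_lt₀
    (by exact_mod_cast hp.out.one_lt : (1 : ℝ) < p))
  have hp0 : (p : K_[L,w]) ≠ 0 := by
    rw [← (Valued.v : Valuation K_[L,w] _).ne_zero_iff, h.valued]
    exact exp_ne_zero
  have h1 : {x : K_[L,w] | x / p ^ n ∈ O_[L,w]} ∈ nhds 0 :=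
    ((isOpen_integers w).preimage (continuous_id.div_const _)).mem_nhds (by simp)
  filter_upwards [h1] with x hx
  have h2 := (hΨ _).mpr hx
  rw [map_div₀, map_pow, map_natCast, norm_div, norm_pow, norm_p,
    div_le_one₀ (by have := hp.out.pos; positivity)] at h2
  rw [dist_zero_right]
  exact h2.trans_lt hn

theorem surjective_padic : Surjective Ψ := by
  have h1 : ∀ y : ℤ_[p], (y : ℚ_[p]) ∈ Ψ '' O_[L,w] := fun y => by
    have hc : IsClosed (Ψ '' O_[L,w]) :=
      ((isCompact_iff_compactSpace.mpr (compactSpace_integers w)).image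
        (continuous_padic h hΨ)).isClosed
    refine PadicInt.denseRange_intCast.induction_on y
      (hc.preimage continuous_subtype_val) fun m => ?_
    exact ⟨m, intCast_mem _ m, by simp⟩
  intro y
  obtain ⟨n, hn⟩ : ∃ n : ℕ, ‖(p : ℚ_[p]) ^ n * y‖ ≤ 1 := by
    obtain ⟨n, hn⟩ := pow_unbounded_of_one_lt ‖y‖ (by exact_mod_cast hp.out.one_lt : (1 : ℝ) < p)
    refine ⟨n, ?_⟩
    rw [norm_mul, norm_pow, norm_p, inv_pow, inv_mul_le_one₀ (by
      have := hp.out.pos; positivity)]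
    exact hn.le
  obtain ⟨x, -, hx⟩ := h1 ⟨_, hn⟩
  refine ⟨x / p ^ n, ?_⟩
  rw [map_div₀, hx, map_pow, map_natCast]
  exact mul_div_cancel_left₀ _ (pow_ne_zero _ (by exact_mod_cast hp.out.ne_zero))

end PadicEmbedding

theorem padic_compat {F 𝒦 : Type*} [Field F] [NumberField F] [Field 𝒦] [NumberField 𝒦]
    [Algebra F 𝒦] {p : ℕ} [hp : Fact p.Prime] {v : Pl(F)}
    {w : Pl(𝒦)} (hv : IsDegreeOne p v) (hw : IsDegreeOne p w)
    (hvw : w.asIdeal.LiesOver v.asIdeal) {Ψ : K_[F,v] →+* ℚ_[p]}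
    (hΨ : ∀ x, ‖Ψ x‖ ≤ 1 ↔ x ∈ O_[F,v]) {Φ : K_[𝒦,w] →+* ℚ_[p]}
    (hΦ : ∀ x, ‖Φ x‖ ≤ 1 ↔ x ∈ O_[𝒦,w]) (x : F) :
    Φ (algebraMap 𝒦 _ (algebraMap F 𝒦 x)) = Ψ (algebraMap F _ x) := by
  have key : ∀ x : 𝓞 F, Φ (algebraMap (𝓞 𝒦) _ (algebraMap (𝓞 F) (𝓞 𝒦) x)) =
      Ψ (algebraMap (𝓞 F) _ x) := fun x => by
    have hsmall : ∀ n : ℕ, ‖Φ (algebraMap (𝓞 𝒦) _ (algebraMap (𝓞 F) (𝓞 𝒦) x)) -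
        Ψ (algebraMap (𝓞 F) _ x)‖ ≤ (p : ℝ) ^ (-n : ℤ) := fun n => by
      obtain ⟨m, y, hy⟩ := exists_pow_dvd_sub hv.exists_dvd_sub n
        (algebraMap (𝓞 F) O_[F,v] x)
      have h1 : Valued.v (algebraMap (𝓞 F) K_[F,v] (x - m)) ≤
          exp (-n : ℤ) := by
        have h2 : algebraMap (𝓞 F) K_[F,v] (x - m) = p ^ n * y := by
          rw [map_sub, map_intCast]
          exact (congrArg Subtype.val hy).trans (by push_cast; rfl)
        rw [h2, map_mul, map_pow, hv.valued, ← WithZero.exp_nsmul, nsmul_eq_mul, mul_neg_one]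
        exact mul_le_of_le_one_right' y.2
      have h3 : algebraMap (𝓞 F) (𝓞 𝒦) (x - m) ∈ w.asIdeal ^ n := by
        rw [valued_algebraMap_int, v.intValuation_le_pow_iff_mem] at h1
        have h4 := Ideal.mem_map_of_mem (algebraMap (𝓞 F) (𝓞 𝒦)) h1
        rw [Ideal.map_pow] at h4
        exact Ideal.pow_right_mono (Ideal.map_le_iff_le_comap.mpr hvw.over.le) n h4
      rw [← w.intValuation_le_pow_iff_mem, ← valued_algebraMap_int, ← norm_le_pow_iff hw hΦ] at h3
      rw [← norm_le_pow_iff hv hΨ] at h1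
      have h5 := (Padic.nonarchimedean _ _).trans (max_le h3 ((norm_neg _).trans_le h1))
      simpa [sub_eq_add_neg] using h5
    by_contra hne
    obtain ⟨n, hn⟩ := exists_pow_lt_of_lt_one (norm_pos_iff.mpr (sub_ne_zero.mpr hne))
      (inv_lt_one_of_one_lt₀ (by exact_mod_cast hp.out.one_lt : (1 : ℝ) < p))
    have := (hsmall n).trans_lt' hn
    rw [zpow_neg, zpow_natCast, inv_pow] at this
    exact lt_irrefl _ this
  have h1 : (Φ.comp (algebraMap 𝒦 _)).comp (algebraMap F 𝒦) = Ψ.comp (algebraMap F _) :=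
    IsFractionRing.ringHom_ext (A := 𝓞 F) fun x => key x
  exact RingHom.congr_fun h1 x

section Splitting

/-- The homomorphism `R ⊗ D → M₂(k)` given by `g : R → k` and `a : D → M₂(k)`. -/
noncomputable def matHom {F D R k : Type*} [Field F] [Ring D] [Algebra F D] [CommRing R]
    [Algebra F R] [CommRing k] (g : R →+* k) (a : D →+* Mat₂(k))
    (h : ∀ x : F, a (algebraMap F D x) = Matrix.scalar (Fin 2) (g (algebraMap F R x))) :
    R ⊗[F] D →+* Mat₂(k) :=
  letI : Algebra F k := (g.comp (algebraMap F R)).toAlgebra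
  let g' : R →ₐ[F] k := { g with commutes' := fun _ => rfl }
  let a' : D →ₐ[F] Mat₂(k) := { a with commutes' := h }
  (Algebra.TensorProduct.lift (((ofId k Mat₂(k)).restrictScalars F).comp
    g') a' fun x _ => Algebra.commutes (g x) _).toRingHom

section

variable {F D R k : Type*} [Field F] [Ring D] [Algebra F D] [CommRing R] [Algebra F R]
  [CommRing k] {g : R →+* k} {a : D →+* Mat₂(k)}
  {h : ∀ x : F, a (algebraMap F D x) = Matrix.scalar (Fin 2) (g (algebraMap F R x))}

theorem matHom_tmul (r : R) (d : D) : matHom g a h (r ⊗ₜ d) = g r • a d := by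
  rw [Algebra.smul_def]
  rfl

theorem matHom_smul (r : R) (z : R ⊗[F] D) : matHom g a h (r • z) = g r • matHom g a h z := by
  rw [Algebra.smul_def, map_mul, Algebra.TensorProduct.algebraMap_apply, matHom_tmul, map_one,
    smul_mul_assoc, one_mul]
  rfl

end

/-- A homomorphism of the `𝒦`-algebra `D` to `M₂(k)`, over some `𝒦 → k`, which induces an
isomorphism `k ⊗ D = M₂(k)`. -/
structure Splitting (𝒦 D k : Type*) [Field 𝒦] [Ring D] [Algebra 𝒦 D] [Field k] where
  κ : 𝒦 →+* k
  a : D →+* Mat₂(k)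
  a_algebraMap : ∀ z, a (algebraMap 𝒦 D z) = Matrix.scalar (Fin 2) (κ z)
  span : Submodule.span k (Set.range a) = ⊤

/-- Change of fields. -/
noncomputable def Splitting.map {𝒦 D k k' : Type*} [Field 𝒦] [Ring D] [Algebra 𝒦 D] [Field k] [Field k']
    (t : Splitting 𝒦 D k) (f : k →+* k') : Splitting 𝒦 D k' where
  κ := f.comp t.κ
  a := f.mapMatrix.comp t.a
  a_algebraMap z := by
    rw [RingHom.comp_apply, t.a_algebraMap]
    ext i j
    fin_cases i <;> fin_cases j <;> simp
  span := by
    have h1 : ∀ x : Mat₂(k), f.mapMatrix x ∈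
        Submodule.span k' (Set.range (f.mapMatrix.comp t.a)) := fun x => by
      have hx : x ∈ Submodule.span k (Set.range t.a) := t.span ▸ mem_top
      induction hx using span_induction with
      | mem x hx =>
        obtain ⟨d, rfl⟩ := hx
        exact subset_span ⟨d, rfl⟩
      | zero => simp
      | add x y _ _ hx hy => rw [map_add]; exact add_mem hx hy
      | smul c x _ hx =>
        have : f.mapMatrix (c • x) = f c • f.mapMatrix x := by ext i j; simp
        rw [this]
        exact smul_mem _ _ hx
    rw [eq_top_iff]
    intro y _
    rw [Matrix.matrix_eq_sum_single y]
    refine sum_mem fun i _ => sum_mem fun j _ => ?_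
    have : Matrix.single i j (y i j) = y i j • f.mapMatrix (Matrix.single i j 1) := by
      rw [RingHom.mapMatrix_apply, Matrix.map_single, map_one, Matrix.smul_single, smul_eq_mul,
        mul_one]
    rw [this]
    exact smul_mem _ _ (h1 _)

/-- The splitting given by an isomorphism `k ⊗ D = M₂(k)`. -/
noncomputable def Splitting.ofAlgEquiv {𝒦 D k : Type*} [Field 𝒦] [Ring D] [Algebra 𝒦 D] [Field k]
    [Algebra 𝒦 k] (e : k ⊗[𝒦] D ≃ₐ[k] Mat₂(k)) : Splitting 𝒦 D k where
  κ := algebraMap 𝒦 k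
  a := (e : k ⊗[𝒦] D →+* _).comp (includeRight : D →ₐ[𝒦] k ⊗[𝒦] D).toRingHom
  a_algebraMap z := by
    change e (1 ⊗ₜ algebraMap 𝒦 D z) = _
    rw [Algebra.algebraMap_eq_smul_one, ← TensorProduct.smul_tmul, ← Algebra.algebraMap_eq_smul_one]
    exact e.commutes _
  span := by
    rw [eq_top_iff]
    intro y _
    obtain ⟨x, rfl⟩ := e.surjective y
    induction x with
    | zero => simp
    | add x y hx hy => rw [map_add]; exact add_mem (hx trivial) (hy trivial)
    | tmul r d =>
      have : r ⊗ₜ[𝒦] d = r • (1 ⊗ₜ d) := by rw [TensorProduct.smul_tmul', smul_eq_mul, mul_one]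
      rw [this, map_smul]
      exact smul_mem _ _ (subset_span ⟨d, rfl⟩)

end Splitting

section SplitForm

theorem adjugate_add_two {k : Type*} [CommRing k] (x y : Mat₂(k)) :
    (x + y).adjugate = x.adjugate + y.adjugate := by
  ext i j
  fin_cases i <;> fin_cases j <;> simp [Matrix.adjugate_fin_two, add_comm]

theorem adjugate_smul_two {k : Type*} [CommRing k] (c : k) (x : Mat₂(k)) :
    (c • x).adjugate = c • x.adjugate := by
  ext i j
  fin_cases i <;> fin_cases j <;> simp [Matrix.adjugate_fin_two]

theorem exists_add_mul_skew {F 𝒦 : Type*} [Field F] [NumberField F] [Field 𝒦] [NumberField 𝒦]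
    [Algebra F 𝒦] [Algebra.IsQuadraticExtension F 𝒦] {u : 𝒦} (hu0 : u ≠ 0)
    (hu : conj F 𝒦 u = -u) (z : 𝒦) :
    ∃ a b : F, z = algebraMap F 𝒦 a + algebraMap F 𝒦 b * u := by
  obtain ⟨a, ha⟩ := add_conj_mem (F := F) z
  obtain ⟨b, hb⟩ := add_conj_mem (F := F) (z / u)
  refine ⟨a / 2, b / 2, ?_⟩
  rw [map_div₀, map_div₀, ha, hb, map_div₀, hu, map_ofNat]
  field_simp
  ring

variable {F 𝒦 D k : Type*} [Field F] [NumberField F] [Field 𝒦] [NumberField 𝒦] [Algebra F 𝒦]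
  [Algebra.IsQuadraticExtension F 𝒦] [Ring D] [Algebra F D] [Algebra 𝒦 D] [IsScalarTower F 𝒦 D]
  (τ : Involution F 𝒦 D) [Field k] [Algebra F k] (t : Splitting 𝒦 D k)
  (ht : ∀ x : F, t.κ (algebraMap F 𝒦 x) = algebraMap F k x)

theorem Splitting.a_algebraMap_base {R : Type*} [CommRing R] [Algebra F R] {g : R →+* k}
    (hg : ∀ x : F, t.κ (algebraMap F 𝒦 x) = g (algebraMap F R x)) (x : F) :
    t.a (algebraMap F D x) = Matrix.scalar (Fin 2) (g (algebraMap F R x)) := by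
  rw [IsScalarTower.algebraMap_apply F 𝒦 D, t.a_algebraMap, hg]

/-- The projection `k ⊗ D → M₂(k)`. -/
noncomputable def Splitting.fst : k ⊗[F] D →+* Mat₂(k) :=
  matHom (RingHom.id k) t.a (t.a_algebraMap_base ht)

/-- The second projection `k ⊗ D → M₂(k)`, for which the involution becomes the adjugate of the
first one. -/
noncomputable def Splitting.snd : k ⊗[F] D →+* Mat₂(k) where
  toFun z := (t.fst ht (τ.ext k z)).adjugate
  map_one' := by rw [τ.ext_one, map_one, Matrix.adjugate_one]
  map_zero' := by rw [map_zero, map_zero, Matrix.adjugate_zero]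
  map_mul' x y := by rw [τ.ext_mul, map_mul, Matrix.adjugate_mul_distrib]
  map_add' x y := by rw [map_add, map_add, adjugate_add_two]

theorem Splitting.fst_smul (c : k) (z : k ⊗[F] D) : t.fst ht (c • z) = c • t.fst ht z :=
  matHom_smul c z

theorem Splitting.snd_apply (z : k ⊗[F] D) :
    t.snd τ ht z = (t.fst ht (τ.ext k z)).adjugate := rfl

theorem Splitting.snd_smul (c : k) (z : k ⊗[F] D) : t.snd τ ht (c • z) = c • t.snd τ ht z := by
  rw [snd_apply, map_smul, fst_smul, adjugate_smul_two, snd_apply]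

theorem Splitting.fst_surjective : Surjective (t.fst ht) := fun y => by
  have hy : y ∈ Submodule.span k (Set.range t.a) := t.span ▸ mem_top
  induction hy using span_induction with
  | mem y hy =>
    obtain ⟨d, rfl⟩ := hy
    exact ⟨1 ⊗ₜ d, (matHom_tmul _ _).trans (one_smul _ _)⟩
  | zero => exact ⟨0, map_zero _⟩
  | add x y _ _ hx hy =>
    obtain ⟨a, rfl⟩ := hx
    obtain ⟨b, rfl⟩ := hy
    exact ⟨a + b, map_add _ _ _⟩
  | smul c x _ hx =>
    obtain ⟨a, rfl⟩ := hx
    exact ⟨c • a, t.fst_smul ht c a⟩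

/-- The homomorphism `k ⊗ 𝒦 → k`. -/
noncomputable def Splitting.eval : k ⊗[F] 𝒦 →ₐ[k] k :=
  Algebra.TensorProduct.lift (AlgHom.id k k) ({ t.κ with commutes' := ht } : 𝒦 →ₐ[F] k)
    fun _ _ => Commute.all _ _

theorem Splitting.eval_tmul (c : k) (z : 𝒦) : t.eval ht (c ⊗ₜ z) = c * t.κ z := rfl

variable (F k) in
/-- The conjugation of `k ⊗ 𝒦`. -/
noncomputable def conjTensor : k ⊗[F] 𝒦 →ₐ[k] k ⊗[F] 𝒦 :=
  Algebra.TensorProduct.map (AlgHom.id _ _) (conj F 𝒦 : 𝒦 →ₐ[F] 𝒦)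

theorem conjTensor_tmul (c : k) (z : 𝒦) : conjTensor F k (c ⊗ₜ z) = c ⊗ₜ conj F 𝒦 z := rfl

include ht in
theorem Splitting.exists_idempotent [CharZero k] : ∃ e : k ⊗[F] 𝒦, e * e = e ∧
    e + conjTensor F k e = 1 ∧ e * conjTensor F k e = 0 ∧ (∀ x, x * e = t.eval ht x • e) ∧
    ∀ x, x * conjTensor F k e = t.eval ht (conjTensor F k x) • conjTensor F k e := by
  obtain ⟨u, hu0, hu, a, ha⟩ := exists_skew (F := F) (𝒦 := 𝒦)
  have hs0 : t.κ u ≠ 0 := (map_ne_zero _).mpr hu0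
  have hs : t.κ u * t.κ u = algebraMap F k a := by rw [← map_mul, ha, ht]
  have htm : ∀ (c : k) (b : F) (z : 𝒦), c ⊗ₜ[F] (algebraMap F 𝒦 b * z) =
      (c * algebraMap F k b) ⊗ₜ[F] z := fun c b z => by
    rw [← Algebra.smul_def, ← TensorProduct.smul_tmul, Algebra.smul_def, mul_comm]
  have hcc : ∀ x : k ⊗[F] 𝒦, conjTensor F k (conjTensor F k x) = x := fun x => by
    induction x with
    | zero => simp
    | add a b ha hb => rw [map_add, map_add, ha, hb]
    | tmul r a => rw [conjTensor_tmul, conjTensor_tmul, conj_conj]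
  set U : k ⊗[F] 𝒦 := (t.κ u)⁻¹ ⊗ₜ u with hU
  have hUU : U * U = 1 := by
    rw [hU, tmul_mul_tmul, ha, ← mul_one (algebraMap F 𝒦 a), htm, ← hs,
      Algebra.TensorProduct.one_def]
    congr 1
    field_simp
  have hcU : conjTensor F k U = -U := by rw [hU, conjTensor_tmul, hu, TensorProduct.tmul_neg]
  set c : k ⊗[F] 𝒦 := algebraMap k _ (1 / 2) with hc
  have hc2 : c * 2 = 1 := by
    have h : (2 : k ⊗[F] 𝒦) = algebraMap k _ 2 := (map_ofNat _ 2).symm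
    rw [hc, h, ← map_mul, one_div, inv_mul_cancel₀ two_ne_zero, map_one]
  set e := c * (1 + U) with he
  have hce : conjTensor F k e = c * (1 - U) := by
    rw [he, map_mul, map_add, map_one, hcU, hc, commutes, sub_eq_add_neg]
  have h0 : e * conjTensor F k e = 0 := by
    rw [hce]
    linear_combination (-c * c) * hUU
  have h1 : e + conjTensor F k e = 1 := by
    rw [hce]
    linear_combination hc2
  have h2 : ∀ x, x * e = t.eval ht x • e := fun x => by
    induction x with
    | zero => simp
    | add x y hx hy => rw [add_mul, map_add, add_smul, hx, hy]
    | tmul r z =>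
      obtain ⟨a', b', rfl⟩ := exists_add_mul_skew hu0 hu z
      have e1 : r ⊗ₜ[F] (algebraMap F 𝒦 a' + algebraMap F 𝒦 b' * u) =
          algebraMap k _ (r * algebraMap F k a') + algebraMap k _ (r * algebraMap F k b' * t.κ u) * U := by
        rw [TensorProduct.tmul_add, htm, ← mul_one (algebraMap F 𝒦 a'), htm,
          Algebra.TensorProduct.algebraMap_apply, Algebra.TensorProduct.algebraMap_apply, hU,
          tmul_mul_tmul, one_mul]
        congr 2
        exact (mul_inv_cancel_right₀ hs0 _).symm
      have e2 : t.eval ht (r ⊗ₜ[F] (algebraMap F 𝒦 a' + algebraMap F 𝒦 b' * u)) =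
          r * algebraMap F k a' + r * algebraMap F k b' * t.κ u := by
        rw [eval_tmul, map_add, map_mul, ht, ht]
        ring
      rw [e2, e1, Algebra.smul_def, map_add, he]
      linear_combination (algebraMap k _ (r * algebraMap F k b' * t.κ u) * c) * hUU
  refine ⟨e, ?_, h1, h0, h2, fun x => ?_⟩
  · linear_combination e * h1 - h0
  · have := congrArg (conjTensor F k) (h2 (conjTensor F k x))
    rwa [map_mul, hcc, map_smul] at this

include ht in
theorem Splitting.exists_idempotent_tensor [CharZero k] : ∃ ε : k ⊗[F] D,
    t.fst ht ε = 1 ∧ t.snd τ ht ε = 0 := by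
  obtain ⟨u, hu0, hu, -⟩ := exists_skew (F := F) (𝒦 := 𝒦)
  have hs0 : t.κ u ≠ 0 := (map_ne_zero _).mpr hu0
  have h1 : t.fst ht ((t.κ u)⁻¹ ⊗ₜ algebraMap 𝒦 D u) = 1 := by
    refine (matHom_tmul _ _).trans ?_
    rw [t.a_algebraMap]
    ext i j
    fin_cases i <;> fin_cases j <;> simp [hs0]
  have h2 : τ.ext k ((t.κ u)⁻¹ ⊗ₜ algebraMap 𝒦 D u) = -((t.κ u)⁻¹ ⊗ₜ algebraMap 𝒦 D u) := by
    rw [Involution.ext_tmul, ← TensorProduct.tmul_neg, ← map_neg, ← hu]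
    exact congrArg _ (τ.map_algebraMap' u)
  refine ⟨(1 / 2 : k) • (1 + (t.κ u)⁻¹ ⊗ₜ algebraMap 𝒦 D u), ?_, ?_⟩
  · rw [fst_smul, map_add, map_one, h1, ← two_smul k, smul_smul]
    simp
  · rw [snd_smul, snd_apply, map_add, h2, τ.ext_one, map_add, map_neg, h1, map_one, add_neg_cancel,
      Matrix.adjugate_zero, smul_zero]

theorem Splitting.exists_algEquiv [CharZero k] [Module.Finite F D] (hD : finrank 𝒦 D = 4)
    {e : k ⊗[F] 𝒦} (hee : e * e = e) (h1 : e + conjTensor F k e = 1)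
    (h0 : e * conjTensor F k e = 0) (he : ∀ x, x * e = t.eval ht x • e)
    (he' : ∀ x, x * conjTensor F k e = t.eval ht (conjTensor F k x) • conjTensor F k e) :
    ∃ φ : (k ⊗[F] D) ≃ₐ[k] Mat₂(k ⊗[F] 𝒦), ∀ z i j, φ z i j =
      t.fst ht z i j • e + t.snd τ ht z i j • conjTensor F k e := by
  set e' := conjTensor F k e
  have hee' : e' * e' = e' := by rw [← map_mul, hee]
  have hmul : ∀ a b a' b' : k, (a • e + b • e') * (a' • e + b' • e') =
      (a * a') • e + (b * b') • e' := fun a b a' b' => by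
    simp only [Algebra.smul_def, map_mul]
    linear_combination (algebraMap k (k ⊗[F] 𝒦) a * algebraMap k (k ⊗[F] 𝒦) a') * hee +
      (algebraMap k (k ⊗[F] 𝒦) b * algebraMap k (k ⊗[F] 𝒦) b') * hee' +
      (algebraMap k (k ⊗[F] 𝒦) a * algebraMap k (k ⊗[F] 𝒦) b' +
        algebraMap k (k ⊗[F] 𝒦) b * algebraMap k (k ⊗[F] 𝒦) a') * h0
  let φ : (k ⊗[F] D) →ₐ[k] Mat₂(k ⊗[F] 𝒦) := AlgHom.ofLinearMap
    { toFun := fun z => Matrix.of fun i j => t.fst ht z i j • e + t.snd τ ht z i j • e'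
      map_add' := fun x y => by
        ext i j
        simp only [map_add, Matrix.add_apply, Matrix.of_apply, add_smul]
        abel
      map_smul' := fun c x => by
        ext i j
        simp only [fst_smul, snd_smul, Matrix.smul_apply, Matrix.of_apply, smul_eq_mul, mul_smul,
          smul_add, id_apply] }
    (by
      ext i j
      simp only [LinearMap.coe_mk, AddHom.coe_mk, map_one, Matrix.of_apply, Matrix.one_apply]
      split_ifs
      · rw [one_smul, one_smul, h1]
      · simp)
    (fun x y => by
      ext i j
      simp only [LinearMap.coe_mk, AddHom.coe_mk, map_mul, Matrix.of_apply, Matrix.mul_apply,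
        Fin.sum_univ_two, hmul, add_smul]
      abel)
  have hφ : ∀ z i j, φ z i j = t.fst ht z i j • e + t.snd τ ht z i j • e' := fun _ _ _ => rfl
  have hsurj : Surjective φ := fun m => by
    obtain ⟨ε, hε, hε'⟩ := t.exists_idempotent_tensor τ ht
    obtain ⟨x, hx⟩ := t.fst_surjective ht (m.map (t.eval ht))
    obtain ⟨y, hy⟩ := t.fst_surjective ht (m.map fun b => t.eval ht (conjTensor F k b)).adjugate
    refine ⟨x * ε + τ.ext k y * (1 - ε), ?_⟩
    ext i j
    have e1 : t.fst ht (x * ε + τ.ext k y * (1 - ε)) = m.map (t.eval ht) := by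
      rw [map_add, map_mul, map_mul, map_sub, hε, map_one, sub_self, mul_zero, add_zero, mul_one, hx]
    have e2 : t.snd τ ht (x * ε + τ.ext k y * (1 - ε)) =
        m.map fun b => t.eval ht (conjTensor F k b) := by
      rw [map_add, map_mul, map_mul, map_sub, hε', map_one, sub_zero, mul_zero, zero_add, mul_one,
        snd_apply, τ.ext_ext, hy, adjugate_adjugate_two]
    rw [hφ, e1, e2, Matrix.map_apply, Matrix.map_apply, ← he, ← he', ← mul_add, h1, mul_one]
  have hfin : finrank k (k ⊗[F] D) =
      finrank k Mat₂(k ⊗[F] 𝒦) := by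
    rw [Module.finrank_matrix, Module.finrank_baseChange, Module.finrank_baseChange,
      ← Module.finrank_mul_finrank F 𝒦 D, hD, Algebra.IsQuadraticExtension.finrank_eq_two]
    rfl
  have hinj : Injective φ :=
    (LinearMap.injective_iff_surjective_of_finrank_eq_finrank (f := φ.toLinearMap) hfin).mpr hsurj
  exact ⟨AlgEquiv.ofBijective φ ⟨hinj, hsurj⟩, hφ⟩

end SplitForm

section Hyperspecial

variable [IsScalarTower F 𝒦 D]
  [Module.Finite F D] (τ : Involution F 𝒦 D) {v : Pl(F)}
  (t : Splitting 𝒦 D K_[F,v])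
  (ht : ∀ x : F, t.κ (algebraMap F 𝒦 x) = algebraMap F K_[F,v] x)

theorem charZero_completion (v : Pl(F)) : CharZero K_[F,v] :=
  charZero_of_injective_algebraMap (algebraMap F K_[F,v]).injective

/-- The subgroup of the `g` with integral matrix. -/
noncomputable def Splitting.integral : Subgroup (τ.localPoints v) where
  carrier := {g | (∀ i j, t.fst ht (τ.val g) i j ∈ O_[F,v]) ∧
    ∀ i j, t.fst ht (τ.val g⁻¹) i j ∈ O_[F,v]}
  one_mem' := by
    have h : ∀ i j, (1 : Mat₂(K_[F,v])) i j ∈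
        O_[F,v] := fun i j => by
      rw [Matrix.one_apply]
      split_ifs
      exacts [one_mem _, zero_mem _]
    have h1 : t.fst ht (τ.val (1 : τ.localPoints v)) = 1 := map_one _
    rw [Set.mem_ofPred_eq, inv_one, h1]
    exact ⟨h, h⟩
  mul_mem' := fun {a b} ha hb => by
    rw [Set.mem_ofPred_eq, mul_inv_rev, τ.val_mul, τ.val_mul, map_mul, map_mul]
    exact ⟨SLEquiv.mul_mem ha.1 hb.1, SLEquiv.mul_mem hb.2 ha.2⟩
  inv_mem' := fun {a} ha => by
    rw [Set.mem_ofPred_eq, inv_inv]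
    exact ⟨ha.2, ha.1⟩

theorem Splitting.mem_integral {g : τ.localPoints v} : g ∈ t.integral τ ht ↔
    (∀ i j, t.fst ht (τ.val g) i j ∈ O_[F,v]) ∧
    ∀ i j, t.fst ht (τ.val g⁻¹) i j ∈ O_[F,v] := Iff.rfl

theorem Splitting.mem_integral_iff_snd {g : τ.localPoints v} : g ∈ t.integral τ ht ↔
    ∀ i j, t.fst ht (τ.val g) i j ∈ O_[F,v] ∧
      t.snd τ ht (τ.val g) i j ∈ O_[F,v] := by
  rw [mem_integral, snd_apply, ← τ.val_inv]
  refine ⟨fun h i j => ⟨h.1 i j, SLEquiv.adj_mem h.2 i j⟩,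
    fun h => ⟨fun i j => (h i j).1, fun i j => ?_⟩⟩
  have := SLEquiv.adj_mem (fun i j => (h i j).2) i j
  rwa [adjugate_adjugate_two] at this

theorem Splitting.isHyperspecial (hD : finrank 𝒦 D = 4)
    (hv : Algebra.IsUnramifiedIn (𝓞 𝒦) v.asIdeal) : IsHyperspecial τ v (t.integral τ ht) := by
  have := charZero_completion v
  obtain ⟨e, hee, h1, h0, he, he'⟩ := t.exists_idempotent ht
  obtain ⟨φ, hφ⟩ := t.exists_algEquiv τ ht hD hee h1 h0 he he'
  have hc : ∀ x, conjAt v x = conjTensor F K_[F,v] (𝒦 := 𝒦) x := fun _ => rfl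
  have hcc : conjAt v (conjTensor F K_[F,v] e) = e := by
    rw [← hc, conjAt_conjAt]
  refine ⟨hv, φ, fun z => ?_, fun x => ?_, fun g => ?_⟩
  · have e1 : t.fst ht (1 ⊗ₜ algebraMap 𝒦 D z) = Matrix.scalar (Fin 2) (t.κ z) := by
      refine (matHom_tmul _ _).trans ?_
      rw [t.a_algebraMap, map_one, one_smul]
    have e2 : t.snd τ ht (1 ⊗ₜ algebraMap 𝒦 D z) = Matrix.scalar (Fin 2) (t.κ (conj F 𝒦 z)) := by
      have h : τ.ext K_[F,v] (1 ⊗ₜ algebraMap 𝒦 D z) =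
          1 ⊗ₜ algebraMap 𝒦 D (conj F 𝒦 z) :=
          congrArg (fun d => (1 : K_[F,v]) ⊗ₜ[F] d) (τ.map_algebraMap' z)
      rw [snd_apply, h]
      refine (congrArg _ ((matHom_tmul _ _).trans (by
        rw [t.a_algebraMap, map_one, one_smul]))).trans ?_
      ext i j
      fin_cases i <;> fin_cases j <;> simp [Matrix.adjugate_fin_two]
    have e3 : (1 : K_[F,v]) ⊗ₜ[F] z = t.κ z • e +
        t.κ (conj F 𝒦 z) • conjTensor F K_[F,v] e := by
      have e4 := he (1 ⊗ₜ z)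
      have e5 := he' (1 ⊗ₜ z)
      rw [conjTensor_tmul] at e5
      rw [eval_tmul, one_mul] at e4 e5
      rw [← e4, ← e5, ← mul_add, h1, mul_one]
    ext i j
    rw [hφ, e1, e2, e3]
    fin_cases i <;> fin_cases j <;> simp
  · have e1 : t.fst ht (τ.ext _ x) = (t.snd τ ht x).adjugate := by
      rw [snd_apply, adjugate_adjugate_two]
    have e2 : t.snd τ ht (τ.ext _ x) = (t.fst ht x).adjugate := by
      rw [snd_apply, τ.ext_ext]
    have e3 : ∀ i j, conjAt v (φ x i j) = t.fst ht x i j • conjTensor F K_[F,v] e +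
        t.snd τ ht x i j • e := fun i j => by
      rw [hφ, map_add, map_smul, map_smul, hcc]
      rfl
    ext i j
    rw [hφ, e1, e2, Matrix.adjugate_fin_two, Matrix.adjugate_fin_two, Matrix.adjugate_fin_two]
    fin_cases i <;> fin_cases j <;> simp [e3, add_comm]
  · rw [mem_integral_iff_snd]
    refine forall_congr' fun i => forall_congr' fun j => ?_
    change _ ↔ φ (τ.val g) i j ∈ _
    rw [hφ]
    set x := t.fst ht (τ.val g) i j
    set y := t.snd τ ht (τ.val g) i j
    set e' := conjTensor F K_[F,v] e with he'def
    have hint : ∀ e : K_[F,v] ⊗[F] 𝒦, e * e = e → ∀ x ∈ O_[F,v],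
        x • e ∈ integralClosure O_[F,v] (K_[F,v] ⊗[F] 𝒦) :=
      fun e he x hx => by
        have h2 : IsIntegral O_[F,v] e :=
          ⟨Polynomial.X ^ 2 - Polynomial.X, by monicity!, by simp [pow_two, he]⟩
        exact (integralClosure O_[F,v]
          (K_[F,v] ⊗[F] 𝒦)).smul_mem h2 ⟨x, hx⟩
    have hev : ∀ (θ : K_[F,v] ⊗[F] 𝒦 →ₐ[K_[F,v]] K_[F,v]) z,
        z ∈ integralClosure O_[F,v] (K_[F,v] ⊗[F] 𝒦) →
        θ z ∈ O_[F,v] := fun θ z hz => by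
      have h3 := IsIntegral.map (θ.restrictScalars O_[F,v]) hz
      obtain ⟨y, hy⟩ := IsIntegrallyClosed.isIntegral_iff.mp h3
      rw [← AlgHom.coe_restrictScalars' O_[F,v], ← hy]
      exact y.2
    have hne : e ≠ 0 := fun h => by
      rw [he'def, h, map_zero, add_zero] at h1
      exact zero_ne_one h1
    have h4 : t.eval ht e = 1 := by
      have := he e
      rw [hee, eq_comm, ← sub_eq_zero] at this
      have h5 : (t.eval ht e - 1) • e = 0 := by rw [sub_smul, one_smul, this]
      exact sub_eq_zero.mp ((smul_eq_zero.mp h5).resolve_right hne)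
    have h5 : t.eval ht e' = 0 := by
      have := congrArg (t.eval ht) h1
      rw [map_add, h4, map_one] at this
      linear_combination this
    have h6 : conjTensor F K_[F,v] e' = e := hcc
    constructor
    · rintro ⟨hx, hy⟩
      exact add_mem (hint e hee x hx) (hint e' (by rw [he'def, ← map_mul, hee]) y hy)
    · intro h
      have h7 := hev (t.eval ht) _ h
      have h8 := hev ((t.eval ht).comp (conjTensor F K_[F,v])) _ h
      rw [map_add, map_smul, map_smul, h4, h5] at h7
      rw [map_add, map_smul, map_smul, AlgHom.comp_apply, AlgHom.comp_apply, ← he'def, h6, h4,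
        h5] at h8
      exact ⟨by simpa using h7, by simpa using h8⟩

theorem Splitting.continuous_fst (i j) : Continuous fun z => t.fst ht z i j :=
  continuous_of_linear (N := K_[F,v])
    { toFun := fun z => t.fst ht z i j
      map_add' := fun x y => by rw [map_add]; rfl
      map_smul' := fun c x => by rw [fst_smul]; rfl }

theorem Splitting.isOpen_integral : IsOpen (t.integral τ ht : Set (τ.localPoints v)) := by
  have h : (t.integral τ ht : Set (τ.localPoints v)) =
      (⋂ i, ⋂ j, {g | t.fst ht (τ.val g) i j ∈ O_[F,v]}) ∩
      ⋂ i, ⋂ j, {g | t.fst ht (τ.val g⁻¹) i j ∈ O_[F,v]} := by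
    ext g
    simp [mem_integral]
  rw [h]
  exact (isOpen_iInter_of_finite fun i => isOpen_iInter_of_finite fun j =>
    (isOpen_integers v).preimage ((t.continuous_fst ht i j).comp τ.continuous_val)).inter
    (isOpen_iInter_of_finite fun i => isOpen_iInter_of_finite fun j =>
    (isOpen_integers v).preimage ((t.continuous_fst ht i j).comp
      (τ.continuous_val.comp continuous_inv)))

theorem Splitting.fst_injective (hD : finrank 𝒦 D = 4) {g : τ.localPoints v}
    (hg : t.fst ht (τ.val g) = 1) : g = 1 := by
  have := charZero_completion v
  obtain ⟨e, hee, h1, h0, he, he'⟩ := t.exists_idempotent ht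
  obtain ⟨φ, hφ⟩ := t.exists_algEquiv τ ht hD hee h1 h0 he he'
  have h2 : t.fst ht (τ.val g⁻¹) = 1 := by
    have h3 : τ.val g⁻¹ * τ.val g = 1 := by rw [τ.val_inv]; exact τ.ext_val_mul g
    have := congrArg (t.fst ht) h3
    rwa [map_mul, hg, mul_one, map_one] at this
  refine τ.val_injective (φ.injective ?_)
  ext i j
  have h3 : τ.val (1 : τ.localPoints v) = 1 := rfl
  rw [hφ, hφ, snd_apply, ← τ.val_inv, h2, hg, h3, map_one, map_one]
  simp

theorem Splitting.isCompact_integral (hD : finrank 𝒦 D = 4) :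
    IsCompact (t.integral τ ht : Set (τ.localPoints v)) := by
  have := charZero_completion v
  obtain ⟨e, hee, h1, h0, he, he'⟩ := t.exists_idempotent ht
  obtain ⟨φ, hφ⟩ := t.exists_algEquiv τ ht hD hee h1 h0 he he'
  let k := K_[F,v]
  let f : ((Fin 2 × Fin 2) ⊕ (Fin 2 × Fin 2) → k) →ₗ[k] k ⊗[F] D :=
    φ.symm.toLinearMap ∘ₗ
      { toFun := fun x => Matrix.of fun i j =>
          x (Sum.inl (i, j)) • e + x (Sum.inr (i, j)) • conjTensor F k e
        map_add' := fun x y => by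
          ext i j
          simp only [Pi.add_apply, Matrix.add_apply, Matrix.of_apply, add_smul]
          abel
        map_smul' := fun c x => by
          ext i j
          simp only [Pi.smul_apply, Matrix.smul_apply, Matrix.of_apply, smul_eq_mul, mul_smul,
            smul_add, id_apply] }
  have hf : Continuous f := LinearMap.continuous_on_pi f
  have hC : IsCompact (Set.univ.pi fun _ : (Fin 2 × Fin 2) ⊕ (Fin 2 × Fin 2) =>
      (O_[F,v] : Set k)) :=
    isCompact_univ_pi fun _ => isCompact_iff_compactSpace.mpr (compactSpace_integers v)
  refine isCompact_of_val_mem τ v (hC.image hf) (t.isOpen_integral τ ht) fun g hg => ?_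
  rw [mem_integral_iff_snd] at hg
  refine ⟨Sum.elim (fun q => t.fst ht (τ.val g) q.1 q.2) fun q => t.snd τ ht (τ.val g) q.1 q.2,
    ?_, ?_⟩
  · rintro (q | q) -
    exacts [(hg _ _).1, (hg _ _).2]
  · refine φ.injective (Matrix.ext fun i j => ?_)
    refine Eq.trans ?_ (hφ _ i j).symm
    change φ (φ.symm _) i j = _
    rw [AlgEquiv.apply_symm_apply]
    rfl

end Hyperspecial

section SplitPrime

variable {F 𝒦 D : Type*} [Field F] [NumberField F] [Field 𝒦] [NumberField 𝒦] [Algebra F 𝒦]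
  {p : ℕ} [hp : Fact p.Prime]

theorem SplitsCompletely.isDegreeOne (hs : SplitsCompletely p 𝒦) {w : Pl(𝒦)}
    (hw : AboveP p w) : IsDegreeOne p w :=
  ⟨hw, (hs w.asIdeal w.isPrime hw).1, (hs w.asIdeal w.isPrime hw).2⟩

theorem AboveP.of_liesOver {v : Pl(F)} (hv : AboveP p v) (P : Ideal (𝓞 𝒦))
    [hP : P.LiesOver v.asIdeal] : (p : 𝓞 𝒦) ∈ P := by
  have h : (p : 𝓞 F) ∈ P.under (𝓞 F) := hP.over ▸ hv
  rwa [Ideal.mem_comap, map_natCast] at h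

theorem SplitsCompletely.tower (hs : SplitsCompletely p 𝒦) {v : Pl(F)}
    (hv : AboveP p v) (P : Ideal (𝓞 𝒦)) [P.IsPrime] [hP : P.LiesOver v.asIdeal] :
    IsDegreeOne p v ∧ P.ramificationIdx (𝓞 F) = 1 := by
  obtain ⟨h1, h2⟩ := hs P inferInstance (hv.of_liesOver P)
  have := v.isPrime
  rw [Ideal.ramificationIdx_tower v.asIdeal P] at h1
  rw [Ideal.inertiaDeg_tower v.asIdeal P] at h2
  exact ⟨⟨hv, Nat.eq_one_of_mul_eq_one_right h1, Nat.eq_one_of_mul_eq_one_right h2⟩,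
    Nat.eq_one_of_mul_eq_one_left h1⟩

theorem SplitsCompletely.isUnramifiedIn (hs : SplitsCompletely p 𝒦) {v : Pl(F)}
    (hv : AboveP p v) : Algebra.IsUnramifiedIn (𝓞 𝒦) v.asIdeal := by
  have := v.isPrime
  refine (Algebra.isUnramifiedIn_iff_forall_ramificationIdx_eq_one).mpr fun P hP _ => ?_
  exact (hs.tower hv P).2

theorem exists_above (v : Pl(F)) :
    ∃ w : Pl(𝒦), w.asIdeal.LiesOver v.asIdeal := by
  have := v.isMaximal
  obtain ⟨P, hP, hPv⟩ := Ideal.exists_maximal_ideal_liesOver_of_isIntegral v.asIdeal (S := 𝓞 𝒦)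
  refine ⟨⟨P, hP.isPrime, ?_⟩, hPv⟩
  rintro rfl
  refine v.ne_bot ?_
  rw [hPv.over]
  exact Ideal.comap_bot_of_injective _ (FaithfulSMul.algebraMap_injective _ _)

variable [Ring D] [Algebra F D] [Algebra 𝒦 D]

theorem exists_splitting (hs : SplitsCompletely p 𝒦) (hD : IsSplitAbove p 𝒦 D)
    {v : Pl(F)} (hv : AboveP p v) :
    ∃ (Ψ : K_[F,v] →+* ℚ_[p]) (t : Splitting 𝒦 D K_[F,v]),
      (∀ x, ‖Ψ x‖ ≤ 1 ↔ x ∈ O_[F,v]) ∧ Continuous Ψ ∧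
      ∀ x : F, t.κ (algebraMap F 𝒦 x) = algebraMap F _ x := by
  obtain ⟨w, hw⟩ := exists_above (𝒦 := 𝒦) v
  have := w.isPrime
  obtain ⟨hv1, -⟩ := hs.tower hv w.asIdeal
  have hwp : AboveP p w := hv.of_liesOver w.asIdeal
  have hw1 := hs.isDegreeOne hwp
  obtain ⟨Ψ, hΨ⟩ := hv1.exists_hom
  obtain ⟨Φ, hΦ⟩ := hw1.exists_hom
  obtain ⟨e⟩ := hD w hwp
  let Ψ' : K_[F,v] ≃+* ℚ_[p] :=
    RingEquiv.ofBijective Ψ ⟨Ψ.injective, surjective_padic hv1 hΨ⟩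
  refine ⟨Ψ, ((Splitting.ofAlgEquiv e).map Φ).map (Ψ'.symm : ℚ_[p] →+* K_[F,v]), hΨ,
    continuous_padic hv1 hΨ, fun x => ?_⟩
  change Ψ'.symm (Φ (algebraMap 𝒦 _ (algebraMap F 𝒦 x))) = _
  rw [padic_compat hv1 hw1 hw hΨ hΦ]
  exact Ψ'.symm_apply_apply _

end SplitPrime

section LocalModel

variable [IsScalarTower F 𝒦 D]
  [Module.Finite F D] (τ : Involution F 𝒦 D) {p : ℕ} [hp : Fact p.Prime]
  (t : ∀ v : PlAbove(F,p), Splitting 𝒦 D K_[F,v.1])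
  (ht : ∀ v (x : F), (t v).κ (algebraMap F 𝒦 x) = algebraMap F K_[F,v.1] x)
  (Ψ : ∀ v : PlAbove(F,p), K_[F,v.1] →+* ℚ_[p])

/-- The `p`-adic matrices attached to a point of `G(ℚ_p)`. -/
noncomputable def splitLoc : τ.padicPoints p →* Mats PlAbove(F,p) ℚ_[p] :=
  MonoidHom.pi fun v => ((Ψ v).mapMatrix.comp ((t v).fst (ht v))).toMonoidHom.comp
    (((Units.coeHom _).comp (τ.points _).subtype).comp (Pi.evalMonoidHom _ v))

theorem splitLoc_apply (z : τ.padicPoints p) (v i j) :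
    splitLoc τ t ht Ψ z v i j = Ψ v ((t v).fst (ht v) (τ.val (z v)) i j) := rfl

theorem continuous_splitLoc (hΨ : ∀ v, Continuous (Ψ v)) : Continuous (splitLoc τ t ht Ψ) := by
  refine continuous_pi fun v => continuous_matrix fun i j => ?_
  exact (hΨ v).comp (((t v).continuous_fst (ht v) i j).comp
    (τ.continuous_val.comp (continuous_apply v)))

theorem splitLoc_injective (hD : finrank 𝒦 D = 4) {z : τ.padicPoints p}
    (h : splitLoc τ t ht Ψ z = 1) : z = 1 := funext fun v => by
  refine (t v).fst_injective τ (ht v) hD (Matrix.ext fun i j => (Ψ v).injective ?_)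
  rw [← splitLoc_apply τ t ht Ψ z, h]
  change (1 : Mat₂(ℚ_[p])) i j = _
  rw [Matrix.one_apply, Matrix.one_apply, apply_ite (Ψ v), map_one, map_zero]

/-- The product of the hyperspecial subgroups. -/
noncomputable def splitLevel (hD : finrank 𝒦 D = 4) : PLevel τ p :=
  ⟨Subgroup.pi Set.univ fun v => (t v).integral τ (ht v),
    isOpen_set_pi Set.finite_univ fun v _ => (t v).isOpen_integral τ (ht v),
    isCompact_univ_pi fun v => (t v).isCompact_integral τ (ht v) hD⟩

theorem mem_splitLevel (hD : finrank 𝒦 D = 4) {z : τ.padicPoints p} :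
    z ∈ (splitLevel τ t ht hD).1 ↔ ∀ v, z v ∈ (t v).integral τ (ht v) :=
  ⟨fun h v => h v (Set.mem_univ v), fun h v _ => h v⟩

variable {Ψ} (hΨ : ∀ v x, ‖Ψ v x‖ ≤ 1 ↔ x ∈ O_[F,v.1])
include hΨ

theorem norm_splitLoc_le (hD : finrank 𝒦 D = 4) {z : τ.padicPoints p}
    (hz : z ∈ (splitLevel τ t ht hD).1) (v i j) : ‖splitLoc τ t ht Ψ z v i j‖ ≤ 1 :=
  (hΨ v _).mpr (((mem_splitLevel τ t ht hD).mp hz v).1 i j)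

/-- A congruence subgroup. -/
theorem exists_congruence (hD : finrank 𝒦 D = 4) (hc : ∀ v, Continuous (Ψ v)) {ε : ℝ}
    (hε : 0 < ε) : ∃ Kp ≤ splitLevel τ t ht hD, ∀ k ∈ Kp.1, ∀ v i j,
      ‖splitLoc τ t ht Ψ k v i j - (1 : Mats _ ℚ_[p]) v i j‖ ≤ ε := by
  set L := splitLevel τ t ht hD
  have hmul : ∀ a ∈ L.1, ∀ b, ∀ v,
      (∀ i j, ‖splitLoc τ t ht Ψ b v i j - (1 : Mats _ ℚ_[p]) v i j‖ ≤ ε) → ∀ i j,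
      ‖(splitLoc τ t ht Ψ a v * (splitLoc τ t ht Ψ b v - (1 : Mats _ ℚ_[p]) v)) i j‖ ≤ ε :=
    fun a ha b v hb i j => by
      rw [Matrix.mul_apply]
      refine norm_sum_le_of_forall_le_of_nonneg hε.le fun l _ => ?_
      rw [norm_mul]
      exact (mul_le_mul (norm_splitLoc_le τ t ht hΨ hD ha v i l) (hb l j) (norm_nonneg _)
        zero_le_one).trans_eq (one_mul ε)
  let N : Subgroup (τ.padicPoints p) :=
    { carrier := {z | z ∈ L.1 ∧ ∀ v i j,
        ‖splitLoc τ t ht Ψ z v i j - (1 : Mats _ ℚ_[p]) v i j‖ ≤ ε}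
      one_mem' := ⟨one_mem _, fun v i j => by rw [map_one, sub_self, norm_zero]; exact hε.le⟩
      mul_mem' := fun {a b} ha hb => ⟨mul_mem ha.1 hb.1, fun v i j => by
        have h1 : splitLoc τ t ht Ψ (a * b) v - (1 : Mats _ ℚ_[p]) v =
            splitLoc τ t ht Ψ a v * (splitLoc τ t ht Ψ b v - (1 : Mats _ ℚ_[p]) v) +
              (splitLoc τ t ht Ψ a v - (1 : Mats _ ℚ_[p]) v) := by
          rw [map_mul, Pi.mul_apply, mul_sub, Pi.one_apply, mul_one, sub_add_sub_cancel]
        rw [← Matrix.sub_apply, h1, Matrix.add_apply]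
        exact (norm_add_le_max _ _).trans
          (max_le (hmul a ha.1 b v (hb.2 v) i j) (ha.2 v i j))⟩
      inv_mem' := fun {a} ha => ⟨inv_mem ha.1, fun v i j => by
        have h1 : splitLoc τ t ht Ψ a⁻¹ v - (1 : Mats _ ℚ_[p]) v =
            -(splitLoc τ t ht Ψ a⁻¹ v * (splitLoc τ t ht Ψ a v - (1 : Mats _ ℚ_[p]) v)) := by
          rw [mul_sub, ← Pi.mul_apply, ← map_mul, inv_mul_cancel, map_one, Pi.one_apply, mul_one,
            neg_sub]
        rw [← Matrix.sub_apply, h1, Matrix.neg_apply, norm_neg]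
        exact hmul _ (inv_mem ha.1) a v (ha.2 v) i j⟩ }
  have hset : (N : Set (τ.padicPoints p)) = (L.1 : Set (τ.padicPoints p)) ∩ ⋂ v, ⋂ i, ⋂ j,
      (fun z => splitLoc τ t ht Ψ z v i j) ⁻¹'
        Metric.closedBall ((1 : Mats PlAbove(F,p) ℚ_[p]) v i j) ε := by
    ext z
    simp only [Set.mem_inter_iff, Set.mem_iInter, Set.mem_preimage, Metric.mem_closedBall,
      dist_eq_norm]
    rfl
  have hcont : ∀ v i j, Continuous fun z => splitLoc τ t ht Ψ z v i j := fun v i j =>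
    (continuous_apply_apply i j).comp
      ((continuous_apply v).comp (continuous_splitLoc τ t ht Ψ hc))
  refine ⟨⟨N, ?_, ?_⟩, fun z hz => hz.1, fun k hk => hk.2⟩
  · rw [hset]
    exact L.2.1.inter (isOpen_iInter_of_finite fun v => isOpen_iInter_of_finite fun i =>
      isOpen_iInter_of_finite fun j =>
        (IsUltrametricDist.isOpen_closedBall _ hε.ne').preimage (hcont v i j))
  · rw [hset]
    exact L.2.2.inter_right (isClosed_iInter fun v => isClosed_iInter fun i =>
      isClosed_iInter fun j => Metric.isClosed_closedBall.preimage (hcont v i j))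

omit hΨ in
theorem exists_separating (hD : finrank 𝒦 D = 4) (hc : ∀ v, Continuous (Ψ v))
    (Kp : PLevel τ p) : ∃ ε > 0, ∀ z ∈ (splitLevel τ t ht hD).1,
    (∀ v i j, ‖splitLoc τ t ht Ψ z v i j - (1 : Mats _ ℚ_[p]) v i j‖ ≤ ε) → z ∈ Kp.1 := by
  have := ofFinite PlAbove(F,p)
  let f : τ.padicPoints p → PlAbove(F,p) → Fin 2 → Fin 2 → ℚ_[p] :=
    splitLoc τ t ht Ψ
  let C : Set (τ.padicPoints p) := (splitLevel τ t ht hD).1 \ Kp.1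
  have hC : IsCompact (f '' C) :=
    ((splitLevel τ t ht hD).2.2.diff Kp.2.1).image (continuous_splitLoc τ t ht Ψ hc)
  obtain ⟨ε, hε, h⟩ := Metric.nhds_basis_closedBall.mem_iff.mp <|
    hC.isClosed.isOpen_compl.mem_nhds (x := f 1) (by
      rintro ⟨z, hz, e⟩
      exact hz.2 (splitLoc_injective τ t ht Ψ hD (e.trans (map_one (splitLoc τ t ht Ψ))) ▸ one_mem Kp.1))
  refine ⟨ε, hε, fun z hz hzK => by_contra fun hn => h ?_ ⟨z, ⟨hz, hn⟩, rfl⟩⟩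
  refine (dist_pi_le_iff hε.le).mpr fun v => (dist_pi_le_iff hε.le).mpr fun i =>
    (dist_pi_le_iff hε.le).mpr fun j => ?_
  have := hzK v i j
  rwa [← map_one (splitLoc τ t ht Ψ), ← dist_eq_norm] at this

end LocalModel

section Cayley

open Matrix MvPolynomial

/-- The evaluation of a polynomial at a matrix. -/
noncomputable def evalMat {k : Type*} [Field k] (Y : Mat₂(k)) :
    MvPolynomial (Fin 2 × Fin 2) k →+* k := eval fun q => Y q.1 q.2

variable {k : Type*} [Field k]

theorem eq_zero_of_evalMat [Infinite k] {Q : MvPolynomial (Fin 2 × Fin 2) k}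
    (h : ∀ Y, evalMat Y Q = 0) : Q = 0 :=
  MvPolynomial.funext fun y => (h (Matrix.of fun i j => y (i, j))).trans (map_zero _).symm

variable (k) in
/-- The polynomial `det (1 + Y)`. -/
noncomputable def cayleyDet : MvPolynomial (Fin 2 × Fin 2) k :=
  (1 + mvPolynomialX (Fin 2) (Fin 2) k).det

theorem evalMat_cayleyDet (Y : Mat₂(k)) :
    evalMat Y (cayleyDet k) = (1 + Y).det := by
  rw [cayleyDet, RingHom.map_det, map_add, map_one]
  exact congrArg (fun Z => (1 + Z).det) (mvPolynomialX_mapMatrix_eval Y)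

theorem cayleyDet_ne_zero : cayleyDet k ≠ 0 := fun h => by
  have := evalMat_cayleyDet (0 : Mat₂(k))
  rw [h, map_zero, add_zero, det_one] at this
  exact zero_ne_one this

theorem exists_comp_cayley (Q : MvPolynomial (Fin 2 × Fin 2) k) :
    ∃ (m : ℕ) (R : MvPolynomial (Fin 2 × Fin 2) k), ∀ Y Z : Mat₂(k),
      Z * (1 + Y) = 1 - Y → evalMat Y R = (1 + Y).det ^ m * evalMat Z Q := by
  induction Q using MvPolynomial.induction_on with
  | C a => exact ⟨0, C a, fun Y Z _ => by simp [evalMat]⟩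
  | add P Q hP hQ =>
    obtain ⟨m, R, hR⟩ := hP
    obtain ⟨n, T, hT⟩ := hQ
    refine ⟨m + n, cayleyDet k ^ n * R + cayleyDet k ^ m * T, fun Y Z h => ?_⟩
    rw [map_add, map_mul, map_mul, map_pow, map_pow, evalMat_cayleyDet, hR Y Z h, hT Y Z h,
      map_add]
    ring
  | mul_X P q hP =>
    obtain ⟨m, R, hR⟩ := hP
    let N := (1 - mvPolynomialX (Fin 2) (Fin 2) k) * (1 + mvPolynomialX (Fin 2) (Fin 2) k).adjugate
    refine ⟨m + 1, R * N q.1 q.2, fun Y Z h => ?_⟩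
    have h1 : (evalMat Y).mapMatrix N = (1 + Y).det • Z := by
      rw [map_mul, RingHom.map_adjugate, map_sub, map_add, map_one]
      have h2 : (evalMat Y).mapMatrix (mvPolynomialX (Fin 2) (Fin 2) k) = Y :=
        mvPolynomialX_mapMatrix_eval Y
      rw [h2, ← h, Matrix.mul_assoc, mul_adjugate, Matrix.mul_smul, Matrix.mul_one]
    have h3 : evalMat Y (N q.1 q.2) = (1 + Y).det * Z q.1 q.2 := congrFun (congrFun h1 q.1) q.2
    have h4 : evalMat Z (X q) = Z q.1 q.2 := eval_X _
    rw [map_mul, hR Y Z h, h3, map_mul, h4]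
    ring

theorem eval_combination_eq_zero [CharZero k] {σ : Type*} {n : ℕ} {R : MvPolynomial σ k}
    (y : Fin n → σ → k) (h : ∀ c : Fin n → ℤ, eval (∑ i, (c i : k) • y i) R = 0)
    (z : Fin n → k) : eval (∑ i, z i • y i) R = 0 := by
  let R' : MvPolynomial (Fin n) k := aeval (fun q => ∑ i, C (y i q) * X i) R
  have h1 : ∀ z : Fin n → k, eval z R' = eval (∑ i, z i • y i) R := fun z => by
    rw [← coe_aeval_eq_eval, ← coe_aeval_eq_eval]
    change aeval z (aeval _ R) = aeval _ R
    rw [comp_aeval_apply]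
    congr 1
    congr 1
    funext q
    simp [map_sum, mul_comm]
  have h2 : R' = 0 := by
    refine funext_set (fun _ => Set.range ((↑) : ℤ → k))
      (fun _ => Set.infinite_range_of_injective Int.cast_injective) fun x hx => ?_
    choose c hc using fun i => hx i (Set.mem_univ i)
    rw [h1, map_zero]
    have := h c
    simpa only [hc] using this
  rw [← h1, h2, map_zero]

end Cayley

section ZariskiDensity

open Matrix

variable [Module.Finite F D] (τ : Involution F 𝒦 D)

theorem exists_cayley_rat {x : D} (hx : τ.toLinearMap x = -x) (hu : IsUnit (1 + x)) :
    ∃ γ : τ.points F, τ.ratVal γ * (1 + x) = 1 - x := by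
  obtain ⟨γ, hγ⟩ := exists_cayley τ (X := (1 : F) ⊗ₜ[F] x)
    (by rw [τ.ext_tmul, hx, TensorProduct.tmul_neg]) 1 (by
      rw [one_smul]
      convert hu.map (includeRight : D →ₐ[F] F ⊗[F] D) using 1
      rw [map_add, map_one]
      rfl)
  refine ⟨γ, ?_⟩
  rw [one_smul, ← tmul_ratVal] at hγ
  have := congrArg (Algebra.TensorProduct.lid F D) hγ
  simpa using this

variable {k : Type*} [Field k] [CharZero k] (t : Splitting 𝒦 D k)

theorem Splitting.span_skew :
    Submodule.span k (t.a '' {x | τ.toLinearMap x = -x}) = ⊤ := by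
  obtain ⟨z, hz0, hz, -⟩ := exists_skew (F := F) (𝒦 := 𝒦)
  set W := Submodule.span k (t.a '' {x | τ.toLinearMap x = -x})
  rw [eq_top_iff, ← t.span, span_le]
  rintro _ ⟨d, rfl⟩
  have h1 : t.a (d - τ.toLinearMap d) ∈ W := subset_span ⟨_, by
    rw [Set.mem_ofPred_eq, map_sub, τ.star_star, neg_sub], rfl⟩
  have h2 : t.a (algebraMap 𝒦 D z * (d + τ.toLinearMap d)) ∈ W := subset_span ⟨_, by
    rw [Set.mem_ofPred_eq, τ.star_mul, map_add, τ.star_star]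
    have : τ.toLinearMap (algebraMap 𝒦 D z) = algebraMap 𝒦 D (conj F 𝒦 z) := τ.map_algebraMap' z
    rw [this, hz, map_neg, mul_neg, ← Algebra.commutes, add_comm], rfl⟩
  have hs : ∀ c (M : Mat₂(k)), Matrix.scalar (Fin 2) c * M = c • M :=
    fun c M => by ext; simp
  rw [map_mul, t.a_algebraMap, hs] at h2
  have hκ : t.κ z ≠ 0 := (map_ne_zero _).mpr hz0
  have h3 := W.smul_mem (t.κ z)⁻¹ h2
  rw [smul_smul, inv_mul_cancel₀ hκ, one_smul] at h3
  have h4 := W.smul_mem (2 : k)⁻¹ (add_mem h1 h3)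
  rw [← map_add, sub_add_add_cancel, ← two_mul, map_mul, map_ofNat] at h4
  have h5 : (2 : Mat₂(k)) = (2 : k) • 1 := by
    ext i j
    fin_cases i <;> fin_cases j <;> simp [Matrix.ofNat_apply]
  rwa [h5, smul_mul_assoc, one_mul, smul_smul, inv_mul_cancel₀ two_ne_zero, one_smul] at h4

theorem Splitting.eq_zero_of_evalMat [IsSimpleRing D]
    {Q : MvPolynomial (Fin 2 × Fin 2) k} (hQ : ∀ γ : τ.points F, evalMat (t.a (τ.ratVal γ)) Q = 0) :
    Q = 0 := by
  have hinj : Injective t.a := t.a.injective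
  obtain ⟨m, R, hR⟩ := exists_comp_cayley Q
  have hR0 : ∀ x : D, τ.toLinearMap x = -x → evalMat (t.a x) (cayleyDet k * R) = 0 := fun x hx => by
    rw [map_mul, evalMat_cayleyDet]
    by_cases h : (1 + t.a x).det = 0
    · rw [h, zero_mul]
    · have hu : IsUnit (1 + x) := by
        refine isUnit_of_isUnit_lmul (R := F) ?_
        rw [LinearMap.isUnit_iff_ker_eq_bot, LinearMap.ker_eq_bot']
        intro y hy
        have h1 : (1 + t.a x) * t.a y = 0 := by
          rw [← map_one t.a, ← map_add, ← map_mul]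
          exact (congrArg t.a hy).trans (map_zero _)
        have h2 : t.a y = 0 := by
          have hdet : IsUnit (1 + t.a x) := (Matrix.isUnit_iff_isUnit_det _).mpr (IsUnit.mk0 _ h)
          exact hdet.mul_right_eq_zero.mp h1
        exact hinj (h2.trans (map_zero _).symm)
      obtain ⟨γ, hγ⟩ := exists_cayley_rat τ hx hu
      have h1 : t.a (τ.ratVal γ) * (1 + t.a x) = 1 - t.a x := by
        rw [← map_one t.a, ← map_add, ← map_mul, hγ, map_sub]
      rw [hR _ _ h1, hQ, mul_zero, mul_zero]
  have hR1 : cayleyDet k * R = 0 := DefiniteUnitary.eq_zero_of_evalMat fun Y => by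
    have hY : Y ∈ Submodule.span k (t.a '' {x | τ.toLinearMap x = -x}) := by
      rw [t.span_skew τ]
      exact mem_top
    obtain ⟨n, z, g, rfl⟩ := Submodule.mem_span_set'.mp hY
    choose x hx hxg using fun i => (g i).2
    have := eval_combination_eq_zero (R := cayleyDet k * R)
      (fun i (q : Fin 2 × Fin 2) => (g i : Mat₂(k)) q.1 q.2) (fun c => by
        have h1 := hR0 (∑ i, c i • x i) (by
          rw [map_sum, ← Finset.sum_neg_distrib]
          refine sum_congr rfl fun i _ => ?_
          rw [map_zsmul, hx i, smul_neg])
        rw [map_sum] at h1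
        convert h1 using 2
        unfold evalMat
        congr 2
        funext q
        simp only [Finset.sum_apply, Pi.smul_apply, Matrix.sum_apply, map_zsmul, hxg,
          ← Int.cast_smul_eq_zsmul k, Matrix.smul_apply]) z
    convert this using 2
    unfold evalMat
    congr 1
    funext q
    simp [Finset.sum_apply, Matrix.sum_apply]
  have hR2 : R = 0 := (mul_eq_zero.mp hR1).resolve_left cayleyDet_ne_zero
  have h3 : cayleyDet k * Q = 0 := DefiniteUnitary.eq_zero_of_evalMat fun Z => by
    rw [map_mul, evalMat_cayleyDet]
    by_cases h : (1 + Z).det = 0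
    · rw [h, zero_mul]
    · have hu := (Matrix.isUnit_iff_isUnit_det _).mpr (IsUnit.mk0 _ h)
      obtain ⟨u, hu⟩ := hu
      set Y : Mat₂(k) := (1 - Z) * (u⁻¹ : (Mat₂(k))ˣ) with hYdef
      have hY : Y * (1 + Z) = 1 - Z := by
        rw [hYdef, ← hu, mul_assoc, Units.inv_mul, mul_one]
      have h1Y : (1 + Y) * (1 + Z) = (2 : k) • 1 := by
        rw [add_mul, hY, one_mul, add_add_sub_cancel, two_smul]
      have hdet : (1 + Y).det ≠ 0 := fun h0 => by
        have := congrArg Matrix.det h1Y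
        rw [Matrix.det_mul, h0, zero_mul, Matrix.det_smul, Matrix.det_one, mul_one] at this
        exact pow_ne_zero _ two_ne_zero this.symm
      have h1Y' : (1 + Z) * (1 + Y) = (2 : k) • 1 := by
        refine (hu ▸ u.isUnit : IsUnit (1 + Z)).mul_right_cancel ?_
        rw [mul_assoc, h1Y, mul_smul_comm, smul_mul_assoc, one_mul, mul_one]
      have hZY : Z * (1 + Y) = 1 - Y := by
        rw [add_mul, one_mul, two_smul] at h1Y'
        rw [eq_sub_of_add_eq' h1Y']
        abel
      have := hR Y Z hZY
      rw [hR2, map_zero, eq_comm] at this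
      rw [(mul_eq_zero.mp this).resolve_left (pow_ne_zero _ hdet), mul_zero]
  exact (mul_eq_zero.mp h3).resolve_left cayleyDet_ne_zero

end ZariskiDensity

section ProductDensity

variable {S k : Type*} [Field k]

open Classical in
theorem exists_evalMat_update {P : Mats S k → k} (hP : P ∈ polyAlg S k) (Y : Mats S k) (s : S) :
    ∃ Q : MvPolynomial (Fin 2 × Fin 2) k, ∀ Z, P (Function.update Y s Z) = evalMat Z Q := by
  induction hP using adjoin_induction with
  | mem f h =>
    obtain ⟨⟨s', i, j⟩, rfl⟩ := h
    by_cases hs : s' = s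
    · subst hs
      exact ⟨MvPolynomial.X (i, j), fun Z => by simp [coordFun, evalMat]⟩
    · exact ⟨MvPolynomial.C (Y s' i j), fun Z => by simp [coordFun, evalMat, hs]⟩
  | algebraMap c => exact ⟨MvPolynomial.C c, fun Z => by simp [evalMat]⟩
  | add f g _ _ hf hg =>
    obtain ⟨Q, hQ⟩ := hf
    obtain ⟨R, hR⟩ := hg
    exact ⟨Q + R, fun Z => by rw [Pi.add_apply, hQ, hR, map_add]⟩
  | mul f g _ _ hf hg =>
    obtain ⟨Q, hQ⟩ := hf
    obtain ⟨R, hR⟩ := hg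
    exact ⟨Q * R, fun Z => by rw [Pi.mul_apply, hQ, hR, map_mul]⟩

theorem eq_zero_of_mem_polyAlg [Finite S] {A : S → Set Mat₂(k)}
    (hA : ∀ s, ∀ Q : MvPolynomial (Fin 2 × Fin 2) k, (∀ Z ∈ A s, evalMat Z Q = 0) → Q = 0)
    {P : Mats S k → k} (hP : P ∈ polyAlg S k) (h : ∀ Y : Mats S k, (∀ s, Y s ∈ A s) → P Y = 0) :
    P = 0 := by
  classical
  have key : ∀ T : Finset S, ∀ Y : Mats S k, (∀ s, s ∉ T → Y s ∈ A s) → P Y = 0 := fun T => by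
    induction T using Finset.induction_on with
    | empty => exact fun Y hY => h Y fun s => hY s (Finset.notMem_empty s)
    | insert s T _ ih =>
      intro Y hY
      obtain ⟨Q, hQ⟩ := exists_evalMat_update hP Y s
      have hQ0 : Q = 0 := hA s Q fun Z hZ => by
        rw [← hQ]
        refine ih _ fun s' hs' => ?_
        by_cases hss : s' = s
        · subst hss
          rwa [Function.update_self]
        · rw [Function.update_of_ne hss]
          exact hY s' (by simp [hss, hs'])
      have := hQ (Y s)
      rwa [Function.update_eq_self, hQ0, map_zero] at this
  have := ofFinite S
  exact funext fun Y => key univ Y fun s hs => (hs (mem_univ s)).elim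

end ProductDensity

section InfiniteModel

variable [IsScalarTower F 𝒦 D]
  [Module.Finite F D] (τ : Involution F 𝒦 D) {S : Type*} (t : S → Splitting 𝒦 D ℂ)
  (u : S → InfinitePlace F)
  (hu : ∀ s (x : F), (t s).κ (algebraMap F 𝒦 x) = (u s).embedding x)

/-- The matrix attached to a point of `U` at an infinite place. -/
noncomputable def infHom (s : S) : (u s).Completion ⊗[F] D →+* Mat₂(ℂ) :=
  matHom (InfinitePlace.Completion.extensionEmbedding (u s)) (t s).a
    fun x => by
      rw [IsScalarTower.algebraMap_apply F 𝒦 D, (t s).a_algebraMap, hu, extensionEmbedding_algebraMap]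

/-- The complex matrices attached to a point of `G(ℝ)`. -/
noncomputable def splitInf : τ.infinite →* Mats S ℂ :=
  MonoidHom.pi fun s => (infHom t u hu s).toMonoidHom.comp
    (((Units.coeHom _).comp (τ.points _).subtype).comp (Pi.evalMonoidHom _ (u s)))

theorem splitInf_apply (g : τ.infinite) (s : S) :
    splitInf τ t u hu g s = infHom t u hu s (τ.val (g (u s))) := rfl

theorem continuous_splitInf : Continuous (splitInf τ t u hu) := by
  refine continuous_pi fun s => ?_
  have h1 : Continuous (infHom t u hu s) :=
    continuous_of_semilinear (g := InfinitePlace.Completion.extensionEmbedding (u s))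
      (InfinitePlace.Completion.isometry_extensionEmbedding (u s)).continuous
      { toFun := infHom t u hu s
        map_add' := map_add _
        map_smul' := fun c x => matHom_smul c x }
  exact h1.comp (τ.continuous_val.comp (continuous_apply (u s)))

theorem splitInf_pointsMap (Γ : InfinitePlace F → τ.points F) (s : S) :
    splitInf τ t u hu (fun w => τ.pointsMap (ofId F w.Completion) (Γ w)) s =
      (t s).a (τ.ratVal (Γ (u s))) := by
  rw [splitInf_apply, val_pointsMap]
  exact (matHom_tmul _ _).trans (by rw [map_one, one_smul])

theorem dense_splitInf [IsSimpleRing D] [Finite S] (hinj : Injective u) {P : Mats S ℂ → ℂ}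
    (hP : P ∈ polyAlg S ℂ) (h : ∀ g, P (splitInf τ t u hu g) = 0) : P = 0 := by
  refine eq_zero_of_mem_polyAlg (A := fun s => Set.range fun γ => (t s).a (τ.ratVal γ))
    (fun s Q hQ => (t s).eq_zero_of_evalMat τ fun γ => hQ _ ⟨γ, rfl⟩) hP fun Y hY => ?_
  choose γ hγ using hY
  have h1 := h fun w => τ.pointsMap (ofId F w.Completion) (Function.extend u γ 1 w)
  convert h1 using 2
  funext s
  rw [splitInf_pointsMap, hinj.extend_apply]
  exact (hγ s).symm

end InfiniteModel

section Model

universe u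

variable {F : Type u} {𝒦 D : Type*} [Field F] [NumberField F] [IsTotallyReal F] [Field 𝒦] [NumberField 𝒦]
  [Algebra F 𝒦] [Algebra.IsQuadraticExtension F 𝒦] [Ring D] [Algebra F D] [Algebra 𝒦 D]
  [IsScalarTower F 𝒦 D] [Module.Finite F D] [IsSimpleRing D] (τ : Involution F 𝒦 D) {p : ℕ}
  [hp : Fact p.Prime]

theorem eq_of_padic_eq {v w : Pl(F)} {Ψ : K_[F,v] →+* ℚ_[p]}
    {Φ : K_[F,w] →+* ℚ_[p]} (hΨ : ∀ x, ‖Ψ x‖ ≤ 1 ↔ x ∈ O_[F,v])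
    (hΦ : ∀ x, ‖Φ x‖ ≤ 1 ↔ x ∈ O_[F,w])
    (h : ∀ x : F, Ψ (algebraMap F _ x) = Φ (algebraMap F _ x)) : v = w := by
  have hval : ∀ (v : Pl(F)) (y : F),
      Valued.v (algebraMap F K_[F,v] y) = v.valuation F y := fun v y =>
    HeightOneSpectrum.valuedAdicCompletion_eq_valuation' v y
  have key : ∀ {v w : Pl(F)} {Ψ : K_[F,v] →+* ℚ_[p]}
      {Φ : K_[F,w] →+* ℚ_[p]} (_ : ∀ x, ‖Ψ x‖ ≤ 1 ↔ x ∈ O_[F,v])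
      (_ : ∀ x, ‖Φ x‖ ≤ 1 ↔ x ∈ O_[F,w])
      (_ : ∀ x : F, Ψ (algebraMap F _ x) = Φ (algebraMap F _ x)), w.asIdeal ≤ v.asIdeal := by
    intro v w Ψ Φ hΨ hΦ h x hx
    by_contra hxv
    have h1 : (algebraMap F K_[F,v] (algebraMap (𝓞 F) F x)⁻¹) ∈
        O_[F,v] := by
      rw [HeightOneSpectrum.mem_adicCompletionIntegers,
        hval, map_inv₀, v.valuation_of_algebraMap,
        (v.intValuation_eq_one_iff).mpr hxv, inv_one]
    have hx0 : x ≠ 0 := fun h => hxv (h ▸ zero_mem _)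
    rw [← hΨ, h, hΦ, HeightOneSpectrum.mem_adicCompletionIntegers,
      hval, map_inv₀, w.valuation_of_algebraMap] at h1
    have h2 := (w.intValuation_lt_one_iff_mem x).mpr hx
    have h3 : w.intValuation x ≠ 0 := w.intValuation_ne_zero x hx0
    rw [inv_le_one₀ (zero_lt_iff.mpr h3)] at h1
    exact h2.not_ge h1
  exact HeightOneSpectrum.ext (le_antisymm (key hΦ hΨ fun x => (h x).symm) (key hΨ hΦ h))

theorem exists_algebraicModel (hD : finrank 𝒦 D = 4) (hs : SplitsCompletely p 𝒦)
    (hDp : IsSplitAbove p 𝒦 D) (ι : ℂ ≃+* Ω_[p]) : Nonempty (AlgebraicModel.{u, _, _, u} τ p ι) := by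
  choose Ψ t hΨ hc ht using fun v : PlAbove(F,p) =>
    exists_splitting hs hDp v.2
  let j : ℚ_[p] →+* ℂ := (ι.symm : Ω_[p] →+* ℂ).comp (algebraMap ℚ_[p] Ω_[p])
  let η : PlAbove(F,p) → F →+* ℂ := fun v =>
    (j.comp (Ψ v)).comp (algebraMap F _)
  let u := fun v => InfinitePlace.mk (η v)
  have hη : ∀ v, (u v).embedding = η v := fun v =>
    InfinitePlace.embedding_mk_eq_of_isReal (IsTotallyReal.complexEmbedding_isReal _)
  let tC := fun v => (t v).map (j.comp (Ψ v))
  have hu : ∀ v (x : F), (tC v).κ (algebraMap F 𝒦 x) = (u v).embedding x := fun v x => by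
    rw [hη]
    exact congrArg (j.comp (Ψ v)) (ht v x)
  have hinj : Injective u := fun v w h => by
    have h1 : η v = η w := by rw [← hη, ← hη, h]
    exact Subtype.ext (eq_of_padic_eq (hΨ v) (hΨ w) fun x => j.injective (RingHom.congr_fun h1 x))
  exact ⟨{
    S := PlAbove(F,p)
    fintype := ofFinite _
    loc := splitLoc τ t ht Ψ
    inf := splitInf τ tC u hu
    compat := fun γ => by
      funext v
      have h1 : splitInf τ tC u hu (τ.diagInf γ) v = (tC v).a (τ.ratVal γ) :=
        splitInf_pointsMap τ tC u hu (fun _ => γ) v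
      ext i j
      change ι (splitInf τ tC u hu (τ.diagInf γ) v i j) =
        algebraMap ℚ_[p] Ω_[p] (Ψ v ((t v).fst (ht v) (τ.val
          (τ.pointsMap (ofId F K_[F,v.1]) γ)) i j))
      rw [h1, val_pointsMap]
      have h2 : (t v).fst (ht v) (1 ⊗ₜ[F] τ.ratVal γ) = (t v).a (τ.ratVal γ) :=
        (matHom_tmul _ _).trans (one_smul _ _)
      rw [h2]
      exact ι.apply_symm_apply _
    continuous_inf := continuous_splitInf τ tC u hu
    dense := fun d P hP h => dense_splitInf τ tC u hu hinj (polyFun_le_polyAlg d hP) h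
    level := splitLevel τ t ht hD
    K := fun v => (t v).integral τ (ht v)
    hyperspecial := fun v => (t v).isHyperspecial τ (ht v) hD (hs.isUnramifiedIn v.2)
    mem_level := fun z => mem_splitLevel τ t ht hD
    norm_le := fun z hz => norm_splitLoc_le τ t ht hΨ hD hz
    small := fun ε hε => exists_congruence τ t ht hΨ hD hc hε
    separating := exists_separating τ t ht hD hc }⟩

end Model

end DefiniteUnitary

theorem corollary2 {F 𝒦 D : Type*} [Field F] [NumberField F] [IsTotallyReal F]
    [Field 𝒦] [NumberField 𝒦] [IsTotallyComplex 𝒦] [Algebra F 𝒦]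
    [Algebra.IsQuadraticExtension F 𝒦]
    [Ring D] [Algebra F D] [Algebra 𝒦 D] [IsScalarTower F 𝒦 D] [Module.Finite F D]
    [Algebra.IsCentral 𝒦 D] [IsSimpleRing D] (hD : Module.finrank 𝒦 D = 4)
    (τ : Involution F 𝒦 D) (hcompact : CompactSpace τ.infinite)
    (p : ℕ) [Fact p.Prime] (hp : 3 < p) (hsplit : SplitsCompletely p 𝒦)
    (hDp : IsSplitAbove p 𝒦 D)
    (U : TameLevel τ p)
    (E : IntermediateField ℚ_[p] (PadicAlgCl p)) [FiniteDimensional ℚ_[p] E]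
    (ι : ℂ ≃+* PadicAlgCl p)
    (𝔪 : Ideal (U.BigHeckeAlg (intE E))) [𝔪.IsMaximal] :
    (⨅ 𝔭 ∈ classicalCrystallineAt U E ι 𝔪,
      𝔭.asIdeal.map (algebraMap _ (Localization.AtPrime 𝔪))) = ⊥ ∧
    Dense (PrimeSpectrum.comap (algebraMap _ (Localization.AtPrime 𝔪)) ⁻¹'
      classicalCrystallineAt U E ι 𝔪) := by
  obtain ⟨M⟩ := exists_algebraicModel τ hD hsplit hDp ι
  obtain ⟨h₁, h₂⟩ := finite_class_number τ
  exact iInf_classicalCrystallineAt_eq_bot_and_dense M (U.hasFiniteLevels h₁ h₂) E 𝔪
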